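/- **Theorem (from the Hartree equation to the Vlasov equation).** Let $d\in\mathbf N$, $\hbar>0$ and $\mathfrak H=L^2(\mathbf R^d;\mathbf C)$. Let $\mathcal D(\mathfrak H)$ be the set of density operators, i.e. bounded operators $R$ on $\mathfrak H$ with $R=R^*\ge 0$ and $\operatorname{trace}R=1$; for such $R$ let $\rho[R](x)=r(x,x)$ be its position density, where $r$ is the integral kernel of $R$ (precisely, $\rho[R](x)=\int|r_{1/2}(x,z)|^2dz$ with $r_{1/2}$ the integral kernel of $R^{1/2}$). *Definitions.* For a probability density $p$ on $\mathbf R^d\times\mathbf R^d$ and $R\in\mathcal D(\mathfrak H)$, let $\mathcal C(p,R)$ be the set of measurable $Q:\mathbf R^d\times\mathbf R^d\to\mathcal L(\mathfrak H)$ with, for a.e. $(x,\xi)$, $Q(x,\xi)=Q(x,\xi)^*\ge0$ and $\operatorname{trace}Q(x,\xi)=p(x,\xi)$, and with $\int Q(x,\xi)\,dxd\xi=R$. Put $$E_\hbar(p,R)=\Big(\inf_{Q\in\mathcal C(p,R)}\int_{\mathbf R^d\times\mathbf R^d}\operatorname{trace}\big(c_\hbar(x,\xi)Q(x,\xi)\big)\,dxd\xi\Big)^{1/2}\in[0,\infty],\qquad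 c_\hbar(x,\xi)=\tfrac12\big(|x-y|^2+|\xi+i\hbar\nabla_y|^2\big),$$ where $c_\hbar(x,\xi)$ acts on functions of $y$, and $\operatorname{trace}(cQ):=\operatorname{trace}(Q^{1/2}cQ^{1/2})\in[0,\infty]$. For Borel probability measures $\mu,\nu$ on $\mathbf R^d\times\mathbf R^d$ put $$\operatorname{dist_{MK,2}}(\mu,\nu)^2=\inf_{\pi}\int\tfrac12\big(|x-y|^2+|\xi-\eta|^2\big)\,\pi(dxd\xi\,dyd\eta)\in[0,\infty],$$ where $\pi$ runs over the couplings of $\mu$ and $\nu$; thus $\operatorname{dist_{MK,2}}(\mu,\nu)^2=\tfrac12W_2(\mu,\nu)^2$ with the usual Wasserstein distance $W_2$. Let $|x+i\xi,\hbar\rangle\in\mathfrak H$ be the coherent state $y\mapsto(\pi\hbar)^{-d/4}e^{-|y-x|^2/2\hbar}e^{i\xi\cdot(y-x)/\hbar}$, let $\widetilde W_\hbar[R](x,\xi)=(2\pi\hbar)^{-d}\langle x+i\xi,\hbar|R|x+i\xi,\hbar\rangle$ be the Husimi transform of $R$ (a probability density), and for a finite Borel measure $\mu$ let $\operatorname{OP}^T_\hbar(\mu)=(2\pi\hbar)^{-d}\int|x+i\xi,\hbar\rangle\langle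 x+i\xi,\hbar|\,\mu(dxd\xi)$ be the Töplitz operator. Probability densities are identified with the corresponding measures. *Hypotheses.* Let $V:\mathbf R^d\to\mathbf R$ be even, bounded and of class $C^1$, with Lipschitz continuous gradient; let $L$ be the Lipschitz constant of $\nabla V$ and $\Lambda=1+\max(1,4L^2)$. Let $f^{in}$ be a probability density on $\mathbf R^d\times\mathbf R^d$ with $\int(|x|^2+|\xi|^2)f^{in}\,dxd\xi<\infty$, and let $t\mapsto f(t)$, $t\ge0$, be the weak solution, among families of probability densities, of the Vlasov equation $$\partial_tf+\xi\cdot\nabla_xf-(\nabla V\star\rho_f)\cdot\nabla_\xi f=0,\qquad f|_{t=0}=f^{in},\qquad\rho_f(t,x)=\int f(t,x,\xi)\,d\xi,$$ i.e. for every $\varphi\in C_c^\infty(\mathbf R^d\times\mathbf R^d)$ and $t\ge0$, $\frac{d}{dt}\int\varphi f(t)\,dxd\xi=\int\big(\xi\cdot\nabla_x\varphi-(\nabla V\star\rho_f)(t,x)\cdot\nabla_\xi\varphi\big)f(t)\,dxd\xi$. Let $R^{in}_\hbar\in\mathcal D(\mathfrak H)$ and let $t\mapsto R_\hbar(t)\in\mathcal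 D(\mathfrak H)$, $t\ge0$, be the weak solution of the Hartree equation $$i\hbar\,\partial_tR_\hbar=\big[-\tfrac12\hbar^2\Delta+V\star\rho[R_\hbar(t)],\,R_\hbar\big],\qquad R_\hbar|_{t=0}=R^{in}_\hbar,$$ i.e. for all Schwartz functions $\varphi,\psi$ and $t\ge0$, $i\hbar\frac{d}{dt}\langle\varphi,R_\hbar(t)\psi\rangle=\langle H(t)\varphi,R_\hbar(t)\psi\rangle-\langle R_\hbar(t)\varphi,H(t)\psi\rangle$ with $H(t)=-\tfrac12\hbar^2\Delta+V\star\rho[R_\hbar(t)]$. *Conclusion.* For each $t\ge0$, $$E_\hbar(f(t),R_\hbar(t))^2\le e^{\Lambda t}E_\hbar(f^{in},R^{in}_\hbar)^2,$$ $$\operatorname{dist_{MK,2}}\big(f(t),\widetilde W_\hbar[R_\hbar(t)]\big)^2\le e^{\Lambda t}E_\hbar(f^{in},R^{in}_\hbar)^2+\tfrac12d\hbar .$$ Moreover, if $R^{in}_\hbar=\operatorname{OP}^T_\hbar((2\pi\hbar)^d\mu^{in})$ for a Borel probability measure $\mu^{in}$ on $\mathbf R^d\times\mathbf R^d$, then for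 each $t\ge0$ $$\operatorname{dist_{MK,2}}\big(f(t),\widetilde W_\hbar[R_\hbar(t)]\big)^2\le e^{\Lambda t}\Big(\operatorname{dist_{MK,2}}(f^{in},\mu^{in})^2+\tfrac12d\hbar\Big)+\tfrac12d\hbar .$$ -/

import Mathlib

open MeasureTheory Set Filter Topology
open scoped ENNReal NNReal ContDiff InnerProductSpace SchwartzMap FourierTransform Laplacian

noncomputable section

namespace HartreeVlasov

/-- Position (or momentum) space `ℝ^d` with its Euclidean norm. -/
abbrev Pos (d : ℕ) : Type := EuclideanSpace ℝ (Fin d)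

/-- Phase space `ℝ^d × ℝ^d`; a point is `z = (x, ξ)`. Only its measurable, topological and
linear structure and its Lebesgue measure are used. -/
abbrev Phase (d : ℕ) : Type := Pos d × Pos d

/-- The state space `L²(ℝ^d; ℂ)`. -/
abbrev StateSpace (d : ℕ) : Type := Lp ℂ 2 (volume : Measure (Pos d))

/-- Bounded operators on the state space. -/
abbrev Op (d : ℕ) : Type := StateSpace d →L[ℂ] StateSpace d

/-! ### Traces and density operators -/

/-- The nonnegative square root `T^{1/2}` of a bounded operator `T = T* ≥ 0`. -/
def opSqrt {H : Type*} [NormedAddCommGroup H] [InnerProductSpace ℂ H] [CompleteSpace H]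
    (T : H →L[ℂ] H) : H →L[ℂ] H := CFC.sqrt T

/-- Index set of a Hilbert basis of `L²(ℝ^d)`. -/
def basisIndex (d : ℕ) : Set (StateSpace d) :=
  (exists_hilbertBasis ℂ (StateSpace d)).choose

/-- A Hilbert basis of `L²(ℝ^d)`, fixed once and for all. None of the quantities below depends
on which one is taken. -/
def basis (d : ℕ) : HilbertBasis (basisIndex d) ℂ (StateSpace d) :=
  (exists_hilbertBasis ℂ (StateSpace d)).choose_spec.choose

/-- The trace, in `[0, ∞]`, of a nonnegative self-adjoint bounded operator. -/
def posTrace {d : ℕ} (T : Op d) : ℝ≥0∞ :=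
  ∑' i, ENNReal.ofReal (RCLike.re ⟪basis d i, T (basis d i)⟫_ℂ)

/-- Density operators: `R = R* ≥ 0` and `trace R = 1`. -/
def IsDensityOperator {d : ℕ} (R : Op d) : Prop :=
  R.IsPositive ∧ posTrace R = 1

/-- The position density `ρ[R](x) = r(x, x) := ∫ |r_{1/2}(x, z)|² dz`, where `r_{1/2}` is the
integral kernel of `R^{1/2}`. By Parseval's identity in the variable `z` this integral is
`∑ i, |(R^{1/2} e_i)(x)|²` for (almost every `x` and) any Hilbert basis `e`. -/
def positionDensity {d : ℕ} (R : Op d) (x : Pos d) : ℝ :=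
  (∑' i, ‖(opSqrt R (basis d i) : StateSpace d) x‖ₑ ^ 2).toReal

/-! ### Probability densities and the Vlasov equation -/

/-- Probability densities on phase space. -/
def IsProbDensity {d : ℕ} (p : Phase d → ℝ) : Prop :=
  Integrable p ∧ (∀ᵐ z, 0 ≤ p z) ∧ ∫ z, p z = 1

/-- The measure `p(x, ξ) dx dξ`. -/
def densityMeasure {d : ℕ} (p : Phase d → ℝ) : Measure (Phase d) :=
  volume.withDensity fun z => ENNReal.ofReal (p z)

/-- The spatial density `ρ_p(x) = ∫ p(x, ξ) dξ`. -/
def spatialDensity {d : ℕ} (p : Phase d → ℝ) (x : Pos d) : ℝ := ∫ ξ, p (x, ξ)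

/-- `(V ⋆ ρ)(x) = ∫ V(x - y) ρ(y) dy`. -/
def meanPotential {d : ℕ} (V ρ : Pos d → ℝ) (x : Pos d) : ℝ := ∫ y, V (x - y) * ρ y

/-- `(∇V ⋆ ρ)(x) = ∫ ∇V(x - y) ρ(y) dy`, the gradient of `V ⋆ ρ`. -/
def meanGradient {d : ℕ} (V ρ : Pos d → ℝ) (x : Pos d) : Pos d :=
  ∫ y, ρ y • gradient V (x - y)

/-- Weak solutions on `[0, ∞)` of the Vlasov equation
`∂ₜ f + {½|ξ|² + V ⋆ ρ_f, f} = ∂ₜ f + ξ·∇ₓ f - (∇V ⋆ ρ_f)·∇_ξ f = 0`, `f|_{t=0} = f₀`: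
probability densities `f(t)` such that, for every smooth compactly supported `φ` on phase space,
`d/dt ∫ φ f(t) = ∫ (ξ·∇ₓφ - (∇V ⋆ ρ_{f(t)})(x)·∇_ξφ) f(t)` for all `t ≥ 0`
(one-sided derivative at `t = 0`). -/
def IsVlasovSolution {d : ℕ} (V : Pos d → ℝ) (f₀ : Phase d → ℝ) (f : ℝ → Phase d → ℝ) : Prop :=
  (∀ t, 0 ≤ t → IsProbDensity (f t)) ∧
  (f 0 =ᵐ[volume] f₀) ∧
  ∀ φ : Phase d → ℝ, ContDiff ℝ ∞ φ → HasCompactSupport φ → ∀ t, 0 ≤ t →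
    HasDerivWithinAt (fun s => ∫ z, φ z * f s z)
      (∫ z, fderiv ℝ φ z (z.2, -meanGradient V (spatialDensity (f t)) z.1) * f t z)
      (Ici 0) t

/-! ### The Hartree equation -/

/-- `(-½ħ²Δ + W) φ` for a Schwartz function `φ` and a real potential `W`. -/
def hamiltonian {d : ℕ} (ħ : ℝ) (W : Pos d → ℝ) (φ : 𝓢(Pos d, ℂ)) (y : Pos d) : ℂ :=
  -((ħ ^ 2 / 2 : ℝ) : ℂ) * (Δ φ) y + (W y : ℂ) * φ y

/-- Weak solutions on `[0, ∞)` of the Hartree equation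
`iħ ∂ₜ R = [-½ħ²Δ + V ⋆ ρ[R], R]`, `R|_{t=0} = R₀`: density operators `R(t)` such that, with
`H(t) = -½ħ²Δ + V ⋆ ρ[R(t)]`, for all Schwartz functions `φ, ψ` and all `t ≥ 0`,
`d/dt ⟨φ, R(t)ψ⟩ = (iħ)⁻¹ (⟨H(t)φ, R(t)ψ⟩ - ⟨R(t)φ, H(t)ψ⟩)`
(one-sided derivative at `t = 0`; brackets are conjugate linear on the left). -/
def IsHartreeSolution {d : ℕ} (ħ : ℝ) (V : Pos d → ℝ) (R₀ : Op d) (R : ℝ → Op d) : Prop :=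
  (∀ t, 0 ≤ t → IsDensityOperator (R t)) ∧
  R 0 = R₀ ∧
  ∀ φ ψ : 𝓢(Pos d, ℂ), ∀ t, 0 ≤ t →
    HasDerivWithinAt (fun s => ⟪φ.toLp 2, R s (ψ.toLp 2)⟫_ℂ)
      ((Complex.I * (ħ : ℂ))⁻¹ *
        ((∫ y, starRingEnd ℂ (hamiltonian ħ (meanPotential V (positionDensity (R t))) φ y) *
            (R t (ψ.toLp 2) : StateSpace d) y) -
          ∫ y, starRingEnd ℂ ((R t (φ.toLp 2) : StateSpace d) y) *
            hamiltonian ħ (meanPotential V (positionDensity (R t))) ψ y))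
      (Ici 0) t

/-! ### The pseudo-distance between a classical and a quantum density -/

/-- Couplings of a probability density `p` and a density operator `R`: measurable operator-valued
`Q` with `Q(z) = Q(z)* ≥ 0`, `trace Q(z) = p(z)` almost everywhere, and `∫ Q(z) dz = R`. Here
`Q` is Bochner integrable in operator norm since `‖Q(z)‖ ≤ trace Q(z) = p(z)`. -/
def IsCoupling {d : ℕ} (p : Phase d → ℝ) (R : Op d) (Q : Phase d → Op d) : Prop :=
  AEStronglyMeasurable Q volume ∧
  (∀ᵐ z, (Q z).IsPositive) ∧
  (∀ᵐ z, posTrace (Q z) = ENNReal.ofReal (p z)) ∧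
  ∫ z, Q z = R

/-- The quadratic form, with values in `[0, ∞]`, of the transportation cost
`c_ħ(x, ξ) = ½(|x - y|² + |ξ + iħ∇_y|²)`, a nonnegative self-adjoint operator on `L²(ℝ^d_y)`:
`½(∫ |x - y|² |φ(y)|² dy + ∫ |ξ - 2πħ k|² |(𝓕φ)(k)|² dk)`. With the normalization
`(𝓕φ)(k) = ∫ exp(-2πi k·y) φ(y) dy`, the operator `ξ + iħ∇_y` is multiplication by `ξ - 2πħ k`
on the Fourier side. The value is `∞` outside the form domain. -/
def costForm {d : ℕ} (ħ : ℝ) (z : Phase d) (φ : StateSpace d) : ℝ≥0∞ :=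
  ENNReal.ofReal (1 / 2) *
    ((∫⁻ y, ‖z.1 - y‖ₑ ^ 2 * ‖φ y‖ₑ ^ 2) +
      ∫⁻ k, ‖z.2 - (2 * Real.pi * ħ) • k‖ₑ ^ 2 * ‖(𝓕 φ : StateSpace d) k‖ₑ ^ 2)

/-- `trace (c_ħ(z) T) := trace (T^{1/2} c_ħ(z) T^{1/2}) ∈ [0, ∞]` for a bounded `T = T* ≥ 0`. -/
def costTrace {d : ℕ} (ħ : ℝ) (z : Phase d) (T : Op d) : ℝ≥0∞ :=
  ∑' i, costForm ħ z (opSqrt T (basis d i))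

/-- `E_ħ(p, R) = (inf over couplings Q of ∫ trace (c_ħ(z) Q(z)) dz)^{1/2} ∈ [0, ∞]`. -/
def Ehbar {d : ℕ} (ħ : ℝ) (p : Phase d → ℝ) (R : Op d) : ℝ≥0∞ :=
  (⨅ (Q : Phase d → Op d) (_ : IsCoupling p R Q), ∫⁻ z, costTrace ħ z (Q z)) ^ (1 / 2 : ℝ)

/-! ### Monge-Kantorovich distance, coherent states, Husimi transform, Töplitz operators -/

/-- The quadratic Monge-Kantorovich distance on phase space for the cost
`½(|x - y|² + |ξ - η|²)`:
`dist(μ, ν) = (inf over transport plans π of ∫ ½(|x - y|² + |ξ - η|²) dπ)^{1/2} ∈ [0, ∞]`. -/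
def distMK2 {d : ℕ} (μ ν : Measure (Phase d)) : ℝ≥0∞ :=
  (⨅ (π : Measure (Phase d × Phase d)) (_ : π.map Prod.fst = μ ∧ π.map Prod.snd = ν),
    ∫⁻ w, ENNReal.ofReal ((‖w.1.1 - w.2.1‖ ^ 2 + ‖w.1.2 - w.2.2‖ ^ 2) / 2) ∂π) ^ (1 / 2 : ℝ)

/-- The wave function `y ↦ (πħ)^{-d/4} exp(-|y - x|²/2ħ) exp(iξ·(y - x)/ħ)`, for `z = (x, ξ)`. -/
def coherentFun {d : ℕ} (ħ : ℝ) (z : Phase d) (y : Pos d) : ℂ :=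
  (((Real.pi * ħ) ^ (-(d : ℝ) / 4) * Real.exp (-‖y - z.1‖ ^ 2 / (2 * ħ)) : ℝ) : ℂ) *
    Complex.exp (Complex.I * ((⟪z.2, y - z.1⟫_ℝ / ħ : ℝ) : ℂ))

open Classical in
/-- The coherent state `|x + iξ, ħ⟩` in `L²(ℝ^d)`; the function above is in `L²` for every
`ħ > 0`, see `memLp_coherentFun`. -/
def coherentState {d : ℕ} (ħ : ℝ) (z : Phase d) : StateSpace d :=
  if h : MemLp (coherentFun ħ z) 2 volume then h.toLp else 0

theorem memLp_coherentFun {d : ℕ} {ħ : ℝ} (hħ : 0 < ħ) (z : Phase d) :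
    MemLp (coherentFun ħ z) 2 volume := by
  have hcont : Continuous (coherentFun ħ z) := by unfold coherentFun; fun_prop
  rw [memLp_two_iff_integrable_sq_norm hcont.aestronglyMeasurable]
  have h1 : Integrable (fun v : Pos d => Real.exp (-(1 / ħ) * ‖v‖ ^ 2)) := by
    have h := (GaussianFourier.integrable_cexp_neg_mul_sq_norm_add
      (b := ((1 / ħ : ℝ) : ℂ)) (by simpa using hħ) 0 (0 : Pos d)).norm
    refine h.congr (ae_of_all _ fun v => ?_)
    simp only [zero_mul, add_zero, Complex.norm_exp]
    congr 1
    norm_cast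
  refine ((h1.comp_sub_right z.1).const_mul (((Real.pi * ħ) ^ (-(d : ℝ) / 4)) ^ 2)).congr
    (ae_of_all _ fun y => ?_)
  have h2 : ‖Complex.exp (Complex.I * ((⟪z.2, y - z.1⟫_ℝ / ħ : ℝ) : ℂ))‖ = 1 := by
    rw [mul_comm]; exact Complex.norm_exp_ofReal_mul_I _
  have h3 : (‖y - z.1‖ ^ 2 / (2 * ħ)) * 2 = 1 / ħ * ‖y - z.1‖ ^ 2 := by field_simp
  simp only [coherentFun, norm_mul, h2, mul_one, Complex.norm_real, Real.norm_eq_abs]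
  rw [mul_pow, sq_abs, sq_abs, ← Real.exp_nat_mul]
  congr 2
  push_cast
  linear_combination -h3

/-- The Husimi transform `(2πħ)^{-d} ⟨x + iξ, ħ| R |x + iξ, ħ⟩` of a density operator `R`, equal
to `exp(ħΔ_{x,ξ}/4)` applied to the Wigner transform of `R` at scale `ħ`. -/
def husimi {d : ℕ} (ħ : ℝ) (R : Op d) (z : Phase d) : ℝ :=
  ((2 * Real.pi * ħ) ^ d)⁻¹ * RCLike.re ⟪coherentState ħ z, R (coherentState ħ z)⟫_ℂ

/-- The Töplitz operator `(2πħ)^{-d} ∫ |x + iξ, ħ⟩⟨x + iξ, ħ| μ(dx dξ)` of a finite measure. -/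
def toeplitz {d : ℕ} (ħ : ℝ) (μ : Measure (Phase d)) : Op d :=
  (((2 * Real.pi * ħ) ^ d)⁻¹ : ℝ) •
    ∫ z, InnerProductSpace.rankOne ℂ (coherentState ħ z) (coherentState ħ z) ∂μ

end HartreeVlasov

end

open MeasureTheory Set Filter Topology
open scoped ENNReal NNReal ContDiff InnerProductSpace SchwartzMap FourierTransform Laplacian

noncomputable section

namespace HartreeVlasov

/-! ### Traces -/

section Trace

variable {H : Type*} [NormedAddCommGroup H] [InnerProductSpace ℂ H] [CompleteSpace H]
  {ι : Type*} (b : HilbertBasis ι ℂ H)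

theorem tsum_enorm_inner_sq (x : H) : ∑' i, ‖⟪b i, x⟫_ℂ‖ₑ ^ 2 = ‖x‖ₑ ^ 2 := by
  have h := b.hasSum_inner_mul_inner x x
  have h2 : HasSum (fun i => ‖⟪b i, x⟫_ℂ‖ ^ 2) (‖x‖ ^ 2) := by
    rw [← Complex.hasSum_ofReal]
    convert! h using 1
    · ext i
      rw [← inner_conj_symm x (b i), Complex.conj_mul']
      push_cast
      rfl
    · rw [inner_self_eq_norm_sq_to_K]
      push_cast
      rfl
  simp_rw [← ofReal_norm, ← ENNReal.ofReal_pow (norm_nonneg _)]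
  rw [← ENNReal.ofReal_tsum_of_nonneg (fun i => by positivity) h2.summable, h2.tsum_eq]

theorem tsum_enorm_apply_sq_comm (A : H →L[ℂ] H) :
    ∑' i, ‖A (b i)‖ₑ ^ 2 = ∑' i, ‖A.adjoint (b i)‖ₑ ^ 2 := by
  simp_rw [← tsum_enorm_inner_sq b (A _), ← tsum_enorm_inner_sq b (A.adjoint _)]
  rw [ENNReal.tsum_comm]
  refine tsum_congr fun i => tsum_congr fun j => ?_
  rw [ContinuousLinearMap.adjoint_inner_right, ← inner_conj_symm, RCLike.enorm_conj]

theorem tsum_enorm_inner_apply_sq (A : H →L[ℂ] H) (x : H) :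
    ∑' i, ‖⟪x, A (b i)⟫_ℂ‖ₑ ^ 2 = ‖A.adjoint x‖ₑ ^ 2 := by
  rw [← tsum_enorm_inner_sq b (A.adjoint x)]
  refine tsum_congr fun i => ?_
  rw [ContinuousLinearMap.adjoint_inner_right, ← inner_conj_symm, RCLike.enorm_conj]

theorem enorm_sq_adjoint_apply (A : H →L[ℂ] H) (x : H) :
    ‖A.adjoint x‖ₑ ^ 2 = ENNReal.ofReal (RCLike.re ⟪x, (A ∘L A.adjoint) x⟫_ℂ) := by
  rw [ContinuousLinearMap.comp_apply, ← ContinuousLinearMap.adjoint_inner_left,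
    inner_self_eq_norm_sq, ENNReal.ofReal_pow (norm_nonneg _), ofReal_norm]

theorem opSqrt_adjoint (T : H →L[ℂ] H) : (opSqrt T).adjoint = opSqrt T := by
  have h : 0 ≤ opSqrt T := CFC.sqrt_nonneg T
  exact (ContinuousLinearMap.nonneg_iff_isPositive _).1 h |>.isSelfAdjoint.adjoint_eq

theorem opSqrt_comp_adjoint {T : H →L[ℂ] H} (hT : T.IsPositive) :
    opSqrt T ∘L (opSqrt T).adjoint = T := by
  rw [opSqrt_adjoint]
  exact CFC.sqrt_mul_sqrt_self T ((ContinuousLinearMap.nonneg_iff_isPositive _).2 hT)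

end Trace

variable {d : ℕ}

instance : TopologicalSpace.SeparableSpace (StateSpace d) :=
  haveI : Fact ((2 : ℝ≥0∞) ≠ ⊤) := ⟨by norm_num⟩
  inferInstance

theorem countable_basisIndex : Countable (basisIndex d) := by
  have hb := (basis d).orthonormal
  have hdisj : Pairwise (Function.onFun Disjoint fun i => Metric.ball (basis d i) (1 / 2)) := by
    intro i j hij
    refine Metric.ball_disjoint_ball ?_
    have h1 : ‖basis d i - basis d j‖ ^ 2 = 2 := by
      rw [@norm_sub_sq ℂ, hb.1, hb.1, hb.2 hij]
      norm_num
    rw [dist_eq_norm]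
    nlinarith [norm_nonneg (basis d i - basis d j)]
  exact hdisj.countable_of_isOpen_disjoint (fun _ => Metric.isOpen_ball)
    fun i => ⟨basis d i, Metric.mem_ball_self (by norm_num)⟩

instance : Countable (basisIndex d) := countable_basisIndex

theorem posTrace_comp_adjoint (A : Op d) :
    posTrace (A ∘L A.adjoint) = ∑' i, ‖A (basis d i)‖ₑ ^ 2 := by
  rw [tsum_enorm_apply_sq_comm]
  simp_rw [posTrace, enorm_sq_adjoint_apply]

theorem posTrace_eq_tsum {T : Op d} (hT : T.IsPositive) :
    posTrace T = ∑' i, ‖opSqrt T (basis d i)‖ₑ ^ 2 := by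
  conv_lhs => rw [← opSqrt_comp_adjoint hT]
  exact posTrace_comp_adjoint _

theorem posTrace_conj (A S : Op d) :
    posTrace (S ∘L (A ∘L A.adjoint) ∘L S.adjoint) = ∑' i, ‖S (A (basis d i))‖ₑ ^ 2 := by
  have := posTrace_comp_adjoint (S ∘L A)
  rwa [ContinuousLinearMap.adjoint_comp] at this

theorem posTrace_conj_isometry {T : Op d} (hT : T.IsPositive) {U : Op d} (hU : ∀ x, ‖U x‖ = ‖x‖) :
    posTrace (U ∘L T ∘L U.adjoint) = posTrace T := by
  rw [← opSqrt_comp_adjoint hT, posTrace_conj, posTrace_comp_adjoint]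
  simp_rw [← ofReal_norm, hU]

theorem enorm_opSqrt_le {T : Op d} (hT : T.IsPositive) (x : StateSpace d) :
    ‖opSqrt T x‖ₑ ^ 2 ≤ posTrace T * ‖x‖ₑ ^ 2 := by
  have h := tsum_enorm_inner_apply_sq (basis d) (opSqrt T) x
  rw [opSqrt_adjoint] at h
  rw [← h, posTrace_eq_tsum hT, ← ENNReal.tsum_mul_right]
  refine ENNReal.tsum_le_tsum fun i => ?_
  rw [← mul_pow, mul_comm]
  gcongr
  rw [← ofReal_norm, ← ofReal_norm, ← ofReal_norm,
    ← ENNReal.ofReal_mul (norm_nonneg _)]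
  exact ENNReal.ofReal_le_ofReal (norm_inner_le_norm _ _)

theorem enorm_le_posTrace {T : Op d} (hT : T.IsPositive) : ‖T‖ₑ ≤ posTrace T := by
  by_cases htop : posTrace T = ⊤
  · simp [htop]
  have hs : ‖opSqrt T‖ ≤ √(posTrace T).toReal := by
    refine ContinuousLinearMap.opNorm_le_bound _ (Real.sqrt_nonneg _) fun x => ?_
    have h := enorm_opSqrt_le hT x
    have h2 : ‖opSqrt T x‖ ^ 2 ≤ (posTrace T).toReal * ‖x‖ ^ 2 := by
      have := ENNReal.toReal_mono (ENNReal.mul_ne_top htop (by simp)) h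
      simpa using this
    rw [← Real.sqrt_sq (norm_nonneg x), ← Real.sqrt_mul ENNReal.toReal_nonneg]
    exact Real.le_sqrt_of_sq_le h2
  have h1 : ‖T‖ ≤ (posTrace T).toReal := by
    have hT' : T = opSqrt T ∘L opSqrt T := by
      conv_lhs => rw [← opSqrt_comp_adjoint hT, opSqrt_adjoint]
    calc ‖T‖ ≤ ‖opSqrt T‖ * ‖opSqrt T‖ := by
            conv_lhs => rw [hT']
            exact ContinuousLinearMap.opNorm_comp_le _ _
      _ ≤ √(posTrace T).toReal * √(posTrace T).toReal := by gcongr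
      _ = _ := Real.mul_self_sqrt ENNReal.toReal_nonneg
  rw [← ofReal_norm]
  exact ENNReal.ofReal_le_of_le_toReal h1

theorem IsDensityOperator.norm_le_one {R : Op d} (hR : IsDensityOperator R) : ‖R‖ ≤ 1 := by
  have := enorm_le_posTrace hR.1
  rw [hR.2, ← ofReal_norm] at this
  simpa [-ofReal_norm] using this

/-! ### Multiplication operators -/

theorem enorm_sq_eq_lintegral (v : StateSpace d) : ‖v‖ₑ ^ 2 = ∫⁻ y, ‖v y‖ₑ ^ 2 := by
  rw [Lp.enorm_def, eLpNorm_eq_lintegral_rpow_enorm_toReal (by norm_num) (by norm_num)]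
  simp only [ENNReal.toReal_ofNat, one_div, ENNReal.rpow_ofNat]
  rw [← ENNReal.rpow_natCast, ← ENNReal.rpow_mul]
  norm_num

/-- Dominated convergence in `L²`. -/
theorem tendsto_state_of_dominated {ι : Type*} {l : Filter ι} [l.IsCountablyGenerated]
    {v : ι → StateSpace d} {v₀ w : StateSpace d} {F : ι → Pos d → ℂ} {F₀ : Pos d → ℂ}
    (hv : ∀ n, v n =ᵐ[volume] F n) (hv₀ : v₀ =ᵐ[volume] F₀)
    (hbound : ∀ᶠ n in l, ∀ᵐ y, ‖F n y - F₀ y‖ ≤ ‖w y‖)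
    (hlim : ∀ᵐ y, Tendsto (fun n => F n y) l (𝓝 (F₀ y))) : Tendsto v l (𝓝 v₀) := by
  have h1 : Tendsto (fun n => ‖v n - v₀‖ₑ ^ 2) l (𝓝 0) := by
    have h2 : Tendsto (fun n => ∫⁻ y, ‖F n y - F₀ y‖ₑ ^ 2) l (𝓝 (∫⁻ _ : Pos d, 0)) := by
      refine tendsto_lintegral_filter_of_dominated_convergence' (fun y => ‖w y‖ₑ ^ 2) ?_ ?_ ?_ ?_
      · exact Eventually.of_forall fun n =>
          ((((Lp.aestronglyMeasurable _).congr (hv n)).sub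
            ((Lp.aestronglyMeasurable _).congr hv₀)).enorm.pow_const 2)
      · filter_upwards [hbound] with n hn
        filter_upwards [hn] with y hy
        gcongr
        exact enorm_le_iff_norm_le.2 hy
      · rw [← enorm_sq_eq_lintegral]
        simp
      · filter_upwards [hlim] with y hy
        have := ENNReal.Tendsto.pow (n := 2) ((hy.sub_const (F₀ y)).enorm)
        simpa using this
    simp only [lintegral_zero] at h2
    refine h2.congr fun n => ?_
    rw [enorm_sq_eq_lintegral]
    refine lintegral_congr_ae ?_
    filter_upwards [Lp.coeFn_sub (v n) v₀, hv n, hv₀] with y hy h3 h4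
    rw [hy, Pi.sub_apply, h3, h4]
  rw [tendsto_iff_edist_tendsto_0]
  have h3 := h1.ennrpow_const (1 / 2 : ℝ)
  simp_rw [← ENNReal.rpow_natCast, ← ENNReal.rpow_mul] at h3
  simpa [edist_eq_enorm_sub] using h3

open Classical in
/-- Multiplication by an essentially bounded function (zero for other functions). -/
def mulOp (m : Pos d → ℂ) : Op d :=
  if h : MemLp m ⊤ volume then
    (ContinuousLinearMap.mul ℂ ℂ).holderL volume ⊤ 2 2 (h.toLp m) else 0

theorem coeFn_mulOp {m : Pos d → ℂ} (hm : MemLp m ⊤ volume) (u : StateSpace d) :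
    mulOp m u =ᵐ[volume] fun y => m y * u y := by
  rw [mulOp, dif_pos hm]
  filter_upwards [(ContinuousLinearMap.mul ℂ ℂ).coeFn_holder (r := 2) (hm.toLp m) u,
    hm.coeFn_toLp] with y h1 h2
  simp only [ContinuousLinearMap.holderL_apply_apply]
  rw [h1, h2]
  rfl

theorem memLp_top_of_norm_le {m : Pos d → ℂ} (hm : AEStronglyMeasurable m) {C : ℝ}
    (hC : ∀ y, ‖m y‖ ≤ C) : MemLp m ⊤ volume :=
  memLp_top_of_bound hm C (ae_of_all _ hC)

theorem mulOp_comp {m n : Pos d → ℂ} (hm : MemLp m ⊤ volume) (hn : MemLp n ⊤ volume)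
    (u : StateSpace d) : mulOp m (mulOp n u) = mulOp (fun y => m y * n y) u := by
  have hmn : MemLp (fun y => m y * n y) ⊤ volume := hn.mul hm
  refine Lp.ext ?_
  filter_upwards [coeFn_mulOp hm (mulOp n u), coeFn_mulOp hn u, coeFn_mulOp hmn u]
    with y h1 h2 h3
  rw [h1, h2, h3, mul_assoc]

theorem mulOp_const (c : ℂ) (u : StateSpace d) : mulOp (fun _ => c) u = c • u := by
  refine Lp.ext ?_
  filter_upwards [coeFn_mulOp (memLp_top_const c) u, Lp.coeFn_smul c u] with y h1 h2
  rw [h1, h2]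
  rfl

theorem mulOp_one (u : StateSpace d) : mulOp (fun _ => 1) u = u := by
  rw [mulOp_const, one_smul]

theorem inner_mulOp_left {m : Pos d → ℂ} (hm : MemLp m ⊤ volume) (u v : StateSpace d) :
    ⟪mulOp m u, v⟫_ℂ = ⟪u, mulOp (fun y => starRingEnd ℂ (m y)) v⟫_ℂ := by
  rw [L2.inner_def, L2.inner_def]
  refine integral_congr_ae ?_
  filter_upwards [coeFn_mulOp hm u, coeFn_mulOp hm.star v] with y h1 h2
  rw [h1]
  erw [h2]
  simp only [RCLike.inner_apply, map_mul, Pi.star_apply, RCLike.star_def]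
  ring

theorem mulOp_adjoint {m : Pos d → ℂ} (hm : MemLp m ⊤ volume) :
    (mulOp m).adjoint = mulOp (fun y => starRingEnd ℂ (m y)) := by
  refine ContinuousLinearMap.ext fun v => ext_inner_left ℂ fun u => ?_
  rw [ContinuousLinearMap.adjoint_inner_right, inner_mulOp_left hm]

theorem norm_mulOp_le {m : Pos d → ℂ} (hm : AEStronglyMeasurable m) {C : ℝ}
    (hC : ∀ y, ‖m y‖ ≤ C) (u : StateSpace d) : ‖mulOp m u‖ ≤ C * ‖u‖ := by
  refine Lp.norm_le_mul_norm_of_ae_le_mul ?_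
  filter_upwards [coeFn_mulOp (memLp_top_of_norm_le hm hC) u] with y hy
  rw [hy, norm_mul]
  gcongr
  exact hC y

theorem tendsto_mulOp {ι : Type*} {l : Filter ι} [l.IsCountablyGenerated]
    {m : ι → Pos d → ℂ} {m₀ : Pos d → ℂ} {C : ℝ} (hm : ∀ n, AEStronglyMeasurable (m n))
    (hm₀ : AEStronglyMeasurable m₀) (hC : ∀ n y, ‖m n y‖ ≤ C) (hC₀ : ∀ y, ‖m₀ y‖ ≤ C)
    (hlim : ∀ y, Tendsto (fun n => m n y) l (𝓝 (m₀ y))) (u : StateSpace d) :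
    Tendsto (fun n => mulOp (m n) u) l (𝓝 (mulOp m₀ u)) := by
  refine tendsto_state_of_dominated (w := ((2 * C : ℝ) : ℂ) • u)
    (fun n => coeFn_mulOp (memLp_top_of_norm_le (hm n) (hC n)) u)
    (coeFn_mulOp (memLp_top_of_norm_le hm₀ hC₀) u) (Eventually.of_forall fun n => ?_)
    (ae_of_all _ fun y => (hlim y).mul_const _)
  filter_upwards [Lp.coeFn_smul ((2 * C : ℝ) : ℂ) u] with y hy
  rw [hy, Pi.smul_apply, norm_smul, ← sub_mul, norm_mul]
  gcongr
  have := (norm_sub_le (m n y) (m₀ y)).trans (add_le_add (hC n y) (hC₀ y))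
  rw [Complex.norm_real, Real.norm_eq_abs]
  exact this.trans ((two_mul C).ge.trans (le_abs_self _))

/-- The unitary multiplication by `exp(i m)`. -/
def expOp (m : Pos d → ℝ) : Op d := mulOp fun y => Complex.exp (Complex.I * (m y : ℂ))

theorem norm_exp_I_mul (r : ℝ) : ‖Complex.exp (Complex.I * (r : ℂ))‖ = 1 := by
  rw [mul_comm]; exact Complex.norm_exp_ofReal_mul_I r

theorem measurable_expI {m : Pos d → ℝ} (hm : Measurable m) :
    Measurable fun y => Complex.exp (Complex.I * (m y : ℂ)) := by fun_prop

theorem memLp_expI {m : Pos d → ℝ} (hm : Measurable m) :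
    MemLp (fun y => Complex.exp (Complex.I * (m y : ℂ))) ⊤ volume :=
  memLp_top_of_norm_le (C := 1) (measurable_expI hm).aestronglyMeasurable
    fun y => (norm_exp_I_mul _).le

theorem expOp_add {m n : Pos d → ℝ} (hm : Measurable m) (hn : Measurable n) (u : StateSpace d) :
    expOp m (expOp n u) = expOp (fun y => m y + n y) u := by
  rw [expOp, expOp, mulOp_comp (memLp_expI hm) (memLp_expI hn), expOp]
  simp_rw [← Complex.exp_add, Complex.ofReal_add, mul_add]

theorem expOp_zero (u : StateSpace d) : expOp (fun _ => 0) u = u := by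
  simp [expOp, mulOp_one]

theorem inner_expOp_left {m : Pos d → ℝ} (hm : Measurable m) (u v : StateSpace d) :
    ⟪expOp m u, v⟫_ℂ = ⟪u, expOp (fun y => -m y) v⟫_ℂ := by
  rw [expOp, inner_mulOp_left (memLp_expI hm), expOp]
  congr 3
  ext y
  rw [← Complex.exp_conj]
  simp

theorem norm_expOp {m : Pos d → ℝ} (hm : Measurable m) (u : StateSpace d) :
    ‖expOp m u‖ = ‖u‖ := by
  have h : ⟪expOp m u, expOp m u⟫_ℂ = ⟪u, u⟫_ℂ := by
    rw [inner_expOp_left hm, expOp_add (m := fun y => -m y) hm.neg hm]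
    simp [expOp_zero]
  rw [inner_self_eq_norm_sq_to_K, inner_self_eq_norm_sq_to_K] at h
  have h2 : ‖expOp m u‖ ^ 2 = ‖u‖ ^ 2 := by exact_mod_cast h
  exact (sq_eq_sq₀ (norm_nonneg _) (norm_nonneg _)).1 h2

theorem continuous_expOp {X : Type*} [TopologicalSpace X] [FirstCountableTopology X]
    {m : X → Pos d → ℝ} (hm : ∀ t, Measurable (m t)) (hc : ∀ y, Continuous fun t => m t y)
    (u : StateSpace d) : Continuous fun t => expOp (m t) u := by
  refine continuous_iff_continuousAt.2 fun t => ?_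
  refine tendsto_mulOp (C := 1) (fun n => (measurable_expI (hm n)).aestronglyMeasurable)
    (measurable_expI (hm t)).aestronglyMeasurable (fun n y => (norm_exp_I_mul _).le)
    (fun y => (norm_exp_I_mul _).le) (fun y => ?_) u
  exact (Complex.continuous_exp.comp
    (continuous_const.mul (Complex.continuous_ofReal.comp (hc y)))).tendsto t

/-! ### Unbounded multiplication operators and their unitary groups -/

theorem norm_exp_sub_one_le (r : ℝ) : ‖Complex.exp (Complex.I * (r : ℂ)) - 1‖ ≤ |r| := by
  simpa using Real.norm_exp_I_mul_ofReal_sub_one_le (x := r)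

/-- If `α = m u` with `u, α ∈ L²`, then `d/dh exp(ihm) u = iα` at `h = 0`. -/
theorem hasDerivAt_expOp {m : Pos d → ℝ} (hm : Measurable m) {u α : StateSpace d}
    (h : α =ᵐ[volume] fun y => (m y : ℂ) * u y) :
    HasDerivAt (fun h : ℝ => expOp (fun y => h * m y) u) (Complex.I • α) 0 := by
  rw [hasDerivAt_iff_tendsto_slope_zero]
  simp only [zero_add, zero_mul, expOp_zero]
  refine tendsto_state_of_dominated (w := (2 : ℂ) • α)
    (F := fun h y => ((h : ℂ)⁻¹ * (Complex.exp (Complex.I * ((h * m y : ℝ) : ℂ)) - 1)) * u y)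
    (F₀ := fun y => Complex.I * (m y : ℂ) * u y) (fun t => ?_) ?_ ?_ ?_
  · filter_upwards [Lp.coeFn_smul (t⁻¹) (expOp (fun y => t * m y) u - u),
      Lp.coeFn_sub (expOp (fun y => t * m y) u) u, coeFn_mulOp (memLp_expI (hm.const_mul t)) u]
      with y h1 h2 h3
    rw [h1, Pi.smul_apply, h2, Pi.sub_apply, expOp, h3, Complex.real_smul]
    push_cast
    ring
  · filter_upwards [Lp.coeFn_smul Complex.I α, h] with y h1 h2
    rw [h1, Pi.smul_apply, h2, smul_eq_mul, mul_assoc]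
  · filter_upwards [self_mem_nhdsWithin] with t (ht : t ≠ 0)
    filter_upwards [Lp.coeFn_smul (2 : ℂ) α, h] with y h1 h2
    rw [h1, Pi.smul_apply, h2, ← sub_mul, norm_mul, norm_smul, norm_mul, ← mul_assoc]
    gcongr
    refine (norm_sub_le _ _).trans ?_
    rw [norm_mul, norm_inv, norm_mul, Complex.norm_I, Complex.norm_real, Complex.norm_real]
    have h3 := norm_exp_sub_one_le (t * m y)
    have h4 : ‖t‖⁻¹ * ‖Complex.exp (Complex.I * ((t * m y : ℝ) : ℂ)) - 1‖ ≤ ‖m y‖ := by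
      rw [inv_mul_le_iff₀ (norm_pos_iff.2 ht)]
      simpa [abs_mul] using h3
    simp only [RCLike.norm_ofNat, one_mul]
    linarith
  · refine ae_of_all _ fun y => Tendsto.mul_const _ ?_
    have h3 : HasDerivAt (fun h : ℝ => Complex.exp (Complex.I * ((h * m y : ℝ) : ℂ)))
        (Complex.I * (m y : ℂ)) 0 := by
      have h4 : HasDerivAt (fun h : ℝ => Complex.I * ((h * m y : ℝ) : ℂ)) (Complex.I * (m y : ℂ)) 0 := by
        have := ((hasDerivAt_id (0 : ℝ)).mul_const (m y)).ofReal_comp.const_mul Complex.I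
        simpa using this
      simpa using h4.cexp
    rw [hasDerivAt_iff_tendsto_slope_zero] at h3
    simpa using h3

theorem abs_mul_inv_one_add_sq_le (r : ℝ) : |r| * (1 + r ^ 2)⁻¹ ≤ 1 := by
  rw [← div_eq_mul_inv, div_le_one (by positivity)]
  nlinarith [sq_nonneg (|r| - 1), sq_abs r, abs_nonneg r]

theorem measurable_inv_one_add_sq {m : Pos d → ℝ} (hm : Measurable m) :
    Measurable fun y => (1 + m y ^ 2)⁻¹ := ((hm.pow_const 2).const_add 1).inv

theorem memLp_inv_one_add_sq {m : Pos d → ℝ} (hm : Measurable m) :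
    MemLp (fun y => (((1 + m y ^ 2)⁻¹ : ℝ) : ℂ)) ⊤ volume := by
  refine memLp_top_of_norm_le (C := 1)
    (Complex.measurable_ofReal.comp (measurable_inv_one_add_sq hm)).aestronglyMeasurable fun y => ?_
  rw [Complex.norm_real, Real.norm_of_nonneg (by positivity)]
  exact inv_le_one_of_one_le₀ (by nlinarith [sq_nonneg (m y)])

theorem memLp_mul_inv_one_add_sq {m : Pos d → ℝ} (hm : Measurable m) :
    MemLp (fun y => ((m y * (1 + m y ^ 2)⁻¹ : ℝ) : ℂ)) ⊤ volume := by
  refine memLp_top_of_norm_le (C := 1)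
    (Complex.measurable_ofReal.comp
      (hm.mul (measurable_inv_one_add_sq hm))).aestronglyMeasurable fun y => ?_
  rw [Complex.norm_real, norm_mul, Real.norm_of_nonneg (r := (1 + m y ^ 2)⁻¹) (by positivity)]
  exact abs_mul_inv_one_add_sq_le _

/-- The graph of multiplication by `m`, described by the bounded functions `m / (1 + m²)` and
`1 / (1 + m²)`. -/
theorem graph_mul_iff {m : Pos d → ℝ} (hm : Measurable m) {u α : StateSpace d} :
    (α =ᵐ[volume] fun y => (m y : ℂ) * u y) ↔
      mulOp (fun y => (((1 + m y ^ 2)⁻¹ : ℝ) : ℂ)) α =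
        mulOp (fun y => ((m y * (1 + m y ^ 2)⁻¹ : ℝ) : ℂ)) u := by
  have h1 := coeFn_mulOp (memLp_inv_one_add_sq hm) α
  have h2 := coeFn_mulOp (memLp_mul_inv_one_add_sq hm) u
  constructor
  · intro h
    refine Lp.ext ?_
    filter_upwards [h, h1, h2] with y h3 h4 h5
    rw [h4, h5, h3]
    push_cast
    ring
  · intro h
    rw [← h] at h2
    filter_upwards [h1, h2] with y h4 h5
    rw [h4] at h5
    have h6 : (((1 + m y ^ 2)⁻¹ : ℝ) : ℂ) ≠ 0 := by
      rw [Complex.ofReal_ne_zero]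
      positivity
    refine mul_left_cancel₀ h6 (h5.trans ?_)
    push_cast
    ring

theorem ae_eq_of_hasDerivAt_expOp {m : Pos d → ℝ} (hm : Measurable m) {u α : StateSpace d}
    (h : HasDerivAt (fun h : ℝ => expOp (fun y => h * m y) u) (Complex.I • α) 0) :
    α =ᵐ[volume] fun y => (m y : ℂ) * u y := by
  rw [graph_mul_iff hm]
  rw [hasDerivAt_iff_tendsto_slope_zero] at h
  simp only [zero_add, zero_mul, expOp_zero] at h
  set r : Pos d → ℂ := fun y => (((1 + m y ^ 2)⁻¹ : ℝ) : ℂ) with hr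
  have h1 := ((mulOp r).continuous.tendsto _).comp h
  have h2 : Tendsto (fun t : ℝ => mulOp (fun y => r y * ((t : ℂ)⁻¹ *
      (Complex.exp (Complex.I * ((t * m y : ℝ) : ℂ)) - 1))) u) (𝓝[≠] 0)
      (𝓝 (mulOp (fun y => Complex.I * ((m y * (1 + m y ^ 2)⁻¹ : ℝ) : ℂ)) u)) := by
    have hr' : ∀ y, ‖r y‖ = (1 + m y ^ 2)⁻¹ := fun y => by
      rw [hr, Complex.norm_real, Real.norm_of_nonneg (by positivity)]
    have hrm : Measurable r := Complex.measurable_ofReal.comp (measurable_inv_one_add_sq hm)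
    have hmr : Measurable fun y => ((m y * (1 + m y ^ 2)⁻¹ : ℝ) : ℂ) :=
      Complex.measurable_ofReal.comp (hm.mul (measurable_inv_one_add_sq hm))
    have hq : ∀ t : ℝ, Measurable fun y => r y * ((t : ℂ)⁻¹ *
        (Complex.exp (Complex.I * ((t * m y : ℝ) : ℂ)) - 1)) := fun t =>
      hrm.mul (((measurable_expI (hm.const_mul t)).sub_const 1).const_mul _)
    have hmr' : Measurable fun y => Complex.I * ((m y * (1 + m y ^ 2)⁻¹ : ℝ) : ℂ) :=
      hmr.const_mul Complex.I
    refine tendsto_mulOp (C := 1) (fun t => (hq t).aestronglyMeasurable)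
      hmr'.aestronglyMeasurable (fun t y => ?_)
      (fun y => ?_) (fun y => ?_) u
    · have h3 := norm_exp_sub_one_le (t * m y)
      have h4 : ‖t‖⁻¹ * ‖Complex.exp (Complex.I * ((t * m y : ℝ) : ℂ)) - 1‖ ≤ ‖m y‖ := by
        rcases eq_or_ne t 0 with rfl | ht
        · simp
        rw [inv_mul_le_iff₀ (norm_pos_iff.2 ht)]
        simpa [abs_mul] using h3
      rw [norm_mul, hr' y, norm_mul, norm_inv, Complex.norm_real]
      calc _ ≤ (1 + m y ^ 2)⁻¹ * ‖m y‖ := by gcongr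
        _ ≤ 1 := by rw [mul_comm]; exact abs_mul_inv_one_add_sq_le _
    · rw [norm_mul, Complex.norm_I, one_mul, Complex.norm_real, norm_mul,
        Real.norm_of_nonneg (r := (1 + m y ^ 2)⁻¹) (by positivity)]
      exact abs_mul_inv_one_add_sq_le _
    · have h3 : HasDerivAt (fun h : ℝ => Complex.exp (Complex.I * ((h * m y : ℝ) : ℂ)))
          (Complex.I * (m y : ℂ)) 0 := by
        have h4 : HasDerivAt (fun h : ℝ => Complex.I * ((h * m y : ℝ) : ℂ))
            (Complex.I * (m y : ℂ)) 0 := by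
          have := ((hasDerivAt_id (0 : ℝ)).mul_const (m y)).ofReal_comp.const_mul Complex.I
          simpa using this
        simpa using h4.cexp
      rw [hasDerivAt_iff_tendsto_slope_zero] at h3
      have h5 := h3.const_mul (r y)
      convert h5 using 2
      · simp
      · simp only [hr]
        push_cast
        ring
  have h3 : mulOp r (Complex.I • α) =
      mulOp (fun y => Complex.I * ((m y * (1 + m y ^ 2)⁻¹ : ℝ) : ℂ)) u := by
    refine tendsto_nhds_unique h1 (h2.congr fun t => ?_)
    refine Lp.ext ?_
    have hmr := memLp_inv_one_add_sq hm
    have hme : MemLp (fun y => r y * ((t : ℂ)⁻¹ *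
      (Complex.exp (Complex.I * ((t * m y : ℝ) : ℂ)) - 1))) ⊤ volume :=
      (((memLp_expI (hm.const_mul t)).sub (memLp_top_const 1)).const_mul _).mul hmr
    filter_upwards [coeFn_mulOp hme u, coeFn_mulOp hmr (t⁻¹ • (expOp (fun y => t * m y) u - u)),
      Lp.coeFn_smul (t⁻¹) (expOp (fun y => t * m y) u - u),
      Lp.coeFn_sub (expOp (fun y => t * m y) u) u, coeFn_mulOp (memLp_expI (hm.const_mul t)) u]
      with y h1 h2 h3 h4 h5
    rw [h1, Function.comp_apply, h2, h3, Pi.smul_apply, h4, Pi.sub_apply, expOp, h5,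
      Complex.real_smul]
    simp only [hr]
    push_cast
    ring
  rw [map_smul] at h3
  have h4 : Complex.I • mulOp (fun y => ((m y * (1 + m y ^ 2)⁻¹ : ℝ) : ℂ)) u =
      mulOp (fun y => Complex.I * ((m y * (1 + m y ^ 2)⁻¹ : ℝ) : ℂ)) u := by
    rw [← mulOp_const, mulOp_comp (memLp_top_const _) (memLp_mul_inv_one_add_sq hm)]
  rw [← h4] at h3
  exact smul_right_injective _ Complex.I_ne_zero h3

/-! ### Translations and the Fourier transform -/

/-- The translation `u ↦ u(· - a)`. -/
def trans (a : Pos d) : Op d :=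
  (Lp.compMeasurePreservingₗᵢ ℂ (fun y : Pos d => y - a)
    (measurePreserving_sub_right volume a)).toContinuousLinearMap

theorem coeFn_trans (a : Pos d) (u : StateSpace d) : trans a u =ᵐ[volume] fun y => u (y - a) :=
  Lp.coeFn_compMeasurePreserving u (measurePreserving_sub_right volume a)

theorem norm_trans (a : Pos d) (u : StateSpace d) : ‖trans a u‖ = ‖u‖ :=
  Lp.norm_compMeasurePreserving u (measurePreserving_sub_right volume a)

theorem continuous_trans (u : StateSpace d) : Continuous fun a : Pos d => trans a u := by
  refine Continuous.compMeasurePreservingLp (g := fun a => ⟨fun y : Pos d => y - a, by fun_prop⟩)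
    continuous_const ?_ (fun a => measurePreserving_sub_right volume a) (by norm_num)
  exact ContinuousMap.continuous_of_continuous_uncurry _
    (continuous_snd.sub continuous_fst)

/-- The Fourier transform as a bounded operator. -/
def fourierOp (d : ℕ) : Op d :=
  (Lp.fourierTransformₗᵢ (Pos d) ℂ).toContinuousLinearEquiv.toContinuousLinearMap

def fourierInvOp (d : ℕ) : Op d :=
  (Lp.fourierTransformₗᵢ (Pos d) ℂ).symm.toContinuousLinearEquiv.toContinuousLinearMap

theorem fourierOp_apply (u : StateSpace d) : fourierOp d u = 𝓕 u := rfl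

theorem fourierOp_fourierInvOp (u : StateSpace d) : fourierOp d (fourierInvOp d u) = u :=
  (Lp.fourierTransformₗᵢ (Pos d) ℂ).apply_symm_apply u

theorem fourierInvOp_fourierOp (u : StateSpace d) : fourierInvOp d (fourierOp d u) = u :=
  (Lp.fourierTransformₗᵢ (Pos d) ℂ).symm_apply_apply u

theorem norm_fourierOp (u : StateSpace d) : ‖fourierOp d u‖ = ‖u‖ := Lp.norm_fourier_eq u

theorem inner_fourierOp (u v : StateSpace d) : ⟪fourierOp d u, fourierOp d v⟫_ℂ = ⟪u, v⟫_ℂ :=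
  Lp.inner_fourier_eq u v

theorem denseRange_toLp : DenseRange fun φ : 𝓢(Pos d, ℂ) => (φ.toLp 2 : StateSpace d) :=
  SchwartzMap.denseRange_toLpCLM (p := 2) ENNReal.ofNat_ne_top

theorem op_ext_schwartz {A B : Op d} (h : ∀ φ : 𝓢(Pos d, ℂ), A (φ.toLp 2) = B (φ.toLp 2)) :
    A = B :=
  ContinuousLinearMap.ext fun u => congrFun (denseRange_toLp.equalizer A.continuous B.continuous
    (funext h)) u

theorem hasTemperateGrowth_expI :
    Function.HasTemperateGrowth fun r : ℝ => Complex.exp (Complex.I * (r : ℂ)) := by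
  have key : ∀ n : ℕ, iteratedDeriv n (fun r : ℝ => Complex.exp (Complex.I * (r : ℂ))) =
      fun r : ℝ => Complex.I ^ n * Complex.exp (Complex.I * (r : ℂ)) := by
    intro n
    induction n with
    | zero => simp
    | succ n ih =>
      rw [iteratedDeriv_succ, ih]
      ext r
      have h4 : HasDerivAt (fun r : ℝ => Complex.I * (r : ℂ)) Complex.I r := by
        simpa using (hasDerivAt_id r).ofReal_comp.const_mul Complex.I
      rw [(h4.cexp.const_mul (Complex.I ^ n)).deriv]
      ring
  refine ⟨(contDiff_const.mul Complex.ofRealCLM.contDiff).cexp, fun n => ⟨0, 1, fun r => ?_⟩⟩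
  rw [norm_iteratedFDeriv_eq_norm_iteratedDeriv, key]
  simp only [pow_zero, mul_one, norm_mul, norm_pow, Complex.norm_I, one_pow, one_mul]
  exact (norm_exp_I_mul r).le

theorem toLp_smulLeft {m : Pos d → ℝ} (hm : m.HasTemperateGrowth) (φ : 𝓢(Pos d, ℂ)) :
    expOp m (φ.toLp 2) =
      (SchwartzMap.smulLeftCLM ℂ (fun y => Complex.exp (Complex.I * (m y : ℂ))) φ).toLp 2 := by
  have hm' : Function.HasTemperateGrowth fun y => Complex.exp (Complex.I * (m y : ℂ)) :=
    hasTemperateGrowth_expI.comp hm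
  refine Lp.ext ?_
  filter_upwards [coeFn_mulOp (memLp_expI hm.1.continuous.measurable) (φ.toLp 2),
    φ.coeFn_toLp 2, (SchwartzMap.smulLeftCLM ℂ (fun y => Complex.exp (Complex.I * (m y : ℂ)))
      φ).coeFn_toLp 2] with y h1 h2 h3
  rw [expOp, h1, h2, h3, SchwartzMap.smulLeftCLM_apply_apply hm', smul_eq_mul]

theorem fourierOp_toLp (φ : 𝓢(Pos d, ℂ)) : fourierOp d (φ.toLp 2) = (𝓕 φ).toLp 2 :=
  SchwartzMap.toLp_fourier_eq φ

theorem measurable_const_mul_inner (r : ℝ) (c : Pos d) :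
    Measurable fun y : Pos d => r * ⟪c, y⟫_ℝ := by fun_prop

theorem fourierOp_trans (a : Pos d) (u : StateSpace d) :
    fourierOp d (trans a u) = expOp (fun k => -(2 * Real.pi) * ⟪a, k⟫_ℝ) (fourierOp d u) := by
  suffices h : fourierOp d ∘L trans a =
      expOp (fun k => -(2 * Real.pi) * ⟪a, k⟫_ℝ) ∘L fourierOp d from DFunLike.congr_fun h u
  refine op_ext_schwartz fun φ => ?_
  have h1 : trans a (φ.toLp 2) = (φ.compSubConstCLM ℂ a).toLp 2 := by
    refine Lp.ext ?_
    have h2 := (measurePreserving_sub_right volume a).quasiMeasurePreserving.ae_eq_comp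
      (φ.coeFn_toLp 2)
    filter_upwards [coeFn_trans a (φ.toLp 2), (φ.compSubConstCLM ℂ a).coeFn_toLp 2, h2]
      with y h3 h4 h5
    rw [h3, h4]
    exact h5
  simp only [ContinuousLinearMap.comp_apply]
  rw [h1, fourierOp_toLp, fourierOp_toLp]
  refine Lp.ext ?_
  filter_upwards [(𝓕 (φ.compSubConstCLM ℂ a)).coeFn_toLp 2, (𝓕 φ).coeFn_toLp 2,
    coeFn_mulOp (memLp_expI (measurable_const_mul_inner (-(2 * Real.pi)) a)) ((𝓕 φ).toLp 2)]
    with k h3 h4 h5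
  rw [h3, expOp, h5, h4, SchwartzMap.fourier_coe, SchwartzMap.fourier_coe]
  have h6 := congrFun (VectorFourier.fourierIntegral_comp_add_right Real.fourierChar volume
    (innerₗ (Pos d)) (φ : Pos d → ℂ) (-a)) k
  have h7 : ((φ.compSubConstCLM ℂ a : 𝓢(Pos d, ℂ)) : Pos d → ℂ) =
      (φ : Pos d → ℂ) ∘ fun v => v + -a := by
    ext y
    simp [sub_eq_add_neg]
  rw [h7]
  refine h6.trans ?_
  rw [Circle.smul_def, Real.fourierChar_apply, smul_eq_mul]
  congr 2
  simp
  ring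

theorem fourierOp_expOp (c : Pos d) (u : StateSpace d) :
    fourierOp d (expOp (fun y => 2 * Real.pi * ⟪c, y⟫_ℝ) u) = trans c (fourierOp d u) := by
  suffices h : fourierOp d ∘L expOp (fun y => 2 * Real.pi * ⟪c, y⟫_ℝ) =
      trans c ∘L fourierOp d from DFunLike.congr_fun h u
  refine op_ext_schwartz fun φ => ?_
  have hg : Function.HasTemperateGrowth fun y : Pos d => 2 * Real.pi * ⟪c, y⟫_ℝ :=
    (Function.HasTemperateGrowth.const _).mul (Function.hasTemperateGrowth_inner_right c)
  have hg' : Function.HasTemperateGrowth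
      fun y : Pos d => Complex.exp (Complex.I * ((2 * Real.pi * ⟪c, y⟫_ℝ : ℝ) : ℂ)) :=
    hasTemperateGrowth_expI.comp hg
  simp only [ContinuousLinearMap.comp_apply]
  rw [toLp_smulLeft hg, fourierOp_toLp, fourierOp_toLp]
  have h2 := (measurePreserving_sub_right volume c).quasiMeasurePreserving.ae_eq_comp
      ((𝓕 φ).coeFn_toLp 2)
  refine Lp.ext ?_
  filter_upwards [coeFn_trans c ((𝓕 φ).toLp 2), h2, SchwartzMap.coeFn_toLp (𝓕
    (SchwartzMap.smulLeftCLM ℂ (fun y : Pos d =>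
      Complex.exp (Complex.I * ((2 * Real.pi * ⟪c, y⟫_ℝ : ℝ) : ℂ))) φ)) 2] with k h3 h4 h5
  rw [h5, h3]
  refine Eq.trans ?_ h4.symm
  rw [Function.comp_apply, SchwartzMap.fourier_coe, SchwartzMap.fourier_coe, Real.fourier_eq,
    Real.fourier_eq]
  refine integral_congr_ae (ae_of_all _ fun y => ?_)
  simp only [SchwartzMap.smulLeftCLM_apply_apply hg', Circle.smul_def, Real.fourierChar_apply,
    smul_eq_mul]
  rw [← mul_assoc, ← Complex.exp_add]
  congr 2
  rw [inner_sub_right, real_inner_comm y c]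
  push_cast
  ring

theorem continuous_fourier_of_integrable {f : Pos d → ℂ} (hf : Integrable f) :
    Continuous (𝓕 f) :=
  VectorFourier.fourierIntegral_continuous Real.continuous_fourierChar
    (by simpa using continuous_inner) hf

/-- On `L¹ ∩ L²` the Fourier transform of `L²` is given by the Fourier integral. -/
theorem coeFn_fourierOp {u : StateSpace d} (hu : Integrable u) :
    fourierOp d u =ᵐ[volume] 𝓕 (u : Pos d → ℂ) := by
  refine ae_eq_of_integral_contDiff_smul_eq
    ((Lp.memLp (fourierOp d u)).locallyIntegrable (by norm_num))
    (continuous_fourier_of_integrable hu).locallyIntegrable fun g hg hg' => ?_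
  have hgc : HasCompactSupport fun y => ((g y : ℝ) : ℂ) := hg'.comp_left Complex.ofReal_zero
  set χ : 𝓢(Pos d, ℂ) := hgc.toSchwartzMap (Complex.ofRealCLM.contDiff.comp hg) with hχ
  have hχa : ∀ y, χ y = ((g y : ℝ) : ℂ) := fun y => rfl
  have h1 := DFunLike.congr_fun (Lp.fourier_toTemperedDistribution_eq u) χ
  rw [TemperedDistribution.fourier_apply, Lp.toTemperedDistribution_apply,
    Lp.toTemperedDistribution_apply] at h1
  have h2 := VectorFourier.integral_fourierIntegral_smul_eq_flip (μ := volume) (ν := volume)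
    (L := innerₗ (Pos d)) (f := (u : Pos d → ℂ)) (g := (χ : Pos d → ℂ))
    Real.continuous_fourierChar (by simpa using continuous_inner) hu χ.integrable
  rw [flip_innerₗ] at h2
  calc ∫ x, g x • fourierOp d u x = ∫ x, χ x • (𝓕 u : StateSpace d) x := by
        refine integral_congr_ae (ae_of_all _ fun y => ?_)
        simp [hχa, fourierOp_apply]
    _ = ∫ x, (𝓕 χ) x • u x := h1.symm
    _ = ∫ x, u x • (𝓕 χ) x := by simp_rw [smul_eq_mul, mul_comm]
    _ = ∫ x, 𝓕 (u : Pos d → ℂ) x • χ x := h2.symm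
    _ = _ := by
        refine integral_congr_ae (ae_of_all _ fun y => ?_)
        simp [hχa, mul_comm]

/-! ### Gaussian moments -/

/-- The profile `(πħ)^{-d/4} exp(-|v|²/2ħ)` of the coherent states. -/
def gaussProfile (ħ : ℝ) (v : Pos d) : ℝ :=
  (Real.pi * ħ) ^ (-(d : ℝ) / 4) * Real.exp (-‖v‖ ^ 2 / (2 * ħ))

theorem continuous_gaussProfile (ħ : ℝ) : Continuous (gaussProfile (d := d) ħ) := by
  unfold gaussProfile; fun_prop

theorem gaussProfile_nonneg {ħ : ℝ} (hħ : 0 < ħ) (v : Pos d) : 0 ≤ gaussProfile ħ v := by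
  unfold gaussProfile; positivity

theorem gaussProfile_neg (ħ : ℝ) (v : Pos d) : gaussProfile ħ (-v) = gaussProfile ħ v := by
  simp [gaussProfile]

theorem gaussProfile_le {ħ : ℝ} (hħ : 0 < ħ) (v : Pos d) :
    gaussProfile ħ v ≤ (Real.pi * ħ) ^ (-(d : ℝ) / 4) := by
  unfold gaussProfile
  refine mul_le_of_le_one_right (by positivity) (Real.exp_le_one_iff.2 ?_)
  rw [neg_div]
  exact neg_nonpos.2 (by positivity)

theorem gaussProfile_sq {ħ : ℝ} (hħ : 0 < ħ) (v : Pos d) :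
    gaussProfile ħ v ^ 2 = (Real.pi * ħ) ^ (-(d : ℝ) / 2) * Real.exp (-ħ⁻¹ * ‖v‖ ^ 2) := by
  rw [gaussProfile, mul_pow, ← Real.rpow_natCast, ← Real.rpow_mul (by positivity),
    ← Real.exp_nat_mul]
  congr 2
  · push_cast; ring
  · push_cast; field_simp

theorem integrable_exp_neg_mul_sq {b : ℝ} (hb : 0 < b) :
    Integrable fun v : Pos d => Real.exp (-b * ‖v‖ ^ 2) := by
  have h := (GaussianFourier.integrable_cexp_neg_mul_sq_norm_add
    (b := (b : ℂ)) (by simpa using hb) 0 (0 : Pos d)).norm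
  refine h.congr (ae_of_all _ fun v => ?_)
  simp only [zero_mul, add_zero, Complex.norm_exp]
  congr 1
  norm_cast

theorem integral_exp_neg_mul_sq {b : ℝ} (hb : 0 < b) :
    ∫ v : Pos d, Real.exp (-b * ‖v‖ ^ 2) = (Real.pi / b) ^ ((d : ℝ) / 2) := by
  have := GaussianFourier.integral_rexp_neg_mul_sq_norm (V := Pos d) hb
  simpa using this

theorem sq_mul_exp_le {b : ℝ} (hb : 0 < b) (r : ℝ) :
    r ^ 2 * Real.exp (-b * r ^ 2) ≤ 2 / b * Real.exp (-(b / 2) * r ^ 2) := by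
  have h1 : b / 2 * r ^ 2 ≤ Real.exp (b / 2 * r ^ 2) := by
    linarith [Real.add_one_le_exp (b / 2 * r ^ 2)]
  have h2 : Real.exp (-b * r ^ 2) = Real.exp (-(b / 2) * r ^ 2) * Real.exp (-(b / 2) * r ^ 2) := by
    rw [← Real.exp_add]; ring_nf
  have h3 : Real.exp (b / 2 * r ^ 2) * Real.exp (-(b / 2) * r ^ 2) = 1 := by
    rw [← Real.exp_add]; simp
  have h4 : r ^ 2 ≤ 2 / b * Real.exp (b / 2 * r ^ 2) := by
    rw [div_mul_eq_mul_div, le_div_iff₀ hb]; linarith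
  calc r ^ 2 * Real.exp (-b * r ^ 2)
      = r ^ 2 * Real.exp (-(b / 2) * r ^ 2) * Real.exp (-(b / 2) * r ^ 2) := by rw [h2]; ring
    _ ≤ (2 / b * Real.exp (b / 2 * r ^ 2)) * Real.exp (-(b / 2) * r ^ 2)
          * Real.exp (-(b / 2) * r ^ 2) := by gcongr
    _ = 2 / b * (Real.exp (b / 2 * r ^ 2) * Real.exp (-(b / 2) * r ^ 2))
          * Real.exp (-(b / 2) * r ^ 2) := by ring
    _ = _ := by rw [h3, mul_one]

theorem integrable_sq_mul_exp {b : ℝ} (hb : 0 < b) :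
    Integrable fun v : Pos d => ‖v‖ ^ 2 * Real.exp (-b * ‖v‖ ^ 2) := by
  refine ((integrable_exp_neg_mul_sq (d := d) (half_pos hb)).const_mul (2 / b)).mono'
    (by fun_prop) (ae_of_all _ fun v => ?_)
  rw [Real.norm_of_nonneg (by positivity)]
  exact sq_mul_exp_le hb _

theorem integral_sq_mul_exp {b : ℝ} (hb : 0 < b) :
    ∫ v : Pos d, ‖v‖ ^ 2 * Real.exp (-b * ‖v‖ ^ 2) =
      (d : ℝ) / (2 * b) * (Real.pi / b) ^ ((d : ℝ) / 2) := by
  have h1 := (hasDerivAt_integral_of_dominated_loc_of_deriv_le (μ := (volume : Measure (Pos d)))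
    (F := fun (b : ℝ) v => Real.exp (-b * ‖v‖ ^ 2))
    (F' := fun (b : ℝ) v => Real.exp (-b * ‖v‖ ^ 2) * (-‖v‖ ^ 2)) (x₀ := b)
    (s := Ioi (b / 2)) (bound := fun v => ‖v‖ ^ 2 * Real.exp (-(b / 2) * ‖v‖ ^ 2))
    (Ioi_mem_nhds (by linarith)) (Eventually.of_forall fun b => by fun_prop)
    (integrable_exp_neg_mul_sq hb) (by fun_prop) (ae_of_all _ fun v c hc => ?_)
    (integrable_sq_mul_exp (half_pos hb)) (ae_of_all _ fun v c hc => ?_)).2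
  · have h2 : HasDerivAt (fun b : ℝ => (Real.pi / b) ^ ((d : ℝ) / 2))
        (-((d : ℝ) / (2 * b) * (Real.pi / b) ^ ((d : ℝ) / 2))) b := by
      have h3 : HasDerivAt (fun b : ℝ => Real.pi / b) (-Real.pi / b ^ 2) b := by
        have := (hasDerivAt_inv hb.ne').const_mul Real.pi
        simpa [div_eq_mul_inv] using this
      have h4 := h3.rpow_const (p := (d : ℝ) / 2) (Or.inl (by positivity))
      convert! h4 using 1
      rw [Real.rpow_sub_one (by positivity)]
      field_simp
    have h5 : HasDerivAt (fun b : ℝ => ∫ v : Pos d, Real.exp (-b * ‖v‖ ^ 2))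
        (-((d : ℝ) / (2 * b) * (Real.pi / b) ^ ((d : ℝ) / 2))) b :=
      h2.congr_of_eventuallyEq (by
        filter_upwards [Ioi_mem_nhds hb] with c hc
        exact integral_exp_neg_mul_sq hc)
    have h6 := h1.unique h5
    rw [← neg_inj, ← h6, ← integral_neg]
    refine integral_congr_ae (ae_of_all _ fun v => ?_)
    ring
  · rw [norm_mul, norm_neg, Real.norm_of_nonneg (by positivity),
      Real.norm_of_nonneg (by positivity), mul_comm]
    have : b / 2 < c := hc
    gcongr
  · have := ((hasDerivAt_id c).neg.mul_const (‖v‖ ^ 2)).exp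
    simpa using this

theorem integrable_gaussProfile_sq {ħ : ℝ} (hħ : 0 < ħ) :
    Integrable fun v : Pos d => gaussProfile ħ v ^ 2 := by
  simp_rw [gaussProfile_sq hħ]
  exact (integrable_exp_neg_mul_sq (inv_pos.2 hħ)).const_mul _

theorem integral_gaussProfile_sq {ħ : ℝ} (hħ : 0 < ħ) :
    ∫ v : Pos d, gaussProfile ħ v ^ 2 = 1 := by
  simp_rw [gaussProfile_sq hħ]
  rw [integral_const_mul, integral_exp_neg_mul_sq (inv_pos.2 hħ), div_inv_eq_mul,
    ← Real.rpow_add (by positivity)]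
  rw [neg_div, neg_add_cancel, Real.rpow_zero]

theorem integrable_sq_mul_gaussProfile_sq {ħ : ℝ} (hħ : 0 < ħ) :
    Integrable fun v : Pos d => ‖v‖ ^ 2 * gaussProfile ħ v ^ 2 := by
  simp_rw [gaussProfile_sq hħ, mul_left_comm]
  exact (integrable_sq_mul_exp (inv_pos.2 hħ)).const_mul _

theorem integral_sq_mul_gaussProfile_sq {ħ : ℝ} (hħ : 0 < ħ) :
    ∫ v : Pos d, ‖v‖ ^ 2 * gaussProfile ħ v ^ 2 = d * ħ / 2 := by
  simp_rw [gaussProfile_sq hħ, mul_left_comm]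
  rw [integral_const_mul, integral_sq_mul_exp (inv_pos.2 hħ), div_inv_eq_mul, mul_left_comm,
    ← Real.rpow_add (by positivity)]
  rw [neg_div, neg_add_cancel, Real.rpow_zero]
  field_simp

theorem lintegral_gaussProfile_sq {ħ : ℝ} (hħ : 0 < ħ) (y : Pos d) :
    ∫⁻ q, ENNReal.ofReal (gaussProfile ħ (y - q) ^ 2) = 1 := by
  rw [lintegral_sub_left_eq_self (fun v => ENNReal.ofReal (gaussProfile ħ v ^ 2)) y,
    ← ofReal_integral_eq_lintegral_ofReal (integrable_gaussProfile_sq hħ)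
    (ae_of_all _ fun v => by positivity), integral_gaussProfile_sq hħ, ENNReal.ofReal_one]

theorem lintegral_sq_mul_gaussProfile_sq {ħ : ℝ} (hħ : 0 < ħ) (x y : Pos d) :
    ∫⁻ q, ‖x - q‖ₑ ^ 2 * ENNReal.ofReal (gaussProfile ħ (y - q) ^ 2) =
      ‖x - y‖ₑ ^ 2 + ENNReal.ofReal (d * ħ / 2) := by
  have h0 := integrable_gaussProfile_sq (d := d) hħ
  have h2 := integrable_sq_mul_gaussProfile_sq (d := d) hħ
  have h1 : Integrable fun v : Pos d => ⟪x - y, v⟫_ℝ * gaussProfile ħ v ^ 2 := by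
    refine ((h0.add h2).const_mul ‖x - y‖).mono'
      (by have := continuous_gaussProfile (d := d) ħ; fun_prop) (ae_of_all _ fun v => ?_)
    rw [norm_mul, Real.norm_of_nonneg (sq_nonneg (gaussProfile ħ v))]
    have h3 : ‖⟪x - y, v⟫_ℝ‖ ≤ ‖x - y‖ * ‖v‖ := norm_inner_le_norm _ _
    have h4 : ‖v‖ ≤ 1 + ‖v‖ ^ 2 := by nlinarith [sq_nonneg (‖v‖ - 1), norm_nonneg v]
    calc _ ≤ ‖x - y‖ * (1 + ‖v‖ ^ 2) * gaussProfile ħ v ^ 2 := by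
          gcongr
          exact h3.trans (by gcongr)
      _ = _ := by simp only [Pi.add_apply]; ring
  have h5 : ∫ v : Pos d, ⟪x - y, v⟫_ℝ * gaussProfile ħ v ^ 2 = 0 := by
    have := integral_neg_eq_self (fun v : Pos d => ⟪x - y, v⟫_ℝ * gaussProfile ħ v ^ 2) volume
    simp only [inner_neg_right, gaussProfile_neg, neg_mul, integral_neg] at this
    linarith
  have h6 : ∀ v : Pos d, ‖x - y + v‖ ^ 2 * gaussProfile ħ v ^ 2 =
      ‖x - y‖ ^ 2 * gaussProfile ħ v ^ 2 + 2 * (⟪x - y, v⟫_ℝ * gaussProfile ħ v ^ 2)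
        + ‖v‖ ^ 2 * gaussProfile ħ v ^ 2 := fun v => by
    rw [norm_add_sq_real]; ring
  calc ∫⁻ q, ‖x - q‖ₑ ^ 2 * ENNReal.ofReal (gaussProfile ħ (y - q) ^ 2)
      = ∫⁻ q, ‖x - y + (y - q)‖ₑ ^ 2 * ENNReal.ofReal (gaussProfile ħ (y - q) ^ 2) := by
        simp
    _ = ∫⁻ v, ‖x - y + v‖ₑ ^ 2 * ENNReal.ofReal (gaussProfile ħ v ^ 2) :=
        lintegral_sub_left_eq_self
          (fun v => ‖x - y + v‖ₑ ^ 2 * ENNReal.ofReal (gaussProfile ħ v ^ 2)) y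
    _ = ∫⁻ v, ENNReal.ofReal (‖x - y + v‖ ^ 2 * gaussProfile ħ v ^ 2) := by
        refine lintegral_congr fun v => ?_
        rw [ENNReal.ofReal_mul (by positivity), ← ofReal_norm, ENNReal.ofReal_pow (norm_nonneg _)]
    _ = ENNReal.ofReal (∫ v, ‖x - y + v‖ ^ 2 * gaussProfile ħ v ^ 2) := by
        rw [ofReal_integral_eq_lintegral_ofReal _ (ae_of_all _ fun v => by positivity)]
        simp_rw [h6]
        exact ((h0.const_mul _).add (h1.const_mul _)).add h2
    _ = ENNReal.ofReal (‖x - y‖ ^ 2 + d * ħ / 2) := by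
        simp_rw [h6]
        rw [integral_add (f := fun v : Pos d => ‖x - y‖ ^ 2 * gaussProfile ħ v ^ 2 +
            2 * (⟪x - y, v⟫_ℝ * gaussProfile ħ v ^ 2))
            ((h0.const_mul _).add (h1.const_mul _)) h2,
          integral_add (h0.const_mul _) (h1.const_mul _), integral_const_mul, integral_const_mul,
          h5, integral_gaussProfile_sq hħ, integral_sq_mul_gaussProfile_sq hħ]
        simp
    _ = _ := by
        rw [ENNReal.ofReal_add (by positivity) (by positivity),
          ENNReal.ofReal_pow (norm_nonneg _), ofReal_norm]

/-! ### Coherent states -/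

theorem coherentState_eq {ħ : ℝ} (hħ : 0 < ħ) (z : Phase d) :
    coherentState ħ z = (memLp_coherentFun hħ z).toLp := dif_pos _

theorem coeFn_coherentState {ħ : ℝ} (hħ : 0 < ħ) (z : Phase d) :
    coherentState ħ z =ᵐ[volume] coherentFun ħ z := by
  rw [coherentState_eq hħ]; exact MemLp.coeFn_toLp _

theorem coherentFun_eq (ħ : ℝ) (z : Phase d) (y : Pos d) :
    coherentFun ħ z y = (gaussProfile ħ (y - z.1) : ℂ) *
      Complex.exp (Complex.I * ((⟪z.2, y - z.1⟫_ℝ / ħ : ℝ) : ℂ)) := rfl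

theorem coherentState_eq_trans {ħ : ℝ} (hħ : 0 < ħ) (z : Phase d) :
    coherentState ħ z =
      trans z.1 (expOp (fun y => ħ⁻¹ * ⟪z.2, y⟫_ℝ) (coherentState ħ (0 : Phase d))) := by
  have h1 := (measurePreserving_sub_right volume z.1).quasiMeasurePreserving.ae_eq_comp
    (coeFn_mulOp (memLp_expI (measurable_const_mul_inner ħ⁻¹ z.2)) (coherentState ħ (0 : Phase d)))
  have h2 := (measurePreserving_sub_right volume z.1).quasiMeasurePreserving.ae_eq_comp
    (coeFn_coherentState hħ (0 : Phase d))
  refine Lp.ext ?_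
  filter_upwards [coeFn_coherentState hħ z, coeFn_trans z.1 (expOp (fun y => ħ⁻¹ * ⟪z.2, y⟫_ℝ)
    (coherentState ħ (0 : Phase d))), h1, h2] with y h3 h4 h5 h6
  simp only [Function.comp_apply] at h5 h6
  rw [h3, h4, expOp, h5, h6, coherentFun_eq, coherentFun_eq]
  simp only [Prod.fst_zero, Prod.snd_zero, sub_zero, inner_zero_left, zero_div, Complex.ofReal_zero,
    mul_zero, Complex.exp_zero, mul_one]
  rw [mul_comm, div_eq_inv_mul]

theorem continuous_coherentState {ħ : ℝ} (hħ : 0 < ħ) :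
    Continuous (coherentState ħ : Phase d → StateSpace d) := by
  have h1 : Continuous fun p : Pos d =>
      expOp (fun y => ħ⁻¹ * ⟪p, y⟫_ℝ) (coherentState ħ (0 : Phase d)) :=
    continuous_expOp (fun p => measurable_const_mul_inner _ _) (fun y => by fun_prop) _
  have h2 : Continuous fun x : StateSpace d × Pos d => trans x.2 x.1 := by
    refine continuous_prod_of_continuous_lipschitzWith _ 1 continuous_trans (fun a => ?_)
    exact (AddMonoidHomClass.isometry_of_norm (trans a) (norm_trans a)).lipschitz
  have h3 : Continuous fun z : Phase d =>
      (expOp (fun y => ħ⁻¹ * ⟪z.2, y⟫_ℝ) (coherentState ħ (0 : Phase d)), z.1) :=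
    Continuous.prodMk (Continuous.comp (g := fun p : Pos d =>
      expOp (fun y => ħ⁻¹ * ⟪p, y⟫_ℝ) (coherentState ħ (0 : Phase d))) h1 continuous_snd)
      continuous_fst
  have h4 := Continuous.comp h2 h3
  exact h4.congr fun z => (coherentState_eq_trans hħ z).symm

/-! ### The cost in terms of coherent states -/

theorem windowed_plancherel {γ : Pos d → ℝ} {C : ℝ} (hγ : Continuous γ) (hC : ∀ y, ‖(γ y : ℂ)‖ ≤ C)
    (hγ2 : MemLp (fun y => (γ y : ℂ)) 2 volume) (φ : StateSpace d) :
    ∫⁻ η, ‖𝓕 (fun y => (γ y : ℂ) * φ y) η‖ₑ ^ 2 =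
      ∫⁻ y, ENNReal.ofReal (γ y ^ 2) * ‖φ y‖ₑ ^ 2 := by
  have hm : MemLp (fun y => (γ y : ℂ)) ⊤ volume :=
    memLp_top_of_norm_le (Continuous.aestronglyMeasurable (by fun_prop)) hC
  have h1 := coeFn_mulOp hm φ
  have hint : Integrable (mulOp (fun y => (γ y : ℂ)) φ) :=
    (hγ2.integrable_mul (Lp.memLp φ)).congr h1.symm
  have h2 := coeFn_fourierOp hint
  have h3 : ∀ η, 𝓕 (mulOp (fun y => (γ y : ℂ)) φ : Pos d → ℂ) η =
      𝓕 (fun y => (γ y : ℂ) * φ y) η := fun η => Real.fourier_congr_ae h1 η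
  calc _ = ∫⁻ η, ‖fourierOp d (mulOp (fun y => (γ y : ℂ)) φ) η‖ₑ ^ 2 := by
        refine lintegral_congr_ae ?_
        filter_upwards [h2] with η hη
        rw [hη, h3]
    _ = ‖mulOp (fun y => (γ y : ℂ)) φ‖ₑ ^ 2 := by
        rw [← enorm_sq_eq_lintegral, ← ofReal_norm, norm_fourierOp, ofReal_norm]
    _ = _ := by
        rw [enorm_sq_eq_lintegral]
        refine lintegral_congr_ae ?_
        filter_upwards [h1] with y hy
        rw [hy, enorm_mul, mul_pow, ← ofReal_norm (γ y : ℂ), Complex.norm_real,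
          ← ENNReal.ofReal_pow (norm_nonneg _), Real.norm_eq_abs, sq_abs]

theorem continuous_fourier_window {γ : Pos d → ℝ}
    (hγ2 : MemLp (fun y => (γ y : ℂ)) 2 volume) (φ : StateSpace d) :
    Continuous (𝓕 fun y => (γ y : ℂ) * φ y) :=
  continuous_fourier_of_integrable (hγ2.integrable_mul (Lp.memLp φ))

theorem lintegral_comp_inv_smul {c : ℝ} (hc : 0 < c) {F : Pos d → ℝ≥0∞} (hF : Measurable F) :
    ∫⁻ p, F (c⁻¹ • p) = ENNReal.ofReal (c ^ d) * ∫⁻ η, F η := by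
  have h1 := Measure.map_addHaar_smul (volume : Measure (Pos d)) (r := c⁻¹) (by positivity)
  rw [← lintegral_map hF (measurable_const_smul c⁻¹)]
  erw [h1]
  rw [lintegral_smul_measure]
  simp only [finrank_euclideanSpace, Fintype.card_fin, inv_pow, inv_inv, smul_eq_mul]
  rw [abs_of_pos (by positivity)]

theorem memLp_gaussProfile_sub {ħ : ℝ} (hħ : 0 < ħ) (q : Pos d) :
    MemLp (fun y => (gaussProfile ħ (y - q) : ℂ)) 2 volume := by
  have hc := continuous_gaussProfile (d := d) ħ
  rw [memLp_two_iff_integrable_sq_norm (Continuous.aestronglyMeasurable (by fun_prop))]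
  refine ((integrable_gaussProfile_sq hħ).comp_sub_right q).congr (ae_of_all _ fun y => ?_)
  simp

theorem norm_gaussProfile_le {ħ : ℝ} (hħ : 0 < ħ) (v : Pos d) :
    ‖(gaussProfile ħ v : ℂ)‖ ≤ (Real.pi * ħ) ^ (-(d : ℝ) / 4) := by
  rw [Complex.norm_real, Real.norm_of_nonneg (gaussProfile_nonneg hħ v)]
  exact gaussProfile_le hħ v

theorem enorm_inner_coherentState_pos {ħ : ℝ} (hħ : 0 < ħ) (z : Phase d) (φ : StateSpace d) :
    ‖⟪coherentState ħ z, φ⟫_ℂ‖ₑ =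
      ‖𝓕 (fun y => (gaussProfile ħ (y - z.1) : ℂ) * φ y) ((2 * Real.pi * ħ)⁻¹ • z.2)‖ₑ := by
  have h1 : ⟪coherentState ħ z, φ⟫_ℂ =
      Complex.exp (Complex.I * ((⟪z.2, z.1⟫_ℝ / ħ : ℝ) : ℂ)) *
        𝓕 (fun y => (gaussProfile ħ (y - z.1) : ℂ) * φ y) ((2 * Real.pi * ħ)⁻¹ • z.2) := by
    rw [L2.inner_def, Real.fourier_eq', ← integral_const_mul]
    refine integral_congr_ae ?_
    filter_upwards [coeFn_coherentState hħ z] with y hy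
    rw [hy, RCLike.inner_apply, coherentFun_eq, map_mul, ← Complex.exp_conj]
    simp only [Complex.conj_ofReal, map_mul, Complex.conj_I, smul_eq_mul]
    have h2 : Complex.exp (-Complex.I * ((⟪z.2, y - z.1⟫_ℝ / ħ : ℝ) : ℂ)) =
        Complex.exp (Complex.I * ((⟪z.2, z.1⟫_ℝ / ħ : ℝ) : ℂ)) *
          Complex.exp (((-2 * Real.pi * ⟪y, (2 * Real.pi * ħ)⁻¹ • z.2⟫_ℝ : ℝ) : ℂ) * Complex.I) := by
      rw [← Complex.exp_add]
      congr 1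
      have h3 : -2 * Real.pi * ⟪y, (2 * Real.pi * ħ)⁻¹ • z.2⟫_ℝ = -(⟪z.2, y⟫_ℝ / ħ) := by
        rw [inner_smul_right, real_inner_comm]
        have := Real.pi_pos.ne'
        field_simp
      rw [h3, inner_sub_right]
      push_cast
      ring
    rw [h2]
    ring
  rw [h1, enorm_mul, ← ofReal_norm (Complex.exp _), norm_exp_I_mul, ENNReal.ofReal_one, one_mul]

theorem lintegral_coherentState_snd {ħ : ℝ} (hħ : 0 < ħ) (q : Pos d) (φ : StateSpace d) :
    ∫⁻ p, ‖⟪coherentState ħ (q, p), φ⟫_ℂ‖ₑ ^ 2 =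
      ENNReal.ofReal ((2 * Real.pi * ħ) ^ d) *
        ∫⁻ y, ENNReal.ofReal (gaussProfile ħ (y - q) ^ 2) * ‖φ y‖ₑ ^ 2 := by
  have hc := continuous_gaussProfile (d := d) ħ
  simp_rw [enorm_inner_coherentState_pos hħ]
  have hcont := continuous_fourier_window (memLp_gaussProfile_sub hħ q) φ
  rw [lintegral_comp_inv_smul (c := 2 * Real.pi * ħ) (by positivity)
    (F := fun η => ‖𝓕 (fun y => (gaussProfile ħ (y - q) : ℂ) * φ y) η‖ₑ ^ 2) (by fun_prop),
    windowed_plancherel (by fun_prop) (fun y => norm_gaussProfile_le hħ _)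
    (memLp_gaussProfile_sub hħ q)]

/-- The profile of the Fourier transform of the coherent state at `(0, p)`. -/
def gaussFourier (ħ : ℝ) (p k : Pos d) : ℝ :=
  (2 * Real.pi * ħ) ^ ((d : ℝ) / 2) * gaussProfile ħ ((2 * Real.pi * ħ) • k - p)

theorem fourier_coherentState {ħ : ℝ} (hħ : 0 < ħ) (p : Pos d) :
    fourierOp d (coherentState ħ ((0 : Pos d), p)) =ᵐ[volume] fun k => (gaussFourier ħ p k : ℂ) := by
  have hG : coherentState ħ ((0 : Pos d), p) =ᵐ[volume] fun v =>
      (((Real.pi * ħ) ^ (-(d : ℝ) / 4) : ℝ) : ℂ) * Complex.exp (-((2 * ħ)⁻¹ : ℝ) * ‖v‖ ^ 2 +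
        2 * Real.pi * Complex.I * ⟪(2 * Real.pi * ħ)⁻¹ • p, v⟫_ℝ) := by
    filter_upwards [coeFn_coherentState hħ ((0 : Pos d), p)] with v hv
    rw [hv, coherentFun_eq, gaussProfile, Complex.ofReal_mul, mul_assoc, Complex.ofReal_exp,
      ← Complex.exp_add]
    congr 2
    simp only [sub_zero, inner_smul_left]
    have := Real.pi_pos.ne'
    push_cast
    have h2 : (ħ : ℂ) ≠ 0 := by exact_mod_cast hħ.ne'
    have h3 : (Real.pi : ℂ) ≠ 0 := by exact_mod_cast this
    simp
    field_simp
  have hint : Integrable (coherentState ħ ((0 : Pos d), p)) := by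
    refine Integrable.congr ?_ hG.symm
    have := GaussianFourier.integrable_cexp_neg_mul_sq_norm_add
      (b := (((2 * ħ)⁻¹ : ℝ) : ℂ)) (by simpa using hħ) (2 * Real.pi * Complex.I)
      ((2 * Real.pi * ħ)⁻¹ • p)
    exact this.const_mul _
  refine (coeFn_fourierOp hint).trans (ae_of_all _ fun k => ?_)
  rw [Real.fourier_congr_ae hG k]
  have h1 := fourier_gaussian_innerProductSpace' (b := (((2 * ħ)⁻¹ : ℝ) : ℂ))
    (by simpa using hħ) ((2 * Real.pi * ħ)⁻¹ • p) k
  have hpi := Real.pi_pos.ne'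
  have h2 : 𝓕 (fun v : Pos d => (((Real.pi * ħ) ^ (-(d : ℝ) / 4) : ℝ) : ℂ) *
      Complex.exp (-((2 * ħ)⁻¹ : ℝ) * ‖v‖ ^ 2 +
        2 * Real.pi * Complex.I * ⟪(2 * Real.pi * ħ)⁻¹ • p, v⟫_ℝ)) k =
      (((Real.pi * ħ) ^ (-(d : ℝ) / 4) : ℝ) : ℂ) *
        𝓕 (fun v : Pos d => Complex.exp (-((2 * ħ)⁻¹ : ℝ) * ‖v‖ ^ 2 +
        2 * Real.pi * Complex.I * ⟪(2 * Real.pi * ħ)⁻¹ • p, v⟫_ℝ)) k := by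
    rw [Real.fourier_eq', Real.fourier_eq', ← integral_const_mul]
    refine integral_congr_ae (ae_of_all _ fun v => ?_)
    simp only [smul_eq_mul]
    ring
  have h3 : ‖(2 * Real.pi * ħ) • k - p‖ ^ 2 / (2 * ħ) =
      Real.pi ^ 2 * ‖(2 * Real.pi * ħ)⁻¹ • p - k‖ ^ 2 / (2 * ħ)⁻¹ := by
    have : (2 * Real.pi * ħ) • k - p = (-(2 * Real.pi * ħ)) • ((2 * Real.pi * ħ)⁻¹ • p - k) := by
      rw [smul_sub, smul_smul, neg_mul, mul_inv_cancel₀ (by positivity)]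
      module
    rw [this, norm_smul, mul_pow, norm_neg, Real.norm_eq_abs, sq_abs]
    field_simp
  have h4 : ((Real.pi : ℂ) / (((2 * ħ)⁻¹ : ℝ) : ℂ)) = ((2 * Real.pi * ħ : ℝ) : ℂ) := by
    push_cast
    rw [div_inv_eq_mul]
    ring
  have h5 : ((Module.finrank ℝ (Pos d) : ℂ) / 2) = (((d : ℝ) / 2 : ℝ) : ℂ) := by
    simp
  rw [h2, h1, h4, h5, ← Complex.ofReal_cpow (by positivity)]
  simp only [gaussFourier, gaussProfile]
  have h6 : -‖(2 * Real.pi * ħ) • k - p‖ ^ 2 / (2 * ħ) =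
      -Real.pi ^ 2 * ‖(2 * Real.pi * ħ)⁻¹ • p - k‖ ^ 2 / (2 * ħ)⁻¹ := by
    rw [neg_div, h3]
    ring
  rw [h6]
  push_cast
  ring_nf

theorem gaussFourier_sq {ħ : ℝ} (hħ : 0 < ħ) (p k : Pos d) :
    gaussFourier ħ p k ^ 2 =
      (2 * Real.pi * ħ) ^ d * gaussProfile ħ ((2 * Real.pi * ħ) • k - p) ^ 2 := by
  rw [gaussFourier, mul_pow, ← Real.rpow_natCast, ← Real.rpow_mul (by positivity)]
  congr 1
  rw [← Real.rpow_natCast]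
  congr 1
  push_cast
  ring

theorem continuous_gaussFourier (ħ : ℝ) (p : Pos d) : Continuous (gaussFourier ħ p) := by
  have hc := continuous_gaussProfile (d := d) ħ
  unfold gaussFourier
  fun_prop

theorem norm_gaussFourier_le {ħ : ℝ} (hħ : 0 < ħ) (p k : Pos d) :
    ‖(gaussFourier ħ p k : ℂ)‖ ≤
      (2 * Real.pi * ħ) ^ ((d : ℝ) / 2) * (Real.pi * ħ) ^ (-(d : ℝ) / 4) := by
  rw [gaussFourier, Complex.ofReal_mul, norm_mul, Complex.norm_real,
    Real.norm_of_nonneg (by positivity)]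
  exact mul_le_mul_of_nonneg_left (norm_gaussProfile_le hħ _) (by positivity)

theorem memLp_gaussFourier {ħ : ℝ} (hħ : 0 < ħ) (p : Pos d) :
    MemLp (fun k => (gaussFourier ħ p k : ℂ)) 2 volume :=
  (memLp_congr_ae (fourier_coherentState hħ p)).1 (Lp.memLp _)

theorem trans_zero (u : StateSpace d) : trans (0 : Pos d) u = u := by
  refine Lp.ext ((coeFn_trans 0 u).trans (ae_of_all _ fun y => ?_))
  simp

theorem fourier_coherentState_mk {ħ : ℝ} (hħ : 0 < ħ) (z : Phase d) :
    fourierOp d (coherentState ħ z) =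
      expOp (fun k => -(2 * Real.pi) * ⟪z.1, k⟫_ℝ)
        (fourierOp d (coherentState ħ ((0 : Pos d), z.2))) := by
  have h : coherentState ħ z = trans z.1 (coherentState ħ ((0 : Pos d), z.2)) := by
    rw [coherentState_eq_trans hħ z, coherentState_eq_trans hħ ((0 : Pos d), z.2), trans_zero]
  rw [h, fourierOp_trans]

theorem coeFn_fourier_coherentState {ħ : ℝ} (hħ : 0 < ħ) (z : Phase d) :
    fourierOp d (coherentState ħ z) =ᵐ[volume] fun k =>
      Complex.exp (Complex.I * ((-(2 * Real.pi) * ⟪z.1, k⟫_ℝ : ℝ) : ℂ)) *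
        (gaussFourier ħ z.2 k : ℂ) := by
  rw [fourier_coherentState_mk hħ z]
  filter_upwards [coeFn_mulOp (memLp_expI (measurable_const_mul_inner (-(2 * Real.pi)) z.1))
    (fourierOp d (coherentState ħ ((0 : Pos d), z.2))), fourier_coherentState hħ z.2] with k h1 h2
  rw [expOp, h1, h2]

theorem enorm_inner_coherentState_mom {ħ : ℝ} (hħ : 0 < ħ) (z : Phase d) (φ : StateSpace d) :
    ‖⟪coherentState ħ z, φ⟫_ℂ‖ₑ =
      ‖𝓕 (fun k => (gaussFourier ħ z.2 k : ℂ) * fourierOp d φ k) (-z.1)‖ₑ := by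
  congr 1
  rw [← inner_fourierOp, L2.inner_def, Real.fourier_eq']
  refine integral_congr_ae ?_
  filter_upwards [coeFn_fourier_coherentState hħ z] with k hk
  rw [hk, RCLike.inner_apply, map_mul, ← Complex.exp_conj, Complex.conj_ofReal, map_mul,
    Complex.conj_I, Complex.conj_ofReal, smul_eq_mul]
  have : -Complex.I * ((-(2 * Real.pi) * ⟪z.1, k⟫_ℝ : ℝ) : ℂ) =
      ((-2 * Real.pi * ⟪k, -z.1⟫_ℝ : ℝ) : ℂ) * Complex.I := by
    rw [inner_neg_right, real_inner_comm]
    push_cast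
    ring
  rw [this]
  ring

theorem lintegral_coherentState_fst {ħ : ℝ} (hħ : 0 < ħ) (p : Pos d) (φ : StateSpace d) :
    ∫⁻ q, ‖⟪coherentState ħ (q, p), φ⟫_ℂ‖ₑ ^ 2 =
      ENNReal.ofReal ((2 * Real.pi * ħ) ^ d) *
        ∫⁻ k, ENNReal.ofReal (gaussProfile ħ ((2 * Real.pi * ħ) • k - p) ^ 2) *
          ‖fourierOp d φ k‖ₑ ^ 2 := by
  simp_rw [enorm_inner_coherentState_mom hħ]
  rw [lintegral_neg_eq_self (μ := volume)
      (f := fun η => ‖𝓕 (fun k => (gaussFourier ħ p k : ℂ) * fourierOp d φ k) η‖ₑ ^ 2),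
    windowed_plancherel (continuous_gaussFourier ħ p) (norm_gaussFourier_le hħ p)
      (memLp_gaussFourier hħ p), ← lintegral_const_mul']
  · refine lintegral_congr fun k => ?_
    rw [gaussFourier_sq hħ, ENNReal.ofReal_mul (by positivity), mul_assoc]
  · simp

instance : MeasurableSpace (StateSpace d) := borel _

instance : BorelSpace (StateSpace d) := ⟨rfl⟩

instance : SecondCountableTopology (StateSpace d) :=
  UniformSpace.secondCountable_of_separable _

theorem measurable_enorm_inner_coherentState {ħ : ℝ} (hħ : 0 < ħ) :
    Measurable fun x : Phase d × StateSpace d => ‖⟪coherentState ħ x.1, x.2⟫_ℂ‖ₑ ^ 2 := by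
  have h := continuous_coherentState (d := d) hħ
  exact Continuous.measurable (by fun_prop)

theorem measurable_enorm_inner_coherentState_left {ħ : ℝ} (hħ : 0 < ħ) (φ : StateSpace d) :
    Measurable fun w : Phase d => ‖⟪coherentState ħ w, φ⟫_ℂ‖ₑ ^ 2 :=
  have h := continuous_coherentState (d := d) hħ
  Continuous.measurable (by fun_prop)

theorem lintegral_mul_coherentState_fst {ħ : ℝ} (hħ : 0 < ħ) {g : Pos d → ℝ≥0∞}
    (hg : Measurable g) (φ : StateSpace d) :
    ∫⁻ w : Phase d, g w.1 * ‖⟪coherentState ħ w, φ⟫_ℂ‖ₑ ^ 2 =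
      ENNReal.ofReal ((2 * Real.pi * ħ) ^ d) *
        ∫⁻ y, (∫⁻ q, g q * ENNReal.ofReal (gaussProfile ħ (y - q) ^ 2)) * ‖φ y‖ₑ ^ 2 := by
  have hc := (continuous_gaussProfile (d := d) ħ).measurable
  have hφ : Measurable φ := (Lp.stronglyMeasurable φ).measurable
  have hm := measurable_enorm_inner_coherentState_left hħ φ
  have hcoh := continuous_coherentState (d := d) hħ
  rw [Measure.volume_eq_prod, lintegral_prod _ (by fun_prop)]
  have h1 : ∀ q : Pos d, ∫⁻ p : Pos d, g q * ‖⟪coherentState ħ (q, p), φ⟫_ℂ‖ₑ ^ 2 =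
      ENNReal.ofReal ((2 * Real.pi * ħ) ^ d) *
        ∫⁻ y, g q * (ENNReal.ofReal (gaussProfile ħ (y - q) ^ 2) * ‖φ y‖ₑ ^ 2) := fun q => by
    rw [lintegral_const_mul _ (Continuous.measurable (by fun_prop)), lintegral_coherentState_snd hħ,
      lintegral_const_mul _ (by fun_prop)]
    ring
  simp_rw [h1]
  rw [lintegral_const_mul' _ _ (by simp), lintegral_lintegral_swap (by fun_prop)]
  congr 1
  refine lintegral_congr fun y => ?_
  rw [← lintegral_mul_const _ (by fun_prop)]
  simp_rw [mul_assoc]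

theorem lintegral_mul_coherentState_snd {ħ : ℝ} (hħ : 0 < ħ) {g : Pos d → ℝ≥0∞}
    (hg : Measurable g) (φ : StateSpace d) :
    ∫⁻ w : Phase d, g w.2 * ‖⟪coherentState ħ w, φ⟫_ℂ‖ₑ ^ 2 =
      ENNReal.ofReal ((2 * Real.pi * ħ) ^ d) *
        ∫⁻ k, (∫⁻ p, g p * ENNReal.ofReal (gaussProfile ħ ((2 * Real.pi * ħ) • k - p) ^ 2)) *
          ‖fourierOp d φ k‖ₑ ^ 2 := by
  have hc := (continuous_gaussProfile (d := d) ħ).measurable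
  have hφ : Measurable (fourierOp d φ) := (Lp.stronglyMeasurable _).measurable
  have hm := measurable_enorm_inner_coherentState_left hħ φ
  have hcoh := continuous_coherentState (d := d) hħ
  rw [Measure.volume_eq_prod, lintegral_prod_symm _ (by fun_prop)]
  have h1 : ∀ p : Pos d, ∫⁻ q : Pos d, g p * ‖⟪coherentState ħ (q, p), φ⟫_ℂ‖ₑ ^ 2 =
      ENNReal.ofReal ((2 * Real.pi * ħ) ^ d) *
        ∫⁻ k, g p * (ENNReal.ofReal (gaussProfile ħ ((2 * Real.pi * ħ) • k - p) ^ 2) *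
          ‖fourierOp d φ k‖ₑ ^ 2) := fun p => by
    rw [lintegral_const_mul _ (Continuous.measurable (by fun_prop)), lintegral_coherentState_fst hħ,
      lintegral_const_mul _ (by fun_prop)]
    ring
  simp_rw [h1]
  rw [lintegral_const_mul' _ _ (by simp), lintegral_lintegral_swap (by fun_prop)]
  congr 1
  refine lintegral_congr fun y => ?_
  rw [← lintegral_mul_const _ (by fun_prop)]
  simp_rw [mul_assoc]

theorem lintegral_enorm_inner_coherentState {ħ : ℝ} (hħ : 0 < ħ) (φ : StateSpace d) :
    ∫⁻ w : Phase d, ‖⟪coherentState ħ w, φ⟫_ℂ‖ₑ ^ 2 =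
      ENNReal.ofReal ((2 * Real.pi * ħ) ^ d) * ‖φ‖ₑ ^ 2 := by
  have := lintegral_mul_coherentState_fst hħ (g := fun _ => 1) measurable_const φ
  simp only [one_mul, lintegral_gaussProfile_sq hħ] at this
  rw [this, enorm_sq_eq_lintegral]

/-- The cost `½(|x - q|² + |ξ - p|²)` between two points of phase space. -/
def phaseCost (z w : Phase d) : ℝ≥0∞ :=
  ENNReal.ofReal ((‖z.1 - w.1‖ ^ 2 + ‖z.2 - w.2‖ ^ 2) / 2)

theorem measurable_phaseCost : Measurable fun x : Phase d × Phase d => phaseCost x.1 x.2 := by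
  unfold phaseCost
  fun_prop

theorem measurable_phaseCost_right (z : Phase d) : Measurable fun w : Phase d => phaseCost z w := by
  unfold phaseCost
  fun_prop

theorem phaseCost_eq (z w : Phase d) : phaseCost z w =
    ENNReal.ofReal (1 / 2) * (‖z.1 - w.1‖ₑ ^ 2 + ‖z.2 - w.2‖ₑ ^ 2) := by
  rw [phaseCost, ← ofReal_norm, ← ofReal_norm, ← ENNReal.ofReal_pow (norm_nonneg _),
    ← ENNReal.ofReal_pow (norm_nonneg _), ← ENNReal.ofReal_add (by positivity) (by positivity),
    ← ENNReal.ofReal_mul (by norm_num)]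
  congr 1
  ring

theorem lintegral_phaseCost_coherentState {ħ : ℝ} (hħ : 0 < ħ) (z : Phase d) (φ : StateSpace d) :
    ∫⁻ w : Phase d, phaseCost z w * ‖⟪coherentState ħ w, φ⟫_ℂ‖ₑ ^ 2 =
      ENNReal.ofReal ((2 * Real.pi * ħ) ^ d) *
        (costForm ħ z φ + ENNReal.ofReal (d * ħ / 2) * ‖φ‖ₑ ^ 2) := by
  have hm := measurable_enorm_inner_coherentState_left hħ φ
  have h1 := lintegral_mul_coherentState_fst hħ (g := fun q => ‖z.1 - q‖ₑ ^ 2) (by fun_prop) φ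
  have h2 := lintegral_mul_coherentState_snd hħ (g := fun q => ‖z.2 - q‖ₑ ^ 2) (by fun_prop) φ
  simp only [lintegral_sq_mul_gaussProfile_sq hħ, add_mul] at h1 h2
  have hφ : Measurable φ := (Lp.stronglyMeasurable φ).measurable
  have hφ' : Measurable (fourierOp d φ) := (Lp.stronglyMeasurable _).measurable
  rw [lintegral_add_left (by fun_prop), lintegral_const_mul _ (by fun_prop),
    ← enorm_sq_eq_lintegral] at h1 h2
  rw [← ofReal_norm (fourierOp d φ), norm_fourierOp, ofReal_norm] at h2
  simp_rw [phaseCost_eq, mul_assoc, add_mul]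
  rw [lintegral_const_mul _ (by fun_prop), lintegral_add_left (by fun_prop), h1, h2, costForm,
    fourierOp_apply]
  have hD : ENNReal.ofReal (1 / 2) * (ENNReal.ofReal (d * ħ / 2) * ‖φ‖ₑ ^ 2 +
      ENNReal.ofReal (d * ħ / 2) * ‖φ‖ₑ ^ 2) = ENNReal.ofReal (d * ħ / 2) * ‖φ‖ₑ ^ 2 := by
    have h2 : ENNReal.ofReal (1 / 2) * 2 = 1 := by
      rw [one_div, ENNReal.ofReal_inv_of_pos two_pos, ENNReal.ofReal_ofNat]
      exact ENNReal.inv_mul_cancel two_ne_zero ENNReal.ofNat_ne_top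
    rw [← two_mul, ← mul_assoc, h2, one_mul]
  conv_rhs => rw [← hD]
  ring_nf

theorem costForm_add {ħ : ℝ} (hħ : 0 < ħ) (z : Phase d) (φ : StateSpace d) :
    costForm ħ z φ + ENNReal.ofReal (d * ħ / 2) * ‖φ‖ₑ ^ 2 =
      ENNReal.ofReal ((2 * Real.pi * ħ) ^ d)⁻¹ *
        ∫⁻ w : Phase d, phaseCost z w * ‖⟪coherentState ħ w, φ⟫_ℂ‖ₑ ^ 2 := by
  rw [lintegral_phaseCost_coherentState hħ, ← mul_assoc, ← ENNReal.ofReal_mul (by positivity),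
    inv_mul_cancel₀ (by positivity), ENNReal.ofReal_one, one_mul]

theorem measurable_costForm {ħ : ℝ} (hħ : 0 < ħ) :
    Measurable fun x : Phase d × StateSpace d => costForm ħ x.1 x.2 := by
  have h1 : (fun x : Phase d × StateSpace d => costForm ħ x.1 x.2) = fun x =>
      ENNReal.ofReal ((2 * Real.pi * ħ) ^ d)⁻¹ *
        (∫⁻ w : Phase d, phaseCost x.1 w * ‖⟪coherentState ħ w, x.2⟫_ℂ‖ₑ ^ 2) -
        ENNReal.ofReal (d * ħ / 2) * ‖x.2‖ₑ ^ 2 := by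
    funext x
    rw [← costForm_add hħ]
    exact (ENNReal.add_sub_cancel_right
      (ENNReal.mul_ne_top ENNReal.ofReal_ne_top (ENNReal.pow_ne_top enorm_ne_top))).symm
  rw [h1]
  have h2 : Measurable fun p : (Phase d × StateSpace d) × Phase d =>
      phaseCost p.1.1 p.2 * ‖⟪coherentState ħ p.2, p.1.2⟫_ℂ‖ₑ ^ 2 := by
    have hcoh := continuous_coherentState (d := d) hħ
    have h4 : Continuous fun p : (Phase d × StateSpace d) × Phase d =>
        ‖⟪coherentState ħ p.2, p.1.2⟫_ℂ‖ₑ ^ 2 := by fun_prop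
    refine Measurable.mul ?_ h4.measurable
    unfold phaseCost
    fun_prop
  have h3 := h2.lintegral_prod_right' (ν := volume)
  exact (h3.const_mul _).sub (by fun_prop)

theorem tsum_costForm_add {ħ : ℝ} (hħ : 0 < ħ) (z : Phase d) (A : Op d) :
    ∑' i, costForm ħ z (A (basis d i)) + ENNReal.ofReal (d * ħ / 2) * posTrace (A ∘L A.adjoint) =
      ENNReal.ofReal ((2 * Real.pi * ħ) ^ d)⁻¹ *
        ∫⁻ w : Phase d, phaseCost z w * ENNReal.ofReal
          (RCLike.re ⟪coherentState ħ w, (A ∘L A.adjoint) (coherentState ħ w)⟫_ℂ) := by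
  have hm := fun i => measurable_enorm_inner_coherentState_left hħ (A (basis d i))
  have hc : Measurable fun w : Phase d => phaseCost z w :=
    measurable_phaseCost_right z
  rw [posTrace_comp_adjoint, ← ENNReal.tsum_mul_left, ← ENNReal.tsum_add]
  simp_rw [costForm_add hħ, ENNReal.tsum_mul_left]
  have hs : ∀ i, AEMeasurable fun w : Phase d =>
      phaseCost z w * ‖⟪coherentState ħ w, A (basis d i)⟫_ℂ‖ₑ ^ 2 :=
    fun i => (hc.mul (hm i)).aemeasurable
  rw [← lintegral_tsum hs]
  simp_rw [ENNReal.tsum_mul_left, tsum_enorm_inner_apply_sq, enorm_sq_adjoint_apply]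

theorem costTrace_add {ħ : ℝ} (hħ : 0 < ħ) (z : Phase d) {T : Op d} (hT : T.IsPositive) :
    costTrace ħ z T + ENNReal.ofReal (d * ħ / 2) * posTrace T =
      ENNReal.ofReal ((2 * Real.pi * ħ) ^ d)⁻¹ *
        ∫⁻ w : Phase d, phaseCost z w * ENNReal.ofReal
          (RCLike.re ⟪coherentState ħ w, T (coherentState ħ w)⟫_ℂ) := by
  have := tsum_costForm_add hħ z (opSqrt T)
  rwa [opSqrt_comp_adjoint hT] at this

theorem costTrace_comp_adjoint {ħ : ℝ} (hħ : 0 < ħ) (z : Phase d) {A T : Op d}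
    (hT : T.IsPositive) (hAT : A ∘L A.adjoint = T) (htr : posTrace T ≠ ⊤) :
    costTrace ħ z T = ∑' i, costForm ħ z (A (basis d i)) := by
  have h := costTrace_add hħ z hT
  rw [← hAT, ← tsum_costForm_add hħ z A, hAT] at h
  exact (ENNReal.add_left_inj (ENNReal.mul_ne_top ENNReal.ofReal_ne_top htr)).1 h

theorem norm_coherentState {ħ : ℝ} (hħ : 0 < ħ) (w : Phase d) : ‖coherentState ħ w‖ₑ = 1 := by
  have h : ‖coherentState ħ w‖ₑ ^ 2 = 1 := by
    rw [enorm_sq_eq_lintegral]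
    have h2 := lintegral_sub_right_eq_self (μ := volume)
      (fun y => ENNReal.ofReal (gaussProfile ħ y ^ 2)) w.1
    have h3 := lintegral_gaussProfile_sq hħ (0 : Pos d)
    simp only [zero_sub, gaussProfile_neg] at h3
    rw [h3] at h2
    rw [← h2]
    refine lintegral_congr_ae ?_
    filter_upwards [coeFn_coherentState hħ w] with y hy
    rw [hy, coherentFun_eq, ← ofReal_norm, norm_mul, norm_exp_I_mul, mul_one, Complex.norm_real,
      ← ENNReal.ofReal_pow (norm_nonneg _), Real.norm_eq_abs, sq_abs]
  exact (ENNReal.pow_right_strictMono two_ne_zero).injective (by simpa using h)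

theorem costForm_coherentState {ħ : ℝ} (hħ : 0 < ħ) (z w : Phase d) :
    costForm ħ z (coherentState ħ w) = phaseCost z w + ENNReal.ofReal (d * ħ / 2) := by
  have h1 : ∫⁻ y, ‖z.1 - y‖ₑ ^ 2 * ‖coherentState ħ w y‖ₑ ^ 2 =
      ‖z.1 - w.1‖ₑ ^ 2 + ENNReal.ofReal (d * ħ / 2) := by
    rw [← lintegral_sq_mul_gaussProfile_sq hħ]
    refine lintegral_congr_ae ?_
    filter_upwards [coeFn_coherentState hħ w] with y hy
    rw [hy, coherentFun_eq, ← ofReal_norm (_ * _), norm_mul, norm_exp_I_mul, mul_one,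
      Complex.norm_real, ← ENNReal.ofReal_pow (norm_nonneg _), Real.norm_eq_abs, sq_abs,
      ← neg_sub w.1, gaussProfile_neg]
  have h2 : ∫⁻ k, ‖z.2 - (2 * Real.pi * ħ) • k‖ₑ ^ 2 * ‖(𝓕 (coherentState ħ w) : StateSpace d) k‖ₑ ^ 2 =
      ‖z.2 - w.2‖ₑ ^ 2 + ENNReal.ofReal (d * ħ / 2) := by
    have hc := (continuous_gaussProfile (d := d) ħ).measurable
    have h3 := lintegral_comp_inv_smul (d := d) (c := (2 * Real.pi * ħ)⁻¹) (by positivity)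
      (F := fun p => ‖z.2 - p‖ₑ ^ 2 * ENNReal.ofReal (gaussProfile ħ (w.2 - p) ^ 2)) (by fun_prop)
    rw [lintegral_sq_mul_gaussProfile_sq hħ, inv_inv] at h3
    have h4 : ∀ a : ℝ≥0∞, a = ENNReal.ofReal ((2 * Real.pi * ħ) ^ d) *
        (ENNReal.ofReal ((2 * Real.pi * ħ)⁻¹ ^ d) * a) := fun a => by
      rw [← mul_assoc, ← ENNReal.ofReal_mul (by positivity), ← mul_pow,
        mul_inv_cancel₀ (by positivity)]
      simp
    rw [h4 (‖z.2 - w.2‖ₑ ^ 2 + _), ← h3, ← lintegral_const_mul _ (by fun_prop), ← fourierOp_apply]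
    refine lintegral_congr_ae ?_
    filter_upwards [coeFn_fourier_coherentState hħ w] with k hk
    rw [hk, ← ofReal_norm (_ * _), norm_mul, norm_exp_I_mul, one_mul,
      Complex.norm_real, ← ENNReal.ofReal_pow (norm_nonneg _), Real.norm_eq_abs, sq_abs,
      gaussFourier_sq hħ, ENNReal.ofReal_mul (by positivity), ← neg_sub w.2, gaussProfile_neg]
    ring
  rw [costForm, h1, h2, phaseCost_eq]
  have hD : ENNReal.ofReal (1 / 2) * (ENNReal.ofReal (d * ħ / 2) +
      ENNReal.ofReal (d * ħ / 2)) = ENNReal.ofReal (d * ħ / 2) := by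
    rw [← ENNReal.ofReal_add (by positivity) (by positivity), ← ENNReal.ofReal_mul (by norm_num)]
    congr 1
    ring
  conv_rhs => rw [← hD]
  ring

/-! ### Couplings and transport plans -/

theorem rpow_half_sq (a : ℝ≥0∞) : (a ^ (1 / 2 : ℝ)) ^ 2 = a := by
  rw [← ENNReal.rpow_natCast, ← ENNReal.rpow_mul]
  norm_num

theorem inner_integral_apply {X : Type*} [MeasurableSpace X] {μ : Measure X} {Q : X → Op d}
    (hQ : Integrable Q μ) (x y : StateSpace d) :
    ⟪x, (∫ z, Q z ∂μ) y⟫_ℂ = ∫ z, ⟪x, Q z y⟫_ℂ ∂μ := by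
  rw [ContinuousLinearMap.integral_apply hQ, integral_inner (hQ.apply_continuousLinearMap y)]

theorem re_inner_integral_apply {X : Type*} [MeasurableSpace X] {μ : Measure X} {Q : X → Op d}
    (hQ : Integrable Q μ) (x : StateSpace d) :
    ENNReal.ofReal (RCLike.re ⟪x, (∫ z, Q z ∂μ) x⟫_ℂ) =
      ENNReal.ofReal (∫ z, RCLike.re ⟪x, Q z x⟫_ℂ ∂μ) := by
  rw [inner_integral_apply hQ, ← integral_re]
  exact (hQ.apply_continuousLinearMap x).const_inner x

theorem ofReal_re_inner_integral {X : Type*} [MeasurableSpace X] {μ : Measure X} {Q : X → Op d}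
    (hQ : Integrable Q μ) (hpos : ∀ᵐ z ∂μ, (Q z).IsPositive) (x : StateSpace d) :
    ENNReal.ofReal (RCLike.re ⟪x, (∫ z, Q z ∂μ) x⟫_ℂ) =
      ∫⁻ z, ENNReal.ofReal (RCLike.re ⟪x, Q z x⟫_ℂ) ∂μ := by
  rw [re_inner_integral_apply hQ, ofReal_integral_eq_lintegral_ofReal]
  · exact ((hQ.apply_continuousLinearMap x).const_inner x).re
  · filter_upwards [hpos] with z hz
    exact hz.re_inner_nonneg_right x

theorem IsCoupling.integrable {p : Phase d → ℝ} {R : Op d} {Q : Phase d → Op d}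
    (hQ : IsCoupling p R Q) (hp : Integrable p) : Integrable Q := by
  refine ⟨hQ.1, ?_⟩
  refine lt_of_le_of_lt (lintegral_mono_ae (g := fun z => ENNReal.ofReal (p z)) ?_)
    hp.lintegral_lt_top
  filter_upwards [hQ.2.1, hQ.2.2.1] with z h1 h2
  exact (enorm_le_posTrace h1).trans h2.le

theorem IsProbDensity.lintegral_eq_one {p : Phase d → ℝ} (hp : IsProbDensity p) :
    ∫⁻ z, ENNReal.ofReal (p z) = 1 := by
  rw [← ofReal_integral_eq_lintegral_ofReal hp.1 hp.2.1, hp.2.2, ENNReal.ofReal_one]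

theorem IsProbDensity.isProbabilityMeasure {p : Phase d → ℝ} (hp : IsProbDensity p) :
    IsProbabilityMeasure (densityMeasure p) :=
  ⟨by rw [densityMeasure, withDensity_apply _ MeasurableSet.univ, Measure.restrict_univ,
    hp.lintegral_eq_one]⟩

theorem lintegral_re_inner_coherentState {ħ : ℝ} (hħ : 0 < ħ) {T : Op d} (hT : T.IsPositive) :
    ∫⁻ w : Phase d, ENNReal.ofReal (RCLike.re ⟪coherentState ħ w, T (coherentState ħ w)⟫_ℂ) =
      ENNReal.ofReal ((2 * Real.pi * ħ) ^ d) * posTrace T := by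
  have hm := fun i => (measurable_enorm_inner_coherentState_left hħ
    (opSqrt T (basis d i))).aemeasurable (μ := volume)
  rw [posTrace_eq_tsum hT, ← ENNReal.tsum_mul_left]
  simp_rw [← lintegral_enorm_inner_coherentState hħ]
  rw [← lintegral_tsum hm]
  refine lintegral_congr fun w => ?_
  rw [tsum_enorm_inner_apply_sq, enorm_sq_adjoint_apply, opSqrt_comp_adjoint hT]

theorem map_fst_withDensity {X Y : Type*} [MeasurableSpace X] [MeasurableSpace Y] {μ : Measure X}
    {ν : Measure Y} [SFinite μ] [SFinite ν] {g : X × Y → ℝ≥0∞} (hg : Measurable g) :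
    ((μ.prod ν).withDensity g).map Prod.fst = μ.withDensity fun x => ∫⁻ y, g (x, y) ∂ν := by
  ext s hs
  rw [Measure.map_apply measurable_fst hs, withDensity_apply _ (measurable_fst hs),
    withDensity_apply _ hs, ← Set.prod_univ, ← Measure.prod_restrict, Measure.restrict_univ,
    lintegral_prod _ hg.aemeasurable]

theorem map_snd_withDensity {X Y : Type*} [MeasurableSpace X] [MeasurableSpace Y] {μ : Measure X}
    {ν : Measure Y} [SFinite μ] [SFinite ν] {g : X × Y → ℝ≥0∞} (hg : Measurable g) :
    ((μ.prod ν).withDensity g).map Prod.snd = ν.withDensity fun y => ∫⁻ x, g (x, y) ∂μ := by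
  ext s hs
  rw [Measure.map_apply measurable_snd hs, withDensity_apply _ (measurable_snd hs),
    withDensity_apply _ hs, ← Set.univ_prod, ← Measure.prod_restrict, Measure.restrict_univ,
    lintegral_prod_symm _ hg.aemeasurable]

theorem distMK2_sq_le_of_coupling {ħ : ℝ} (hħ : 0 < ħ) {p : Phase d → ℝ} (hp : IsProbDensity p)
    {R : Op d} {Q : Phase d → Op d} (hQ : IsCoupling p R Q) :
    distMK2 (densityMeasure p) (densityMeasure (husimi ħ R)) ^ 2 ≤
      (∫⁻ z, costTrace ħ z (Q z)) + ENNReal.ofReal (d * ħ / 2) := by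
  obtain ⟨Q', hQ'm, hQQ'⟩ := hQ.1
  have hint := hQ.integrable hp.1
  set c : ℝ := ((2 * Real.pi * ħ) ^ d)⁻¹ with hc
  have hc0 : 0 ≤ c := by positivity
  have hcc : ENNReal.ofReal c * ENNReal.ofReal ((2 * Real.pi * ħ) ^ d) = 1 := by
    rw [← ENNReal.ofReal_mul hc0, hc, inv_mul_cancel₀ (by positivity), ENNReal.ofReal_one]
  set g : Phase d × Phase d → ℝ≥0∞ := fun x => ENNReal.ofReal c *
    ENNReal.ofReal (RCLike.re ⟪coherentState ħ x.2, Q' x.1 (coherentState ħ x.2)⟫_ℂ) with hg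
  have hgm : Measurable g := by
    have h1 : Continuous fun x : Op d × StateSpace d => RCLike.re ⟪x.2, x.1 x.2⟫_ℂ := by fun_prop
    have h2 : StronglyMeasurable fun x : Phase d × Phase d => (Q' x.1, coherentState ħ x.2) :=
      (hQ'm.comp_measurable measurable_fst).prodMk
        ((continuous_coherentState hħ).stronglyMeasurable.comp_measurable measurable_snd)
    exact (h1.comp_stronglyMeasurable h2).measurable.ennreal_ofReal.const_mul _
  have h1 : ∀ᵐ z : Phase d, ∫⁻ w, g (z, w) = ENNReal.ofReal (p z) := by
    filter_upwards [hQ.2.1, hQ.2.2.1, hQQ'] with z hz1 hz2 hz3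
    simp only [hg, ← hz3]
    rw [lintegral_const_mul' _ _ ENNReal.ofReal_ne_top, lintegral_re_inner_coherentState hħ hz1,
      hz2, ← mul_assoc, hcc, one_mul]
  have h2 : ∀ w : Phase d, ∫⁻ z, g (z, w) = ENNReal.ofReal (husimi ħ R w) := by
    intro w
    rw [husimi, ENNReal.ofReal_mul hc0, ← hQ.2.2.2, ofReal_re_inner_integral hint hQ.2.1]
    simp only [hg]
    rw [lintegral_const_mul' _ _ ENNReal.ofReal_ne_top]
    congr 1
    refine lintegral_congr_ae ?_
    filter_upwards [hQQ'] with z hz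
    rw [hz]
  have h3 : ∀ᵐ z : Phase d, ∫⁻ w, g (z, w) * phaseCost z w =
      costTrace ħ z (Q z) + ENNReal.ofReal (d * ħ / 2) * ENNReal.ofReal (p z) := by
    filter_upwards [hQ.2.1, hQ.2.2.1, hQQ'] with z hz1 hz2 hz3
    rw [← hz2, costTrace_add hħ z hz1, ← lintegral_const_mul' _ _ ENNReal.ofReal_ne_top]
    simp only [hg, ← hz3]
    refine lintegral_congr fun w => ?_
    ring
  rw [distMK2, rpow_half_sq]
  refine (iInf₂_le ((volume.prod volume).withDensity g) ⟨?_, ?_⟩).trans ?_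
  · have hpc := measurable_phaseCost (d := d)
    change ∫⁻ w : Phase d × Phase d, phaseCost w.1 w.2 ∂_ ≤ _
    rw [lintegral_withDensity_eq_lintegral_mul _ hgm hpc, lintegral_prod _
      (hgm.mul hpc).aemeasurable]
    simp only [Pi.mul_apply]
    rw [lintegral_congr_ae h3, lintegral_add_right', lintegral_const_mul' _ _ ENNReal.ofReal_ne_top,
      hp.lintegral_eq_one, mul_one]
    exact hp.1.aemeasurable.ennreal_ofReal.const_mul _
  · rw [map_fst_withDensity hgm]
    exact withDensity_congr_ae h1
  · rw [map_snd_withDensity hgm]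
    simp_rw [h2]
    rfl

theorem Ehbar_sq (ħ : ℝ) (p : Phase d → ℝ) (R : Op d) : Ehbar ħ p R ^ 2 =
    ⨅ (Q : Phase d → Op d) (_ : IsCoupling p R Q), ∫⁻ z, costTrace ħ z (Q z) := by
  rw [Ehbar, rpow_half_sq]

theorem distMK2_sq_le_Ehbar {ħ : ℝ} (hħ : 0 < ħ) {p : Phase d → ℝ} (hp : IsProbDensity p)
    (R : Op d) : distMK2 (densityMeasure p) (densityMeasure (husimi ħ R)) ^ 2 ≤
      Ehbar ħ p R ^ 2 + ENNReal.ofReal (d * ħ / 2) := by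
  rw [Ehbar_sq, ← tsub_le_iff_right]
  exact le_iInf₂ fun Q hQ => tsub_le_iff_right.2 (distMK2_sq_le_of_coupling hħ hp hQ)

/-! ### Töplitz operators -/

/-- The projection on the coherent state at `w`. -/
def coherentProj (ħ : ℝ) (w : Phase d) : Op d :=
  InnerProductSpace.rankOne ℂ (coherentState ħ w) (coherentState ħ w)

theorem continuous_coherentProj {ħ : ℝ} (hħ : 0 < ħ) : Continuous (coherentProj (d := d) ħ) := by
  have h := continuous_coherentState (d := d) hħ
  have h1 : Continuous fun w => innerSL ℂ (coherentState ħ w) := (innerSL ℂ).continuous.comp h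
  exact ((ContinuousLinearMap.smulRightL ℂ (StateSpace d) (StateSpace d)).continuous.comp
    h1).clm_apply h

theorem stronglyMeasurable_coherentProj {ħ : ℝ} (hħ : 0 < ħ) :
    StronglyMeasurable (coherentProj (d := d) ħ) := by
  have : SecondCountableTopologyEither (Phase d) (Op d) := ⟨Or.inl inferInstance⟩
  exact (continuous_coherentProj hħ).stronglyMeasurable

theorem re_inner_coherentProj (ħ : ℝ) (w : Phase d) (x : StateSpace d) :
    RCLike.re ⟪x, coherentProj ħ w x⟫_ℂ = ‖⟪coherentState ħ w, x⟫_ℂ‖ ^ 2 := by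
  rw [coherentProj, InnerProductSpace.rankOne_apply, inner_smul_right, ← inner_conj_symm x,
    RCLike.mul_conj]
  norm_cast

theorem isPositive_coherentProj (ħ : ℝ) (w : Phase d) : (coherentProj ħ w).IsPositive := by
  rw [ContinuousLinearMap.isPositive_iff_complex]
  intro x
  have h : ⟪coherentProj ħ w x, x⟫_ℂ = ((‖⟪coherentState ħ w, x⟫_ℂ‖ ^ 2 : ℝ) : ℂ) := by
    rw [coherentProj, InnerProductSpace.rankOne_apply, inner_smul_left, RCLike.conj_mul]
    norm_cast
  rw [h]
  refine ⟨congrArg (fun r : ℝ => (r : ℂ)) (Complex.ofReal_re _), ?_⟩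
  rw [RCLike.re_eq_complex_re, Complex.ofReal_re]
  positivity

theorem ofReal_re_inner_coherentProj (ħ : ℝ) (w : Phase d) (x : StateSpace d) :
    ENNReal.ofReal (RCLike.re ⟪x, coherentProj ħ w x⟫_ℂ) = ‖⟪coherentState ħ w, x⟫_ℂ‖ₑ ^ 2 := by
  rw [re_inner_coherentProj, ENNReal.ofReal_pow (norm_nonneg _), ofReal_norm]

theorem posTrace_coherentProj {ħ : ℝ} (hħ : 0 < ħ) (w : Phase d) :
    posTrace (coherentProj ħ w) = 1 := by
  simp_rw [posTrace, ofReal_re_inner_coherentProj]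
  simp_rw [← ofReal_norm, norm_inner_symm (coherentState ħ w), ofReal_norm]
  rw [tsum_enorm_inner_sq, norm_coherentState hħ, one_pow]

theorem isPositive_integral {X : Type*} [MeasurableSpace X] {μ : Measure X} {Q : X → Op d}
    (hQ : Integrable Q μ) (hpos : ∀ᵐ z ∂μ, (Q z).IsPositive) : (∫ z, Q z ∂μ).IsPositive := by
  rw [ContinuousLinearMap.isPositive_iff_complex]
  intro x
  have h1 : ⟪(∫ z, Q z ∂μ) x, x⟫_ℂ = ((∫ z, RCLike.re ⟪x, Q z x⟫_ℂ ∂μ : ℝ) : ℂ) := by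
    rw [← inner_conj_symm, inner_integral_apply hQ, ← integral_conj, ← integral_complex_ofReal]
    refine integral_congr_ae ?_
    filter_upwards [hpos] with z hz
    rw [inner_conj_symm, ← ((ContinuousLinearMap.isPositive_iff_complex _).1 hz x).1,
      inner_re_symm]
  rw [h1]
  refine ⟨congrArg (fun r : ℝ => (r : ℂ)) (Complex.ofReal_re _), ?_⟩
  rw [RCLike.re_eq_complex_re, Complex.ofReal_re]
  refine integral_nonneg_of_ae ?_
  filter_upwards [hpos] with z hz
  exact hz.re_inner_nonneg_right x

theorem posTrace_integral {X : Type*} [MeasurableSpace X] {μ : Measure X} {Q : X → Op d}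
    (hQ : Integrable Q μ) (hpos : ∀ᵐ z ∂μ, (Q z).IsPositive) :
    posTrace (∫ z, Q z ∂μ) = ∫⁻ z, posTrace (Q z) ∂μ := by
  simp only [posTrace]
  rw [lintegral_tsum]
  · exact tsum_congr fun i => ofReal_re_inner_integral hQ hpos _
  · intro i
    exact ((hQ.apply_continuousLinearMap _).const_inner _).re.aemeasurable.ennreal_ofReal

theorem integrable_coherentProj {ħ : ℝ} (hħ : 0 < ħ) (ν : Measure (Phase d)) [IsFiniteMeasure ν] :
    Integrable (coherentProj ħ) ν := by
  refine Integrable.of_bound (stronglyMeasurable_coherentProj hħ).aestronglyMeasurable 1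
    (ae_of_all _ fun w => ?_)
  have := enorm_le_posTrace (isPositive_coherentProj ħ w)
  rwa [posTrace_coherentProj hħ, ← ofReal_norm, ENNReal.ofReal_le_one] at this

theorem isPositive_real_smul {T : Op d} (hT : T.IsPositive) {r : ℝ} (hr : 0 ≤ r) :
    (r • T).IsPositive := by
  rw [RCLike.real_smul_eq_coe_smul (K := ℂ)]
  exact hT.smul_of_nonneg (RCLike.ofReal_nonneg.2 hr)

theorem posTrace_real_smul (T : Op d) {r : ℝ} (hr : 0 ≤ r) :
    posTrace (r • T) = ENNReal.ofReal r * posTrace T := by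
  rw [posTrace, posTrace, ← ENNReal.tsum_mul_left]
  refine tsum_congr fun i => ?_
  rw [← ENNReal.ofReal_mul hr, _root_.smul_apply, RCLike.real_smul_eq_coe_smul (K := ℂ),
    inner_smul_right, RCLike.re_ofReal_mul]

theorem Ehbar_toeplitz_sq_le {ħ : ℝ} (hħ : 0 < ħ) {p : Phase d → ℝ} (hp : IsProbDensity p)
    (μ : Measure (Phase d)) [IsProbabilityMeasure μ] :
    Ehbar ħ p (toeplitz ħ (ENNReal.ofReal ((2 * Real.pi * ħ) ^ d) • μ)) ^ 2 ≤
      distMK2 (densityMeasure p) μ ^ 2 + ENNReal.ofReal (d * ħ / 2) := by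
  rw [distMK2, rpow_half_sq, ← tsub_le_iff_right]
  refine le_iInf₂ fun π hπ => tsub_le_iff_right.2 ?_
  rw [Ehbar_sq]
  have hpm := hp.isProbabilityMeasure
  have hfin : IsProbabilityMeasure π := by
    constructor
    rw [← preimage_univ (f := Prod.fst), ← Measure.map_apply measurable_fst MeasurableSet.univ, hπ.1]
    exact measure_univ
  have hfst : π.fst = densityMeasure p := hπ.1
  set Q : Phase d → Op d := fun z => p z • ∫ w, coherentProj ħ w ∂(π.condKernel z) with hQ
  have hPi := fun z => integrable_coherentProj hħ (π.condKernel z)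
  have hPm : StronglyMeasurable fun z => ∫ w, coherentProj ħ w ∂(π.condKernel z) :=
    StronglyMeasurable.integral_kernel_prod_right (f := fun _ w => coherentProj ħ w)
      ((stronglyMeasurable_coherentProj hħ).comp_measurable measurable_snd)
  have hPpos : ∀ z, (∫ w, coherentProj ħ w ∂(π.condKernel z)).IsPositive := fun z =>
    isPositive_integral (hPi z) (ae_of_all _ fun w => isPositive_coherentProj ħ w)
  have hPtr : ∀ z, posTrace (∫ w, coherentProj ħ w ∂(π.condKernel z)) = 1 := fun z => by
    rw [posTrace_integral (hPi z) (ae_of_all _ fun w => isPositive_coherentProj ħ w)]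
    simp [posTrace_coherentProj hħ]
  have hpae := hp.1.aemeasurable.ennreal_ofReal
  have hcoup : IsCoupling p (toeplitz ħ (ENNReal.ofReal ((2 * Real.pi * ħ) ^ d) • μ)) Q := by
    refine ⟨hp.1.1.smul hPm.aestronglyMeasurable, ?_, ?_, ?_⟩
    · filter_upwards [hp.2.1] with z hz
      exact isPositive_real_smul (hPpos z) hz
    · filter_upwards [hp.2.1] with z hz
      rw [hQ, posTrace_real_smul _ hz, hPtr, mul_one]
    · have h1 : ∫ z, Q z = ∫ z, ∫ w, coherentProj ħ w ∂(π.condKernel z) ∂(densityMeasure p) := by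
        rw [densityMeasure, integral_withDensity_eq_integral_toReal_smul₀ hpae
          (ae_of_all _ fun z => ENNReal.ofReal_lt_top)]
        refine integral_congr_ae ?_
        filter_upwards [hp.2.1] with z hz
        rw [hQ, ENNReal.toReal_ofReal hz]
      have h2 := Measure.integral_condKernel (ρ := π) (f := fun x => coherentProj ħ x.2)
        (by
          refine Integrable.comp_measurable (f := Prod.snd) (g := coherentProj ħ) ?_ measurable_snd
          rw [hπ.2]
          exact integrable_coherentProj hħ μ)
      rw [h1, ← hfst, h2, toeplitz, integral_smul_measure]
      have h3 : ∫ x, coherentProj ħ x.2 ∂π = ∫ w, coherentProj ħ w ∂μ := by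
        rw [← hπ.2, integral_map measurable_snd.aemeasurable
          (stronglyMeasurable_coherentProj hħ).aestronglyMeasurable]
      rw [h3, smul_smul, ENNReal.toReal_ofReal (by positivity), inv_mul_cancel₀ (by positivity),
        one_smul]
      rfl
  refine (iInf₂_le Q hcoup).trans ?_
  have hpc := measurable_phaseCost (d := d)
  have hcost : ∀ᵐ z, costTrace ħ z (Q z) = ENNReal.ofReal (p z) *
      ∫⁻ w, (phaseCost z w + ENNReal.ofReal (d * ħ / 2)) ∂(π.condKernel z) := by
    filter_upwards [hp.2.1] with z hz
    have h1 := costTrace_add hħ z (isPositive_real_smul (hPpos z) hz)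
    have hJ := measurable_enorm_inner_coherentState (d := d) hħ
    have hcoh := continuous_coherentState (d := d) hħ
    have hjoint : Measurable fun x : Phase d × Phase d =>
        phaseCost z x.1 * ‖⟪coherentState ħ x.2, coherentState ħ x.1⟫_ℂ‖ₑ ^ 2 := by
      refine Measurable.mul ((measurable_phaseCost_right z).comp measurable_fst) ?_
      exact Continuous.measurable (by fun_prop)
    have h2 : ∀ w' : Phase d, phaseCost z w' * ENNReal.ofReal (RCLike.re ⟪coherentState ħ w',
        (p z • ∫ w, coherentProj ħ w ∂(π.condKernel z)) (coherentState ħ w')⟫_ℂ) =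
        ENNReal.ofReal (p z) * ∫⁻ w, phaseCost z w' *
          ‖⟪coherentState ħ w, coherentState ħ w'⟫_ℂ‖ₑ ^ 2 ∂(π.condKernel z) := by
      intro w'
      rw [_root_.smul_apply, RCLike.real_smul_eq_coe_smul (K := ℂ), inner_smul_right,
        RCLike.re_ofReal_mul, ENNReal.ofReal_mul hz, ofReal_re_inner_integral (hPi z)
          (ae_of_all _ fun w => isPositive_coherentProj ħ w), lintegral_const_mul']
      · simp_rw [ofReal_re_inner_coherentProj]
        ring
      · exact ENNReal.ofReal_ne_top
    simp_rw [h2] at h1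
    rw [posTrace_real_smul _ hz, hPtr, mul_one, lintegral_const_mul' _ _ ENNReal.ofReal_ne_top,
      lintegral_lintegral_swap hjoint.aemeasurable] at h1
    have h3 : ∀ w : Phase d, ENNReal.ofReal ((2 * Real.pi * ħ) ^ d)⁻¹ * ∫⁻ w', phaseCost z w' *
        ‖⟪coherentState ħ w, coherentState ħ w'⟫_ℂ‖ₑ ^ 2 =
        (phaseCost z w + ENNReal.ofReal (d * ħ / 2)) + ENNReal.ofReal (d * ħ / 2) := by
      intro w
      have h4 := costForm_add hħ z (coherentState ħ w)
      rw [costForm_coherentState hħ, norm_coherentState hħ, one_pow, mul_one] at h4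
      rw [h4]
      congr 1
      refine lintegral_congr fun w' => ?_
      rw [← ofReal_norm, norm_inner_symm, ofReal_norm]
    rw [mul_left_comm, ← lintegral_const_mul' _ _ ENNReal.ofReal_ne_top] at h1
    simp_rw [h3] at h1
    rw [lintegral_add_right _ measurable_const, lintegral_const, measure_univ, mul_one, mul_add,
      mul_comm (ENNReal.ofReal (d * ħ / 2)) (ENNReal.ofReal (p z))] at h1
    exact (ENNReal.add_left_inj (ENNReal.mul_ne_top ENNReal.ofReal_ne_top
      ENNReal.ofReal_ne_top)).1 h1
  rw [lintegral_congr_ae hcost]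
  have hpcD : Measurable fun x : Phase d × Phase d =>
    phaseCost x.1 x.2 + ENNReal.ofReal (d * ħ / 2) := hpc.add_const _
  have h5 : Measurable fun z =>
      ∫⁻ w, (phaseCost z w + ENNReal.ofReal (d * ħ / 2)) ∂(π.condKernel z) :=
    Measurable.lintegral_kernel_prod_right (f := fun z w =>
      phaseCost z w + ENNReal.ofReal (d * ħ / 2)) hpcD
  have h6 := lintegral_withDensity_eq_lintegral_mul₀ hpae h5.aemeasurable
  simp only [Pi.mul_apply] at h6
  rw [← h6]
  change ∫⁻ z, _ ∂(densityMeasure p) ≤ _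
  rw [← hfst, Measure.lintegral_condKernel hpcD, lintegral_add_right _ measurable_const,
    lintegral_const, measure_univ, mul_one]
  rfl

/-! ### Global flows of Lipschitz vector fields -/

theorem continuous_uncurry_of_lipschitz {X E F : Type*} [TopologicalSpace X]
    [PseudoEMetricSpace E] [PseudoEMetricSpace F] {v : X → E → F} {K : ℝ≥0}
    (hv : ∀ t, LipschitzWith K (v t)) (hc : ∀ x, Continuous fun t => v t x) :
    Continuous fun p : X × E => v p.1 p.2 :=
  continuous_prod_of_continuous_lipschitzWith' (fun p : X × E => v p.1 p.2) K hv hc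

section Existence

variable {E : Type*} [NormedAddCommGroup E] [NormedSpace ℝ E]

theorem norm_integral_le_exp_of_nonneg {κ A : ℝ} (hκ : 0 < κ) {f : ℝ → E} {t : ℝ}
    (ht : 0 ≤ t) (hf : ∀ s, ‖f s‖ ≤ A * Real.exp (κ * |s|)) :
    ‖∫ s in (0 : ℝ)..t, f s‖ ≤ A / κ * Real.exp (κ * |t|) := by
  have hA : 0 ≤ A := by simpa using (norm_nonneg _).trans (hf 0)
  have h1 : ‖∫ s in (0 : ℝ)..t, f s‖ ≤ ∫ s in (0 : ℝ)..t, A * Real.exp (κ * s) := by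
    refine intervalIntegral.norm_integral_le_of_norm_le ht (ae_of_all _ fun s hs => ?_)
      (Continuous.intervalIntegrable (by fun_prop) _ _)
    simpa [abs_of_pos hs.1] using hf s
  have h2 : ∫ s in (0 : ℝ)..t, A * Real.exp (κ * s) = A / κ * (Real.exp (κ * t) - 1) := by
    have : ∀ s ∈ uIcc 0 t, HasDerivAt (fun s => A / κ * Real.exp (κ * s))
        (A * Real.exp (κ * s)) s := fun s _ => by
      have := (((hasDerivAt_id s).const_mul κ).exp).const_mul (A / κ)
      have h3 : A / κ * (Real.exp (κ * s) * (κ * 1)) = A * Real.exp (κ * s) := by field_simp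
      rwa [← h3]
    rw [intervalIntegral.integral_eq_sub_of_hasDerivAt this
      (Continuous.intervalIntegrable (by fun_prop) _ _)]
    simp
    ring
  rw [abs_of_nonneg ht]
  have : 0 ≤ A / κ := by positivity
  nlinarith

theorem norm_integral_le_exp {κ A : ℝ} (hκ : 0 < κ) {f : ℝ → E} (t : ℝ)
    (hf : ∀ s, ‖f s‖ ≤ A * Real.exp (κ * |s|)) :
    ‖∫ s in (0 : ℝ)..t, f s‖ ≤ A / κ * Real.exp (κ * |t|) := by
  rcases le_total 0 t with ht | ht
  · exact norm_integral_le_exp_of_nonneg hκ ht hf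
  · have h := norm_integral_le_exp_of_nonneg (f := fun s => f (-s)) hκ (neg_nonneg.2 ht)
      (fun s => by simpa using hf (-s))
    rw [intervalIntegral.integral_comp_neg, intervalIntegral.integral_symm] at h
    simpa using h

variable [CompleteSpace E]

theorem exists_global_solution_zero {v : ℝ → E → E} {K : ℝ≥0} {C : ℝ}
    (hv : ∀ t, LipschitzWith K (v t)) (hc : ∀ x, Continuous fun t => v t x)
    (hC : ∀ t, ‖v t 0‖ ≤ C) (x₀ : E) :
    ∃ γ : ℝ → E, γ 0 = x₀ ∧ ∀ t, HasDerivAt γ (v t (γ t)) t := by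
  set κ : ℝ := 2 * (K + 1) with hκ
  have hκ0 : 0 < κ := by positivity
  have hjoint := continuous_uncurry_of_lipschitz hv hc
  have hexp : ∀ t : ℝ, 1 ≤ Real.exp (κ * |t|) := fun t => Real.one_le_exp (by positivity)
  have hC0 : 0 ≤ C := (norm_nonneg _).trans (hC 0)
  -- the curve represented by `g`
  set curve : BoundedContinuousFunction ℝ E → ℝ → E :=
    fun g t => x₀ + Real.exp (κ * |t|) • g t with hcurve
  have hcc : ∀ g, Continuous (curve g) := fun g => by
    have := g.continuous
    simp only [hcurve]
    fun_prop
  have hvc : ∀ g, Continuous fun s => v s (curve g s) := fun g =>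
    hjoint.comp (continuous_id.prodMk (hcc g))
  have hbound : ∀ g s, ‖v s (curve g s)‖ ≤ (C + K * (‖x₀‖ + ‖g‖)) * Real.exp (κ * |s|) := by
    intro g s
    have h1 : ‖v s (curve g s) - v s 0‖ ≤ K * ‖curve g s‖ := by
      simpa using (hv s).norm_sub_le (curve g s) 0
    have h2 : ‖curve g s‖ ≤ (‖x₀‖ + ‖g‖) * Real.exp (κ * |s|) := by
      refine (norm_add_le _ _).trans ?_
      rw [norm_smul, Real.norm_of_nonneg (Real.exp_pos _).le]
      have := g.norm_coe_le_norm s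
      nlinarith [hexp s, norm_nonneg x₀, Real.exp_pos (κ * |s|)]
    have h3 : ‖v s (curve g s)‖ ≤ ‖v s (curve g s) - v s 0‖ + ‖v s 0‖ := by
      simpa using norm_add_le (v s (curve g s) - v s 0) (v s 0)
    have h4 : (K : ℝ) * ‖curve g s‖ ≤ K * ((‖x₀‖ + ‖g‖) * Real.exp (κ * |s|)) :=
      mul_le_mul_of_nonneg_left h2 K.coe_nonneg
    nlinarith [hC s, hexp s]
  have hprim : ∀ g, Continuous fun t => ∫ s in (0 : ℝ)..t, v s (curve g s) := fun g =>
    intervalIntegral.continuous_primitive (fun a b => (hvc g).intervalIntegrable a b) 0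
  set T : BoundedContinuousFunction ℝ E → BoundedContinuousFunction ℝ E := fun g =>
    BoundedContinuousFunction.ofNormedAddCommGroup
      (fun t => Real.exp (-(κ * |t|)) • ∫ s in (0 : ℝ)..t, v s (curve g s))
      (by have := hprim g; fun_prop) ((C + K * (‖x₀‖ + ‖g‖)) / κ) (fun t => by
        rw [norm_smul, Real.norm_of_nonneg (Real.exp_pos _).le]
        calc _ ≤ Real.exp (-(κ * |t|)) * ((C + K * (‖x₀‖ + ‖g‖)) / κ * Real.exp (κ * |t|)) :=
              mul_le_mul_of_nonneg_left (norm_integral_le_exp hκ0 t (hbound g)) (Real.exp_pos _).le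
          _ = (C + K * (‖x₀‖ + ‖g‖)) / κ * (Real.exp (-(κ * |t|)) * Real.exp (κ * |t|)) := by ring
          _ = _ := by rw [← Real.exp_add]; simp) with hT
  have hTapply : ∀ g t, T g t = Real.exp (-(κ * |t|)) • ∫ s in (0 : ℝ)..t, v s (curve g s) :=
    fun g t => rfl
  have hcontr : ContractingWith (1 / 2) T := by
    refine ⟨by
      rw [← NNReal.coe_lt_coe]
      norm_num, LipschitzWith.of_dist_le_mul fun g g' => ?_⟩
    rw [BoundedContinuousFunction.dist_le (by positivity)]
    intro t
    have h1 : ∀ s, ‖v s (curve g s) - v s (curve g' s)‖ ≤ K * dist g g' * Real.exp (κ * |s|) := by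
      intro s
      refine ((hv s).norm_sub_le _ _).trans ?_
      have h2 : curve g s - curve g' s = Real.exp (κ * |s|) • (g s - g' s) := by
        simp only [hcurve]
        rw [smul_sub]
        abel
      rw [h2, norm_smul, Real.norm_of_nonneg (Real.exp_pos _).le, ← dist_eq_norm, mul_assoc (K : ℝ)]
      refine mul_le_mul_of_nonneg_left ?_ K.coe_nonneg
      rw [mul_comm (dist g g')]
      exact mul_le_mul_of_nonneg_left (BoundedContinuousFunction.dist_coe_le_dist s)
        (Real.exp_pos _).le
    rw [dist_eq_norm, hTapply, hTapply, ← smul_sub, ← intervalIntegral.integral_sub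
      ((hvc g).intervalIntegrable _ _) ((hvc g').intervalIntegrable _ _), norm_smul,
      Real.norm_of_nonneg (Real.exp_pos _).le]
    calc _ ≤ Real.exp (-(κ * |t|)) * (K * dist g g' / κ * Real.exp (κ * |t|)) :=
          mul_le_mul_of_nonneg_left (norm_integral_le_exp hκ0 t h1) (Real.exp_pos _).le
      _ = K * dist g g' / κ * (Real.exp (-(κ * |t|)) * Real.exp (κ * |t|)) := by ring
      _ = (K / κ) * dist g g' := by rw [← Real.exp_add]; simp; ring
      _ ≤ _ := by
          refine mul_le_mul_of_nonneg_right ?_ dist_nonneg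
          rw [div_le_iff₀ hκ0]
          push_cast
          rw [hκ]
          linarith [K.coe_nonneg]
  obtain ⟨g, hg⟩ : ∃ g, T g = g := ⟨_, hcontr.fixedPoint_isFixedPt⟩
  have hsol : ∀ t, curve g t = x₀ + ∫ s in (0 : ℝ)..t, v s (curve g s) := by
    intro t
    have h1 : g t = Real.exp (-(κ * |t|)) • ∫ s in (0 : ℝ)..t, v s (curve g s) := by
      rw [← hTapply, hg]
    have h2 : curve g t = x₀ + Real.exp (κ * |t|) • g t := rfl
    rw [h2]
    conv_lhs => rw [h1]
    rw [smul_smul, ← Real.exp_add]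
    simp
  refine ⟨curve g, by rw [hsol]; simp, fun t => ?_⟩
  have h1 : HasDerivAt (fun t => x₀ + ∫ s in (0 : ℝ)..t, v s (curve g s)) (v t (curve g t)) t :=
    (intervalIntegral.integral_hasDerivAt_right ((hvc g).intervalIntegrable _ _)
      ((hvc g).stronglyMeasurableAtFilter _ _) (hvc g).continuousAt).const_add x₀
  rwa [← funext hsol] at h1

end Existence

/-- A time-dependent vector field, Lipschitz in space uniformly in time, continuous in time and
bounded at the origin. -/
structure LipschitzField (E : Type*) [NormedAddCommGroup E] where
  /-- the vector field -/
  toFun : ℝ → E → E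
  /-- its Lipschitz constant -/
  K : ℝ≥0
  /-- a bound at the origin -/
  C : ℝ
  lipschitz : ∀ t, LipschitzWith K (toFun t)
  continuous : ∀ x, Continuous fun t => toFun t x
  bound : ∀ t, ‖toFun t 0‖ ≤ C

namespace LipschitzField

variable {E : Type*} [NormedAddCommGroup E] [NormedSpace ℝ E] [CompleteSpace E]
  (X : LipschitzField E)

theorem continuous_uncurry : Continuous fun p : ℝ × E => X.toFun p.1 p.2 :=
  continuous_uncurry_of_lipschitz X.lipschitz X.continuous

theorem exists_solution (t₀ : ℝ) (x₀ : E) :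
    ∃ γ : ℝ → E, γ t₀ = x₀ ∧ ∀ t, HasDerivAt γ (X.toFun t (γ t)) t := by
  obtain ⟨γ, h0, hγ⟩ := exists_global_solution_zero (v := fun t => X.toFun (t + t₀))
    (fun t => X.lipschitz _) (fun x => (X.continuous x).comp (by fun_prop))
    (fun t => X.bound _) x₀
  refine ⟨fun t => γ (t - t₀), by simpa using h0, fun t => ?_⟩
  have := (hγ (t - t₀)).comp_sub_const t t₀
  simpa using this

/-- The flow: `X.flow t₀ t x` is the value at time `t` of the solution through `x` at time
`t₀`. -/
def flow (t₀ t : ℝ) (x : E) : E := (X.exists_solution t₀ x).choose t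

theorem flow_self (t₀ : ℝ) (x : E) : X.flow t₀ t₀ x = x := (X.exists_solution t₀ x).choose_spec.1

theorem hasDerivAt_flow (t₀ t : ℝ) (x : E) :
    HasDerivAt (fun s => X.flow t₀ s x) (X.toFun t (X.flow t₀ t x)) t :=
  (X.exists_solution t₀ x).choose_spec.2 t

theorem continuous_flow_right (t₀ : ℝ) (x : E) : Continuous fun t => X.flow t₀ t x :=
  continuous_iff_continuousAt.2 fun t => (X.hasDerivAt_flow t₀ t x).continuousAt

theorem norm_sub_le_of_le {γ γ' : ℝ → E} (h : ∀ t, HasDerivAt γ (X.toFun t (γ t)) t)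
    (h' : ∀ t, HasDerivAt γ' (X.toFun t (γ' t)) t) {s t : ℝ} (hst : s ≤ t) :
    ‖γ t - γ' t‖ ≤ ‖γ s - γ' s‖ * Real.exp (X.K * (t - s)) := by
  have := dist_le_of_trajectories_ODE (v := X.toFun) (K := X.K) (f := γ) (g := γ') (a := s)
    (b := t) (δ := dist (γ s) (γ' s)) X.lipschitz
    (fun r _ => (h r).continuousAt.continuousWithinAt) (fun r _ => (h r).hasDerivWithinAt)
    (fun r _ => (h' r).continuousAt.continuousWithinAt) (fun r _ => (h' r).hasDerivWithinAt)
    le_rfl t ⟨hst, le_rfl⟩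
  simpa [dist_eq_norm] using this

/-- The field run backwards in time. -/
def reverse : LipschitzField E where
  toFun t x := -X.toFun (-t) x
  K := X.K
  C := X.C
  lipschitz t := (X.lipschitz _).neg
  continuous x := ((X.continuous x).comp continuous_neg).neg
  bound t := by simpa using X.bound (-t)

theorem hasDerivAt_reverse {γ : ℝ → E} (h : ∀ t, HasDerivAt γ (X.toFun t (γ t)) t) (t : ℝ) :
    HasDerivAt (fun s => γ (-s)) (X.reverse.toFun t (γ (-t))) t := by
  have := (h (-t)).scomp t (hasDerivAt_neg t)
  rw [neg_smul, one_smul] at this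
  exact this

theorem norm_sub_le {γ γ' : ℝ → E} (h : ∀ t, HasDerivAt γ (X.toFun t (γ t)) t)
    (h' : ∀ t, HasDerivAt γ' (X.toFun t (γ' t)) t) (s t : ℝ) :
    ‖γ t - γ' t‖ ≤ ‖γ s - γ' s‖ * Real.exp (X.K * |t - s|) := by
  rcases le_total s t with hst | hst
  · rw [abs_of_nonneg (by linarith)]
    exact X.norm_sub_le_of_le h h' hst
  · have := X.reverse.norm_sub_le_of_le (X.hasDerivAt_reverse h) (X.hasDerivAt_reverse h')
      (neg_le_neg hst)
    rw [abs_of_nonpos (by linarith)]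
    simp only [neg_neg] at this
    have h2 : -t - -s = -(t - s) := by ring
    rwa [h2] at this

theorem eq_flow {γ : ℝ → E} (h : ∀ t, HasDerivAt γ (X.toFun t (γ t)) t) (s t : ℝ) :
    γ t = X.flow s t (γ s) := by
  have := X.norm_sub_le h (fun t => X.hasDerivAt_flow s t (γ s)) s t
  rw [X.flow_self, sub_self, norm_zero, zero_mul] at this
  exact sub_eq_zero.1 (norm_le_zero_iff.1 this)

theorem flow_flow (r s t : ℝ) (x : E) : X.flow s t (X.flow r s x) = X.flow r t x :=
  (X.eq_flow (fun t => X.hasDerivAt_flow r t x) s t).symm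

theorem norm_flow_sub_le (s t : ℝ) (x y : E) :
    ‖X.flow s t x - X.flow s t y‖ ≤ Real.exp (X.K * |t - s|) * ‖x - y‖ := by
  have := X.norm_sub_le (fun t => X.hasDerivAt_flow s t x) (fun t => X.hasDerivAt_flow s t y) s t
  rwa [X.flow_self, X.flow_self, mul_comm] at this

theorem lipschitz_flow (s t : ℝ) :
    LipschitzWith (Real.exp (X.K * |t - s|)).toNNReal (X.flow s t) :=
  LipschitzWith.of_dist_le_mul fun x y => by
    rw [dist_eq_norm, dist_eq_norm, Real.coe_toNNReal _ (Real.exp_pos _).le]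
    exact X.norm_flow_sub_le s t x y

theorem continuous_flow (s t : ℝ) : Continuous (X.flow s t) := (X.lipschitz_flow s t).continuous

end LipschitzField

/-! ### Position and momentum operators -/

theorem hasDerivAt_apply_of_tendsto {E : Type*} [NormedAddCommGroup E] [NormedSpace ℝ E]
    {A : ℝ → E → E} {C : ℝ} (hsub : ∀ h x y, A h (x - y) = A h x - A h y)
    (hsmul : ∀ h (r : ℝ) x, A h (r • x) = r • A h x) (hA : ∀ h x, ‖A h x‖ ≤ C * ‖x‖)
    {s : ℝ} {v : ℝ → E} {v' w : E} (hlim : Tendsto (fun h => A h v') (𝓝[≠] s) (𝓝 (A s v')))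
    (hv : HasDerivAt v v' s) (hw : HasDerivAt (fun h => A h (v s)) w s) :
    HasDerivAt (fun h => A h (v h)) (A s v' + w) s := by
  rw [hasDerivAt_iff_tendsto_slope] at hv hw ⊢
  have h1 : Tendsto (fun h => A h (slope v s h - v')) (𝓝[≠] s) (𝓝 0) := by
    have h2 : Tendsto (fun h => C * ‖slope v s h - v'‖) (𝓝[≠] s) (𝓝 0) := by
      have := (hv.sub_const v').norm.const_mul C
      simpa using this
    exact squeeze_zero_norm (fun h => hA h _) h2
  have h3 := (h1.add hlim).add hw
  rw [zero_add] at h3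
  refine h3.congr fun h => ?_
  simp only [slope_def_module, hsub, hsmul]
  rw [sub_add_cancel, ← smul_add]
  congr 1
  abel

/-- `α = y_j u`. -/
def IsPos (j : Fin d) (u α : StateSpace d) : Prop :=
  α =ᵐ[volume] fun y => ((y j : ℝ) : ℂ) * u y

/-- `β = -iħ∂_j u`. -/
def IsMom (ħ : ℝ) (j : Fin d) (u β : StateSpace d) : Prop :=
  fourierOp d β =ᵐ[volume] fun k => ((2 * Real.pi * ħ * k j : ℝ) : ℂ) * fourierOp d u k

theorem single_eq_smul (j : Fin d) (r : ℝ) :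
    (EuclideanSpace.single j r : Pos d) = r • EuclideanSpace.single j (1 : ℝ) := by
  ext i
  by_cases h : i = j <;> simp [h]

theorem measurable_coord (j : Fin d) : Measurable fun y : Pos d => y j := by fun_prop

theorem isPos_iff_hasDerivAt {j : Fin d} {u α : StateSpace d} :
    IsPos j u α ↔ HasDerivAt (fun h : ℝ => expOp (fun y => h * y j) u) (Complex.I • α) 0 :=
  ⟨hasDerivAt_expOp (measurable_coord j), ae_eq_of_hasDerivAt_expOp (measurable_coord j)⟩

theorem fourierOp_injective : Function.Injective (fourierOp d) :=
  Function.LeftInverse.injective fourierInvOp_fourierOp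

theorem trans_single_eq (ħ h : ℝ) (j : Fin d) (u : StateSpace d) :
    fourierOp d (trans (EuclideanSpace.single j (-(h * ħ))) u) =
      expOp (fun k => h * (2 * Real.pi * ħ * k j)) (fourierOp d u) := by
  rw [fourierOp_trans]
  congr 2
  ext k
  rw [EuclideanSpace.inner_single_left]
  simp
  ring

theorem isMom_iff_hasDerivAt {ħ : ℝ} {j : Fin d} {u β : StateSpace d} :
    IsMom ħ j u β ↔ HasDerivAt (fun h : ℝ => trans (EuclideanSpace.single j (-(h * ħ))) u)
      (Complex.I • β) 0 := by
  have hm : Measurable fun k : Pos d => 2 * Real.pi * ħ * k j := by fun_prop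
  have h1 : IsMom ħ j u β ↔ HasDerivAt
      (fun h : ℝ => expOp (fun k => h * (2 * Real.pi * ħ * k j)) (fourierOp d u))
      (Complex.I • fourierOp d β) 0 :=
    ⟨hasDerivAt_expOp hm, ae_eq_of_hasDerivAt_expOp hm⟩
  rw [h1]
  simp_rw [← trans_single_eq, ← map_smul]
  constructor
  · intro h
    have := ((fourierInvOp d).restrictScalars ℝ).hasFDerivAt.comp_hasDerivAt (0 : ℝ) h
    simpa [Function.comp_def, fourierInvOp_fourierOp] using this
  · intro h
    have := ((fourierOp d).restrictScalars ℝ).hasFDerivAt.comp_hasDerivAt (0 : ℝ) h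
    simpa [Function.comp_def] using this

theorem IsPos.add {j : Fin d} {u u' α α' : StateSpace d} (h : IsPos j u α) (h' : IsPos j u' α') :
    IsPos j (u + u') (α + α') := by
  unfold IsPos at *
  filter_upwards [h, h', Lp.coeFn_add u u', Lp.coeFn_add α α'] with y h1 h2 h3 h4
  rw [h3, h4, Pi.add_apply, Pi.add_apply, h1, h2, mul_add]

theorem IsPos.smul {j : Fin d} {u α : StateSpace d} (c : ℂ) (h : IsPos j u α) :
    IsPos j (c • u) (c • α) := by
  unfold IsPos at *
  filter_upwards [h, Lp.coeFn_smul c u, Lp.coeFn_smul c α] with y h1 h3 h4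
  rw [h3, h4, Pi.smul_apply, Pi.smul_apply, h1, smul_eq_mul, smul_eq_mul, mul_left_comm]

theorem IsPos.zero (j : Fin d) : IsPos j (0 : StateSpace d) 0 := by
  unfold IsPos
  filter_upwards [Lp.coeFn_zero ℂ 2 (volume : Measure (Pos d))] with y hy
  simp

theorem IsMom.add {ħ : ℝ} {j : Fin d} {u u' α α' : StateSpace d} (h : IsMom ħ j u α)
    (h' : IsMom ħ j u' α') : IsMom ħ j (u + u') (α + α') := by
  unfold IsMom at *
  rw [map_add, map_add]
  filter_upwards [h, h', Lp.coeFn_add (fourierOp d u) (fourierOp d u'),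
    Lp.coeFn_add (fourierOp d α) (fourierOp d α')] with y h1 h2 h3 h4
  rw [h3, h4, Pi.add_apply, Pi.add_apply, h1, h2, mul_add]

theorem IsMom.smul {ħ : ℝ} {j : Fin d} {u α : StateSpace d} (c : ℂ) (h : IsMom ħ j u α) :
    IsMom ħ j (c • u) (c • α) := by
  unfold IsMom at *
  rw [map_smul, map_smul]
  filter_upwards [h, Lp.coeFn_smul c (fourierOp d u), Lp.coeFn_smul c (fourierOp d α)]
    with y h1 h3 h4
  rw [h3, h4, Pi.smul_apply, Pi.smul_apply, h1, smul_eq_mul, smul_eq_mul, mul_left_comm]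

theorem IsMom.zero (ħ : ℝ) (j : Fin d) : IsMom ħ j (0 : StateSpace d) 0 := by
  unfold IsMom
  rw [map_zero]
  filter_upwards [Lp.coeFn_zero ℂ 2 (volume : Measure (Pos d))] with y hy
  simp

/-- States `u` together with all `y_j u` and `-iħ∂_j u`. -/
abbrev Triple (d : ℕ) : Type := StateSpace d × (Fin d → StateSpace d) × (Fin d → StateSpace d)

/-- The graph of the position and momentum operators. -/
def posMomGraph (d : ℕ) (ħ : ℝ) : Submodule ℝ (Triple d) where
  carrier := {p | ∀ j, IsPos j p.1 (p.2.1 j) ∧ IsMom ħ j p.1 (p.2.2 j)}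
  add_mem' h h' j := ⟨(h j).1.add (h' j).1, (h j).2.add (h' j).2⟩
  zero_mem' j := ⟨IsPos.zero j, IsMom.zero ħ j⟩
  smul_mem' c p h j := by
    have h1 : ∀ v : StateSpace d, c • v = (c : ℂ) • v := fun v =>
      RCLike.real_smul_eq_coe_smul (K := ℂ) c v
    simp only [Prod.smul_fst, Prod.smul_snd, Pi.smul_apply, h1]
    exact ⟨(h j).1.smul c, (h j).2.smul c⟩

theorem isClosed_posMomGraph (d : ℕ) (ħ : ℝ) :
    IsClosed (posMomGraph d ħ : Set (Triple d)) := by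
  have hm : ∀ j : Fin d, Measurable fun k : Pos d => 2 * Real.pi * ħ * k j := fun j => by fun_prop
  have h : (posMomGraph d ħ : Set (Triple d)) = ⋂ j : Fin d,
      {p | mulOp (fun y => (((1 + y j ^ 2)⁻¹ : ℝ) : ℂ)) (p.2.1 j) =
        mulOp (fun y => ((y j * (1 + y j ^ 2)⁻¹ : ℝ) : ℂ)) p.1} ∩
      {p | mulOp (fun k => (((1 + (2 * Real.pi * ħ * k j) ^ 2)⁻¹ : ℝ) : ℂ))
          (fourierOp d (p.2.2 j)) =
        mulOp (fun k => ((2 * Real.pi * ħ * k j * (1 + (2 * Real.pi * ħ * k j) ^ 2)⁻¹ : ℝ) : ℂ))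
          (fourierOp d p.1)} := by
    ext p
    simp only [posMomGraph, Submodule.coe_set_mk, AddSubmonoid.coe_set_mk, AddSubsemigroup.coe_set_mk,
      mem_ofPred_eq, mem_iInter, mem_inter_iff]
    exact forall_congr' fun j =>
      and_congr (graph_mul_iff (measurable_coord j)) (graph_mul_iff (hm j))
  rw [h]
  refine isClosed_iInter fun j => (isClosed_eq ?_ ?_).inter (isClosed_eq ?_ ?_) <;> fun_prop

/-! ### Multiplication by a Lipschitz differentiable potential -/

theorem IsPos.mulOp {j : Fin d} {u α : StateSpace d} (h : IsPos j u α) {m : Pos d → ℂ}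
    (hm : MemLp m ⊤ volume) : IsPos j (mulOp m u) (HartreeVlasov.mulOp m α) := by
  unfold IsPos at *
  filter_upwards [h, coeFn_mulOp hm u, coeFn_mulOp hm α] with y h1 h2 h3
  rw [h2, h3, h1]
  ring

theorem trans_mulOp {m : Pos d → ℂ} (hm : Continuous m) {C : ℝ} (hC : ∀ y, ‖m y‖ ≤ C)
    (a : Pos d) (u : StateSpace d) :
    trans a (mulOp m u) = mulOp (fun y => m (y - a)) (trans a u) := by
  have h1 := coeFn_mulOp (memLp_top_of_norm_le hm.aestronglyMeasurable hC) u
  have h2 := coeFn_mulOp (memLp_top_of_norm_le (m := fun y => m (y - a))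
    (Continuous.aestronglyMeasurable (by fun_prop)) (fun y => hC _)) (trans a u)
  refine Lp.ext ?_
  filter_upwards [coeFn_trans a (mulOp m u), h2, coeFn_trans a u,
    (measurePreserving_sub_right volume a).quasiMeasurePreserving.ae_eq_comp h1] with y h3 h4 h5 h6
  rw [h3, h4, h5]
  exact h6

theorem IsMom.mulOp {ħ : ℝ} {j : Fin d} {u β : StateSpace d} (h : IsMom ħ j u β) {W : Pos d → ℝ}
    {G : Pos d → Pos d} {A L : ℝ} (hW : Continuous W) (hG : Continuous G) (hA : ∀ y, |W y| ≤ A)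
    (hGA : ∀ y, ‖G y‖ ≤ A) (hL : ∀ y a, |W (y + a) - W y - ⟪G y, a⟫_ℝ| ≤ L * ‖a‖ ^ 2) :
    IsMom ħ j (mulOp (fun y => (W y : ℂ)) u) (HartreeVlasov.mulOp (fun y => (W y : ℂ)) β -
      (Complex.I * ħ) • HartreeVlasov.mulOp (fun y => ((G y j : ℝ) : ℂ)) u) := by
  rw [isMom_iff_hasDerivAt] at h ⊢
  set a : ℝ → Pos d := fun h => EuclideanSpace.single j (-(h * ħ)) with ha
  have hac : Continuous a := by
    have : a = fun h : ℝ => (-(h * ħ)) • EuclideanSpace.single j (1 : ℝ) := by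
      ext1 h
      exact single_eq_smul j _
    rw [this]
    fun_prop
  have ha0 : a 0 = 0 := by simp [ha]
  have hWc : Continuous fun y => (W y : ℂ) := by fun_prop
  have hWA : ∀ y, ‖(W y : ℂ)‖ ≤ A := fun y => by simpa using hA y
  have hWm : ∀ b : Pos d, AEStronglyMeasurable (fun y => (W (y - b) : ℂ)) volume := fun b =>
    Continuous.aestronglyMeasurable (by fun_prop)
  have hmem : ∀ b : Pos d, MemLp (fun y => (W (y - b) : ℂ)) ⊤ volume := fun b =>
    memLp_top_of_norm_le (hWm b) fun y => hWA _
  have hGm : AEStronglyMeasurable (fun y => ((G y j : ℝ) : ℂ)) volume :=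
    Continuous.aestronglyMeasurable (by fun_prop)
  have hGj : ∀ y, ‖((G y j : ℝ) : ℂ)‖ ≤ A := fun y => by
    rw [Complex.norm_real]
    exact (PiLp.norm_apply_le (G y) j).trans (hGA y)
  have hGmem := memLp_top_of_norm_le hGm hGj
  simp_rw [trans_mulOp hWc hWA]
  have hmain := hasDerivAt_apply_of_tendsto (s := 0) (C := A)
    (A := fun h u => HartreeVlasov.mulOp (fun y => (W (y - a h) : ℂ)) u)
    (v := fun h => trans (a h) u) (v' := Complex.I • β)
    (w := (ħ : ℂ) • HartreeVlasov.mulOp (fun y => ((G y j : ℝ) : ℂ)) u)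
    (fun h x y => map_sub _ _ _) (fun h r x => by simp)
    (fun h x => norm_mulOp_le (hWm _) (fun y => hWA _) x) ?_ h ?_
  · refine hmain.congr_deriv ?_
    simp only [ha0, sub_zero, map_smul]
    rw [smul_sub, smul_smul, ← mul_assoc, Complex.I_mul_I, neg_one_mul, neg_smul, sub_neg_eq_add]
  · refine (tendsto_mulOp (fun n => hWm _) (hWm _) (fun n y => hWA _) (fun y => hWA _)
      (fun y => ?_) _).mono_left nhdsWithin_le_nhds
    exact Continuous.tendsto (f := fun h => (W (y - a h) : ℂ)) (by fun_prop) 0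
  · rw [hasDerivAt_iff_tendsto_slope_zero]
    simp only [zero_add, ha0, sub_zero]
    have htr0 : trans (0 : Pos d) u = u := trans_zero u
    rw [htr0]
    have hkey : ∀ h : ℝ, h ≠ 0 → ‖h⁻¹ • (HartreeVlasov.mulOp (fun y => (W (y - a h) : ℂ)) u -
        HartreeVlasov.mulOp (fun y => (W y : ℂ)) u) -
        (ħ : ℂ) • HartreeVlasov.mulOp (fun y => ((G y j : ℝ) : ℂ)) u‖ ≤ L * ħ ^ 2 * |h| * ‖u‖ := by
      intro h hh
      have hbd : ∀ y, |h⁻¹ * (W (y - a h) - W y) - ħ * G y j| ≤ L * ħ ^ 2 * |h| := by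
        intro y
        have h1 := hL y (-a h)
        have h2 : ⟪G y, -a h⟫_ℝ = h * ħ * G y j := by
          rw [inner_neg_right, ha, EuclideanSpace.inner_single_right]
          simp
        have h3 : ‖-a h‖ ^ 2 = h ^ 2 * ħ ^ 2 := by
          rw [norm_neg, ha, PiLp.norm_single]
          simp [mul_pow]
        rw [h2, h3, ← sub_eq_add_neg] at h1
        have h4 : h⁻¹ * (W (y - a h) - W y) - ħ * G y j =
            h⁻¹ * (W (y - a h) - W y - h * ħ * G y j) := by
          field_simp
        rw [h4, abs_mul, abs_inv, inv_mul_le_iff₀ (abs_pos.2 hh)]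
        calc _ ≤ _ := h1
          _ = L * (|h| ^ 2 * ħ ^ 2) := by rw [sq_abs]
          _ = _ := by ring
      have hdm : AEStronglyMeasurable
          (fun y => ((h⁻¹ * (W (y - a h) - W y) - ħ * G y j : ℝ) : ℂ)) volume :=
        Continuous.aestronglyMeasurable (by fun_prop)
      have hdb : ∀ y, ‖((h⁻¹ * (W (y - a h) - W y) - ħ * G y j : ℝ) : ℂ)‖ ≤ L * ħ ^ 2 * |h| :=
        fun y => by
          rw [Complex.norm_real]
          exact hbd y
      have heq : h⁻¹ • (HartreeVlasov.mulOp (fun y => (W (y - a h) : ℂ)) u -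
          HartreeVlasov.mulOp (fun y => (W y : ℂ)) u) -
          (ħ : ℂ) • HartreeVlasov.mulOp (fun y => ((G y j : ℝ) : ℂ)) u =
          HartreeVlasov.mulOp (fun y => ((h⁻¹ * (W (y - a h) - W y) - ħ * G y j : ℝ) : ℂ)) u := by
        refine Lp.ext ?_
        have h0 := coeFn_mulOp (hmem 0) u
        simp only [sub_zero] at h0
        filter_upwards [coeFn_mulOp (memLp_top_of_norm_le hdm hdb) u, coeFn_mulOp (hmem (a h)) u,
          h0, coeFn_mulOp hGmem u,
          Lp.coeFn_sub (h⁻¹ • (HartreeVlasov.mulOp (fun y => (W (y - a h) : ℂ)) u -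
          HartreeVlasov.mulOp (fun y => (W y : ℂ)) u))
          ((ħ : ℂ) • HartreeVlasov.mulOp (fun y => ((G y j : ℝ) : ℂ)) u),
          Lp.coeFn_smul h⁻¹ (HartreeVlasov.mulOp (fun y => (W (y - a h) : ℂ)) u -
          HartreeVlasov.mulOp (fun y => (W y : ℂ)) u),
          Lp.coeFn_sub (HartreeVlasov.mulOp (fun y => (W (y - a h) : ℂ)) u)
          (HartreeVlasov.mulOp (fun y => (W y : ℂ)) u),
          Lp.coeFn_smul (ħ : ℂ) (HartreeVlasov.mulOp (fun y => ((G y j : ℝ) : ℂ)) u)]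
          with y h1 h2 h3 h4 h5 h6 h7 h8
        rw [h1, h5, Pi.sub_apply, h6, Pi.smul_apply, h7, Pi.sub_apply, h8, Pi.smul_apply, h2, h3,
          h4, Complex.real_smul, smul_eq_mul]
        push_cast
        ring
      rw [heq]
      exact norm_mulOp_le hdm hdb u
    rw [tendsto_iff_norm_sub_tendsto_zero]
    have hlim : Tendsto (fun h : ℝ => L * ħ ^ 2 * |h| * ‖u‖) (𝓝[≠] 0) (𝓝 0) := by
      have : Tendsto (fun h : ℝ => L * ħ ^ 2 * |h| * ‖u‖) (𝓝 0) (𝓝 (L * ħ ^ 2 * |0| * ‖u‖)) :=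
        Continuous.tendsto (by fun_prop) 0
      simpa using this.mono_left nhdsWithin_le_nhds
    refine squeeze_zero' (Eventually.of_forall fun _ => norm_nonneg _) ?_ hlim
    filter_upwards [self_mem_nhdsWithin] with h hh using hkey h hh

/-! ### The free propagator -/

/-- The symbol of the free propagator. -/
def freePhase (ħ t : ℝ) (k : Pos d) : ℝ := -(t * ħ * (2 * Real.pi) ^ 2 / 2 * ‖k‖ ^ 2)

/-- The free propagator `exp(itħΔ/2)`. -/
def free (d : ℕ) (ħ t : ℝ) : Op d := fourierInvOp d ∘L expOp (freePhase ħ t) ∘L fourierOp d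

theorem measurable_freePhase (ħ t : ℝ) : Measurable (freePhase (d := d) ħ t) := by
  unfold freePhase; fun_prop

theorem fourierOp_free (ħ t : ℝ) (u : StateSpace d) :
    fourierOp d (free d ħ t u) = expOp (freePhase ħ t) (fourierOp d u) :=
  fourierOp_fourierInvOp _

theorem free_add (ħ s t : ℝ) (u : StateSpace d) :
    free d ħ s (free d ħ t u) = free d ħ (s + t) u := by
  refine fourierOp_injective ?_
  rw [fourierOp_free, fourierOp_free, fourierOp_free,
    expOp_add (measurable_freePhase ħ s) (measurable_freePhase ħ t)]
  congr 2
  ext k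
  simp only [freePhase]
  ring

theorem free_zero (ħ : ℝ) (u : StateSpace d) : free d ħ 0 u = u := by
  refine fourierOp_injective ?_
  rw [fourierOp_free]
  have : freePhase (d := d) ħ 0 = fun _ => 0 := by ext k; simp [freePhase]
  rw [this, expOp_zero]

theorem free_neg_free (ħ t : ℝ) (u : StateSpace d) : free d ħ (-t) (free d ħ t u) = u := by
  rw [free_add, neg_add_cancel, free_zero]

theorem free_free_neg (ħ t : ℝ) (u : StateSpace d) : free d ħ t (free d ħ (-t) u) = u := by
  rw [free_add, add_neg_cancel, free_zero]

theorem norm_free (ħ t : ℝ) (u : StateSpace d) : ‖free d ħ t u‖ = ‖u‖ := by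
  rw [← norm_fourierOp, fourierOp_free, norm_expOp (measurable_freePhase ħ t), norm_fourierOp]

theorem inner_free_left (ħ t : ℝ) (u v : StateSpace d) :
    ⟪free d ħ t u, v⟫_ℂ = ⟪u, free d ħ (-t) v⟫_ℂ := by
  rw [← inner_fourierOp, fourierOp_free, inner_expOp_left (measurable_freePhase ħ t),
    ← inner_fourierOp u, fourierOp_free]
  congr 3
  ext k
  simp only [freePhase]
  ring

theorem continuous_free_apply (ħ : ℝ) (u : StateSpace d) : Continuous fun t => free d ħ t u :=
  (fourierInvOp d).continuous.comp (continuous_expOp (measurable_freePhase ħ)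
    (fun k => by unfold freePhase; fun_prop) _)

theorem continuous_free (ħ : ℝ) : Continuous fun p : ℝ × StateSpace d => free d ħ p.1 p.2 := by
  refine continuous_uncurry_of_lipschitz (K := 1) (v := fun t u => free d ħ t u) (fun t => ?_)
    (continuous_free_apply ħ)
  refine LipschitzWith.of_dist_le_mul fun u v => ?_
  rw [dist_eq_norm, dist_eq_norm, ← map_sub, norm_free]
  simp

theorem IsMom.free {ħ : ℝ} {j : Fin d} {u β : StateSpace d} (h : IsMom ħ j u β) (t : ℝ) :
    IsMom ħ j (free d ħ t u) (HartreeVlasov.free d ħ t β) := by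
  unfold IsMom at *
  rw [fourierOp_free, fourierOp_free]
  filter_upwards [h, coeFn_mulOp (memLp_expI (measurable_freePhase ħ t)) (fourierOp d u),
    coeFn_mulOp (memLp_expI (measurable_freePhase ħ t)) (fourierOp d β)] with k h1 h2 h3
  rw [expOp, h2, h3, h1]
  ring

theorem expOp_coord_free (ħ t h : ℝ) (j : Fin d) (u : StateSpace d) :
    expOp (fun y => h * y j) (free d ħ t u) =
      Complex.exp (Complex.I * ((-(t * ħ * h ^ 2 / 2) : ℝ) : ℂ)) •
        free d ħ t (trans (EuclideanSpace.single j (-(h * t * ħ))) (expOp (fun y => h * y j) u)) := by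
  refine fourierOp_injective ?_
  set a : Pos d := EuclideanSpace.single j (h / (2 * Real.pi)) with ha
  have hpi := Real.pi_pos.ne'
  have h1 : (fun y : Pos d => h * y j) = fun y => 2 * Real.pi * ⟪a, y⟫_ℝ := by
    ext y
    rw [ha, EuclideanSpace.inner_single_left]
    simp
    field_simp
  rw [map_smul, h1, fourierOp_expOp, fourierOp_free, fourierOp_free, trans_single_eq,
    fourierOp_expOp]
  set v := fourierOp d u with hv
  have hm2 : Measurable fun k : Pos d => h * t * (2 * Real.pi * ħ * k j) := by fun_prop
  refine Lp.ext ?_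
  have h2 := coeFn_mulOp (memLp_expI (measurable_freePhase ħ t)) v
  filter_upwards [coeFn_trans a (expOp (freePhase ħ t) v), coeFn_trans a v,
    (measurePreserving_sub_right volume a).quasiMeasurePreserving.ae_eq_comp h2,
    Lp.coeFn_smul (Complex.exp (Complex.I * ((-(t * ħ * h ^ 2 / 2) : ℝ) : ℂ)))
      (expOp (freePhase ħ t) (expOp (fun k => h * t * (2 * Real.pi * ħ * k j)) (trans a v))),
    coeFn_mulOp (memLp_expI (measurable_freePhase ħ t))
      (expOp (fun k => h * t * (2 * Real.pi * ħ * k j)) (trans a v)),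
    coeFn_mulOp (memLp_expI hm2) (trans a v)] with k h3 h4 h5 h6 h7 h8
  simp only [Function.comp_apply] at h5
  simp only [expOp] at h3 h6 h7 ⊢
  rw [h3, h5, h6, Pi.smul_apply, h7, h8, h4, smul_eq_mul, ← mul_assoc,
    ← mul_assoc, ← Complex.exp_add, ← Complex.exp_add, ← mul_add, ← mul_add]
  congr 3
  norm_cast
  simp only [freePhase]
  have h9 : ‖k - a‖ ^ 2 = ‖k‖ ^ 2 - 2 * (h / (2 * Real.pi) * k j) + (h / (2 * Real.pi)) ^ 2 := by
    rw [norm_sub_sq_real, ha, EuclideanSpace.inner_single_right, PiLp.norm_single]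
    simp only [Real.norm_eq_abs, sq_abs, conj_trivial]
  rw [h9]
  field_simp
  ring

theorem IsPos.free {ħ : ℝ} {j : Fin d} {u α β : StateSpace d} (hα : IsPos j u α)
    (hβ : IsMom ħ j u β) (t : ℝ) :
    IsPos j (free d ħ t u) (HartreeVlasov.free d ħ t (α + (t : ℂ) • β)) := by
  rw [isPos_iff_hasDerivAt] at hα ⊢
  rw [isMom_iff_hasDerivAt] at hβ
  simp_rw [expOp_coord_free]
  set c : ℝ → ℂ := fun h => Complex.exp (Complex.I * ((-(t * ħ * h ^ 2 / 2) : ℝ) : ℂ)) with hc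
  have hc0 : c 0 = 1 := by simp [hc]
  have hcd : HasDerivAt c 0 0 := by
    have h1 : HasDerivAt (fun h : ℝ => Complex.I * ((-(t * ħ * h ^ 2 / 2) : ℝ) : ℂ)) 0 0 := by
      have h2 : HasDerivAt (fun h : ℝ => -(t * ħ * h ^ 2 / 2)) 0 0 := by
        have := ((((hasDerivAt_id (0 : ℝ)).pow 2).const_mul (t * ħ)).div_const 2).neg
        exact this.congr_deriv (by simp)
      simpa using h2.ofReal_comp.const_mul Complex.I
    simpa [hc] using h1.cexp
  set b : ℝ → Pos d := fun h => EuclideanSpace.single j (-(h * t * ħ)) with hb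
  have hbc : Continuous b := by
    have : b = fun h : ℝ => (-(h * t * ħ)) • EuclideanSpace.single j (1 : ℝ) := by
      ext1 h
      exact single_eq_smul j _
    rw [this]
    fun_prop
  have hb0 : b 0 = 0 := by simp [hb]
  have hbd : HasDerivAt (fun h => trans (b h) u) (t • Complex.I • β) 0 := by
    have h1 : HasDerivAt (fun h : ℝ => h * t) t 0 := by
      simpa using (hasDerivAt_id (0 : ℝ)).mul_const t
    have h2 := HasDerivAt.scomp (h := fun h : ℝ => h * t) (0 : ℝ) (by simpa using hβ) h1
    exact h2
  have hexp0 : expOp (fun y : Pos d => (0 : ℝ) * y j) u = u := by simp [expOp_zero]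
  have hmain := hasDerivAt_apply_of_tendsto (s := 0) (C := 1)
    (A := fun h u => c h • HartreeVlasov.free d ħ t (trans (b h) u))
    (v := fun h => expOp (fun y => h * y j) u) (v' := Complex.I • α)
    (w := HartreeVlasov.free d ħ t (t • Complex.I • β))
    (fun h x y => by simp only [map_sub, smul_sub])
    (fun h r x => by
      simp only [RCLike.real_smul_eq_coe_smul (K := ℂ), map_smul]
      rw [smul_comm])
    (fun h x => by
      rw [norm_smul, norm_free, norm_trans, hc, norm_exp_I_mul]) ?_ hα ?_
  · refine hmain.congr_deriv ?_
    simp only [hc0, one_smul, hb0, trans_zero]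
    rw [← map_add, ← map_smul, smul_add, RCLike.real_smul_eq_coe_smul (K := ℂ), smul_comm Complex.I]
    rfl
  · have h1 : Continuous fun h => c h • HartreeVlasov.free d ħ t (trans (b h) (Complex.I • α)) := by
      have hcc : Continuous c := by fun_prop
      exact hcc.smul ((HartreeVlasov.free d ħ t).continuous.comp ((continuous_trans _).comp hbc))
    exact (h1.tendsto 0).mono_left nhdsWithin_le_nhds
  · simp only [hexp0]
    have h1 := ((HartreeVlasov.free d ħ t).restrictScalars ℝ).hasFDerivAt.comp_hasDerivAt (0 : ℝ) hbd
    have h2 := hcd.smul h1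
    simp only [hc0, one_smul, zero_smul, add_zero] at h2
    exact h2

/-! ### Time-dependent potentials and their propagators -/

/-- A bounded time-dependent potential `W` with bounded gradient `G`. -/
structure TimePotential (d : ℕ) where
  /-- the potential -/
  W : ℝ → Pos d → ℝ
  /-- its gradient -/
  G : ℝ → Pos d → Pos d
  /-- a bound for the potential and its gradient -/
  A : ℝ
  /-- a constant in the Taylor expansion -/
  L : ℝ
  continuous_W : ∀ t, Continuous (W t)
  continuous_G : ∀ t, Continuous (G t)
  time_W : ∀ y, Continuous fun t => W t y
  time_G : ∀ y, Continuous fun t => G t y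
  abs_W_le : ∀ t y, |W t y| ≤ A
  norm_G_le : ∀ t y, ‖G t y‖ ≤ A
  taylor : ∀ t y a, |W t (y + a) - W t y - ⟪G t y, a⟫_ℝ| ≤ L * ‖a‖ ^ 2

theorem continuous_op_apply {X : Type*} [TopologicalSpace X] {B : ℝ → Op d}
    (hB : Continuous fun p : ℝ × StateSpace d => B p.1 p.2) {a : X → ℝ} {u : X → StateSpace d}
    (ha : Continuous a) (hu : Continuous u) : Continuous fun x => B (a x) (u x) :=
  Continuous.comp (g := fun p : ℝ × StateSpace d => B p.1 p.2) (f := fun x => (a x, u x)) hB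
    (ha.prodMk hu)

/-- Projection of a time onto `[0, T]`. -/
def clamp (T t : ℝ) : ℝ := max 0 (min t T)

theorem continuous_clamp (T : ℝ) : Continuous (clamp T) := by unfold clamp; fun_prop

theorem clamp_of_mem {T t : ℝ} (h : t ∈ Icc 0 T) : clamp T t = t := by
  rw [clamp, min_eq_left h.2, max_eq_right h.1]

theorem clamp_mem {T : ℝ} (hT : 0 ≤ T) (t : ℝ) : clamp T t ∈ Icc 0 T :=
  ⟨le_max_left _ _, max_le hT (min_le_right _ _)⟩

namespace TimePotential

variable (P : TimePotential d)

theorem A_nonneg : 0 ≤ P.A := (abs_nonneg _).trans (P.abs_W_le 0 0)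

/-- Multiplication by the potential at time `t`. -/
def potOp (t : ℝ) : Op d := mulOp fun y => (P.W t y : ℂ)

/-- Multiplication by a component of the gradient of the potential at time `t`. -/
def gradOp (j : Fin d) (t : ℝ) : Op d := mulOp fun y => ((P.G t y j : ℝ) : ℂ)

theorem norm_coe_W_le (t : ℝ) (y : Pos d) : ‖(P.W t y : ℂ)‖ ≤ P.A := by
  rw [Complex.norm_real]; exact P.abs_W_le t y

theorem norm_coe_G_le (j : Fin d) (t : ℝ) (y : Pos d) : ‖((P.G t y j : ℝ) : ℂ)‖ ≤ P.A := by
  rw [Complex.norm_real]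
  exact (PiLp.norm_apply_le (P.G t y) j).trans (P.norm_G_le t y)

theorem continuous_coe_W (t : ℝ) : Continuous fun y => (P.W t y : ℂ) := by
  have := P.continuous_W t
  fun_prop

theorem continuous_coe_G (j : Fin d) (t : ℝ) : Continuous fun y => ((P.G t y j : ℝ) : ℂ) := by
  have := P.continuous_G t
  fun_prop

theorem norm_potOp_le (t : ℝ) (u : StateSpace d) : ‖P.potOp t u‖ ≤ P.A * ‖u‖ :=
  norm_mulOp_le (P.continuous_coe_W t).aestronglyMeasurable (P.norm_coe_W_le t) u

theorem norm_gradOp_le (j : Fin d) (t : ℝ) (u : StateSpace d) : ‖P.gradOp j t u‖ ≤ P.A * ‖u‖ :=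
  norm_mulOp_le (P.continuous_coe_G j t).aestronglyMeasurable (P.norm_coe_G_le j t) u

theorem lipschitz_of_norm_le {A : ℝ} {B : Op d} (h : ∀ u, ‖B u‖ ≤ A * ‖u‖) :
    LipschitzWith A.toNNReal B := by
  refine LipschitzWith.of_dist_le_mul fun u v => ?_
  rw [dist_eq_norm, dist_eq_norm, ← map_sub]
  exact (h _).trans (mul_le_mul_of_nonneg_right (Real.le_coe_toNNReal A) (norm_nonneg _))

theorem continuous_potOp : Continuous fun p : ℝ × StateSpace d => P.potOp p.1 p.2 := by
  refine continuous_uncurry_of_lipschitz (v := fun t u => P.potOp t u)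
    (fun t => lipschitz_of_norm_le (P.norm_potOp_le t)) fun u =>
    continuous_iff_continuousAt.2 fun t => ?_
  exact tendsto_mulOp (fun n => (P.continuous_coe_W n).aestronglyMeasurable)
    (P.continuous_coe_W t).aestronglyMeasurable P.norm_coe_W_le (P.norm_coe_W_le t)
    (fun y => (Complex.continuous_ofReal.comp (P.time_W y)).tendsto t) u

theorem continuous_gradOp (j : Fin d) :
    Continuous fun p : ℝ × StateSpace d => P.gradOp j p.1 p.2 := by
  refine continuous_uncurry_of_lipschitz (v := fun t u => P.gradOp j t u)
    (fun t => lipschitz_of_norm_le (P.norm_gradOp_le j t)) fun u =>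
    continuous_iff_continuousAt.2 fun t => ?_
  have hc : ∀ y, Continuous fun t => ((P.G t y j : ℝ) : ℂ) := fun y => by
    have := P.time_G y
    fun_prop
  exact tendsto_mulOp (fun n => (P.continuous_coe_G j n).aestronglyMeasurable)
    (P.continuous_coe_G j t).aestronglyMeasurable (P.norm_coe_G_le j) (P.norm_coe_G_le j t)
    (fun y => (hc y).tendsto t) u

theorem inner_potOp_left (t : ℝ) (u v : StateSpace d) :
    ⟪P.potOp t u, v⟫_ℂ = ⟪u, P.potOp t v⟫_ℂ := by
  rw [potOp, inner_mulOp_left (memLp_top_of_norm_le (P.continuous_coe_W t).aestronglyMeasurable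
    (P.norm_coe_W_le t))]
  simp

variable (ħ T : ℝ)

/-- The potential in the interaction picture. -/
def interPot (t : ℝ) : Op d :=
  free d ħ (-clamp T t) ∘L P.potOp t ∘L free d ħ (clamp T t)

/-- A component of the gradient of the potential in the interaction picture. -/
def interGrad (j : Fin d) (t : ℝ) : Op d :=
  free d ħ (-clamp T t) ∘L P.gradOp j t ∘L free d ħ (clamp T t)

theorem norm_interPot_le (t : ℝ) (u : StateSpace d) : ‖P.interPot ħ T t u‖ ≤ P.A * ‖u‖ := by
  have := P.norm_potOp_le t (free d ħ (clamp T t) u)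
  rwa [norm_free, ← norm_free ħ (-clamp T t)] at this

theorem norm_interGrad_le (j : Fin d) (t : ℝ) (u : StateSpace d) :
    ‖P.interGrad ħ T j t u‖ ≤ P.A * ‖u‖ := by
  have := P.norm_gradOp_le j t (free d ħ (clamp T t) u)
  rwa [norm_free, ← norm_free ħ (-clamp T t)] at this

theorem continuous_interPot : Continuous fun p : ℝ × StateSpace d => P.interPot ħ T p.1 p.2 :=
  have h0 := (continuous_clamp T).comp continuous_fst
  continuous_op_apply (continuous_free ħ) h0.neg
    (continuous_op_apply P.continuous_potOp continuous_fst
      (continuous_op_apply (continuous_free ħ) h0 continuous_snd))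

theorem continuous_interGrad (j : Fin d) :
    Continuous fun p : ℝ × StateSpace d => P.interGrad ħ T j p.1 p.2 :=
  have h0 := (continuous_clamp T).comp continuous_fst
  continuous_op_apply (continuous_free ħ) h0.neg
    (continuous_op_apply (P.continuous_gradOp j) continuous_fst
      (continuous_op_apply (continuous_free ħ) h0 continuous_snd))

theorem inner_interPot_left (t : ℝ) (u v : StateSpace d) :
    ⟪P.interPot ħ T t u, v⟫_ℂ = ⟪u, P.interPot ħ T t v⟫_ℂ := by
  simp only [interPot, ContinuousLinearMap.comp_apply]
  rw [inner_free_left, neg_neg, P.inner_potOp_left, ← neg_neg (clamp T t), ← inner_free_left,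
    neg_neg]

theorem continuous_interPot_apply (u : StateSpace d) : Continuous fun t => P.interPot ħ T t u :=
  continuous_op_apply (P.continuous_interPot ħ T) continuous_id continuous_const

theorem continuous_interGrad_apply (j : Fin d) (u : StateSpace d) :
    Continuous fun t => P.interGrad ħ T j t u :=
  continuous_op_apply (P.continuous_interGrad ħ T j) continuous_id continuous_const

/-- The Schrödinger equation in the interaction picture. -/
def stateField : LipschitzField (StateSpace d) where
  toFun t u := (-(Complex.I / ħ)) • P.interPot ħ T t u
  K := ‖Complex.I / (ħ : ℂ)‖₊ * P.A.toNNReal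
  C := 0
  lipschitz t := by
    have := (lipschitzWith_smul (-(Complex.I / (ħ : ℂ)))).comp
      (lipschitz_of_norm_le (P.norm_interPot_le ħ T t))
    rwa [nnnorm_neg] at this
  continuous u := by
    have := P.continuous_interPot_apply ħ T u
    fun_prop
  bound t := by simp

/-- The evolution in the interaction picture of a state together with its positions and
momenta. -/
def tripleMap (t : ℝ) (p : Triple d) : Triple d :=
  ((-(Complex.I / ħ)) • P.interPot ħ T t p.1,
    fun j => (-(Complex.I / ħ)) • P.interPot ħ T t (p.2.1 j) +
      clamp T t • P.interGrad ħ T j t p.1,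
    fun j => (-(Complex.I / ħ)) • P.interPot ħ T t (p.2.2 j) - P.interGrad ħ T j t p.1)

variable {ħ T}

theorem tripleMap_mem (hħ : ħ ≠ 0) (t : ℝ) {p : Triple d} (hp : p ∈ posMomGraph d ħ) :
    P.tripleMap ħ T t p ∈ posMomGraph d ħ := by
  intro j
  obtain ⟨hα, hβ⟩ := hp j
  set θ := clamp T t
  have hW := memLp_top_of_norm_le (P.continuous_coe_W t).aestronglyMeasurable (P.norm_coe_W_le t)
  have hα1 := (hα.free hβ θ).mulOp hW
  have hβ1 := (hβ.free θ).mulOp (P.continuous_W t) (P.continuous_G t) (P.abs_W_le t)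
    (P.norm_G_le t) (P.taylor t)
  have hα2 := (hα1.free hβ1 (-θ)).smul (-(Complex.I / (ħ : ℂ)))
  have hβ2 := (hβ1.free (-θ)).smul (-(Complex.I / (ħ : ℂ)))
  have hc : -(Complex.I / (ħ : ℂ)) * (Complex.I * ħ) = 1 := by
    have h2 : (ħ : ℂ) ≠ 0 := by exact_mod_cast hħ
    field_simp
    rw [Complex.I_sq]
    ring
  have e1 : (P.tripleMap ħ T t p).2.1 j = (-(Complex.I / (ħ : ℂ))) • free d ħ (-θ)
      (mulOp (fun y => (P.W t y : ℂ)) (free d ħ θ (p.2.1 j + (θ : ℂ) • p.2.2 j)) +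
        ((-θ : ℝ) : ℂ) • (mulOp (fun y => (P.W t y : ℂ)) (free d ħ θ (p.2.2 j)) -
          (Complex.I * ħ) • mulOp (fun y => ((P.G t y j : ℝ) : ℂ)) (free d ħ θ p.1))) := by
    simp only [tripleMap, interPot, interGrad, ContinuousLinearMap.comp_apply, potOp, gradOp,
      map_add, map_sub, map_smul, smul_add, smul_sub, smul_smul]
    have h3 : -(Complex.I / (ħ : ℂ)) * (((-θ : ℝ) : ℂ) * (Complex.I * ħ)) = -(θ : ℂ) := by
      rw [mul_left_comm, hc]
      push_cast
      ring
    have h4 : -(Complex.I / (ħ : ℂ)) * ((-θ : ℝ) : ℂ) = -(-(Complex.I / (ħ : ℂ)) * (θ : ℂ)) := by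
      push_cast
      ring
    rw [h3, h4, RCLike.real_smul_eq_coe_smul (K := ℂ), neg_smul (θ : ℂ),
      neg_smul (-(Complex.I / (ħ : ℂ)) * (θ : ℂ))]
    change _ + (θ : ℂ) • _ = _
    abel
  have e2 : (P.tripleMap ħ T t p).2.2 j = (-(Complex.I / (ħ : ℂ))) • free d ħ (-θ)
      (mulOp (fun y => (P.W t y : ℂ)) (free d ħ θ (p.2.2 j)) -
        (Complex.I * ħ) • mulOp (fun y => ((P.G t y j : ℝ) : ℂ)) (free d ħ θ p.1)) := by
    simp only [tripleMap, interPot, interGrad, ContinuousLinearMap.comp_apply, potOp, gradOp,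
      map_sub, map_smul, smul_sub, smul_smul, hc, one_smul]
    rfl
  constructor
  · rw [e1]
    exact hα2
  · rw [e2]
    exact hβ2

theorem tripleMap_sub (t : ℝ) (p q : Triple d) :
    P.tripleMap ħ T t p - P.tripleMap ħ T t q = P.tripleMap ħ T t (p - q) := by
  refine Prod.ext ?_ (Prod.ext ?_ ?_)
  · simp [tripleMap, smul_sub]
  · ext1 j
    simp [tripleMap, smul_sub]
    abel
  · ext1 j
    simp [tripleMap, smul_sub]
    abel

theorem norm_tripleMap_le (hT : 0 ≤ T) (t : ℝ) (p : Triple d) :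
    ‖P.tripleMap ħ T t p‖ ≤ (‖Complex.I / (ħ : ℂ)‖ * P.A + (T + 1) * P.A) * ‖p‖ := by
  have hA := P.A_nonneg
  have h1 : ∀ u : StateSpace d, ‖u‖ ≤ ‖p‖ →
      ‖(-(Complex.I / (ħ : ℂ))) • P.interPot ħ T t u‖ ≤ ‖Complex.I / (ħ : ℂ)‖ * P.A * ‖p‖ :=
    fun u hu => by
      rw [norm_smul, norm_neg, mul_assoc]
      refine mul_le_mul_of_nonneg_left ?_ (norm_nonneg _)
      exact (P.norm_interPot_le ħ T t u).trans (mul_le_mul_of_nonneg_left hu hA)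
  have h2 : ∀ j, ‖P.interGrad ħ T j t p.1‖ ≤ P.A * ‖p‖ := fun j =>
    (P.norm_interGrad_le ħ T j t _).trans (mul_le_mul_of_nonneg_left (norm_fst_le p) hA)
  have h3 : ∀ j, ‖p.2.1 j‖ ≤ ‖p‖ := fun j =>
    (norm_le_pi_norm p.2.1 j).trans ((norm_fst_le p.2).trans (norm_snd_le p))
  have h4 : ∀ j, ‖p.2.2 j‖ ≤ ‖p‖ := fun j =>
    (norm_le_pi_norm p.2.2 j).trans ((norm_snd_le p.2).trans (norm_snd_le p))
  have hAp : 0 ≤ P.A * ‖p‖ := by positivity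
  have hθ := clamp_mem hT t
  have hpos : 0 ≤ (‖Complex.I / (ħ : ℂ)‖ * P.A + (T + 1) * P.A) * ‖p‖ := by positivity
  refine norm_prod_le_iff.2 ⟨?_, norm_prod_le_iff.2 ⟨?_, ?_⟩⟩
  · refine (h1 _ (norm_fst_le p)).trans ?_
    nlinarith
  · refine (pi_norm_le_iff_of_nonneg hpos).2 fun j => ?_
    refine (norm_add_le _ _).trans ?_
    have h5 : ‖clamp T t • P.interGrad ħ T j t p.1‖ ≤ T * (P.A * ‖p‖) := by
      rw [norm_smul, Real.norm_of_nonneg hθ.1]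
      exact mul_le_mul hθ.2 (h2 j) (norm_nonneg _) hT
    have := h1 _ (h3 j)
    nlinarith
  · refine (pi_norm_le_iff_of_nonneg hpos).2 fun j => ?_
    refine (norm_sub_le _ _).trans ?_
    have := h1 _ (h4 j)
    have := h2 j
    nlinarith

theorem continuous_tripleMap (p : Triple d) : Continuous fun t => P.tripleMap ħ T t p := by
  have h1 := P.continuous_interPot_apply ħ T
  have h2 := P.continuous_interGrad_apply ħ T
  have h3 := continuous_clamp T
  unfold tripleMap
  fun_prop

/-- The vector field `tripleMap` on the graph of the position and momentum operators. -/
def tripleField (hħ : ħ ≠ 0) (hT : 0 ≤ T) : LipschitzField (posMomGraph d ħ) where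
  toFun t p := ⟨P.tripleMap ħ T t p.1, P.tripleMap_mem hħ t p.2⟩
  K := (‖Complex.I / (ħ : ℂ)‖ * P.A + (T + 1) * P.A).toNNReal
  C := 0
  lipschitz t := by
    refine LipschitzWith.of_dist_le_mul fun p q => ?_
    rw [Subtype.dist_eq, Subtype.dist_eq, dist_eq_norm, dist_eq_norm, tripleMap_sub]
    exact (P.norm_tripleMap_le hT t _).trans
      (mul_le_mul_of_nonneg_right (Real.le_coe_toNNReal _) (norm_nonneg _))
  continuous p := (P.continuous_tripleMap p.1).subtype_mk _
  bound t := by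
    have := P.norm_tripleMap_le (ħ := ħ) hT t 0
    simpa using this

instance : CompleteSpace (posMomGraph d ħ) :=
  (isClosed_posMomGraph d ħ).completeSpace_coe

end TimePotential

/-! ### The quadratic forms of position and momentum -/

/-- The quadratic form `∫ |x - y|² |φ(y)|² dy`. -/
def posForm (x : Pos d) (φ : StateSpace d) : ℝ≥0∞ := ∫⁻ y, ‖x - y‖ₑ ^ 2 * ‖φ y‖ₑ ^ 2

/-- The quadratic form `∫ |ξ - 2πħ k|² |(𝓕φ)(k)|² dk`. -/
def momForm (ħ : ℝ) (ξ : Pos d) (φ : StateSpace d) : ℝ≥0∞ :=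
  ∫⁻ k, ‖ξ - (2 * Real.pi * ħ) • k‖ₑ ^ 2 * ‖fourierOp d φ k‖ₑ ^ 2

theorem costForm_eq (ħ : ℝ) (z : Phase d) (φ : StateSpace d) :
    costForm ħ z φ = ENNReal.ofReal (1 / 2) * (posForm z.1 φ + momForm ħ z.2 φ) := rfl

theorem posForm_add {ħ : ℝ} (hħ : 0 < ħ) (x : Pos d) (φ : StateSpace d) :
    ENNReal.ofReal ((2 * Real.pi * ħ) ^ d)⁻¹ *
        (∫⁻ w : Phase d, ‖x - w.1‖ₑ ^ 2 * ‖⟪coherentState ħ w, φ⟫_ℂ‖ₑ ^ 2) =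
      posForm x φ + ENNReal.ofReal (d * ħ / 2) * ‖φ‖ₑ ^ 2 := by
  have h1 := lintegral_mul_coherentState_fst hħ (g := fun q => ‖x - q‖ₑ ^ 2) (by fun_prop) φ
  simp only [lintegral_sq_mul_gaussProfile_sq hħ, add_mul] at h1
  have hφ : Measurable φ := (Lp.stronglyMeasurable φ).measurable
  rw [lintegral_add_left (by fun_prop), lintegral_const_mul _ (by fun_prop),
    ← enorm_sq_eq_lintegral] at h1
  rw [h1, ← mul_assoc, ← ENNReal.ofReal_mul (by positivity), inv_mul_cancel₀ (by positivity),
    ENNReal.ofReal_one, one_mul]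
  rfl

theorem momForm_add {ħ : ℝ} (hħ : 0 < ħ) (ξ : Pos d) (φ : StateSpace d) :
    ENNReal.ofReal ((2 * Real.pi * ħ) ^ d)⁻¹ *
        (∫⁻ w : Phase d, ‖ξ - w.2‖ₑ ^ 2 * ‖⟪coherentState ħ w, φ⟫_ℂ‖ₑ ^ 2) =
      momForm ħ ξ φ + ENNReal.ofReal (d * ħ / 2) * ‖φ‖ₑ ^ 2 := by
  have h2 := lintegral_mul_coherentState_snd hħ (g := fun q => ‖ξ - q‖ₑ ^ 2) (by fun_prop) φ
  simp only [lintegral_sq_mul_gaussProfile_sq hħ, add_mul] at h2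
  have hφ' : Measurable (fourierOp d φ) := (Lp.stronglyMeasurable _).measurable
  rw [lintegral_add_left (by fun_prop), lintegral_const_mul _ (by fun_prop),
    ← enorm_sq_eq_lintegral] at h2
  rw [← ofReal_norm (fourierOp d φ), norm_fourierOp, ofReal_norm] at h2
  rw [h2, ← mul_assoc, ← ENNReal.ofReal_mul (by positivity), inv_mul_cancel₀ (by positivity),
    ENNReal.ofReal_one, one_mul]
  rfl

theorem measurable_posForm : Measurable fun x : Pos d × StateSpace d => posForm x.1 x.2 := by
  have h1 : (fun x : Pos d × StateSpace d => posForm x.1 x.2) = fun x =>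
      ENNReal.ofReal ((2 * Real.pi * 1) ^ d)⁻¹ *
        (∫⁻ w : Phase d, ‖x.1 - w.1‖ₑ ^ 2 * ‖⟪coherentState 1 w, x.2⟫_ℂ‖ₑ ^ 2) -
        ENNReal.ofReal (d * 1 / 2) * ‖x.2‖ₑ ^ 2 := by
    funext x
    rw [posForm_add one_pos]
    exact (ENNReal.add_sub_cancel_right
      (ENNReal.mul_ne_top ENNReal.ofReal_ne_top (ENNReal.pow_ne_top enorm_ne_top))).symm
  rw [h1]
  have h2 : Measurable fun p : (Pos d × StateSpace d) × Phase d =>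
      ‖p.1.1 - p.2.1‖ₑ ^ 2 * ‖⟪coherentState 1 p.2, p.1.2⟫_ℂ‖ₑ ^ 2 := by
    have hcoh := continuous_coherentState (d := d) one_pos
    have h4 : Continuous fun p : (Pos d × StateSpace d) × Phase d =>
        ‖⟪coherentState 1 p.2, p.1.2⟫_ℂ‖ₑ ^ 2 := by fun_prop
    exact Measurable.mul (by fun_prop) h4.measurable
  have h3 := h2.lintegral_prod_right' (ν := volume)
  exact (h3.const_mul _).sub (by fun_prop)

theorem measurable_momForm {ħ : ℝ} (hħ : 0 < ħ) :
    Measurable fun x : Pos d × StateSpace d => momForm ħ x.1 x.2 := by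
  have h1 : (fun x : Pos d × StateSpace d => momForm ħ x.1 x.2) = fun x =>
      ENNReal.ofReal ((2 * Real.pi * ħ) ^ d)⁻¹ *
        (∫⁻ w : Phase d, ‖x.1 - w.2‖ₑ ^ 2 * ‖⟪coherentState ħ w, x.2⟫_ℂ‖ₑ ^ 2) -
        ENNReal.ofReal (d * ħ / 2) * ‖x.2‖ₑ ^ 2 := by
    funext x
    rw [momForm_add hħ]
    exact (ENNReal.add_sub_cancel_right
      (ENNReal.mul_ne_top ENNReal.ofReal_ne_top (ENNReal.pow_ne_top enorm_ne_top))).symm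
  rw [h1]
  have h2 : Measurable fun p : (Pos d × StateSpace d) × Phase d =>
      ‖p.1.1 - p.2.2‖ₑ ^ 2 * ‖⟪coherentState ħ p.2, p.1.2⟫_ℂ‖ₑ ^ 2 := by
    have hcoh := continuous_coherentState (d := d) hħ
    have h4 : Continuous fun p : (Pos d × StateSpace d) × Phase d =>
        ‖⟪coherentState ħ p.2, p.1.2⟫_ℂ‖ₑ ^ 2 := by fun_prop
    exact Measurable.mul (by fun_prop) h4.measurable
  have h3 := h2.lintegral_prod_right' (ν := volume)
  exact (h3.const_mul _).sub (by fun_prop)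

theorem sum_enorm_sq_eq_lintegral {m : Pos d → Pos d} (hm : Measurable m) {φ : StateSpace d}
    {v : Fin d → StateSpace d} (hv : ∀ j, v j =ᵐ[volume] fun y => ((m y j : ℝ) : ℂ) * φ y) :
    ∑ j, ‖v j‖ₑ ^ 2 = ∫⁻ y, ‖m y‖ₑ ^ 2 * ‖φ y‖ₑ ^ 2 := by
  have hφ : Measurable φ := (Lp.stronglyMeasurable φ).measurable
  have h1 : ∀ y, ‖m y‖ₑ ^ 2 = ∑ j, ‖((m y j : ℝ) : ℂ)‖ₑ ^ 2 := fun y => by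
    rw [← ofReal_norm, ← ENNReal.ofReal_pow (norm_nonneg _), EuclideanSpace.norm_sq_eq,
      ENNReal.ofReal_sum_of_nonneg fun _ _ => by positivity]
    refine Finset.sum_congr rfl fun j _ => ?_
    rw [ENNReal.ofReal_pow (norm_nonneg _), ← ofReal_norm, Complex.norm_real]
  simp_rw [h1, Finset.sum_mul]
  rw [lintegral_finsetSum _ fun j _ => by fun_prop]
  refine Finset.sum_congr rfl fun j _ => ?_
  rw [enorm_sq_eq_lintegral]
  refine lintegral_congr_ae ?_
  filter_upwards [hv j] with y hy
  rw [hy, enorm_mul, mul_pow]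

theorem exists_of_lintegral_ne_top {m : Pos d → Pos d} (hm : Measurable m) {φ : StateSpace d}
    (h : ∫⁻ y, ‖m y‖ₑ ^ 2 * ‖φ y‖ₑ ^ 2 ≠ ⊤) (j : Fin d) :
    ∃ v : StateSpace d, v =ᵐ[volume] fun y => ((m y j : ℝ) : ℂ) * φ y := by
  have hφ : Measurable φ := (Lp.stronglyMeasurable φ).measurable
  have h1 : MemLp (fun y => ((m y j : ℝ) : ℂ) * φ y) 2 volume := by
    refine ⟨by fun_prop, ?_⟩
    rw [eLpNorm_lt_top_iff_lintegral_rpow_enorm_lt_top (by norm_num) (by norm_num)]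
    refine lt_of_le_of_lt (lintegral_mono fun y => ?_) (lt_top_iff_ne_top.2 h)
    simp only [ENNReal.toReal_ofNat, ENNReal.rpow_ofNat]
    rw [enorm_mul, mul_pow]
    gcongr
    rw [enorm_le_iff_norm_le, Complex.norm_real]
    exact PiLp.norm_apply_le _ _
  exact ⟨h1.toLp, h1.coeFn_toLp⟩

theorem coeFn_smul_sub (c : ℝ) (u v : StateSpace d) :
    (((c : ℂ) • u - v : StateSpace d) : Pos d → ℂ) =ᵐ[volume] fun y => (c : ℂ) * u y - v y := by
  filter_upwards [Lp.coeFn_sub ((c : ℂ) • u) v, Lp.coeFn_smul (c : ℂ) u] with y h1 h2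
  rw [h1, Pi.sub_apply, h2, Pi.smul_apply, smul_eq_mul]

theorem posForm_eq_sum {φ : StateSpace d} {α : Fin d → StateSpace d} (h : ∀ j, IsPos j φ (α j))
    (x : Pos d) : posForm x φ = ∑ j, ‖((x j : ℝ) : ℂ) • φ - α j‖ₑ ^ 2 := by
  refine (sum_enorm_sq_eq_lintegral (m := fun y => x - y) (by fun_prop) fun j => ?_).symm
  filter_upwards [h j, coeFn_smul_sub (x j) φ (α j)] with y h1 h2
  rw [h2, h1, PiLp.sub_apply]
  push_cast
  ring

theorem momForm_eq_sum {ħ : ℝ} {φ : StateSpace d} {β : Fin d → StateSpace d}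
    (h : ∀ j, IsMom ħ j φ (β j)) (ξ : Pos d) :
    momForm ħ ξ φ = ∑ j, ‖((ξ j : ℝ) : ℂ) • φ - β j‖ₑ ^ 2 := by
  have h1 : ∀ j, ‖((ξ j : ℝ) : ℂ) • φ - β j‖ₑ =
      ‖((ξ j : ℝ) : ℂ) • fourierOp d φ - fourierOp d (β j)‖ₑ := fun j => by
    rw [← map_smul, ← map_sub, ← ofReal_norm (fourierOp d _), norm_fourierOp, ofReal_norm]
  simp_rw [h1]
  refine (sum_enorm_sq_eq_lintegral (m := fun k => ξ - (2 * Real.pi * ħ) • k) (by fun_prop)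
    fun j => ?_).symm
  filter_upwards [h j, coeFn_smul_sub (ξ j) (fourierOp d φ) (fourierOp d (β j))] with y h1 h2
  rw [h2, h1, PiLp.sub_apply, PiLp.smul_apply, smul_eq_mul]
  push_cast
  ring

theorem exists_isPos {x : Pos d} {φ : StateSpace d} (h : posForm x φ ≠ ⊤) (j : Fin d) :
    ∃ α, IsPos j φ α := by
  obtain ⟨v, hv⟩ := exists_of_lintegral_ne_top (m := fun y => x - y) (by fun_prop) h j
  refine ⟨((x j : ℝ) : ℂ) • φ - v, ?_⟩
  unfold IsPos
  filter_upwards [hv, coeFn_smul_sub (x j) φ v] with y h1 h2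
  rw [h2, h1, PiLp.sub_apply]
  push_cast
  ring

theorem exists_isMom {ħ : ℝ} {ξ : Pos d} {φ : StateSpace d} (h : momForm ħ ξ φ ≠ ⊤) (j : Fin d) :
    ∃ β, IsMom ħ j φ β := by
  obtain ⟨v, hv⟩ := exists_of_lintegral_ne_top (m := fun k => ξ - (2 * Real.pi * ħ) • k)
    (by fun_prop) h j
  refine ⟨fourierInvOp d (((ξ j : ℝ) : ℂ) • fourierOp d φ - v), ?_⟩
  unfold IsMom
  rw [fourierOp_fourierInvOp]
  filter_upwards [hv, coeFn_smul_sub (ξ j) (fourierOp d φ) v] with y h1 h2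
  rw [h2, h1, PiLp.sub_apply, PiLp.smul_apply, smul_eq_mul]
  push_cast
  ring

namespace TimePotential

variable (P : TimePotential d) (ħ T : ℝ)

/-! ### The propagator -/

/-- The propagator in the interaction picture. -/
def interProp (s t : ℝ) : Op d where
  toFun := (P.stateField ħ T).flow s t
  map_add' u v := by
    have h := (P.stateField ħ T).eq_flow (γ := fun r => (P.stateField ħ T).flow s r u +
      (P.stateField ħ T).flow s r v) (fun r => (((P.stateField ħ T).hasDerivAt_flow s r u).add
        ((P.stateField ħ T).hasDerivAt_flow s r v)).congr_deriv
          (by simp only [stateField, map_add, smul_add])) s t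
    simp only [LipschitzField.flow_self] at h
    exact h.symm
  map_smul' c u := by
    have h := (P.stateField ħ T).eq_flow (γ := fun r => c • (P.stateField ħ T).flow s r u)
      (fun r => (((P.stateField ħ T).hasDerivAt_flow s r u).const_smul c).congr_deriv
          (by simp only [stateField, map_smul, smul_comm c])) s t
    simp only [LipschitzField.flow_self] at h
    exact h.symm
  cont := (P.stateField ħ T).continuous_flow s t

theorem hasDerivAt_interProp (s t : ℝ) (u : StateSpace d) :
    HasDerivAt (fun r => P.interProp ħ T s r u)
      (-(Complex.I / ħ) • P.interPot ħ T t (P.interProp ħ T s t u)) t :=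
  (P.stateField ħ T).hasDerivAt_flow s t u

theorem interProp_self (s : ℝ) (u : StateSpace d) : P.interProp ħ T s s u = u :=
  (P.stateField ħ T).flow_self s u

theorem interProp_interProp (r s t : ℝ) (u : StateSpace d) :
    P.interProp ħ T s t (P.interProp ħ T r s u) = P.interProp ħ T r t u :=
  (P.stateField ħ T).flow_flow r s t u

theorem inner_interProp (s t : ℝ) (u v : StateSpace d) :
    ⟪P.interProp ħ T s t u, P.interProp ħ T s t v⟫_ℂ = ⟪u, v⟫_ℂ := by
  have h : ∀ r, HasDerivAt (fun r => ⟪P.interProp ħ T s r u, P.interProp ħ T s r v⟫_ℂ) 0 r :=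
    fun r => ((P.hasDerivAt_interProp ħ T s r u).inner ℂ
      (P.hasDerivAt_interProp ħ T s r v)).congr_deriv (by
        rw [inner_smul_left, inner_smul_right, inner_interPot_left]
        simp
        ring)
  have h2 := is_const_of_deriv_eq_zero (fun r => (h r).differentiableAt) (fun r => (h r).deriv) t s
  simpa only [interProp_self] using h2

theorem norm_interProp (s t : ℝ) (u : StateSpace d) : ‖P.interProp ħ T s t u‖ = ‖u‖ := by
  rw [← sq_eq_sq₀ (norm_nonneg _) (norm_nonneg _), ← inner_self_eq_norm_sq (𝕜 := ℂ),
    inner_interProp, inner_self_eq_norm_sq]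

theorem continuous_interProp (s : ℝ) :
    Continuous fun p : ℝ × StateSpace d => P.interProp ħ T s p.1 p.2 := by
  refine continuous_uncurry_of_lipschitz (v := fun t u => P.interProp ħ T s t u) (K := 1)
    (fun t => LipschitzWith.of_dist_le_mul fun u v => ?_)
    fun u => (P.stateField ħ T).continuous_flow_right s u
  rw [dist_eq_norm, dist_eq_norm, ← map_sub, norm_interProp]
  simp

/-- The propagator from time `0`. -/
def prop (t : ℝ) : Op d := free d ħ (clamp T t) ∘L P.interProp ħ T 0 t

theorem prop_apply (t : ℝ) (u : StateSpace d) :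
    P.prop ħ T t u = free d ħ (clamp T t) (P.interProp ħ T 0 t u) := rfl

theorem inner_prop (t : ℝ) (u v : StateSpace d) :
    ⟪P.prop ħ T t u, P.prop ħ T t v⟫_ℂ = ⟪u, v⟫_ℂ := by
  rw [prop_apply, prop_apply, inner_free_left, free_neg_free, inner_interProp]

theorem norm_prop (t : ℝ) (u : StateSpace d) : ‖P.prop ħ T t u‖ = ‖u‖ := by
  rw [prop_apply, norm_free, norm_interProp]

theorem adjoint_prop_comp (t : ℝ) :
    (P.prop ħ T t).adjoint ∘L P.prop ħ T t = ContinuousLinearMap.id ℂ _ := by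
  ext1 u
  refine ext_inner_left ℂ fun v => ?_
  rw [ContinuousLinearMap.comp_apply, ContinuousLinearMap.adjoint_inner_right, inner_prop]
  rfl

theorem continuous_prop : Continuous fun p : ℝ × StateSpace d => P.prop ħ T p.1 p.2 :=
  continuous_op_apply (continuous_free ħ) ((continuous_clamp T).comp continuous_fst)
    (P.continuous_interProp ħ T 0)

theorem prop_zero (hT : 0 ≤ T) (u : StateSpace d) : P.prop ħ T 0 u = u := by
  rw [prop_apply, clamp_of_mem ⟨le_rfl, hT⟩, free_zero, interProp_self]

end TimePotential

/-! ### Evolution of the cost along a characteristic -/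

theorem ofReal_integral_le_lintegral {α : Type*} [MeasurableSpace α] {μ : Measure α} {f : α → ℝ}
    (hf : Integrable f μ) : ENNReal.ofReal (∫ x, f x ∂μ) ≤ ∫⁻ x, ENNReal.ofReal (f x) ∂μ := by
  rw [integral_eq_lintegral_pos_part_sub_lintegral_neg_part hf]
  refine (ENNReal.ofReal_le_ofReal (sub_le_self _ ENNReal.toReal_nonneg)).trans ?_
  exact ENNReal.ofReal_toReal_le

theorem sum_enorm_sq_eq_ofReal (v : Fin d → StateSpace d) :
    ∑ j, ‖v j‖ₑ ^ 2 = ENNReal.ofReal (∑ j, ‖v j‖ ^ 2) := by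
  rw [ENNReal.ofReal_sum_of_nonneg fun _ _ => by positivity]
  refine Finset.sum_congr rfl fun j _ => ?_
  rw [ENNReal.ofReal_pow (norm_nonneg _), ofReal_norm]

theorem re_inner_le (u v : StateSpace d) :
    RCLike.re ⟪u, v⟫_ℂ ≤ (‖u‖ ^ 2 + ‖v‖ ^ 2) / 2 := by
  have h1 := re_inner_le_norm (𝕜 := ℂ) u v
  nlinarith [sq_nonneg (‖u‖ - ‖v‖)]

namespace TimePotential

variable (P : TimePotential d) {ħ T : ℝ}

theorem re_inner_interPot (t : ℝ) (u : StateSpace d) :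
    RCLike.re ⟪u, (-(Complex.I / (ħ : ℂ))) • P.interPot ħ T t u⟫_ℂ = 0 := by
  have h1 : starRingEnd ℂ ⟪u, P.interPot ħ T t u⟫_ℂ = ⟪u, P.interPot ħ T t u⟫_ℂ := by
    rw [inner_conj_symm, inner_interPot_left]
  obtain ⟨r, hr⟩ := Complex.conj_eq_iff_real.1 h1
  rw [inner_smul_right, hr]
  have : -(Complex.I / (ħ : ℂ)) * (r : ℂ) = ((-(r / ħ) : ℝ) : ℂ) * Complex.I := by
    push_cast
    ring
  rw [this, RCLike.re_eq_complex_re, Complex.re_ofReal_mul, Complex.I_re, mul_zero]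

theorem hasDerivAt_half_norm_sq {a : ℝ → StateSpace d} {w : StateSpace d} {t : ℝ}
    (h : HasDerivAt a ((-(Complex.I / (ħ : ℂ))) • P.interPot ħ T t (a t) + w) t) :
    HasDerivAt (fun s => ‖a s‖ ^ 2 / 2) (RCLike.re ⟪a t, w⟫_ℂ) t := by
  have h1 := (h.inner ℂ h)
  have h2 : HasDerivAt (fun s => RCLike.re ⟪a s, a s⟫_ℂ / 2) _ t :=
    (Complex.reCLM.hasFDerivAt.comp_hasDerivAt t h1).div_const 2
  have h3 : (fun s => RCLike.re ⟪a s, a s⟫_ℂ / 2) = fun s => ‖a s‖ ^ 2 / 2 := by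
    funext s
    rw [inner_self_eq_norm_sq]
  rw [h3] at h2
  refine h2.congr_deriv ?_
  have h4 := P.re_inner_interPot (ħ := ħ) (T := T) t (a t)
  rw [map_add, ← inner_conj_symm _ (a t), inner_add_right]
  simp only [Complex.reCLM_apply, Complex.conj_re, RCLike.re_eq_complex_re,
    map_add] at h4 ⊢
  rw [h4]
  ring

theorem hasDerivAt_coe_smul {c : ℝ → ℝ} {c' t : ℝ} (hc : HasDerivAt c c' t) {u : ℝ → StateSpace d}
    {u' : StateSpace d} (hu : HasDerivAt u u' t) :
    HasDerivAt (fun s => ((c s : ℝ) : ℂ) • u s) ((c t : ℂ) • u' + (c' : ℂ) • u t) t := by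
  have h := hc.smul hu
  have h1 : (fun s => ((c s : ℝ) : ℂ) • u s) = fun s => c s • u s := by
    funext s
    exact (RCLike.real_smul_eq_coe_smul (K := ℂ) _ _).symm
  rw [h1]
  refine h.congr_deriv ?_
  rw [RCLike.real_smul_eq_coe_smul (K := ℂ), RCLike.real_smul_eq_coe_smul (K := ℂ)]
  rfl

theorem norm_free_sub (θ : ℝ) (c : ℂ) (u v : StateSpace d) :
    ‖c • free d ħ θ u - free d ħ θ v‖ = ‖c • u - v‖ := by
  rw [← map_smul, ← map_sub, norm_free]

/-- A position component of a triple. -/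
def coordFst (d : ℕ) (j : Fin d) : Triple d →L[ℝ] StateSpace d :=
  (ContinuousLinearMap.proj (R := ℝ) (φ := fun _ : Fin d => StateSpace d) j).comp
    ((ContinuousLinearMap.fst ℝ (Fin d → StateSpace d) (Fin d → StateSpace d)).comp
      (ContinuousLinearMap.snd ℝ (StateSpace d) _))

/-- A momentum component of a triple. -/
def coordSnd (d : ℕ) (j : Fin d) : Triple d →L[ℝ] StateSpace d :=
  (ContinuousLinearMap.proj (R := ℝ) (φ := fun _ : Fin d => StateSpace d) j).comp
    ((ContinuousLinearMap.snd ℝ (Fin d → StateSpace d) (Fin d → StateSpace d)).comp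
      (ContinuousLinearMap.snd ℝ (StateSpace d) _))

theorem exists_energy (hħ : ħ ≠ 0) (hT : 0 ≤ T) {x ξ F : ℝ → Pos d}
    (hx : ∀ t, HasDerivAt x (ξ t) t) (hξ : ∀ t, HasDerivAt ξ (F t) t) (hF : Continuous F)
    {u : StateSpace d} (hu : costForm ħ (x 0, ξ 0) u ≠ ⊤) :
    ∃ g g' : ℝ → ℝ, Continuous g ∧ Continuous g' ∧
      (∀ t ∈ Icc 0 T, HasDerivAt g (g' t) t) ∧
      (∀ t ∈ Icc 0 T, costForm ħ (x t, ξ t) (P.prop ħ T t u) = ENNReal.ofReal (g t)) ∧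
      ∀ t ∈ Icc 0 T, ENNReal.ofReal (g' t) ≤ costForm ħ (x t, ξ t) (P.prop ħ T t u) +
        ENNReal.ofReal (1 / 2) * momForm ħ (ξ t) (P.prop ħ T t u) +
        ENNReal.ofReal (1 / 2) * ∫⁻ y, ‖F t + P.G t y‖ₑ ^ 2 * ‖P.prop ħ T t u y‖ₑ ^ 2 := by
  have hhalf : ENNReal.ofReal (1 / 2) ≠ 0 := by simp
  rw [costForm_eq] at hu
  have hu1 : posForm (x 0) u ≠ ⊤ := fun h => hu (by
    rw [h, top_add, ENNReal.mul_top hhalf])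
  have hu2 : momForm ħ (ξ 0) u ≠ ⊤ := fun h => hu (by
    rw [h, add_top, ENNReal.mul_top hhalf])
  choose α hα using exists_isPos hu1
  choose β hβ using exists_isMom hu2
  set Y := P.tripleField hħ hT
  set p₀ : posMomGraph d ħ := ⟨(u, α, β), fun j => ⟨hα j, hβ j⟩⟩
  set p : ℝ → Triple d := fun t => (Y.flow 0 t p₀ : Triple d) with hp
  have hp0 : p 0 = (u, α, β) := by
    simp only [hp, LipschitzField.flow_self]
    rfl
  have hpd : ∀ t, HasDerivAt p (P.tripleMap ħ T t (p t)) t := fun t =>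
    ((posMomGraph d ħ).subtypeL.hasFDerivAt).comp_hasDerivAt t (Y.hasDerivAt_flow 0 t p₀)
  have hpc : Continuous p := continuous_iff_continuousAt.2 fun t => (hpd t).continuousAt
  have hmem : ∀ t, p t ∈ posMomGraph d ħ := fun t => (Y.flow 0 t p₀).2
  have hd1 : ∀ t, HasDerivAt (fun s => (p s).1)
      ((-(Complex.I / (ħ : ℂ))) • P.interPot ħ T t (p t).1) t := fun t =>
    (ContinuousLinearMap.fst ℝ (StateSpace d) ((Fin d → StateSpace d) ×
      (Fin d → StateSpace d))).hasFDerivAt.comp_hasDerivAt t (hpd t)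
  have hd2 : ∀ j t, HasDerivAt (fun s => (p s).2.1 j)
      ((-(Complex.I / (ħ : ℂ))) • P.interPot ħ T t ((p t).2.1 j) +
        clamp T t • P.interGrad ħ T j t (p t).1) t := fun j t =>
    (coordFst d j).hasFDerivAt.comp_hasDerivAt t (hpd t)
  have hd3 : ∀ j t, HasDerivAt (fun s => (p s).2.2 j)
      ((-(Complex.I / (ħ : ℂ))) • P.interPot ħ T t ((p t).2.2 j) -
        P.interGrad ħ T j t (p t).1) t := fun j t =>
    (coordSnd d j).hasFDerivAt.comp_hasDerivAt t (hpd t)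
  have hprop : ∀ t, P.prop ħ T t u = free d ħ (clamp T t) (p t).1 := fun t => by
    have h1 := (P.stateField ħ T).eq_flow (γ := fun s => (p s).1) hd1 0 t
    rw [hp0] at h1
    rw [prop_apply, h1]
    rfl
  have hxj : ∀ j t, HasDerivAt (fun s => x s j) (ξ t j) t := fun j t =>
    (EuclideanSpace.proj (𝕜 := ℝ) j).hasFDerivAt.comp_hasDerivAt t (hx t)
  have hξj : ∀ j t, HasDerivAt (fun s => ξ s j) (F t j) t := fun j t =>
    (EuclideanSpace.proj (𝕜 := ℝ) j).hasFDerivAt.comp_hasDerivAt t (hξ t)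
  set a : Fin d → ℝ → StateSpace d := fun j t =>
    ((x t j : ℝ) : ℂ) • (p t).1 - ((p t).2.1 j + (t : ℂ) • (p t).2.2 j) with ha
  set b : Fin d → ℝ → StateSpace d := fun j t => ((ξ t j : ℝ) : ℂ) • (p t).1 - (p t).2.2 j with hb
  set c : Fin d → ℝ → StateSpace d := fun j t =>
    ((F t j : ℝ) : ℂ) • (p t).1 + P.interGrad ħ T j t (p t).1 with hc
  have had : ∀ j, ∀ t ∈ Icc 0 T, HasDerivAt (a j)
      ((-(Complex.I / (ħ : ℂ))) • P.interPot ħ T t (a j t) + b j t) t := fun j t ht => by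
    refine ((hasDerivAt_coe_smul (hxj j t) (hd1 t)).sub ((hd2 j t).add
      (hasDerivAt_coe_smul (c := fun s => s) (hasDerivAt_id t) (hd3 j t)))).congr_deriv ?_
    rw [clamp_of_mem ht, RCLike.real_smul_eq_coe_smul (K := ℂ)]
    simp only [ha, hb, map_add, map_sub, map_smul, smul_add, smul_sub]
    rw [smul_comm (-(Complex.I / (ħ : ℂ))), smul_comm (-(Complex.I / (ħ : ℂ))) ((t : ℝ) : ℂ)]
    simp
    abel
  have hbd : ∀ j, ∀ t, HasDerivAt (b j)
      ((-(Complex.I / (ħ : ℂ))) • P.interPot ħ T t (b j t) + c j t) t := fun j t => by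
    refine ((hasDerivAt_coe_smul (hξj j t) (hd1 t)).sub (hd3 j t)).congr_deriv ?_
    simp only [hc, hb, map_add, map_sub, map_smul, smul_add, smul_sub]
    rw [smul_comm (-(Complex.I / (ħ : ℂ)))]
    abel
  have hxc : Continuous x := continuous_iff_continuousAt.2 fun t => (hx t).continuousAt
  have hξc : Continuous ξ := continuous_iff_continuousAt.2 fun t => (hξ t).continuousAt
  have hac : ∀ j, Continuous (a j) := fun j => by fun_prop
  have hbc : ∀ j, Continuous (b j) := fun j => by fun_prop
  have hcc : ∀ j, Continuous (c j) := fun j => by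
    have := continuous_op_apply (P.continuous_interGrad ħ T j) continuous_id hpc.fst
    simp only [id] at this
    fun_prop
  have hpos : ∀ t ∈ Icc 0 T, posForm (x t) (P.prop ħ T t u) = ∑ j, ‖a j t‖ₑ ^ 2 := fun t ht => by
    rw [hprop, clamp_of_mem ht, posForm_eq_sum fun j => (hmem t j).1.free (hmem t j).2 t]
    refine Finset.sum_congr rfl fun j _ => ?_
    rw [← ofReal_norm, norm_free_sub, ofReal_norm]
  have hmom : ∀ t, momForm ħ (ξ t) (P.prop ħ T t u) = ∑ j, ‖b j t‖ₑ ^ 2 := fun t => by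
    rw [hprop, momForm_eq_sum fun j => (hmem t j).2.free (clamp T t)]
    refine Finset.sum_congr rfl fun j _ => ?_
    rw [← ofReal_norm, norm_free_sub, ofReal_norm]
  have hforce : ∀ t, ∫⁻ y, ‖F t + P.G t y‖ₑ ^ 2 * ‖P.prop ħ T t u y‖ₑ ^ 2 =
      ∑ j, ‖c j t‖ₑ ^ 2 := fun t => by
    have hG := (P.continuous_G t).measurable
    rw [← sum_enorm_sq_eq_lintegral (m := fun y => F t + P.G t y) (by fun_prop)
      (v := fun j => free d ħ (clamp T t) (c j t)) fun j => ?_]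
    · refine Finset.sum_congr rfl fun j _ => ?_
      rw [← ofReal_norm, norm_free, ofReal_norm]
    · have h1 : free d ħ (clamp T t) (c j t) = ((F t j : ℝ) : ℂ) • P.prop ħ T t u +
          P.gradOp j t (P.prop ħ T t u) := by
        rw [hprop]
        simp only [hc, map_add, map_smul, interGrad, ContinuousLinearMap.comp_apply, free_free_neg]
      rw [h1]
      filter_upwards [Lp.coeFn_add (((F t j : ℝ) : ℂ) • P.prop ħ T t u)
        (P.gradOp j t (P.prop ħ T t u)), Lp.coeFn_smul ((F t j : ℝ) : ℂ) (P.prop ħ T t u),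
        coeFn_mulOp (memLp_top_of_norm_le (P.continuous_coe_G j t).aestronglyMeasurable
          (P.norm_coe_G_le j t)) (P.prop ħ T t u)] with y h1 h2 h3
      rw [h1, Pi.add_apply, h2, Pi.smul_apply, gradOp, h3, smul_eq_mul, PiLp.add_apply]
      push_cast
      ring
  have hcost : ∀ t ∈ Icc 0 T, costForm ħ (x t, ξ t) (P.prop ħ T t u) =
      ENNReal.ofReal (∑ j, (‖a j t‖ ^ 2 / 2 + ‖b j t‖ ^ 2 / 2)) := fun t ht => by
    rw [costForm_eq]
    simp only
    rw [hpos t ht, hmom, sum_enorm_sq_eq_ofReal, sum_enorm_sq_eq_ofReal,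
      ← ENNReal.ofReal_add (by positivity) (by positivity), ← ENNReal.ofReal_mul (by norm_num)]
    congr 1
    rw [Finset.sum_add_distrib, ← Finset.sum_div, ← Finset.sum_div]
    ring
  refine ⟨fun t => ∑ j, (‖a j t‖ ^ 2 / 2 + ‖b j t‖ ^ 2 / 2),
    fun t => ∑ j, (RCLike.re ⟪a j t, b j t⟫_ℂ + RCLike.re ⟪b j t, c j t⟫_ℂ), by fun_prop, ?_,
    fun t ht => ?_, hcost, fun t ht => ?_⟩
  · refine continuous_finsetSum _ fun j _ => ?_
    simp only [RCLike.re_eq_complex_re]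
    fun_prop
  · exact HasDerivAt.fun_sum fun j _ => (P.hasDerivAt_half_norm_sq (had j t ht)).add
      (P.hasDerivAt_half_norm_sq (hbd j t))
  · rw [hcost t ht, hmom, hforce, sum_enorm_sq_eq_ofReal, sum_enorm_sq_eq_ofReal,
      ← ENNReal.ofReal_mul (by norm_num), ← ENNReal.ofReal_mul (by norm_num),
      ← ENNReal.ofReal_add (by positivity) (by positivity),
      ← ENNReal.ofReal_add (by positivity) (by positivity)]
    refine ENNReal.ofReal_le_ofReal ?_
    rw [Finset.mul_sum, Finset.mul_sum, ← Finset.sum_add_distrib, ← Finset.sum_add_distrib]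
    refine Finset.sum_le_sum fun j _ => ?_
    have h1 := re_inner_le (a j t) (b j t)
    have h2 := re_inner_le (b j t) (c j t)
    linarith

/-- The cost along a characteristic satisfies an integral inequality. -/
theorem costForm_prop_le (hħ : ħ ≠ 0) (hT : 0 ≤ T) {x ξ F : ℝ → Pos d}
    (hx : ∀ t, HasDerivAt x (ξ t) t) (hξ : ∀ t, HasDerivAt ξ (F t) t) (hF : Continuous F)
    (u : StateSpace d) {t : ℝ} (ht : t ∈ Icc 0 T) :
    costForm ħ (x t, ξ t) (P.prop ħ T t u) ≤ costForm ħ (x 0, ξ 0) u +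
      ∫⁻ s in Ioc 0 t, (costForm ħ (x s, ξ s) (P.prop ħ T s u) +
        ENNReal.ofReal (1 / 2) * momForm ħ (ξ s) (P.prop ħ T s u) +
        ENNReal.ofReal (1 / 2) * ∫⁻ y, ‖F s + P.G s y‖ₑ ^ 2 * ‖P.prop ħ T s u y‖ₑ ^ 2) := by
  by_cases hu : costForm ħ (x 0, ξ 0) u = ⊤
  · rw [hu, top_add]
    exact le_top
  obtain ⟨g, g', hg, hg', hd, hcost, hle⟩ := P.exists_energy hħ hT hx hξ hF hu
  have h0 : ENNReal.ofReal (g 0) = costForm ħ (x 0, ξ 0) u := by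
    rw [← hcost 0 ⟨le_rfl, hT⟩, P.prop_zero ħ T hT]
  have hint := intervalIntegral.integral_eq_sub_of_hasDerivAt (f := g) (f' := g') (a := 0) (b := t)
    (fun s hs => hd s (by
      rw [uIcc_of_le ht.1] at hs
      exact ⟨hs.1, hs.2.trans ht.2⟩)) (hg'.intervalIntegrable _ _)
  rw [intervalIntegral.integral_of_le ht.1] at hint
  have hgt : g t = g 0 + ∫ s in Ioc 0 t, g' s := by rw [hint]; ring
  rw [hcost t ht, hgt, ← h0]
  refine ENNReal.ofReal_add_le.trans ?_
  gcongr
  refine (ofReal_integral_le_lintegral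
    (hg'.integrableOn_Icc.mono_set Ioc_subset_Icc_self)).trans ?_
  exact setLIntegral_mono' measurableSet_Ioc fun s hs =>
    hle s ⟨hs.1.le, hs.2.trans ht.2⟩

theorem exists_costForm_prop_le (hħ : ħ ≠ 0) (hT : 0 ≤ T) {x ξ F : ℝ → Pos d}
    (hx : ∀ t, HasDerivAt x (ξ t) t) (hξ : ∀ t, HasDerivAt ξ (F t) t) (hF : Continuous F)
    {u : StateSpace d} (hu : costForm ħ (x 0, ξ 0) u ≠ ⊤) :
    ∃ B : ℝ, ∀ t ∈ Icc 0 T, costForm ħ (x t, ξ t) (P.prop ħ T t u) ≤ ENNReal.ofReal B := by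
  obtain ⟨g, g', hg, hg', hd, hcost, hle⟩ := P.exists_energy hħ hT hx hξ hF hu
  obtain ⟨B, hB⟩ := isCompact_Icc.bddAbove_image (f := g) (K := Icc 0 T) hg.continuousOn
  refine ⟨B, fun t ht => ?_⟩
  rw [hcost t ht]
  exact ENNReal.ofReal_le_ofReal (hB ⟨t, ht, rfl⟩)

end TimePotential

/-! ### Position densities -/

theorem tsum_lintegral_mul_enorm_sq (A : Op d) {h : Pos d → ℝ} (hm : Measurable h)
    (h0 : ∀ y, 0 ≤ h y) {C : ℝ} (hC : ∀ y, h y ≤ C) :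
    ∑' i, ∫⁻ y, ENNReal.ofReal (h y) * ‖A (basis d i) y‖ₑ ^ 2 =
      ∑' i, ENNReal.ofReal (RCLike.re ⟪mulOp (fun y => ((√(h y) : ℝ) : ℂ)) (basis d i),
        (A ∘L A.adjoint) (mulOp (fun y => ((√(h y) : ℝ) : ℂ)) (basis d i))⟫_ℂ) := by
  have hmem : MemLp (fun y => ((√(h y) : ℝ) : ℂ)) ⊤ (volume : Measure (Pos d)) := by
    refine memLp_top_of_norm_le (by fun_prop) (C := √C) fun y => ?_
    rw [Complex.norm_real, Real.norm_of_nonneg (Real.sqrt_nonneg _)]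
    exact Real.sqrt_le_sqrt (hC y)
  set M : Op d := mulOp fun y => ((√(h y) : ℝ) : ℂ) with hM
  have hadj : M.adjoint = M := by
    rw [hM, mulOp_adjoint hmem]
    simp
  have h1 : ∀ v : StateSpace d, ∫⁻ y, ENNReal.ofReal (h y) * ‖v y‖ₑ ^ 2 = ‖M v‖ₑ ^ 2 := fun v => by
    rw [enorm_sq_eq_lintegral]
    refine lintegral_congr_ae ?_
    filter_upwards [coeFn_mulOp hmem v] with y hy
    rw [hM, hy, enorm_mul, mul_pow, ← ofReal_norm (((√(h y) : ℝ) : ℂ)), Complex.norm_real,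
      Real.norm_of_nonneg (Real.sqrt_nonneg _), ← ENNReal.ofReal_pow (Real.sqrt_nonneg _),
      Real.sq_sqrt (h0 y)]
  simp_rw [h1]
  have h2 := tsum_enorm_apply_sq_comm (basis d) (M ∘L A)
  simp only [ContinuousLinearMap.adjoint_comp, ContinuousLinearMap.comp_apply, hadj] at h2
  rw [h2]
  refine tsum_congr fun i => ?_
  rw [enorm_sq_adjoint_apply]

theorem measurable_tsum_enorm_sq (A : Op d) :
    Measurable fun y => ∑' i, ‖A (basis d i) y‖ₑ ^ 2 := by
  have : ∀ i, Measurable (A (basis d i)) := fun i => (Lp.stronglyMeasurable _).measurable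
  fun_prop

theorem measurable_positionDensity (R : Op d) : Measurable (positionDensity R) :=
  (measurable_tsum_enorm_sq (opSqrt R)).ennreal_toReal

theorem positionDensity_nonneg (R : Op d) (y : Pos d) : 0 ≤ positionDensity R y :=
  ENNReal.toReal_nonneg

theorem lintegral_mul_tsum (A : Op d) {h : Pos d → ℝ} (hm : Measurable h) :
    ∫⁻ y, ENNReal.ofReal (h y) * ∑' i, ‖A (basis d i) y‖ₑ ^ 2 =
      ∑' i, ∫⁻ y, ENNReal.ofReal (h y) * ‖A (basis d i) y‖ₑ ^ 2 := by
  have : ∀ i, Measurable (A (basis d i)) := fun i => (Lp.stronglyMeasurable _).measurable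
  simp_rw [← ENNReal.tsum_mul_left]
  exact lintegral_tsum fun i => by fun_prop

namespace IsDensityOperator

theorem lintegral_tsum_eq_one {R : Op d} (hR : IsDensityOperator R) :
    ∫⁻ y, ∑' i, ‖opSqrt R (basis d i) y‖ₑ ^ 2 = 1 := by
  have h := lintegral_mul_tsum (opSqrt R) (h := fun _ => 1) measurable_const
  simp only [ENNReal.ofReal_one, one_mul, ← enorm_sq_eq_lintegral] at h
  rw [h, ← posTrace_eq_tsum hR.1, hR.2]

theorem ofReal_positionDensity {R : Op d} (hR : IsDensityOperator R) :
    (fun y => ENNReal.ofReal (positionDensity R y)) =ᵐ[volume]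
      fun y => ∑' i, ‖opSqrt R (basis d i) y‖ₑ ^ 2 := by
  have h := ae_lt_top (measurable_tsum_enorm_sq (opSqrt R))
    (by rw [hR.lintegral_tsum_eq_one]; exact ENNReal.one_ne_top)
  filter_upwards [h] with y hy
  exact ENNReal.ofReal_toReal hy.ne

theorem lintegral_positionDensity {R : Op d} (hR : IsDensityOperator R) :
    ∫⁻ y, ENNReal.ofReal (positionDensity R y) = 1 := by
  rw [lintegral_congr_ae hR.ofReal_positionDensity, hR.lintegral_tsum_eq_one]

theorem integrable_positionDensity {R : Op d} (hR : IsDensityOperator R) :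
    Integrable (positionDensity R) := by
  refine ⟨(measurable_positionDensity R).aestronglyMeasurable, ?_⟩
  rw [hasFiniteIntegral_iff_ofReal (ae_of_all _ (positionDensity_nonneg R)),
    hR.lintegral_positionDensity]
  exact ENNReal.one_lt_top

theorem integral_positionDensity {R : Op d} (hR : IsDensityOperator R) : ∫ y, positionDensity R y = 1 := by
  rw [integral_eq_lintegral_of_nonneg_ae (ae_of_all _ (positionDensity_nonneg R))
    (measurable_positionDensity R).aestronglyMeasurable, hR.lintegral_positionDensity]
  rfl

theorem lintegral_mul_positionDensity {R : Op d} (hR : IsDensityOperator R)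
    {h : Pos d → ℝ} (hm : Measurable h)
    (h0 : ∀ y, 0 ≤ h y) {C : ℝ} (hC : ∀ y, h y ≤ C) :
    ∫⁻ y, ENNReal.ofReal (h y) * ENNReal.ofReal (positionDensity R y) =
      ∑' i, ENNReal.ofReal (RCLike.re ⟪mulOp (fun y => ((√(h y) : ℝ) : ℂ)) (basis d i),
        R (mulOp (fun y => ((√(h y) : ℝ) : ℂ)) (basis d i))⟫_ℂ) := by
  have h1 := tsum_lintegral_mul_enorm_sq (opSqrt R) hm h0 hC
  rw [opSqrt_comp_adjoint hR.1] at h1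
  rw [← h1, ← lintegral_mul_tsum _ hm]
  refine lintegral_congr_ae ?_
  filter_upwards [hR.ofReal_positionDensity] with y hy
  rw [hy]

end IsDensityOperator

/-- A weakly continuous curve of probability densities on `ℝ^d`. -/
structure DensityCurve (d : ℕ) where
  /-- the density at time `t` -/
  ρ : ℝ → Pos d → ℝ
  integrable : ∀ t, Integrable (ρ t)
  nonneg : ∀ t, ∀ᵐ y, 0 ≤ ρ t y
  integral_eq : ∀ t, ∫ y, ρ t y = 1
  continuous : ∀ h : Pos d → ℝ, Continuous h → (∃ C, ∀ y, |h y| ≤ C) →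
    Continuous fun t => ∫ y, h y * ρ t y

theorem integrable_bdd_mul {X : Type*} [MeasurableSpace X] {μ : Measure X} {h ρ : X → ℝ}
    (hρ : Integrable ρ μ) (hh : AEStronglyMeasurable h μ) {C : ℝ} (hC : ∀ y, |h y| ≤ C) :
    Integrable (fun y => h y * ρ y) μ :=
  hρ.bdd_mul hh (ae_of_all _ hC)

/-- The position densities of a weakly continuous curve of density operators. -/
def DensityCurve.ofOperators (R : ℝ → Op d) (hR : ∀ t, IsDensityOperator (R t))
    (hc : ∀ u, Continuous fun t => ⟪u, R t u⟫_ℂ) : DensityCurve d where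
  ρ t := positionDensity (R t)
  integrable t := (hR t).integrable_positionDensity
  nonneg t := ae_of_all _ (positionDensity_nonneg _)
  integral_eq t := (hR t).integral_positionDensity
  continuous := by
    have hint : ∀ h : Pos d → ℝ, Continuous h → ∀ C, (∀ y, |h y| ≤ C) → ∀ t,
        Integrable fun y => h y * positionDensity (R t) y := fun h hh C hC t =>
      integrable_bdd_mul (hR t).integrable_positionDensity hh.aestronglyMeasurable hC
    have hlsc : ∀ h : Pos d → ℝ, Continuous h → (∀ y, 0 ≤ h y) → ∀ C, (∀ y, h y ≤ C) →
        LowerSemicontinuous fun t => ∫ y, h y * positionDensity (R t) y := by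
      intro h hh h0 C hC
      have hnn : ∀ t, 0 ≤ ∫ y, h y * positionDensity (R t) y := fun t =>
        integral_nonneg fun y => mul_nonneg (h0 y) (positionDensity_nonneg _ _)
      have h1 : LowerSemicontinuous fun t =>
          ENNReal.ofReal (∫ y, h y * positionDensity (R t) y) := by
        have h2 : (fun t => ENNReal.ofReal (∫ y, h y * positionDensity (R t) y)) = fun t =>
            ∑' i, ENNReal.ofReal (RCLike.re ⟪mulOp (fun y => ((√(h y) : ℝ) : ℂ)) (basis d i),
              R t (mulOp (fun y => ((√(h y) : ℝ) : ℂ)) (basis d i))⟫_ℂ) := by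
          funext t
          rw [← (hR t).lintegral_mul_positionDensity hh.measurable h0 hC,
            ofReal_integral_eq_lintegral_ofReal
              (hint h hh C (fun y => by rw [abs_of_nonneg (h0 y)]; exact hC y) t)
              (ae_of_all _ fun y => mul_nonneg (h0 y) (positionDensity_nonneg _ _))]
          exact lintegral_congr fun y => ENNReal.ofReal_mul (h0 y)
        rw [h2]
        exact lowerSemicontinuous_tsum fun i => (ENNReal.continuous_ofReal.comp
          (RCLike.continuous_re.comp (hc _))).lowerSemicontinuous
      intro t y hy
      rcases lt_or_ge y 0 with hy0 | hy0
      · exact Eventually.of_forall fun s => hy0.trans_le (hnn s)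
      · filter_upwards [h1 t (ENNReal.ofReal y)
          ((ENNReal.ofReal_lt_ofReal_iff_of_nonneg hy0).2 hy)] with s hs
        exact (ENNReal.ofReal_lt_ofReal_iff_of_nonneg hy0).1 hs
    have hcont : ∀ h : Pos d → ℝ, Continuous h → (∀ y, 0 ≤ h y) → ∀ C, (∀ y, h y ≤ C) →
        Continuous fun t => ∫ y, h y * positionDensity (R t) y := by
      intro h hh h0 C hC
      have h3 : (fun t => ∫ y, (C - h y) * positionDensity (R t) y) = fun t =>
          C - ∫ y, h y * positionDensity (R t) y := by
        funext t
        simp_rw [sub_mul]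
        rw [integral_sub ((hR t).integrable_positionDensity.const_mul C)
          (hint h hh C (fun y => by rw [abs_of_nonneg (h0 y)]; exact hC y) t),
          integral_const_mul, (hR t).integral_positionDensity, mul_one]
      have h4 := hlsc (fun y => C - h y) (by fun_prop) (fun y => sub_nonneg.2 (hC y)) C
        (fun y => sub_le_self _ (h0 y))
      rw [h3] at h4
      refine continuous_iff_lower_upperSemicontinuous.2 ⟨hlsc h hh h0 C hC, fun t y hy => ?_⟩
      filter_upwards [h4 t (C - y) (by simpa using hy)] with s hs
      simpa using hs
    rintro h hh ⟨C, hC⟩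
    have h5 : (fun t => ∫ y, h y * positionDensity (R t) y) = fun t =>
        (∫ y, (h y + C) * positionDensity (R t) y) - C := by
      funext t
      simp_rw [add_mul]
      rw [integral_add (hint h hh C hC t) ((hR t).integrable_positionDensity.const_mul C),
        integral_const_mul, (hR t).integral_positionDensity, mul_one, add_sub_cancel_right]
    rw [h5]
    exact (hcont (fun y => h y + C) (by fun_prop) (fun y => by linarith [(abs_le.1 (hC y)).1])
      (C + C) (fun y => by linarith [(abs_le.1 (hC y)).2])).sub continuous_const

/-! ### Bounded potentials with Lipschitz gradient -/

/-- Bounded `C¹` potentials with bounded, Lipschitz gradient. -/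
structure SmoothPotential (d : ℕ) where
  /-- the potential -/
  V : Pos d → ℝ
  /-- a bound for the potential and its gradient -/
  A : ℝ
  /-- the Lipschitz constant of the gradient -/
  L : ℝ≥0
  contDiff : ContDiff ℝ 1 V
  lipschitz : LipschitzWith L (gradient V)
  abs_le : ∀ y, |V y| ≤ A
  norm_gradient_le : ∀ y, ‖gradient V y‖ ≤ A

theorem taylor_of_lipschitz {V : Pos d → ℝ} (hV : ContDiff ℝ 1 V) {L : ℝ≥0}
    (hL : LipschitzWith L (gradient V)) (y a : Pos d) :
    |V (y + a) - V y - ⟪gradient V y, a⟫_ℝ| ≤ L * ‖a‖ ^ 2 := by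
  have hd : ∀ x, HasGradientAt V (gradient V x) x := fun x =>
    ((hV.differentiable one_ne_zero) x).hasGradientAt
  have h := (convex_closedBall y ‖a‖).norm_image_sub_le_of_norm_hasFDerivWithin_le' (𝕜 := ℝ)
    (f := V) (f' := fun x => InnerProductSpace.toDual ℝ (Pos d) (gradient V x))
    (φ := InnerProductSpace.toDual ℝ (Pos d) (gradient V y)) (C := L * ‖a‖) (x := y) (y := y + a)
    (fun x _ => (hd x).hasFDerivAt.hasFDerivWithinAt) (fun x hx => by
      rw [← map_sub, LinearIsometryEquiv.norm_map]
      refine (hL.norm_sub_le x y).trans ?_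
      gcongr
      rwa [← dist_eq_norm, ← Metric.mem_closedBall]) (by simp) (by simp)
  simpa [sq, mul_assoc] using h

theorem norm_gradient_le_of_bounded {V : Pos d → ℝ} (hV : ContDiff ℝ 1 V) {L : ℝ≥0}
    (hL : LipschitzWith L (gradient V)) {C : ℝ} (hC : ∀ y, |V y| ≤ C) (y : Pos d) :
    ‖gradient V y‖ ≤ 2 * C + L := by
  have hC0 : 0 ≤ C := (abs_nonneg _).trans (hC 0)
  by_cases h0 : gradient V y = 0
  · rw [h0, norm_zero]
    positivity
  have hn : ‖gradient V y‖ ≠ 0 := norm_ne_zero_iff.2 h0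
  set a : Pos d := ‖gradient V y‖⁻¹ • gradient V y with ha
  have ha1 : ‖a‖ = 1 := by
    rw [ha, norm_smul, norm_inv, norm_norm, inv_mul_cancel₀ hn]
  have ha2 : ⟪gradient V y, a⟫_ℝ = ‖gradient V y‖ := by
    rw [ha, inner_smul_right, real_inner_self_eq_norm_sq, sq, ← mul_assoc, inv_mul_cancel₀ hn,
      one_mul]
  have h1 := taylor_of_lipschitz hV hL y a
  rw [ha1, ha2] at h1
  have h2 := abs_le.1 (hC y)
  have h3 := abs_le.1 (hC (y + a))
  have h4 := abs_le.1 h1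
  linarith [h4.1]

/-- Bounded potentials with Lipschitz gradient have bounded gradient. -/
def SmoothPotential.ofBounded {V : Pos d → ℝ} (hV : ContDiff ℝ 1 V) {L : ℝ≥0}
    (hL : LipschitzWith L (gradient V)) {C : ℝ} (hC : ∀ y, |V y| ≤ C) : SmoothPotential d where
  V := V
  A := 2 * C + L
  L := L
  contDiff := hV
  lipschitz := hL
  abs_le y := (hC y).trans (by
    have hC0 : 0 ≤ C := (abs_nonneg _).trans (hC 0)
    linarith [L.coe_nonneg])
  norm_gradient_le := norm_gradient_le_of_bounded hV hL hC

namespace SmoothPotential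

variable (S : SmoothPotential d)

theorem A_nonneg : 0 ≤ S.A := (abs_nonneg _).trans (S.abs_le 0)

theorem continuous_V : Continuous S.V := S.contDiff.continuous

theorem continuous_gradient : Continuous (gradient S.V) := S.lipschitz.continuous

theorem integrable_gradient {ρ : Pos d → ℝ} (hρ : Integrable ρ) (x : Pos d) :
    Integrable fun y => ρ y • gradient S.V (x - y) := by
  have hc := S.continuous_gradient
  refine (hρ.norm.mul_const S.A).mono' (hρ.1.smul (by fun_prop)) (ae_of_all _ fun y => ?_)
  rw [norm_smul]
  exact mul_le_mul_of_nonneg_left (S.norm_gradient_le _) (norm_nonneg _)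

theorem integrable_potential {ρ : Pos d → ℝ} (hρ : Integrable ρ) (x : Pos d) :
    Integrable fun y => S.V (x - y) * ρ y := by
  have hc := S.continuous_V
  exact integrable_bdd_mul hρ (by fun_prop) fun y => S.abs_le (x - y)

variable (D : DensityCurve d)

theorem norm_integral_smul_le {E : Type*} [NormedAddCommGroup E] [NormedSpace ℝ E] (t : ℝ)
    {g : Pos d → E} {B : ℝ} (hB : ∀ y, ‖g y‖ ≤ B) : ‖∫ y, D.ρ t y • g y‖ ≤ B := by
  have h1 : ‖∫ y, D.ρ t y • g y‖ ≤ ∫ y, D.ρ t y * B := by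
    refine norm_integral_le_of_norm_le ((D.integrable t).mul_const B) ?_
    filter_upwards [D.nonneg t] with y hy
    rw [norm_smul, Real.norm_of_nonneg hy]
    exact mul_le_mul_of_nonneg_left (hB y) hy
  rwa [integral_mul_const, D.integral_eq, one_mul] at h1

theorem norm_meanGradient_le (t : ℝ) (x : Pos d) : ‖meanGradient S.V (D.ρ t) x‖ ≤ S.A :=
  norm_integral_smul_le D t fun y => S.norm_gradient_le (x - y)

theorem abs_meanPotential_le (t : ℝ) (x : Pos d) : |meanPotential S.V (D.ρ t) x| ≤ S.A := by
  have := norm_integral_smul_le D t (g := fun y => S.V (x - y)) fun y => S.abs_le (x - y)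
  simp only [smul_eq_mul, mul_comm (D.ρ t _)] at this
  exact this

theorem lipschitz_meanGradient (t : ℝ) : LipschitzWith S.L (meanGradient S.V (D.ρ t)) := by
  refine LipschitzWith.of_dist_le_mul fun x x' => ?_
  rw [dist_eq_norm, dist_eq_norm, meanGradient, meanGradient,
    ← integral_sub (S.integrable_gradient (D.integrable t) x)
      (S.integrable_gradient (D.integrable t) x')]
  simp_rw [← smul_sub]
  refine norm_integral_smul_le D t fun y => ?_
  simpa using S.lipschitz.norm_sub_le (x - y) (x' - y)

theorem continuous_meanPotential (t : ℝ) : Continuous (meanPotential S.V (D.ρ t)) := by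
  have hc := S.continuous_V
  refine continuous_of_dominated (bound := fun y => S.A * |D.ρ t y|)
    (fun x => (S.integrable_potential (D.integrable t) x).1) (fun x => ae_of_all _ fun y => ?_)
    ((D.integrable t).abs.const_mul _) (ae_of_all _ fun y => by fun_prop)
  rw [norm_mul]
  exact mul_le_mul_of_nonneg_right (S.abs_le _) (abs_nonneg _)

theorem continuous_time_meanPotential (x : Pos d) :
    Continuous fun t => meanPotential S.V (D.ρ t) x := by
  have hc := S.continuous_V
  exact D.continuous (fun y => S.V (x - y)) (by fun_prop) ⟨S.A, fun y => S.abs_le _⟩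

theorem continuous_time_meanGradient (x : Pos d) :
    Continuous fun t => meanGradient S.V (D.ρ t) x := by
  have hc := S.continuous_gradient
  have h1 : ∀ j, Continuous fun t => meanGradient S.V (D.ρ t) x j := fun j => by
    have h2 : (fun t => meanGradient S.V (D.ρ t) x j) = fun t =>
        ∫ y, (gradient S.V (x - y) j) * D.ρ t y := by
      funext t
      have := (EuclideanSpace.proj (𝕜 := ℝ) j).integral_comp_comm
        (S.integrable_gradient (D.integrable t) x)
      refine this.symm.trans (integral_congr_ae (ae_of_all _ fun y => ?_))
      exact mul_comm _ _
    rw [h2]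
    exact D.continuous (fun y => gradient S.V (x - y) j) (by fun_prop)
      ⟨S.A, fun y => (PiLp.norm_apply_le _ j).trans (S.norm_gradient_le _)⟩
  exact (PiLp.continuous_toLp 2 fun _ : Fin d => ℝ).comp (continuous_pi h1)

theorem taylor_meanPotential (t : ℝ) (x a : Pos d) :
    |meanPotential S.V (D.ρ t) (x + a) - meanPotential S.V (D.ρ t) x -
      ⟪meanGradient S.V (D.ρ t) x, a⟫_ℝ| ≤ S.L * ‖a‖ ^ 2 := by
  have h1 : ⟪meanGradient S.V (D.ρ t) x, a⟫_ℝ = ∫ y, D.ρ t y * ⟪gradient S.V (x - y), a⟫_ℝ := by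
    rw [real_inner_comm, meanGradient, ← integral_inner (S.integrable_gradient (D.integrable t) x)]
    refine integral_congr_ae (ae_of_all _ fun y => ?_)
    simp only
    rw [inner_smul_right, real_inner_comm]
  have h2 : Integrable fun y => D.ρ t y * ⟪gradient S.V (x - y), a⟫_ℝ := by
    have := (S.integrable_gradient (D.integrable t) x).inner_const (𝕜 := ℝ) a
    simpa only [inner_smul_left, RCLike.conj_to_real] using this
  rw [h1, meanPotential, meanPotential, ← integral_sub
    (S.integrable_potential (D.integrable t) _) (S.integrable_potential (D.integrable t) _),
    ← integral_sub (f := fun y => S.V (x + a - y) * D.ρ t y - S.V (x - y) * D.ρ t y)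
      ((S.integrable_potential (D.integrable t) _).sub
      (S.integrable_potential (D.integrable t) _)) h2]
  have h3 := norm_integral_smul_le D t (g := fun y => S.V (x + a - y) - S.V (x - y) -
    ⟪gradient S.V (x - y), a⟫_ℝ) (B := S.L * ‖a‖ ^ 2) fun y => by
      have := taylor_of_lipschitz S.contDiff S.lipschitz (x - y) a
      rwa [sub_add_eq_add_sub] at this
  refine le_trans (le_of_eq ?_) h3
  rw [Real.norm_eq_abs]
  congr 1
  refine integral_congr_ae (ae_of_all _ fun y => ?_)
  simp only [smul_eq_mul]
  ring

/-- The mean field potential of a curve of densities. -/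
def timePotential : TimePotential d where
  W t := meanPotential S.V (D.ρ t)
  G t := meanGradient S.V (D.ρ t)
  A := S.A
  L := S.L
  continuous_W := S.continuous_meanPotential D
  continuous_G t := (S.lipschitz_meanGradient D t).continuous
  time_W := S.continuous_time_meanPotential D
  time_G := S.continuous_time_meanGradient D
  abs_W_le := S.abs_meanPotential_le D
  norm_G_le := S.norm_meanGradient_le D
  taylor := S.taylor_meanPotential D

end SmoothPotential

/-! ### Curves of operators -/

/-- A curve of contractions which is weakly continuous. -/
def WeaklyContinuous (B : ℝ → Op d) : Prop :=
  (∀ t, ‖B t‖ ≤ 1) ∧ ∀ u v, Continuous fun t => ⟪u, B t v⟫_ℂ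

theorem WeaklyContinuous.norm_apply_le {B : ℝ → Op d} (hB : WeaklyContinuous B) (t : ℝ)
    (u : StateSpace d) : ‖B t u‖ ≤ ‖u‖ := by
  simpa using (B t).le_of_opNorm_le (hB.1 t) u

theorem WeaklyContinuous.norm_inner_le {B : ℝ → Op d} (hB : WeaklyContinuous B) (t : ℝ)
    (u v : StateSpace d) : ‖⟪u, B t v⟫_ℂ‖ ≤ ‖u‖ * ‖v‖ :=
  (norm_inner_le_norm _ _).trans
    (mul_le_mul_of_nonneg_left (hB.norm_apply_le t v) (norm_nonneg _))

theorem WeaklyContinuous.tendsto {B : ℝ → Op d} (hB : WeaklyContinuous B) {X : Type*}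
    {l : Filter X} {s : X → ℝ} {t : ℝ} {u v : X → StateSpace d} {u₀ v₀ : StateSpace d}
    (hs : Tendsto s l (𝓝 t)) (hu : Tendsto u l (𝓝 u₀)) (hv : Tendsto v l (𝓝 v₀)) :
    Tendsto (fun x => ⟪u x, B (s x) (v x)⟫_ℂ) l (𝓝 ⟪u₀, B t v₀⟫_ℂ) := by
  have h1 : Tendsto (fun x => ⟪u₀, B (s x) v₀⟫_ℂ) l (𝓝 ⟪u₀, B t v₀⟫_ℂ) :=
    ((hB.2 u₀ v₀).tendsto t).comp hs
  have h2 : Tendsto (fun x => ⟪u x - u₀, B (s x) (v x)⟫_ℂ) l (𝓝 0) := by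
    have h3 := ((hu.sub_const u₀).norm).mul hv.norm
    rw [sub_self, norm_zero, zero_mul] at h3
    exact squeeze_zero_norm (fun x => hB.norm_inner_le _ _ _) h3
  have h4 : Tendsto (fun x => ⟪u₀, B (s x) (v x - v₀)⟫_ℂ) l (𝓝 0) := by
    have h3 := ((hv.sub_const v₀).norm).const_mul ‖u₀‖
    rw [sub_self, norm_zero, mul_zero] at h3
    exact squeeze_zero_norm (fun x => hB.norm_inner_le _ _ _) h3
  have h5 := (h2.add h4).add h1
  rw [add_zero, zero_add] at h5
  refine h5.congr fun x => ?_
  rw [map_sub, inner_sub_left, inner_sub_right]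
  ring

theorem WeaklyContinuous.continuous {B : ℝ → Op d} (hB : WeaklyContinuous B) {X : Type*}
    [TopologicalSpace X] {s : X → ℝ} {u v : X → StateSpace d} (hs : Continuous s)
    (hu : Continuous u) (hv : Continuous v) : Continuous fun x => ⟪u x, B (s x) (v x)⟫_ℂ :=
  continuous_iff_continuousAt.2 fun x =>
    hB.tendsto (hs.tendsto x) (hu.tendsto x) (hv.tendsto x)

theorem inner_real_smul_left (r : ℝ) (u v : StateSpace d) : ⟪r • u, v⟫_ℂ = r • ⟪u, v⟫_ℂ := by
  rw [RCLike.real_smul_eq_coe_smul (K := ℂ), inner_smul_real_left]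

theorem inner_real_smul_right (r : ℝ) (u v : StateSpace d) : ⟪u, r • v⟫_ℂ = r • ⟪u, v⟫_ℂ := by
  rw [RCLike.real_smul_eq_coe_smul (K := ℂ), inner_smul_real_right]

/-- Product rule for the matrix elements of a weakly continuous curve of operators. -/
theorem WeaklyContinuous.hasDerivAt {B : ℝ → Op d} (hB : WeaklyContinuous B)
    {φ ψ : ℝ → StateSpace d} {φ' ψ' : StateSpace d} {t : ℝ} {k' : ℂ} (hφ : HasDerivAt φ φ' t)
    (hψ : HasDerivAt ψ ψ' t) (hk : HasDerivAt (fun s => ⟪φ t, B s (ψ t)⟫_ℂ) k' t) :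
    HasDerivAt (fun s => ⟪φ s, B s (ψ s)⟫_ℂ) (⟪φ', B t (ψ t)⟫_ℂ + k' + ⟪φ t, B t ψ'⟫_ℂ) t := by
  have hs : Tendsto (fun s : ℝ => s) (𝓝[≠] t) (𝓝 t) := nhdsWithin_le_nhds
  have h1 := hB.tendsto hs (hasDerivAt_iff_tendsto_slope.1 hφ)
    (hψ.continuousAt.tendsto.comp hs)
  have h2 := hB.tendsto hs tendsto_const_nhds (hasDerivAt_iff_tendsto_slope.1 hψ) (u₀ := φ t)
  refine hasDerivAt_iff_tendsto_slope.2
    (((h1.add (hasDerivAt_iff_tendsto_slope.1 hk)).add h2).congr fun s => ?_)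
  simp only [slope_def_module, Function.comp_apply]
  have h4 : B s ((s - t)⁻¹ • (ψ s - ψ t)) = (s - t)⁻¹ • B s (ψ s - ψ t) :=
    (B s).map_smul_of_tower _ _
  rw [h4, inner_real_smul_left, inner_real_smul_right, ← smul_add, ← smul_add, map_sub,
    inner_sub_left, inner_sub_right]
  congr 1
  ring

/-! ### The free evolution on Schwartz functions -/

theorem hasTemperateGrowth_freePhase (ħ t : ℝ) :
    (freePhase (d := d) ħ t).HasTemperateGrowth :=
  ((Function.HasTemperateGrowth.const _).mul (Function.hasTemperateGrowth_norm_sq _)).neg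

/-- The free evolution on Schwartz functions. -/
def freeSchwartz (ħ t : ℝ) (φ : 𝓢(Pos d, ℂ)) : 𝓢(Pos d, ℂ) :=
  𝓕⁻ (SchwartzMap.smulLeftCLM ℂ (fun k => Complex.exp (Complex.I * (freePhase ħ t k : ℂ))) (𝓕 φ))

theorem free_toLp (ħ t : ℝ) (φ : 𝓢(Pos d, ℂ)) :
    free d ħ t (φ.toLp 2) = (freeSchwartz ħ t φ).toLp 2 := by
  apply fourierOp_injective
  rw [fourierOp_free, fourierOp_toLp, fourierOp_toLp,
    toLp_smulLeft (hasTemperateGrowth_freePhase ħ t), freeSchwartz, FourierTransform.fourier_fourierInv_eq]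

/-- The function `φ ↦ (iħ/2) Δφ` on the Fourier side. -/
theorem fourierOp_laplacian (ħ : ℝ) (φ : 𝓢(Pos d, ℂ)) :
    fourierOp d ((ħ / 2 : ℂ) • (Δ φ).toLp 2) =ᵐ[volume]
      fun k => ((freePhase ħ 1 k : ℝ) : ℂ) * fourierOp d (φ.toLp 2) k := by
  have h1 : 𝓕 (Δ φ) = -(2 * Real.pi) ^ 2 • SchwartzMap.smulLeftCLM ℂ (‖·‖ ^ 2) (𝓕 φ) := by
    rw [SchwartzMap.laplacian_eq_fourierMultiplierCLM, SchwartzMap.fourierMultiplierCLM_apply]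
    simp
  rw [map_smul, fourierOp_toLp, fourierOp_toLp]
  filter_upwards [Lp.coeFn_smul (ħ / 2 : ℂ) ((𝓕 (Δ φ)).toLp 2 : StateSpace d),
    (𝓕 (Δ φ)).coeFn_toLp 2, (𝓕 φ).coeFn_toLp 2] with k h2 h3 h4
  rw [h2, Pi.smul_apply, h3, h4, h1, smul_apply, SchwartzMap.smulLeftCLM_apply_apply
    (Function.hasTemperateGrowth_norm_sq _), freePhase]
  simp
  ring

theorem hasDerivAt_free_zero (ħ : ℝ) (φ : 𝓢(Pos d, ℂ)) :
    HasDerivAt (fun s => free d ħ s (φ.toLp 2)) ((Complex.I * ħ / 2) • (Δ φ).toLp 2) 0 := by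
  have hm := measurable_freePhase (d := d) ħ 1
  have h1 := hasDerivAt_expOp hm (fourierOp_laplacian ħ φ)
  have h2 : HasDerivAt (fun s : ℝ => fourierInvOp d (expOp (fun y => s * freePhase ħ 1 y)
      (fourierOp d (φ.toLp 2)))) (fourierInvOp d (Complex.I • fourierOp d
        ((ħ / 2 : ℂ) • (Δ φ).toLp 2))) 0 :=
    ((fourierInvOp d).restrictScalars ℝ).hasFDerivAt.comp_hasDerivAt (0 : ℝ) h1
  have h3 : (fun s => free d ħ s (φ.toLp 2)) = fun s : ℝ =>
      fourierInvOp d (expOp (fun y => s * freePhase ħ 1 y) (fourierOp d (φ.toLp 2))) := by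
    funext s
    rw [free]
    simp only [ContinuousLinearMap.comp_apply]
    congr 3
    funext y
    simp only [freePhase]
    ring
  rw [h3]
  refine h2.congr_deriv ?_
  rw [← map_smul, fourierInvOp_fourierOp, smul_smul]
  congr 1
  ring

theorem hasDerivAt_free (ħ t : ℝ) (φ : 𝓢(Pos d, ℂ)) :
    HasDerivAt (fun s => free d ħ s (φ.toLp 2))
      ((Complex.I * ħ / 2) • (Δ (freeSchwartz ħ t φ)).toLp 2) t := by
  have h4 : HasDerivAt (fun s => free d ħ s ((freeSchwartz ħ t φ).toLp 2))
      ((Complex.I * ħ / 2) • (Δ (freeSchwartz ħ t φ)).toLp 2) (t - t) := by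
    rw [sub_self]
    exact hasDerivAt_free_zero ħ _
  refine (h4.comp_sub_const t t).congr_of_eventuallyEq (Eventually.of_forall fun s => ?_)
  simp only
  rw [← free_toLp, free_add, sub_add_cancel]

/-! ### The Hartree equation as a conjugation by unitary propagators -/

theorem continuous_inner_of_schwartz {B : ℝ → Op d} (hB : ∀ t, ‖B t‖ ≤ 1)
    (h : ∀ φ ψ : 𝓢(Pos d, ℂ), Continuous fun t => ⟪φ.toLp 2, B t (ψ.toLp 2)⟫_ℂ)
    (u v : StateSpace d) : Continuous fun t => ⟪u, B t v⟫_ℂ := by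
  have hB' : ∀ t w, ‖B t w‖ ≤ ‖w‖ := fun t w => by simpa using (B t).le_of_opNorm_le (hB t) w
  refine continuous_of_uniform_approx_of_continuous fun U hU => ?_
  obtain ⟨ε, hε, hU⟩ := Metric.mem_uniformity_dist.1 hU
  set M : ℝ := ‖u‖ + ‖v‖ + 1 with hM
  have hM0 : 0 < M := by positivity
  set δ : ℝ := min 1 (ε / (2 * M)) with hδ
  have hδ0 : 0 < δ := by positivity
  obtain ⟨φ, hφ⟩ := denseRange_toLp.exists_dist_lt u hδ0
  obtain ⟨ψ, hψ⟩ := denseRange_toLp.exists_dist_lt v hδ0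
  refine ⟨_, h φ ψ, fun t => hU ?_⟩
  rw [dist_eq_norm] at hφ hψ ⊢
  set p : StateSpace d := φ.toLp 2
  set q : StateSpace d := ψ.toLp 2
  have h1 : ⟪u, B t v⟫_ℂ - ⟪p, B t q⟫_ℂ = ⟪u - p, B t v⟫_ℂ + ⟪p, B t (v - q)⟫_ℂ := by
    rw [map_sub, inner_sub_left, inner_sub_right]
    ring
  have h2 : ‖p‖ ≤ ‖u‖ + 1 := by
    have h3 : ‖p‖ ≤ ‖u‖ + ‖u - p‖ := by
      have := norm_sub_le u (u - p)
      rwa [sub_sub_cancel] at this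
    linarith [min_le_left 1 (ε / (2 * M))]
  rw [h1]
  refine (norm_add_le _ _).trans_lt ?_
  have h4 : ‖⟪u - p, B t v⟫_ℂ‖ ≤ δ * ‖v‖ := (norm_inner_le_norm _ _).trans
    (mul_le_mul hφ.le (hB' t v) (norm_nonneg _) hδ0.le)
  have h5 : ‖⟪p, B t (v - q)⟫_ℂ‖ ≤ (‖u‖ + 1) * δ := (norm_inner_le_norm _ _).trans
    (mul_le_mul h2 ((hB' t _).trans hψ.le) (norm_nonneg _) (by positivity))
  have h6 : δ * M ≤ ε / 2 := by
    have := mul_le_mul_of_nonneg_right (min_le_right 1 (ε / (2 * M))) hM0.le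
    calc δ * M ≤ ε / (2 * M) * M := this
      _ = ε / 2 := by field_simp
  nlinarith

/-- A density operator solution, with times projected onto `[0, T]`. -/
def clampCurve (R : ℝ → Op d) (T t : ℝ) : Op d := R (clamp T t)

namespace IsHartreeSolution

theorem weaklyContinuous {ħ : ℝ} {V : Pos d → ℝ} {R₀ : Op d} {R : ℝ → Op d}
    (hR : IsHartreeSolution ħ V R₀ R) {T : ℝ} (hT : 0 ≤ T) :
    WeaklyContinuous (clampCurve R T) := by
  have h1 : ∀ t, ‖clampCurve R T t‖ ≤ 1 := fun t => (hR.1 _ (clamp_mem hT t).1).norm_le_one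
  refine ⟨h1, fun u v => continuous_inner_of_schwartz h1 (fun φ ψ => ?_) u v⟩
  have h2 : ContinuousOn (fun s => ⟪φ.toLp 2, R s (ψ.toLp 2)⟫_ℂ) (Ici 0) := fun t ht =>
    (hR.2.2 φ ψ t ht).continuousWithinAt
  exact h2.comp_continuous (continuous_clamp T) fun t => (clamp_mem hT t).1

/-- The position densities of a solution of the Hartree equation. -/
def densityCurve {ħ : ℝ} {V : Pos d → ℝ} {R₀ : Op d} {R : ℝ → Op d}
    (hR : IsHartreeSolution ħ V R₀ R) {T : ℝ} (hT : 0 ≤ T) : DensityCurve d :=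
  DensityCurve.ofOperators (clampCurve R T) (fun t => hR.1 _ (clamp_mem hT t).1)
    fun u => (hR.weaklyContinuous hT).2 u u

end IsHartreeSolution

namespace TimePotential

variable (P : TimePotential d) (ħ : ℝ)

/-- The Hamiltonian at time `t` on Schwartz functions, with values in `L²`. -/
def hamOp (t : ℝ) (φ : 𝓢(Pos d, ℂ)) : StateSpace d :=
  (-((ħ ^ 2 / 2 : ℝ) : ℂ)) • (Δ φ).toLp 2 + P.potOp t (φ.toLp 2)

theorem coeFn_hamOp (t : ℝ) (φ : 𝓢(Pos d, ℂ)) :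
    P.hamOp ħ t φ =ᵐ[volume] hamiltonian ħ (P.W t) φ := by
  filter_upwards [Lp.coeFn_add ((-((ħ ^ 2 / 2 : ℝ) : ℂ)) • ((Δ φ).toLp 2 : StateSpace d))
    (P.potOp t (φ.toLp 2)), Lp.coeFn_smul (-((ħ ^ 2 / 2 : ℝ) : ℂ)) ((Δ φ).toLp 2 : StateSpace d),
    (Δ φ).coeFn_toLp 2, φ.coeFn_toLp 2, coeFn_mulOp (memLp_top_of_norm_le
      (P.continuous_coe_W t).aestronglyMeasurable (P.norm_coe_W_le t)) (φ.toLp 2)]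
    with y h1 h2 h3 h4 h5
  rw [hamOp, h1, Pi.add_apply, h2, Pi.smul_apply, h3, potOp, h5, h4, smul_eq_mul, hamiltonian]

theorem integral_conj_mul_eq_inner {f g : Pos d → ℂ} {u v : StateSpace d} (hf : u =ᵐ[volume] f)
    (hg : v =ᵐ[volume] g) : ∫ y, starRingEnd ℂ (f y) * g y = ⟪u, v⟫_ℂ := by
  rw [L2.inner_def]
  refine integral_congr_ae ?_
  filter_upwards [hf, hg] with y h1 h2
  rw [RCLike.inner_apply, h1, h2, mul_comm]

end TimePotential

/-- The derivative of a matrix element in the interaction picture. -/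
def interRate (P : TimePotential d) (ħ : ℝ) (B : ℝ → Op d) (s : ℝ) (u v : StateSpace d) : ℂ :=
  (Complex.I * (ħ : ℂ))⁻¹ * (⟪P.potOp s (free d ħ s u), B s (free d ħ s v)⟫_ℂ -
    ⟪free d ħ s u, B s (P.potOp s (free d ħ s v))⟫_ℂ)

theorem continuous_interRate (P : TimePotential d) (ħ : ℝ) {B : ℝ → Op d}
    (hB : WeaklyContinuous B) {X : Type*} [TopologicalSpace X] {s : X → ℝ}
    {u v : X → StateSpace d} (hs : Continuous s) (hu : Continuous u) (hv : Continuous v) :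
    Continuous fun x => interRate P ħ B (s x) (u x) (v x) := by
  have h1 := continuous_op_apply (continuous_free ħ) hs hu
  have h2 := continuous_op_apply (continuous_free ħ) hs hv
  have h3 := continuous_op_apply P.continuous_potOp hs h1
  have h4 := continuous_op_apply P.continuous_potOp hs h2
  exact continuous_const.mul ((hB.continuous hs h3 h2).sub (hB.continuous hs h1 h4))

theorem norm_interRate_le (P : TimePotential d) (ħ : ℝ) {B : ℝ → Op d}
    (hB : WeaklyContinuous B) (s : ℝ) (u v : StateSpace d) :
    ‖interRate P ħ B s u v‖ ≤ ‖(Complex.I * (ħ : ℂ))⁻¹‖ * (2 * P.A) * (‖u‖ * ‖v‖) := by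
  have h1 := hB.norm_inner_le s (P.potOp s (free d ħ s u)) (free d ħ s v)
  have h2 := hB.norm_inner_le s (free d ħ s u) (P.potOp s (free d ħ s v))
  have h3 := P.norm_potOp_le s (free d ħ s u)
  have h4 := P.norm_potOp_le s (free d ħ s v)
  rw [norm_free] at h1 h2 h3 h4
  rw [interRate, norm_mul, mul_assoc]
  refine mul_le_mul_of_nonneg_left ?_ (norm_nonneg _)
  have h5 := mul_le_mul_of_nonneg_right h3 (norm_nonneg v)
  have h6 := mul_le_mul_of_nonneg_left h4 (norm_nonneg u)
  refine (norm_sub_le _ _).trans ?_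
  linarith

section Evolution

variable {ħ : ℝ} {P : TimePotential d} {B : ℝ → Op d} {T : ℝ}

theorem integral_interRate (hB : WeaklyContinuous B)
    (h : ∀ φ ψ : 𝓢(Pos d, ℂ), ∀ t ∈ Ioo 0 T,
      HasDerivAt (fun s => ⟪free d ħ s (φ.toLp 2), B s (free d ħ s (ψ.toLp 2))⟫_ℂ)
        (interRate P ħ B t (φ.toLp 2) (ψ.toLp 2)) t) {t : ℝ} (ht : t ∈ Icc 0 T)
    (u v : StateSpace d) :
    ∫ s in (0 : ℝ)..t, interRate P ħ B s u v =
      ⟪free d ħ t u, B t (free d ħ t v)⟫_ℂ - ⟪free d ħ 0 u, B 0 (free d ħ 0 v)⟫_ℂ := by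
  have hcont : ∀ t : ℝ, Continuous fun p : StateSpace d × StateSpace d =>
      ⟪free d ħ t p.1, B t (free d ħ t p.2)⟫_ℂ := fun t =>
    hB.continuous continuous_const ((free d ħ t).continuous.comp continuous_fst)
      ((free d ħ t).continuous.comp continuous_snd)
  have hdense : DenseRange (Prod.map (fun φ : 𝓢(Pos d, ℂ) => (φ.toLp 2 : StateSpace d))
      fun φ : 𝓢(Pos d, ℂ) => (φ.toLp 2 : StateSpace d)) :=
    denseRange_toLp.prodMap denseRange_toLp
  have hint : Continuous fun p : StateSpace d × StateSpace d =>
      ∫ s in (0 : ℝ)..t, interRate P ħ B s p.1 p.2 := by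
    refine continuous_iff_continuousAt.2 fun p => ?_
    refine intervalIntegral.continuousAt_of_dominated_interval (bound := fun _ =>
      ‖(Complex.I * (ħ : ℂ))⁻¹‖ * (2 * P.A) * (‖p.1‖ * ‖p.2‖ + 1))
      (Eventually.of_forall fun q => (continuous_interRate P ħ hB continuous_id continuous_const
        continuous_const).aestronglyMeasurable) ?_ (intervalIntegrable_const)
      (ae_of_all _ fun s _ => (continuous_interRate P ħ hB continuous_const continuous_fst
        continuous_snd).continuousAt)
    have hn : ∀ᶠ q : StateSpace d × StateSpace d in 𝓝 p, ‖q.1‖ * ‖q.2‖ < ‖p.1‖ * ‖p.2‖ + 1 :=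
      (continuous_fst.norm.mul continuous_snd.norm).continuousAt.eventually_lt_const
        (lt_add_one _)
    filter_upwards [hn] with q hq
    refine ae_of_all _ fun s _ => (norm_interRate_le P ħ hB s _ _).trans ?_
    have := P.A_nonneg
    gcongr
  have key := hdense.equalizer hint ((hcont t).sub (hcont 0)) (funext fun p => ?_)
  · exact congrFun key (u, v)
  · exact intervalIntegral.integral_eq_sub_of_hasDerivAt_of_le ht.1
      (hB.continuous continuous_id (continuous_free_apply ħ _)
        (continuous_free_apply ħ _)).continuousOn
      (fun s hs => h p.1 p.2 s ⟨hs.1, hs.2.trans_le ht.2⟩)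
      (Continuous.intervalIntegrable (continuous_interRate P ħ hB continuous_id continuous_const
        continuous_const) _ _)

theorem inner_prop_const (hħ : ħ ≠ 0) (hB : WeaklyContinuous B)
    (h : ∀ φ ψ : 𝓢(Pos d, ℂ), ∀ t ∈ Ioo 0 T,
      HasDerivAt (fun s => ⟪free d ħ s (φ.toLp 2), B s (free d ħ s (ψ.toLp 2))⟫_ℂ)
        (interRate P ħ B t (φ.toLp 2) (ψ.toLp 2)) t) {t : ℝ} (ht : t ∈ Icc 0 T)
    (u v : StateSpace d) :
    ⟪P.prop ħ T t u, B t (P.prop ħ T t v)⟫_ℂ = ⟪u, B 0 v⟫_ℂ := by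
  have hħ' : (ħ : ℂ) ≠ 0 := by exact_mod_cast hħ
  set B' : ℝ → Op d := fun s => free d ħ (-s) ∘L B s ∘L free d ħ s with hB'def
  have hB'i : ∀ s u v, ⟪u, B' s v⟫_ℂ = ⟪free d ħ s u, B s (free d ħ s v)⟫_ℂ := fun s u v => by
    rw [inner_free_left]
    rfl
  have hB' : WeaklyContinuous B' := by
    refine ⟨fun s => ContinuousLinearMap.opNorm_le_bound _ zero_le_one fun u => ?_, fun u v => ?_⟩
    · simp only [hB'def, ContinuousLinearMap.comp_apply]
      rw [norm_free, one_mul]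
      exact (hB.norm_apply_le _ _).trans (norm_free _ _ _).le
    · simp_rw [hB'i]
      exact hB.continuous continuous_id (continuous_free_apply ħ _) (continuous_free_apply ħ _)
  have hderiv : ∀ s ∈ Ioo 0 T, ∀ u v,
      HasDerivAt (fun r => ⟪u, B' r v⟫_ℂ) (interRate P ħ B s u v) s := fun s hs u v => by
    have hc : Continuous fun r => interRate P ħ B r u v :=
      continuous_interRate P ħ hB continuous_id continuous_const continuous_const
    have h1 := (intervalIntegral.integral_hasDerivAt_right (hc.intervalIntegrable 0 s)
      (hc.stronglyMeasurableAtFilter _ _) hc.continuousAt).add_const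
        ⟪free d ħ 0 u, B 0 (free d ħ 0 v)⟫_ℂ
    refine h1.congr_of_eventuallyEq ?_
    filter_upwards [Ioo_mem_nhds hs.1 hs.2] with r hr
    rw [integral_interRate hB h ⟨hr.1.le, hr.2.le⟩, hB'i, sub_add_cancel]
  have hzero : ∀ s ∈ Ioo 0 T, HasDerivAt
      (fun r => ⟪P.interProp ħ T 0 r u, B' r (P.interProp ħ T 0 r v)⟫_ℂ) 0 s := fun s hs => by
    refine (hB'.hasDerivAt (P.hasDerivAt_interProp ħ T 0 s u) (P.hasDerivAt_interProp ħ T 0 s v)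
      (hderiv s hs _ _)).congr_deriv ?_
    have hpot : ∀ w, free d ħ s (P.interPot ħ T s w) = P.potOp s (free d ħ s w) := fun w => by
      rw [TimePotential.interPot, clamp_of_mem ⟨hs.1.le, hs.2.le⟩]
      simp only [ContinuousLinearMap.comp_apply, free_free_neg]
    rw [map_smul, inner_smul_left, inner_smul_right, hB'i, hB'i, hpot, hpot, interRate]
    simp only [map_neg, map_div₀, Complex.conj_I, Complex.conj_ofReal, mul_inv, Complex.inv_I]
    field_simp
    ring
  have hconst := intervalIntegral.integral_eq_sub_of_hasDerivAt_of_le (f' := fun _ => (0 : ℂ)) ht.1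
    (f := fun r => ⟪P.interProp ħ T 0 r u, B' r (P.interProp ħ T 0 r v)⟫_ℂ)
    (hB'.continuous continuous_id
      (continuous_op_apply (P.continuous_interProp ħ T 0) continuous_id continuous_const)
      (continuous_op_apply (P.continuous_interProp ħ T 0) continuous_id
        continuous_const)).continuousOn
    (fun s hs => hzero s ⟨hs.1, hs.2.trans_le ht.2⟩) intervalIntegrable_const
  rw [intervalIntegral.integral_zero, eq_comm, sub_eq_zero, P.interProp_self, P.interProp_self,
    hB'i, hB'i, free_zero, free_zero] at hconst
  rw [P.prop_apply, P.prop_apply, clamp_of_mem ht]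
  exact hconst

end Evolution

namespace TimePotential

variable (P : TimePotential d) (ħ T : ℝ)

theorem prop_comp_adjoint (t : ℝ) :
    P.prop ħ T t ∘L (P.prop ħ T t).adjoint = ContinuousLinearMap.id ℂ _ := by
  ext1 u
  set w := P.interProp ħ T t 0 (free d ħ (-clamp T t) u)
  have h1 : P.prop ħ T t w = u := by
    rw [prop_apply, interProp_interProp, interProp_self, free_free_neg]
  have h2 := DFunLike.congr_fun (P.adjoint_prop_comp ħ T t) w
  rw [ContinuousLinearMap.comp_apply, h1] at h2
  rw [ContinuousLinearMap.comp_apply, h2]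
  exact h1

end TimePotential

namespace IsHartreeSolution

theorem inner_kinetic_cancel {ħ : ℝ} (hħ : ħ ≠ 0) (A : Op d) (a b p q u v : StateSpace d) :
    ⟪(Complex.I * ħ / 2) • a, A v⟫_ℂ +
      (Complex.I * (ħ : ℂ))⁻¹ * (⟪(-((ħ ^ 2 / 2 : ℝ) : ℂ)) • a + p, A v⟫_ℂ -
        ⟪u, A ((-((ħ ^ 2 / 2 : ℝ) : ℂ)) • b + q)⟫_ℂ) + ⟪u, A ((Complex.I * ħ / 2) • b)⟫_ℂ =
      (Complex.I * (ħ : ℂ))⁻¹ * (⟪p, A v⟫_ℂ - ⟪u, A q⟫_ℂ) := by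
  have hħ' : (ħ : ℂ) ≠ 0 := by exact_mod_cast hħ
  simp only [map_add, map_smul, inner_add_left, inner_add_right, inner_smul_left, inner_smul_right]
  simp only [map_neg, map_div₀, map_mul, Complex.conj_I, Complex.conj_ofReal, mul_inv,
    Complex.inv_I, map_ofNat]
  push_cast
  field_simp
  ring

theorem adjoint_eq {ħ : ℝ} {V : Pos d → ℝ} {R₀ : Op d} {R : ℝ → Op d}
    (hR : IsHartreeSolution ħ V R₀ R) {t : ℝ} (ht : 0 ≤ t) : (R t).adjoint = R t :=
  (hR.1 t ht).1.isSelfAdjoint.adjoint_eq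

theorem hasDerivAt_inner {ħ : ℝ} {V : Pos d → ℝ} {R₀ : Op d} {R : ℝ → Op d}
    (hR : IsHartreeSolution ħ V R₀ R) {T : ℝ} {P : TimePotential d}
    {t : ℝ} (ht : t ∈ Ioo 0 T) (hW : P.W t = meanPotential V (positionDensity (R t)))
    (φ ψ : 𝓢(Pos d, ℂ)) :
    HasDerivAt (fun s => ⟪φ.toLp 2, clampCurve R T s (ψ.toLp 2)⟫_ℂ)
      ((Complex.I * (ħ : ℂ))⁻¹ * (⟪P.hamOp ħ t φ, R t (ψ.toLp 2)⟫_ℂ -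
        ⟪φ.toLp 2, R t (P.hamOp ħ t ψ)⟫_ℂ)) t := by
  have h2 := (hR.2.2 φ ψ t ht.1.le).hasDerivAt (Ici_mem_nhds ht.1)
  rw [← hW, TimePotential.integral_conj_mul_eq_inner (P.coeFn_hamOp ħ t _) ae_eq_rfl,
    TimePotential.integral_conj_mul_eq_inner ae_eq_rfl (P.coeFn_hamOp ħ t _)] at h2
  rw [← ContinuousLinearMap.adjoint_inner_left (R t) (P.hamOp ħ t ψ), hR.adjoint_eq ht.1.le]
  refine h2.congr_of_eventuallyEq ?_
  filter_upwards [Ioo_mem_nhds ht.1 ht.2] with s hs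
  rw [clampCurve, clamp_of_mem ⟨hs.1.le, hs.2.le⟩]

theorem hasDerivAt_inner_free {ħ : ℝ} {V : Pos d → ℝ} {R₀ : Op d} {R : ℝ → Op d}
    (hħ : ħ ≠ 0) (hR : IsHartreeSolution ħ V R₀ R) {T : ℝ} (hT : 0 ≤ T) {P : TimePotential d}
    {t : ℝ} (ht : t ∈ Ioo 0 T) (hW : P.W t = meanPotential V (positionDensity (R t)))
    (φ ψ : 𝓢(Pos d, ℂ)) :
    HasDerivAt (fun s => ⟪free d ħ s (φ.toLp 2),
      clampCurve R T s (free d ħ s (ψ.toLp 2))⟫_ℂ)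
      (interRate P ħ (clampCurve R T) t (φ.toLp 2) (ψ.toLp 2)) t := by
  have hc : clampCurve R T t = R t := congrArg R (clamp_of_mem ⟨ht.1.le, ht.2.le⟩)
  have h1 := hR.hasDerivAt_inner ht hW (freeSchwartz ħ t φ) (freeSchwartz ħ t ψ)
  rw [← free_toLp, ← free_toLp] at h1
  refine ((hR.weaklyContinuous hT).hasDerivAt (hasDerivAt_free ħ t φ) (hasDerivAt_free ħ t ψ)
    h1).congr_deriv ?_
  rw [interRate, hc, TimePotential.hamOp, TimePotential.hamOp, inner_kinetic_cancel hħ,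
    ← free_toLp, ← free_toLp]

/-- Solutions of the Hartree equation are conjugate to their initial data. -/
theorem eq_conj {ħ : ℝ} {R₀ : Op d} {R : ℝ → Op d} {S : SmoothPotential d}
    (hħ : ħ ≠ 0) (hR : IsHartreeSolution ħ S.V R₀ R) {T : ℝ} (hT : 0 ≤ T) {t : ℝ} (ht : t ∈ Icc 0 T) :
    R t = (S.timePotential (hR.densityCurve hT)).prop ħ T t ∘L R₀ ∘L
      ((S.timePotential (hR.densityCurve hT)).prop ħ T t).adjoint := by
  set P := S.timePotential (hR.densityCurve hT)
  set U := P.prop ħ T t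
  have hW : ∀ s ∈ Ioo 0 T, P.W s = meanPotential S.V (positionDensity (R s)) := fun s hs => by
    change meanPotential S.V (positionDensity (R (clamp T s))) = _
    rw [clamp_of_mem ⟨hs.1.le, hs.2.le⟩]
  have h1 : U.adjoint ∘L R t ∘L U = R₀ := by
    ext1 v
    refine ext_inner_left ℂ fun u => ?_
    have h2 := inner_prop_const hħ (hR.weaklyContinuous hT)
      (fun φ ψ s hs => hR.hasDerivAt_inner_free hħ hT (P := P) hs (hW s hs) φ ψ) ht u v
    rw [clampCurve, clampCurve, clamp_of_mem ht, clamp_of_mem ⟨le_rfl, hT⟩, hR.2.1] at h2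
    rw [← h2, ContinuousLinearMap.comp_apply, ContinuousLinearMap.adjoint_inner_right]
    rfl
  have h3 := P.prop_comp_adjoint ħ T t
  rw [← h1]
  ext1 u
  have h4 := fun w => DFunLike.congr_fun h3 w
  simp only [ContinuousLinearMap.comp_apply, ContinuousLinearMap.id_apply] at h4 ⊢
  rw [h4, h4]

end IsHartreeSolution

/-! ### More on flows -/

namespace LipschitzField

variable {E : Type*} [NormedAddCommGroup E] [NormedSpace ℝ E] [CompleteSpace E]
  (X : LipschitzField E)

theorem continuous_flow_prod (s : ℝ) : Continuous fun p : ℝ × E => X.flow s p.1 p.2 := by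
  refine continuous_iff_continuousAt.2 fun q => tendsto_iff_norm_sub_tendsto_zero.2 ?_
  have h1 : Tendsto (fun p : ℝ × E => Real.exp (X.K * |p.1 - s|) * ‖p.2 - q.2‖ +
      ‖X.flow s p.1 q.2 - X.flow s q.1 q.2‖) (𝓝 q) (𝓝 (Real.exp (X.K * |q.1 - s|) *
        ‖q.2 - q.2‖ + ‖X.flow s q.1 q.2 - X.flow s q.1 q.2‖)) := by
    have := X.continuous_flow_right s q.2
    have hc : Continuous fun p : ℝ × E => Real.exp (X.K * |p.1 - s|) * ‖p.2 - q.2‖ +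
      ‖X.flow s p.1 q.2 - X.flow s q.1 q.2‖ := by fun_prop
    exact hc.tendsto q
  simp only [sub_self, norm_zero, mul_zero, add_zero] at h1
  refine squeeze_zero (fun _ => norm_nonneg _) (fun p => ?_) h1
  have h2 := norm_add_le (X.flow s p.1 p.2 - X.flow s p.1 q.2)
    (X.flow s p.1 q.2 - X.flow s q.1 q.2)
  rw [sub_add_sub_cancel] at h2
  exact h2.trans (add_le_add_left (X.norm_flow_sub_le _ _ _ _) _)

theorem continuous_flow_left (t : ℝ) : Continuous fun p : ℝ × E => X.flow p.1 t p.2 := by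
  refine continuous_iff_continuousAt.2 fun q => tendsto_iff_norm_sub_tendsto_zero.2 ?_
  have h1 : Tendsto (fun p : ℝ × E => Real.exp (X.K * |t - p.1|) *
      ‖p.2 - X.flow t p.1 (X.flow q.1 t q.2)‖) (𝓝 q) (𝓝 (Real.exp (X.K * |t - q.1|) *
      ‖q.2 - X.flow t q.1 (X.flow q.1 t q.2)‖)) := by
    have := X.continuous_flow_right t (X.flow q.1 t q.2)
    have hc : Continuous fun p : ℝ × E => Real.exp (X.K * |t - p.1|) *
      ‖p.2 - X.flow t p.1 (X.flow q.1 t q.2)‖ := by fun_prop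
    exact hc.tendsto q
  rw [X.flow_flow, X.flow_self, sub_self, norm_zero, mul_zero] at h1
  refine squeeze_zero (fun _ => norm_nonneg _) (fun p => ?_) h1
  have h2 := X.norm_flow_sub_le p.1 t p.2 (X.flow t p.1 (X.flow q.1 t q.2))
  rwa [X.flow_flow, X.flow_self] at h2

theorem continuous_flow_joint {Y : Type*} [TopologicalSpace Y] {s t : Y → ℝ} {z : Y → E}
    (hs : Continuous s) (ht : Continuous t) (hz : Continuous z) :
    Continuous fun y => X.flow (s y) (t y) (z y) := by
  have h1 : Continuous fun y => X.flow (s y) 0 (z y) :=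
    (X.continuous_flow_left 0).comp (hs.prodMk hz)
  have h2 := (X.continuous_flow_prod 0).comp (ht.prodMk h1)
  refine h2.congr fun y => ?_
  simp only [Function.comp_apply]
  rw [X.flow_flow]

theorem norm_flow_sub_sub_le (s t : ℝ) (a b : E) :
    ‖X.flow s t a - X.flow s t b - (a - b)‖ ≤
      X.K * |t - s| * Real.exp (X.K * |t - s|) * ‖a - b‖ := by
  have h := (convex_uIcc s t).norm_image_sub_le_of_norm_hasDerivWithin_le
    (f := fun r => X.flow s r a - X.flow s r b)
    (f' := fun r => X.toFun r (X.flow s r a) - X.toFun r (X.flow s r b))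
    (C := X.K * (Real.exp (X.K * |t - s|) * ‖a - b‖)) (x := s) (y := t)
    (fun r _ => ((X.hasDerivAt_flow s r a).sub (X.hasDerivAt_flow s r b)).hasDerivWithinAt)
    (fun r hr => by
      refine ((X.lipschitz r).norm_sub_le _ _).trans (mul_le_mul_of_nonneg_left ?_ X.K.2)
      refine (X.norm_flow_sub_le s r a b).trans (mul_le_mul_of_nonneg_right ?_ (norm_nonneg _))
      refine Real.exp_le_exp.2 (mul_le_mul_of_nonneg_left ?_ X.K.2)
      exact abs_sub_left_of_mem_uIcc hr) left_mem_uIcc right_mem_uIcc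
  simp only [X.flow_self, Real.norm_eq_abs] at h
  refine h.trans (le_of_eq (by ring))

end LipschitzField

/-! ### Mollification -/

section Mollify

variable {E : Type*} [NormedAddCommGroup E] [NormedSpace ℝ E] [FiniteDimensional ℝ E]
  [MeasureSpace E] [BorelSpace E] [(volume : Measure E).IsAddHaarMeasure]

/-- The convolution of a function with a normalized bump function. -/
def mollify (η : ContDiffBump (0 : E)) (g : E → ℝ) (x : E) : ℝ :=
  ∫ t, η.normed volume t * g (x - t)

theorem mollify_eq_convolution (η : ContDiffBump (0 : E)) (g : E → ℝ) :
    mollify η g = MeasureTheory.convolution (η.normed volume) g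
      (ContinuousLinearMap.lsmul ℝ ℝ) volume := rfl

theorem contDiff_mollify (η : ContDiffBump (0 : E)) {g : E → ℝ} (hg : Continuous g) :
    ContDiff ℝ ∞ (mollify η g) := by
  rw [mollify_eq_convolution]
  exact HasCompactSupport.contDiff_convolution_left _ η.hasCompactSupport_normed
    η.contDiff_normed hg.locallyIntegrable

theorem hasCompactSupport_mollify (η : ContDiffBump (0 : E)) {g : E → ℝ}
    (hg : HasCompactSupport g) : HasCompactSupport (mollify η g) := by
  rw [mollify_eq_convolution]
  exact HasCompactSupport.convolution _ η.hasCompactSupport_normed hg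

theorem abs_mollify_sub_mollify_le (η : ContDiffBump (0 : E)) {g g' : E → ℝ} (hg : Continuous g)
    (hg' : Continuous g') {x y : E} {ε : ℝ}
    (h : ∀ t, ‖t‖ ≤ η.rOut → |g (x - t) - g' (y - t)| ≤ ε) :
    |mollify η g x - mollify η g' y| ≤ ε := by
  have hη := η.continuous_normed (μ := volume)
  have hi : ∀ g : E → ℝ, Continuous g → ∀ x, Integrable fun t => η.normed volume t * g (x - t) :=
    fun g hg x => Continuous.integrable_of_hasCompactSupport (by fun_prop)
      (η.hasCompactSupport_normed.mul_right)
  rw [mollify, mollify, ← integral_sub (hi g hg x) (hi g' hg' y)]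
  have h1 : ∫ t, η.normed volume t * ε = ε := by
    rw [integral_mul_const, η.integral_normed, one_mul]
  rw [← h1, ← Real.norm_eq_abs]
  refine norm_integral_le_of_norm_le (η.integrable_normed.mul_const ε) (ae_of_all _ fun t => ?_)
  rw [← mul_sub, norm_mul, Real.norm_of_nonneg (η.nonneg_normed t)]
  by_cases ht : t ∈ Metric.ball (0 : E) η.rOut
  · refine mul_le_mul_of_nonneg_left (h t ?_) (η.nonneg_normed t)
    simpa using (Metric.mem_ball.1 ht).le
  · rw [← η.support_normed_eq (μ := volume), Function.notMem_support] at ht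
    rw [ht, zero_mul, zero_mul]

theorem abs_mollify_sub_le (η : ContDiffBump (0 : E)) {g : E → ℝ} (hg : Continuous g) {x : E}
    {ε : ℝ} (h : ∀ t, ‖t‖ ≤ η.rOut → |g (x - t) - g x| ≤ ε) : |mollify η g x - g x| ≤ ε := by
  have h1 : mollify η (fun _ => g x) x = g x := by
    rw [mollify, integral_mul_const, η.integral_normed, one_mul]
  have h2 := abs_mollify_sub_mollify_le η hg (continuous_const (y := g x)) (x := x) (y := x) h
  rwa [h1] at h2

theorem continuous_mollify (η : ContDiffBump (0 : E)) {u : ℝ → E → ℝ}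
    (hu : Continuous fun p : ℝ × E => u p.1 p.2) :
    Continuous fun p : ℝ × E => mollify η (u p.1) p.2 := by
  have hη := η.continuous_normed (μ := volume)
  have h1 : ∀ p : ℝ × E, mollify η (u p.1) p.2 =
      ∫ t in Metric.closedBall 0 η.rOut, η.normed volume t * u p.1 (p.2 - t) := fun p => by
    rw [mollify, setIntegral_eq_integral_of_forall_compl_eq_zero]
    intro t ht
    rw [← η.tsupport_normed_eq (μ := volume)] at ht
    rw [image_eq_zero_of_notMem_tsupport ht, zero_mul]
  simp_rw [h1]
  refine continuous_parametric_integral_of_continuous ?_ (isCompact_closedBall _ _)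
  have h2 : Continuous fun q : (ℝ × E) × E => u q.1.1 (q.1.2 - q.2) :=
    hu.comp (f := fun q : (ℝ × E) × E => (q.1.1, q.1.2 - q.2)) (by fun_prop)
  exact (hη.comp continuous_snd).mul h2

theorem exists_bump {δ : ℝ} (hδ : 0 < δ) : ∃ η : ContDiffBump (0 : E), η.rOut = δ :=
  ⟨⟨δ / 2, δ, half_pos hδ, half_lt_self hδ⟩, rfl⟩

/-- Smooth uniform approximation of compactly supported continuous functions. -/
theorem exists_smooth_approx {g : E → ℝ} (hg : Continuous g) (hc : HasCompactSupport g) {ε : ℝ}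
    (hε : 0 < ε) :
    ∃ φ : E → ℝ, ContDiff ℝ ∞ φ ∧ HasCompactSupport φ ∧ ∀ z, |φ z - g z| ≤ ε := by
  obtain ⟨δ, hδ, h⟩ := Metric.uniformContinuous_iff.1 (hc.uniformContinuous_of_continuous hg)
    ε hε
  obtain ⟨η, hη⟩ := exists_bump (E := E) (half_pos hδ)
  refine ⟨mollify η g, contDiff_mollify η hg, hasCompactSupport_mollify η hc, fun z =>
    abs_mollify_sub_le η hg fun t ht => ?_⟩
  refine (h (a := z - t) (b := z) ?_).le
  rw [dist_eq_norm]
  simp only [sub_sub_cancel_left, norm_neg]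
  linarith

end Mollify

/-! ### Vaguely continuous curves of probability measures -/

section Vague

variable {E : Type*} [NormedAddCommGroup E] [NormedSpace ℝ E] [FiniteDimensional ℝ E]
  [MeasureSpace E] [BorelSpace E] [(volume : Measure E).IsAddHaarMeasure]
  {μ : ℝ → Measure E} [∀ t, IsProbabilityMeasure (μ t)]

theorem integrable_of_abs_le {ν : Measure E} [IsFiniteMeasure ν] {g : E → ℝ} (hg : Continuous g)
    {C : ℝ} (hC : ∀ z, |g z| ≤ C) : Integrable g ν :=
  (integrable_const C).mono' hg.aestronglyMeasurable (ae_of_all _ hC)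

theorem abs_integral_sub_le {ν : Measure E} [IsProbabilityMeasure ν] {g g' : E → ℝ}
    (hg : Integrable g ν) (hg' : Integrable g' ν) {ε : ℝ} (h : ∀ z, |g z - g' z| ≤ ε) :
    |∫ z, g z ∂ν - ∫ z, g' z ∂ν| ≤ ε := by
  rw [← integral_sub hg hg', ← Real.norm_eq_abs]
  refine (norm_integral_le_of_norm_le (integrable_const ε) (ae_of_all _ h)).trans ?_
  simp

theorem integrable_of_compact {ν : Measure E} [IsFiniteMeasure ν] {g : E → ℝ} (hg : Continuous g)
    (hc : HasCompactSupport g) : Integrable g ν :=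
  hg.integrable_of_hasCompactSupport hc

theorem continuous_integral_of_compact
    (h : ∀ φ : E → ℝ, ContDiff ℝ ∞ φ → HasCompactSupport φ → Continuous fun t => ∫ z, φ z ∂μ t)
    {g : E → ℝ} (hg : Continuous g) (hc : HasCompactSupport g) :
    Continuous fun t => ∫ z, g z ∂μ t := by
  refine continuous_of_uniform_approx_of_continuous fun U hU => ?_
  obtain ⟨ε, hε, hU⟩ := Metric.mem_uniformity_dist.1 hU
  obtain ⟨φ, hφ, hφc, hφg⟩ := exists_smooth_approx hg hc (half_pos hε)
  refine ⟨_, h φ hφ hφc, fun t => hU ?_⟩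
  rw [dist_comm, Real.dist_eq]
  exact (abs_integral_sub_le (integrable_of_compact hφ.continuous hφc)
    (integrable_of_compact hg hc) hφg).trans_lt (half_lt_self hε)

/-- A continuous cutoff function. -/
def cutoff (n : ℕ) (z : E) : ℝ := max 0 (min 1 (n + 1 - ‖z‖))

theorem continuous_cutoff (n : ℕ) : Continuous (cutoff (E := E) n) := by
  unfold cutoff
  fun_prop

theorem cutoff_nonneg (n : ℕ) (z : E) : 0 ≤ cutoff n z := le_max_left _ _

theorem cutoff_le_one (n : ℕ) (z : E) : cutoff n z ≤ 1 := max_le zero_le_one (min_le_left _ _)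

theorem cutoff_eq_one {n : ℕ} {z : E} (h : ‖z‖ ≤ n) : cutoff n z = 1 := by
  rw [cutoff, min_eq_left (by linarith), max_eq_right zero_le_one]

theorem hasCompactSupport_cutoff (n : ℕ) : HasCompactSupport (cutoff (E := E) n) := by
  refine HasCompactSupport.intro (isCompact_closedBall (0 : E) (n + 1)) fun z hz => ?_
  rw [Metric.mem_closedBall, dist_zero_right, not_le] at hz
  rw [cutoff, max_eq_left]
  exact (min_le_right _ _).trans (by linarith)

theorem lowerSemicontinuous_integral
    (h : ∀ φ : E → ℝ, Continuous φ → HasCompactSupport φ → Continuous fun t => ∫ z, φ z ∂μ t)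
    {g : E → ℝ} (hg : Continuous g) (h0 : ∀ z, 0 ≤ g z) {C : ℝ} (hC : ∀ z, g z ≤ C) :
    LowerSemicontinuous fun t => ∫ z, g z ∂μ t := by
  have habs : ∀ z, |g z| ≤ C := fun z => by rw [abs_of_nonneg (h0 z)]; exact hC z
  intro t y hy
  have h1 : Tendsto (fun n : ℕ => ∫ z, g z * cutoff n z ∂μ t) atTop (𝓝 (∫ z, g z ∂μ t)) := by
    refine tendsto_integral_of_dominated_convergence (fun _ => C) (fun n =>
      (hg.mul (continuous_cutoff n)).aestronglyMeasurable) (integrable_const C)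
      (fun n => ae_of_all _ fun z => ?_) (ae_of_all _ fun z => ?_)
    · rw [norm_mul, Real.norm_of_nonneg (h0 z), Real.norm_of_nonneg (cutoff_nonneg n z)]
      exact (mul_le_of_le_one_right (h0 z) (cutoff_le_one n z)).trans (hC z)
    · obtain ⟨n, hn⟩ := exists_nat_ge ‖z‖
      refine tendsto_const_nhds.congr' ?_
      filter_upwards [eventually_ge_atTop n] with m hm
      rw [cutoff_eq_one (hn.trans (by exact_mod_cast hm)), mul_one]
  obtain ⟨n, hn⟩ := (h1.eventually_const_lt hy).exists
  have h2 := h (fun z => g z * cutoff n z) (hg.mul (continuous_cutoff n))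
    (hasCompactSupport_cutoff n).mul_left
  filter_upwards [(h2.tendsto t).eventually_const_lt hn] with s hs
  refine hs.trans_le (integral_mono (integrable_of_compact (hg.mul (continuous_cutoff n))
    (hasCompactSupport_cutoff n).mul_left) (integrable_of_abs_le hg habs) fun z => ?_)
  exact mul_le_of_le_one_right (h0 z) (cutoff_le_one n z)

theorem continuous_integral_of_bounded
    (h : ∀ φ : E → ℝ, Continuous φ → HasCompactSupport φ → Continuous fun t => ∫ z, φ z ∂μ t)
    {g : E → ℝ} (hg : Continuous g) {C : ℝ} (hC : ∀ z, |g z| ≤ C) :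
    Continuous fun t => ∫ z, g z ∂μ t := by
  have hi : ∀ t, Integrable g (μ t) := fun t => integrable_of_abs_le hg hC
  have h1 := lowerSemicontinuous_integral h (g := fun z => g z + C) (by fun_prop)
    (fun z => by linarith [(abs_le.1 (hC z)).1]) (C := C + C)
    (fun z => by linarith [(abs_le.1 (hC z)).2])
  have h2 := lowerSemicontinuous_integral h (g := fun z => C - g z) (by fun_prop)
    (fun z => by linarith [(abs_le.1 (hC z)).2]) (C := C + C)
    (fun z => by linarith [(abs_le.1 (hC z)).1])
  have e1 : ∀ t, ∫ z, (g z + C) ∂μ t = ∫ z, g z ∂μ t + C := fun t => by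
    rw [integral_add (hi t) (integrable_const C)]
    simp
  have e2 : ∀ t, ∫ z, (C - g z) ∂μ t = C - ∫ z, g z ∂μ t := fun t => by
    rw [integral_sub (integrable_const C) (hi t)]
    simp
  simp only [e1] at h1
  simp only [e2] at h2
  refine continuous_iff_lower_upperSemicontinuous.2 ⟨fun t y hy => ?_, fun t y hy => ?_⟩
  · filter_upwards [h1 t (y + C) (by simpa using hy)] with s hs
    simpa using hs
  · filter_upwards [h2 t (C - y) (by simpa using hy)] with s hs
    simpa using hs

/-- Continuity of the integrals of a time-dependent, uniformly compactly supported function. -/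
theorem tendsto_integral_of_compact
    (h : ∀ φ : E → ℝ, Continuous φ → HasCompactSupport φ → Continuous fun t => ∫ z, φ z ∂μ t)
    {G : ℝ → E → ℝ} (hG : Continuous fun p : ℝ × E => G p.1 p.2) {K : Set E} (hK : IsCompact K)
    {s : ℝ} (h0 : ∀ᶠ t in 𝓝 s, ∀ z ∉ K, G t z = 0) :
    Tendsto (fun t => ∫ z, G t z ∂μ t) (𝓝 s) (𝓝 (∫ z, G s z ∂μ s)) := by
  have hGt : ∀ t, Continuous (G t) := fun t => hG.comp (f := fun z => (t, z)) (by fun_prop)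
  have hs0 : ∀ z ∉ K, G s z = 0 := h0.self_of_nhds
  have h1 := (h (G s) (hGt s) (HasCompactSupport.intro hK hs0)).tendsto s
  have h2 : Tendsto (fun t => ∫ z, G t z ∂μ t - ∫ z, G s z ∂μ t) (𝓝 s) (𝓝 0) := by
    rw [Metric.tendsto_nhds]
    intro ε hε
    obtain ⟨v, hv, hvK⟩ := hK.mem_uniformity_of_prod (f := G) (s := univ) (q := s)
      (u := {p | dist p.1 p.2 < ε / 2}) (by rw [univ_prod]; exact hG.continuousOn) (mem_univ s)
      (Metric.dist_mem_uniformity (half_pos hε))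
    rw [nhdsWithin_univ] at hv
    filter_upwards [h0, hv] with t ht htv
    rw [Real.dist_eq, sub_zero]
    refine (abs_integral_sub_le (integrable_of_compact (hGt t) (HasCompactSupport.intro hK ht))
      (integrable_of_compact (hGt s) (HasCompactSupport.intro hK hs0)) fun z => ?_).trans_lt
      (half_lt_self hε)
    by_cases hz : z ∈ K
    · exact (hvK t htv z hz).le
    · rw [ht z hz, hs0 z hz, sub_self, abs_zero]
      exact (half_pos hε).le
  have h3 := h2.add h1
  simpa using h3

end Vague

/-! ### Uniqueness for the continuity equation -/

namespace LipschitzField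

variable {E : Type*} [NormedAddCommGroup E] [NormedSpace ℝ E] [FiniteDimensional ℝ E]
  [MeasureSpace E] [BorelSpace E] [(volume : Measure E).IsAddHaarMeasure]
  (X : LipschitzField E) {μ : ℝ → Measure E} [∀ t, IsProbabilityMeasure (μ t)] {T : ℝ}

/-- The mean over a trajectory between the times `s` and `σ` of the derivative of `ψ` along the
field. -/
def meanDeriv (ψ : E → ℝ) (s σ : ℝ) (z : E) : ℝ :=
  ∫ τ in (0 : ℝ)..1, fderiv ℝ ψ (X.flow σ (s + (σ - s) * τ) z)
    (X.toFun (s + (σ - s) * τ) (X.flow σ (s + (σ - s) * τ) z))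

theorem meanDeriv_self (ψ : E → ℝ) (s : ℝ) (z : E) :
    X.meanDeriv ψ s s z = fderiv ℝ ψ z (X.toFun s z) := by
  simp [meanDeriv, X.flow_self]

theorem continuous_fderiv_field {ψ : E → ℝ} (hψ : ContDiff ℝ ∞ ψ) {Y : Type*} [TopologicalSpace Y]
    {r : Y → ℝ} {w : Y → E} (hr : Continuous r) (hw : Continuous w) :
    Continuous fun y => fderiv ℝ ψ (w y) (X.toFun (r y) (w y)) := by
  have h1 := (hψ.continuous_fderiv (by simp)).comp hw
  have h2 := X.continuous_uncurry.comp (hr.prodMk hw)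
  exact h1.clm_apply h2

theorem continuous_meanDeriv {ψ : E → ℝ} (hψ : ContDiff ℝ ∞ ψ) (s : ℝ) :
    Continuous fun p : ℝ × E => X.meanDeriv ψ s p.1 p.2 := by
  refine intervalIntegral.continuous_parametric_intervalIntegral_of_continuous'
    (f := fun (p : ℝ × E) (τ : ℝ) => fderiv ℝ ψ (X.flow p.1 (s + (p.1 - s) * τ) p.2)
      (X.toFun (s + (p.1 - s) * τ) (X.flow p.1 (s + (p.1 - s) * τ) p.2))) ?_ 0 1
  refine X.continuous_fderiv_field hψ (by fun_prop)
    (X.continuous_flow_joint (by fun_prop) (by fun_prop) (by fun_prop))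

theorem sub_comp_flow {ψ : E → ℝ} (hψ : ContDiff ℝ ∞ ψ) (s σ : ℝ) (z : E) :
    ψ z - ψ (X.flow σ s z) = (σ - s) * X.meanDeriv ψ s σ z := by
  have h1 : ∀ r ∈ uIcc s σ, HasDerivAt (fun r => ψ (X.flow σ r z))
      (fderiv ℝ ψ (X.flow σ r z) (X.toFun r (X.flow σ r z))) r := fun r _ =>
    ((hψ.differentiable (by simp)) _).hasFDerivAt.comp_hasDerivAt r (X.hasDerivAt_flow σ r z)
  have hc : Continuous fun r => fderiv ℝ ψ (X.flow σ r z) (X.toFun r (X.flow σ r z)) :=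
    X.continuous_fderiv_field (r := fun r => r) hψ continuous_id (X.continuous_flow_right σ z)
  have h2 := intervalIntegral.integral_eq_sub_of_hasDerivAt h1 (hc.intervalIntegrable s σ)
  rw [X.flow_self] at h2
  rw [← h2, meanDeriv, ← smul_eq_mul, intervalIntegral.smul_integral_comp_add_mul (a := 0) (b := 1)
    (fun r => fderiv ℝ ψ (X.flow σ r z) (X.toFun r (X.flow σ r z)))]
  simp

theorem exists_compact_meanDeriv {ψ : E → ℝ} (hψc : HasCompactSupport ψ) (s : ℝ) :
    ∃ K : Set E, IsCompact K ∧ ∀ᶠ σ in 𝓝 s, ∀ z ∉ K, X.meanDeriv ψ s σ z = 0 := by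
  refine ⟨(fun p : (ℝ × ℝ) × E => X.flow p.1.1 p.1.2 p.2) ''
    ((Icc (s - 1) (s + 1) ×ˢ Icc (s - 1) (s + 1)) ×ˢ tsupport ψ),
    ((isCompact_Icc.prod isCompact_Icc).prod hψc).image
      (X.continuous_flow_joint (by fun_prop) (by fun_prop) (by fun_prop)), ?_⟩
  filter_upwards [Icc_mem_nhds (sub_one_lt s) (lt_add_one s)] with σ hσ z hz
  refine (intervalIntegral.integral_congr (g := fun _ => (0 : ℝ)) fun τ hτ => ?_).trans
    intervalIntegral.integral_zero
  rw [uIcc_of_le zero_le_one] at hτ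
  have hr : s + (σ - s) * τ ∈ Icc (s - 1) (s + 1) := by
    have h1 : |(σ - s) * τ| ≤ 1 := by
      rw [abs_mul]
      have h2 : |σ - s| ≤ 1 := abs_le.2 ⟨by linarith [hσ.1], by linarith [hσ.2]⟩
      have h3 : |τ| ≤ 1 := abs_le.2 ⟨by linarith [hτ.1], hτ.2⟩
      exact mul_le_one₀ h2 (abs_nonneg _) h3
    constructor <;> linarith [(abs_le.1 h1).1, (abs_le.1 h1).2]
  have h0 : fderiv ℝ ψ (X.flow σ (s + (σ - s) * τ) z) = 0 := by
    refine image_eq_zero_of_notMem_tsupport fun hm => hz ?_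
    refine ⟨((s + (σ - s) * τ, σ), X.flow σ (s + (σ - s) * τ) z),
      ⟨⟨hr, hσ⟩, tsupport_fderiv_subset ℝ hm⟩, ?_⟩
    simp only [X.flow_flow, X.flow_self]
  simp only [h0, zero_apply]

theorem hasDerivWithinAt_integral_comp_flow
    (hv : ∀ φ : E → ℝ, Continuous φ → HasCompactSupport φ → Continuous fun t => ∫ z, φ z ∂μ t)
    {ψ : E → ℝ} (hψ : ContDiff ℝ ∞ ψ) (hψc : HasCompactSupport ψ) {s : ℝ}
    (hw : HasDerivWithinAt (fun σ => ∫ z, ψ z ∂μ σ) (∫ z, fderiv ℝ ψ z (X.toFun s z) ∂μ s)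
      (Ici s) s) :
    HasDerivWithinAt (fun σ => ∫ z, ψ (X.flow σ s z) ∂μ σ) 0 (Ici s) s := by
  obtain ⟨K, hK, h0⟩ := X.exists_compact_meanDeriv hψc s
  have hG := tendsto_integral_of_compact hv (X.continuous_meanDeriv hψ s) hK h0
  simp only [X.meanDeriv_self] at hG
  have h1 : HasDerivAt (fun σ => (σ - s) * ∫ z, X.meanDeriv ψ s σ z ∂μ σ)
      (∫ z, fderiv ℝ ψ z (X.toFun s z) ∂μ s) s := by
    rw [hasDerivAt_iff_tendsto_slope]
    refine (hG.mono_left nhdsWithin_le_nhds).congr' ?_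
    filter_upwards [self_mem_nhdsWithin] with σ hσ
    have : σ - s ≠ 0 := sub_ne_zero.2 hσ
    rw [slope_def_field, sub_self, zero_mul, sub_zero, mul_div_cancel_left₀ _ this]
  have h2 := hw.sub h1.hasDerivWithinAt
  rw [sub_self] at h2
  have he : ∀ᶠ σ in 𝓝 s, ∫ z, ψ (X.flow σ s z) ∂μ σ =
      ∫ z, ψ z ∂μ σ - (σ - s) * ∫ z, X.meanDeriv ψ s σ z ∂μ σ := by
    filter_upwards [h0] with σ hσ
    have hm : Integrable (X.meanDeriv ψ s σ) (μ σ) := integrable_of_compact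
      ((X.continuous_meanDeriv hψ s).comp (f := fun z => (σ, z)) (by fun_prop))
      (HasCompactSupport.intro hK hσ)
    rw [← integral_const_mul, ← integral_sub (integrable_of_compact hψ.continuous hψc)
      (hm.const_mul _)]
    refine integral_congr_ae (ae_of_all _ fun z => ?_)
    have := X.sub_comp_flow hψ s σ z
    simp only
    linarith
  exact h2.congr_of_eventuallyEq (he.filter_mono nhdsWithin_le_nhds) he.self_of_nhds

section Dual

variable {φ : E → ℝ} {M : ℝ≥0}

theorem abs_comp_flow_sub_le (hφ : LipschitzWith M φ) {s : ℝ} (hs : s ∈ Icc 0 T) (x y : E) :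
    |φ (X.flow s T x) - φ (X.flow s T y)| ≤ M * Real.exp (X.K * T) * ‖x - y‖ := by
  rw [← Real.norm_eq_abs, mul_assoc]
  refine (hφ.norm_sub_le _ _).trans (mul_le_mul_of_nonneg_left
    ((X.norm_flow_sub_le s T x y).trans (mul_le_mul_of_nonneg_right
      (Real.exp_le_exp.2 (mul_le_mul_of_nonneg_left ?_ X.K.2)) (norm_nonneg _))) M.2)
  rw [abs_of_nonneg (by linarith [hs.2])]
  linarith [hs.1]

theorem abs_mollify_comp_flow_sub_le (hφ : LipschitzWith M φ) (η : ContDiffBump (0 : E))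
    {s : ℝ} (hs : s ∈ Icc 0 T) (σ : ℝ) (z : E) :
    |mollify η (fun x => φ (X.flow σ T x)) z -
      mollify η (fun x => φ (X.flow s T x)) (X.flow σ s z)| ≤
      M * Real.exp (X.K * T) * (X.K * |σ - s| * Real.exp (X.K * |σ - s|) * η.rOut) := by
  refine abs_mollify_sub_mollify_le η (hφ.continuous.comp (X.continuous_flow _ _))
    (hφ.continuous.comp (X.continuous_flow _ _)) fun t ht => ?_
  have h1 := X.abs_comp_flow_sub_le hφ hs (X.flow σ s (z - t)) (X.flow σ s z - t)
  rw [X.flow_flow] at h1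
  refine h1.trans (mul_le_mul_of_nonneg_left ?_ (by positivity))
  have h2 := X.norm_flow_sub_sub_le σ s (z - t) z
  rw [sub_sub_cancel_left, norm_neg, abs_sub_comm s σ] at h2
  have h3 : X.flow σ s (z - t) - (X.flow σ s z - t) = X.flow σ s (z - t) - X.flow σ s z - -t := by
    abel
  rw [h3]
  exact h2.trans (mul_le_mul_of_nonneg_left ht (by positivity))

theorem continuous_integral_mollify_comp_flow
    (hv : ∀ φ : E → ℝ, Continuous φ → HasCompactSupport φ → Continuous fun t => ∫ z, φ z ∂μ t)
    (hφ : Continuous φ) (hφc : HasCompactSupport φ) (η : ContDiffBump (0 : E)) :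
    Continuous fun s => ∫ z, mollify η (fun x => φ (X.flow s T x)) z ∂μ s := by
  have hu : Continuous fun p : ℝ × E => φ (X.flow p.1 T p.2) :=
    hφ.comp (X.continuous_flow_joint (by fun_prop) (by fun_prop) (by fun_prop))
  refine continuous_iff_continuousAt.2 fun s => ?_
  have hK : IsCompact ((fun p : (ℝ × E) × E => X.flow T p.1.1 p.1.2 + p.2) ''
      ((Icc (s - 1) (s + 1) ×ˢ tsupport φ) ×ˢ Metric.closedBall (0 : E) η.rOut)) := by
    refine ((isCompact_Icc.prod hφc).prod (isCompact_closedBall _ _)).image ?_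
    exact (X.continuous_flow_joint (by fun_prop) (by fun_prop) (by fun_prop)).add continuous_snd
  refine tendsto_integral_of_compact hv
    (continuous_mollify η (u := fun s x => φ (X.flow s T x)) hu) hK ?_
  filter_upwards [Icc_mem_nhds (sub_one_lt s) (lt_add_one s)] with σ hσ z hz
  have h0 : mollify η (fun _ : E => (0 : ℝ)) z = 0 := by simp [mollify]
  have h1 := abs_mollify_sub_mollify_le η (g := fun x => φ (X.flow σ T x)) (g' := fun _ => 0)
    (hφ.comp (X.continuous_flow _ _)) continuous_const (x := z) (y := z) (ε := 0) fun t ht => ?_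
  · rw [h0, sub_zero] at h1
    exact abs_nonpos_iff.1 h1
  · rw [sub_zero, image_eq_zero_of_notMem_tsupport (f := φ) (x := X.flow σ T (z - t)), abs_zero]
    intro hm
    refine hz ⟨((σ, X.flow σ T (z - t)), t), ⟨⟨hσ, hm⟩, by simpa using ht⟩, ?_⟩
    simp only [X.flow_flow, X.flow_self, sub_add_cancel]

theorem hasCompactSupport_comp_flow (hφc : HasCompactSupport φ) (s : ℝ) :
    HasCompactSupport fun x => φ (X.flow s T x) := by
  refine HasCompactSupport.intro ((hφc : IsCompact _).image (X.continuous_flow T s)) fun z hz => ?_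
  refine image_eq_zero_of_notMem_tsupport fun hm => hz ⟨_, hm, ?_⟩
  rw [X.flow_flow, X.flow_self]

theorem integral_mollify_le
    (hv : ∀ φ : E → ℝ, Continuous φ → HasCompactSupport φ → Continuous fun t => ∫ z, φ z ∂μ t)
    (hw : ∀ ψ : E → ℝ, ContDiff ℝ ∞ ψ → HasCompactSupport ψ → ∀ s ∈ Ico 0 T,
      HasDerivWithinAt (fun σ => ∫ z, ψ z ∂μ σ) (∫ z, fderiv ℝ ψ z (X.toFun s z) ∂μ s) (Ici s) s)
    (hT : 0 ≤ T) (hφ : LipschitzWith M φ) (hφc : HasCompactSupport φ) (η : ContDiffBump (0 : E)) :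
    ∫ z, mollify η (fun x => φ (X.flow T T x)) z ∂μ T ≤
      ∫ z, mollify η (fun x => φ (X.flow 0 T x)) z ∂μ 0 +
        M * Real.exp (X.K * T) * (X.K * η.rOut) * T := by
  set H : ℝ → ℝ := fun s => ∫ z, mollify η (fun x => φ (X.flow s T x)) z ∂μ s with hH
  set c : ℝ := M * Real.exp (X.K * T) * (X.K * η.rOut) with hc
  have hcontH : Continuous H := X.continuous_integral_mollify_comp_flow hv hφ.continuous hφc η
  have hB : ∀ x : ℝ, HasDerivAt (fun x => H 0 + c * x) c x := fun x => by
    simpa using ((hasDerivAt_id x).const_mul c).const_add (H 0)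
  refine image_le_of_liminf_slope_right_le_deriv_boundary (f := H) (a := 0) (b := T)
    hcontH.continuousOn (B := fun x => H 0 + c * x) (B' := fun _ => c) (by simp)
    (by fun_prop) (fun x _ => (hB x).hasDerivWithinAt) ?_ ⟨hT, le_rfl⟩
  intro s hs r hr
  have hsT : s ∈ Icc 0 T := ⟨hs.1, hs.2.le⟩
  have hcont : ∀ σ, Continuous fun x => φ (X.flow σ T x) := fun σ =>
    hφ.continuous.comp (X.continuous_flow _ _)
  set ψ : E → ℝ := mollify η (fun x => φ (X.flow s T x)) with hψ
  have hψs : ContDiff ℝ ∞ ψ := contDiff_mollify η (hcont s)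
  have hψc : HasCompactSupport ψ := hasCompactSupport_mollify η (X.hasCompactSupport_comp_flow hφc s)
  have h1 := X.hasDerivWithinAt_integral_comp_flow hv hψs hψc (hw ψ hψs hψc s hs)
  rw [hasDerivWithinAt_iff_tendsto_slope, Ici_sdiff_left] at h1
  have h2 : Tendsto (fun σ => M * Real.exp (X.K * T) *
      (X.K * Real.exp (X.K * |σ - s|) * η.rOut)) (𝓝[>] s) (𝓝 c) := by
    have h3 : Continuous fun σ => M * Real.exp (X.K * T) *
      (X.K * Real.exp (X.K * |σ - s|) * η.rOut) := by fun_prop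
    have h4 := (h3.tendsto s).mono_left (nhdsWithin_le_nhds (s := Ioi s))
    simpa [hc] using h4
  have h5 := h1.add h2
  rw [zero_add] at h5
  refine Eventually.frequently ?_
  filter_upwards [h5.eventually_lt_const hr, self_mem_nhdsWithin] with σ hσ hσs
  refine lt_of_le_of_lt ?_ hσ
  have hpos : 0 < σ - s := sub_pos.2 hσs
  rw [slope_def_field, slope_def_field, div_add' _ _ _ hpos.ne']
  refine div_le_div_of_nonneg_right ?_ hpos.le
  have h6 := abs_integral_sub_le (ν := μ σ)
    (integrable_of_compact (contDiff_mollify η (hcont σ)).continuous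
      (hasCompactSupport_mollify η (X.hasCompactSupport_comp_flow hφc σ)))
    (integrable_of_compact (hψs.continuous.comp (X.continuous_flow σ s))
      (X.hasCompactSupport_comp_flow hψc σ)) (X.abs_mollify_comp_flow_sub_le hφ η hsT σ)
  rw [abs_of_pos hpos] at h6 ⊢
  have h7 := (abs_le.1 h6).2
  simp only [X.flow_self]
  simp only [hH, Function.comp_apply] at h7 ⊢
  rw [← hψ]
  linarith

theorem integral_le_integral_comp_flow
    (hv : ∀ φ : E → ℝ, Continuous φ → HasCompactSupport φ → Continuous fun t => ∫ z, φ z ∂μ t)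
    (hw : ∀ ψ : E → ℝ, ContDiff ℝ ∞ ψ → HasCompactSupport ψ → ∀ s ∈ Ico 0 T,
      HasDerivWithinAt (fun σ => ∫ z, ψ z ∂μ σ) (∫ z, fderiv ℝ ψ z (X.toFun s z) ∂μ s) (Ici s) s)
    (hT : 0 ≤ T) (hφ : LipschitzWith M φ) (hφc : HasCompactSupport φ) :
    ∫ z, φ z ∂μ T ≤ ∫ z, φ (X.flow 0 T z) ∂μ 0 := by
  have key : ∀ δ > 0, ∫ z, φ z ∂μ T ≤ ∫ z, φ (X.flow 0 T z) ∂μ 0 +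
      M * Real.exp (X.K * T) * (2 + X.K * T) * δ := by
    intro δ hδ
    obtain ⟨η, hη⟩ := exists_bump (E := E) hδ
    have h1 := X.integral_mollify_le hv hw hT hφ hφc η
    have h2 : ∀ s ∈ Icc 0 T, |∫ z, mollify η (fun x => φ (X.flow s T x)) z ∂μ s -
        ∫ z, φ (X.flow s T z) ∂μ s| ≤ M * Real.exp (X.K * T) * δ := fun s hs => by
      have hcont : Continuous fun x => φ (X.flow s T x) :=
        hφ.continuous.comp (X.continuous_flow _ _)
      have hcs := X.hasCompactSupport_comp_flow (T := T) hφc s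
      refine abs_integral_sub_le (integrable_of_compact (contDiff_mollify η hcont).continuous
        (hasCompactSupport_mollify η hcs)) (integrable_of_compact hcont hcs) fun z =>
        abs_mollify_sub_le η hcont fun t ht => ?_
      refine (X.abs_comp_flow_sub_le hφ hs _ _).trans
        (mul_le_mul_of_nonneg_left ?_ (by positivity))
      rw [sub_sub_cancel_left, norm_neg, ← hη]
      exact ht
    have h3 := (abs_le.1 (h2 T ⟨hT, le_rfl⟩)).1
    have h4 := (abs_le.1 (h2 0 ⟨le_rfl, hT⟩)).2
    rw [hη] at h1
    simp only [X.flow_self] at h1 h3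
    linarith
  have hlim : Tendsto (fun n : ℕ => ∫ z, φ (X.flow 0 T z) ∂μ 0 +
      M * Real.exp (X.K * T) * (2 + X.K * T) * (1 / ((n : ℝ) + 1))) atTop
      (𝓝 (∫ z, φ (X.flow 0 T z) ∂μ 0)) := by
    have h1 := ((tendsto_one_div_add_atTop_nhds_zero_nat (𝕜 := ℝ)).const_mul
      (M * Real.exp (X.K * T) * (2 + X.K * T))).const_add (∫ z, φ (X.flow 0 T z) ∂μ 0)
    rwa [mul_zero, add_zero] at h1
  exact ge_of_tendsto' hlim fun n => key _ (by positivity)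

end Dual

/-- Vaguely continuous weak solutions of the continuity equation are transported by the flow. -/
theorem eq_map_flow
    (hv : ∀ φ : E → ℝ, Continuous φ → HasCompactSupport φ → Continuous fun t => ∫ z, φ z ∂μ t)
    (hw : ∀ ψ : E → ℝ, ContDiff ℝ ∞ ψ → HasCompactSupport ψ → ∀ s ∈ Ico 0 T,
      HasDerivWithinAt (fun σ => ∫ z, ψ z ∂μ σ) (∫ z, fderiv ℝ ψ z (X.toFun s z) ∂μ s) (Ici s) s)
    (hT : 0 ≤ T) : μ T = (μ 0).map (X.flow 0 T) := by
  have hm := (X.continuous_flow 0 T).measurable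
  have := Measure.isProbabilityMeasure_map (μ := μ 0) hm.aemeasurable
  have hsm : ∀ φ : E → ℝ, ContDiff ℝ ∞ φ → HasCompactSupport φ →
      ∫ z, φ z ∂μ T = ∫ z, φ (X.flow 0 T z) ∂μ 0 := fun φ hφ hφc => by
    obtain ⟨M, hM⟩ := (hφ.of_le (by simp) : ContDiff ℝ 1 φ).lipschitzWith_of_hasCompactSupport hφc
      (by simp)
    have h1 := X.integral_le_integral_comp_flow hv hw hT hM hφc
    have h2 := X.integral_le_integral_comp_flow hv hw hT hM.neg
      (hφc.comp_left (g := fun x => -x) neg_zero)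
    simp only [Pi.neg_apply, integral_neg] at h2
    linarith
  refine Measure.ext_of_integral_eq_on_compactlySupported fun g => ?_
  have hg : Continuous g := map_continuous g
  have hgc : HasCompactSupport g := g.hasCompactSupport
  rw [integral_map hm.aemeasurable hg.aestronglyMeasurable]
  refine eq_of_forall_dist_le fun ε hε => ?_
  obtain ⟨φ, hφ, hφc, hφg⟩ := exists_smooth_approx hg hgc (half_pos hε)
  have h1 := abs_integral_sub_le (ν := μ T) (integrable_of_compact hφ.continuous hφc)
    (integrable_of_compact hg hgc) hφg
  have h2 := abs_integral_sub_le (ν := μ 0)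
    (integrable_of_compact (hφ.continuous.comp (X.continuous_flow 0 T))
      (X.hasCompactSupport_comp_flow hφc 0))
    (integrable_of_compact (hg.comp (X.continuous_flow 0 T)) (X.hasCompactSupport_comp_flow hgc 0))
    (fun z => hφg (X.flow 0 T z))
  simp only [Function.comp_apply] at h2
  rw [← hsm φ hφ hφc] at h2
  rw [Real.dist_eq, abs_le]
  rw [abs_le] at h1 h2
  constructor <;> linarith [h1.1, h1.2, h2.1, h2.2]

end LipschitzField

/-! ### The Vlasov equation: representation by characteristics -/

instance : (volume : Measure (Phase d)).IsAddHaarMeasure :=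
  inferInstanceAs ((volume : Measure (Pos d)).prod (volume : Measure (Pos d))).IsAddHaarMeasure

theorem IsProbDensity.integral_densityMeasure {p : Phase d → ℝ} (hp : IsProbDensity p)
    (φ : Phase d → ℝ) : ∫ z, φ z ∂densityMeasure p = ∫ z, φ z * p z := by
  rw [densityMeasure, integral_withDensity_eq_integral_toReal_smul₀
    hp.1.1.aemeasurable.ennreal_ofReal (ae_of_all _ fun _ => ENNReal.ofReal_lt_top)]
  refine integral_congr_ae ?_
  filter_upwards [hp.2.1] with z hz
  rw [ENNReal.toReal_ofReal hz, smul_eq_mul, mul_comm]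

theorem IsProbDensity.integrable_spatialDensity {p : Phase d → ℝ} (hp : IsProbDensity p) :
    Integrable (spatialDensity p) :=
  Integrable.integral_prod_left (μ := (volume : Measure (Pos d))) (ν := volume) hp.1

theorem IsProbDensity.spatialDensity_nonneg {p : Phase d → ℝ} (hp : IsProbDensity p) :
    ∀ᵐ x, 0 ≤ spatialDensity p x := by
  have h := Measure.ae_ae_of_ae_prod (μ := (volume : Measure (Pos d))) (ν := volume) hp.2.1
  filter_upwards [h] with x hx
  exact integral_nonneg_of_ae hx

theorem IsProbDensity.integral_mul_spatialDensity {p : Phase d → ℝ} (hp : IsProbDensity p)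
    {h : Pos d → ℝ} (hh : Continuous h) {C : ℝ} (hC : ∀ x, |h x| ≤ C) :
    ∫ x, h x * spatialDensity p x = ∫ z, h z.1 ∂densityMeasure p := by
  rw [hp.integral_densityMeasure]
  have hi : Integrable (fun z : Phase d => h z.1 * p z) :=
    integrable_bdd_mul hp.1 (by fun_prop) fun z => hC z.1
  refine Eq.symm ((integral_prod (μ := (volume : Measure (Pos d))) (ν := volume) _ hi).trans ?_)
  refine integral_congr_ae (ae_of_all _ fun x => ?_)
  simp only [spatialDensity]
  rw [integral_const_mul]

namespace IsVlasovSolution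

variable {V : Pos d → ℝ} {f₀ : Phase d → ℝ} {f : ℝ → Phase d → ℝ} {T : ℝ}

theorem isProbabilityMeasure_clamp (hf : IsVlasovSolution V f₀ f) (hT : 0 ≤ T) (t : ℝ) :
    IsProbabilityMeasure (densityMeasure (f (clamp T t))) :=
  (hf.1 _ (clamp_mem hT t).1).isProbabilityMeasure

theorem continuous_integral_clamp (hf : IsVlasovSolution V f₀ f) (hT : 0 ≤ T) {φ : Phase d → ℝ}
    (hφ : Continuous φ) (hφc : HasCompactSupport φ) :
    Continuous fun t => ∫ z, φ z ∂densityMeasure (f (clamp T t)) := by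
  have := hf.isProbabilityMeasure_clamp hT
  refine continuous_integral_of_compact (fun φ hφ hφc => ?_) hφ hφc
  have h1 : ContinuousOn (fun s => ∫ z, φ z * f s z) (Ici 0) := fun t ht =>
    (hf.2.2 φ hφ hφc t ht).continuousWithinAt
  have h2 := h1.comp_continuous (continuous_clamp T) fun t => (clamp_mem hT t).1
  refine h2.congr fun t => ?_
  exact ((hf.1 _ (clamp_mem hT t).1).integral_densityMeasure φ).symm

/-- The spatial densities of a solution of the Vlasov equation. -/
def densityCurve (hf : IsVlasovSolution V f₀ f) (hT : 0 ≤ T) : DensityCurve d where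
  ρ t := spatialDensity (f (clamp T t))
  integrable t := (hf.1 _ (clamp_mem hT t).1).integrable_spatialDensity
  nonneg t := (hf.1 _ (clamp_mem hT t).1).spatialDensity_nonneg
  integral_eq t := by
    have hp := hf.1 _ (clamp_mem hT t).1
    have := hp.isProbabilityMeasure
    have h := hp.integral_mul_spatialDensity (h := fun _ => 1) continuous_const (C := 1) (by simp)
    simpa using h
  continuous h hh := by
    rintro ⟨C, hC⟩
    have := hf.isProbabilityMeasure_clamp hT
    have h1 := continuous_integral_of_bounded
      (fun φ hφ hφc => hf.continuous_integral_clamp hT hφ hφc) (g := fun z : Phase d => h z.1)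
      (by fun_prop) (C := C) (fun z => hC z.1)
    refine h1.congr fun t => ?_
    exact ((hf.1 _ (clamp_mem hT t).1).integral_mul_spatialDensity hh hC).symm

end IsVlasovSolution

/-- The vector field `(x, ξ) ↦ (ξ, -∇V ⋆ ρ(x))` on phase space. -/
def SmoothPotential.phaseField (S : SmoothPotential d) (D : DensityCurve d) :
    LipschitzField (Phase d) where
  toFun t z := (z.2, -meanGradient S.V (D.ρ t) z.1)
  K := max (1 : ℝ≥0) (S.L * 1)
  C := S.A
  lipschitz t := LipschitzWith.prod_snd.prodMk
    (((S.lipschitz_meanGradient D t).comp LipschitzWith.prod_fst).neg)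
  continuous z := by
    have := S.continuous_time_meanGradient D z.1
    fun_prop
  bound t := by
    simpa [Prod.norm_def] using S.norm_meanGradient_le D t 0

theorem IsVlasovSolution.densityMeasure_eq_map {S : SmoothPotential d} {f₀ : Phase d → ℝ}
    {f : ℝ → Phase d → ℝ} (hf : IsVlasovSolution S.V f₀ f) {T : ℝ} (hT : 0 ≤ T) {t : ℝ}
    (ht : t ∈ Icc 0 T) :
    densityMeasure (f t) =
      (densityMeasure f₀).map ((S.phaseField (hf.densityCurve hT)).flow 0 t) := by
  have := hf.isProbabilityMeasure_clamp hT
  have h := (S.phaseField (hf.densityCurve hT)).eq_map_flow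
    (μ := fun t => densityMeasure (f (clamp T t))) (T := t)
    (fun φ hφ hφc => hf.continuous_integral_clamp hT hφ hφc) (fun φ hφ hφc s hs => ?_) ht.1
  · rw [clamp_of_mem ht, clamp_of_mem ⟨le_rfl, hT⟩] at h
    rw [h]
    congr 1
    refine withDensity_congr_ae ?_
    filter_upwards [hf.2.1] with z hz
    rw [hz]
  · have hsT : s < T := hs.2.trans_le ht.2
    have hcs : clamp T s = s := clamp_of_mem ⟨hs.1, hsT.le⟩
    have h1 := (hf.2.2 φ hφ hφc s hs.1).mono (Ici_subset_Ici.2 hs.1)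
    have h2 : ∫ z, fderiv ℝ φ z ((S.phaseField (hf.densityCurve hT)).toFun s z)
        ∂densityMeasure (f (clamp T s)) =
        ∫ z, fderiv ℝ φ z (z.2, -meanGradient S.V (spatialDensity (f s)) z.1) * f s z := by
      rw [hcs, (hf.1 s hs.1).integral_densityMeasure]
      simp only [SmoothPotential.phaseField, densityCurve, hcs]
    rw [h2]
    refine h1.congr_of_eventuallyEq ?_ ?_
    · filter_upwards [self_mem_nhdsWithin, mem_nhdsWithin_of_mem_nhds (Iio_mem_nhds hsT)]
        with r hr hrT
      have hr0 : 0 ≤ r := hs.1.trans hr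
      rw [clamp_of_mem ⟨hr0, le_of_lt hrT⟩, (hf.1 r hr0).integral_densityMeasure]
    · rw [hcs, (hf.1 s hs.1).integral_densityMeasure]

/-! ### Couplings as fields of amplitudes -/

theorem posForm_smul (x : Pos d) (c : ℂ) (φ : StateSpace d) :
    posForm x (c • φ) = ‖c‖ₑ ^ 2 * posForm x φ := by
  have hφ : Measurable φ := (Lp.stronglyMeasurable φ).measurable
  rw [posForm, posForm, ← lintegral_const_mul _ (by fun_prop)]
  refine lintegral_congr_ae ?_
  filter_upwards [Lp.coeFn_smul c φ] with y hy
  rw [hy, Pi.smul_apply, enorm_smul, mul_pow, mul_left_comm]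

theorem momForm_smul (ħ : ℝ) (ξ : Pos d) (c : ℂ) (φ : StateSpace d) :
    momForm ħ ξ (c • φ) = ‖c‖ₑ ^ 2 * momForm ħ ξ φ := by
  have hφ : Measurable (fourierOp d φ) := (Lp.stronglyMeasurable _).measurable
  rw [momForm, momForm, map_smul, ← lintegral_const_mul _ (by fun_prop)]
  refine lintegral_congr_ae ?_
  filter_upwards [Lp.coeFn_smul c (fourierOp d φ)] with y hy
  rw [hy, Pi.smul_apply, enorm_smul, mul_pow, mul_left_comm]

theorem costForm_real_smul (ħ : ℝ) (z : Phase d) (r : ℝ) (φ : StateSpace d) :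
    costForm ħ z (r • φ) = ENNReal.ofReal (r ^ 2) * costForm ħ z φ := by
  rw [RCLike.real_smul_eq_coe_smul (K := ℂ), costForm_eq, costForm_eq, posForm_smul, momForm_smul,
    ← mul_add, mul_left_comm, ← ofReal_norm, ← ENNReal.ofReal_pow (norm_nonneg _)]
  simp

/-- A measurable field of amplitudes `A(z)` such that `A(z) A(z)*` has trace `1` and mean `R`. -/
structure IsAmplitude (ν : Measure (Phase d)) (R : Op d) (A : Phase d → Op d) : Prop where
  stronglyMeasurable : StronglyMeasurable A
  trace : ∀ᵐ z ∂ν, posTrace (A z ∘L (A z).adjoint) = 1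
  integral : ∫ z, A z ∘L (A z).adjoint ∂ν = R

/-- The transport cost of a field of amplitudes. -/
def amplitudeCost (ħ : ℝ) (ν : Measure (Phase d)) (A : Phase d → Op d) : ℝ≥0∞ :=
  ∫⁻ z, ∑' i, costForm ħ z (A z (basis d i)) ∂ν

theorem isPositive_comp_adjoint (A : Op d) : (A ∘L A.adjoint).IsPositive := by
  exact ContinuousLinearMap.isPositive_self_comp_adjoint A

theorem continuous_comp_adjoint : Continuous fun A : Op d => A ∘L A.adjoint :=
  continuous_id.clm_comp (ContinuousLinearMap.adjoint (𝕜 := ℂ) (E := StateSpace d)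
    (F := StateSpace d)).continuous

theorem real_smul_comp_adjoint (r : ℝ) (A : Op d) :
    (r • A) ∘L (r • A).adjoint = (r ^ 2) • (A ∘L A.adjoint) := by
  rw [RCLike.real_smul_eq_coe_smul (K := ℂ) r A, RCLike.real_smul_eq_coe_smul (K := ℂ) (r ^ 2),
    map_smulₛₗ, ContinuousLinearMap.smul_comp, ContinuousLinearMap.comp_smul, smul_smul]
  simp [sq]

section AbsSqrt

variable {H : Type*} [NormedAddCommGroup H] [InnerProductSpace ℂ H] [CompleteSpace H]

/-- A continuous extension of the square root of nonnegative operators. -/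
def absSqrt (T : H →L[ℂ] H) : H →L[ℂ] H := CFC.sqrt (CFC.sqrt (star T * T))

theorem continuous_absSqrt : Continuous (absSqrt (H := H)) := by
  have h := CFC.continuousOn_sqrt (A := H →L[ℂ] H)
  have h1 : Continuous fun T : H →L[ℂ] H => CFC.sqrt (star T * T) :=
    h.comp_continuous (continuous_star.mul continuous_id) fun T => star_mul_self_nonneg T
  exact h.comp_continuous h1 fun T => CFC.sqrt_nonneg (star T * T)

theorem absSqrt_eq_opSqrt {T : H →L[ℂ] H} (hT : T.IsPositive) : absSqrt T = opSqrt T := by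
  have h0 : 0 ≤ T := (ContinuousLinearMap.nonneg_iff_isPositive T).2 hT
  have h1 : CFC.sqrt (star T * T) = T := CFC.abs_of_nonneg T h0
  rw [absSqrt, h1, opSqrt]

end AbsSqrt

namespace IsAmplitude

variable {ν : Measure (Phase d)} [IsProbabilityMeasure ν] {R : Op d} {A : Phase d → Op d}

theorem measurable_apply (hA : IsAmplitude ν R A) (u : StateSpace d) :
    Measurable fun z => A z u :=
  ((ContinuousLinearMap.apply ℂ (StateSpace d) u).continuous.comp_stronglyMeasurable
    hA.stronglyMeasurable).measurable

theorem integrable (hA : IsAmplitude ν R A) : Integrable (fun z => A z ∘L (A z).adjoint) ν := by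
  refine (integrable_const (1 : ℝ)).mono' (continuous_comp_adjoint.comp_stronglyMeasurable
    hA.stronglyMeasurable).aestronglyMeasurable ?_
  filter_upwards [hA.trace] with z hz
  have h := enorm_le_posTrace (isPositive_comp_adjoint (A z))
  rw [hz, ← ofReal_norm] at h
  simpa using ENNReal.ofReal_le_one.1 h

theorem tsum_enorm_sq (hA : IsAmplitude ν R A) :
    ∀ᵐ z ∂ν, ∑' i, ‖A z (basis d i)‖ₑ ^ 2 = 1 := by
  filter_upwards [hA.trace] with z hz
  rw [← posTrace_comp_adjoint, hz]

theorem isPositive (hA : IsAmplitude ν R A) : R.IsPositive := by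
  rw [← hA.integral]
  exact isPositive_integral hA.integrable (ae_of_all _ fun z => isPositive_comp_adjoint _)

theorem isDensityOperator (hA : IsAmplitude ν R A) : IsDensityOperator R := by
  refine ⟨hA.isPositive, ?_⟩
  rw [← hA.integral, posTrace_integral hA.integrable
    (ae_of_all _ fun z => isPositive_comp_adjoint _), lintegral_congr_ae hA.trace]
  simp

/-- The position marginal of a field of amplitudes. -/
theorem lintegral_mul_enorm_sq (hA : IsAmplitude ν R A) {h : Pos d → ℝ} (hm : Measurable h)
    (h0 : ∀ y, 0 ≤ h y) {C : ℝ} (hC : ∀ y, h y ≤ C) :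
    ∫⁻ z, (∑' i, ∫⁻ y, ENNReal.ofReal (h y) * ‖A z (basis d i) y‖ₑ ^ 2) ∂ν =
      ∫⁻ y, ENNReal.ofReal (h y) * ENNReal.ofReal (positionDensity R y) := by
  rw [hA.isDensityOperator.lintegral_mul_positionDensity hm h0 hC]
  simp_rw [tsum_lintegral_mul_enorm_sq _ hm h0 hC]
  have hi := hA.integrable
  rw [lintegral_tsum fun i => ((hi.apply_continuousLinearMap _).const_inner
    _).re.aemeasurable.ennreal_ofReal]
  refine tsum_congr fun i => ?_
  rw [← ofReal_re_inner_integral hi (ae_of_all _ fun z => isPositive_comp_adjoint _), hA.integral]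

/-- Fields of amplitudes are transported by measurable bijections and isometries. -/
theorem transport (hA : IsAmplitude ν R A) {Φ Ψ : Phase d → Phase d} (hΦ : Measurable Φ)
    (hΨ : Measurable Ψ) (h : ∀ z, Ψ (Φ z) = z) {U : Op d} (hU : ∀ x, ‖U x‖ = ‖x‖) :
    IsAmplitude (ν.map Φ) (U ∘L R ∘L U.adjoint) fun z => U ∘L A (Ψ z) := by
  have hc : Continuous fun B : Op d => U ∘L B := continuous_const.clm_comp continuous_id
  have hmap : (ν.map Φ).map Ψ = ν := by
    rw [Measure.map_map hΨ hΦ]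
    have : Ψ ∘ Φ = id := funext h
    rw [this, Measure.map_id]
  have he : ∀ B : Op d, (U ∘L B) ∘L (U ∘L B).adjoint = U ∘L (B ∘L B.adjoint) ∘L U.adjoint :=
    fun B => by rw [ContinuousLinearMap.adjoint_comp]; rfl
  refine ⟨hc.comp_stronglyMeasurable (hA.stronglyMeasurable.comp_measurable hΨ), ?_, ?_⟩
  · have h1 := hA.trace
    rw [← hmap] at h1
    filter_upwards [ae_of_ae_map hΨ.aemeasurable h1] with z hz
    rw [he, posTrace_conj_isometry (isPositive_comp_adjoint _) hU, hz]
  · have hm : StronglyMeasurable fun z => (U ∘L A (Ψ z)) ∘L (U ∘L A (Ψ z)).adjoint :=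
      (continuous_comp_adjoint.comp hc).comp_stronglyMeasurable
        (hA.stronglyMeasurable.comp_measurable hΨ)
    rw [integral_map hΦ.aemeasurable hm.aestronglyMeasurable]
    simp_rw [h, he]
    have hL : ∫ z, U ∘L (A z ∘L (A z).adjoint) ∘L U.adjoint ∂ν =
        U ∘L (∫ z, (A z ∘L (A z).adjoint) ∂ν) ∘L U.adjoint := by
      have h2 := ((ContinuousLinearMap.compL ℂ (StateSpace d) (StateSpace d) (StateSpace d)
        U).comp ((ContinuousLinearMap.compL ℂ (StateSpace d) (StateSpace d) (StateSpace d)).flip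
        U.adjoint)).integral_comp_comm hA.integrable
      simpa using h2
    rw [hL, hA.integral]

theorem amplitudeCost_transport (hA : IsAmplitude ν R A) {ħ : ℝ} (hħ : 0 < ħ)
    {Φ Ψ : Phase d → Phase d} (hΦ : Measurable Φ) (hΨ : Measurable Ψ) (h : ∀ z, Ψ (Φ z) = z)
    (U : Op d) :
    amplitudeCost ħ (ν.map Φ) (fun z => U ∘L A (Ψ z)) =
      ∫⁻ z, ∑' i, costForm ħ (Φ z) (U (A z (basis d i))) ∂ν := by
  have hm : Measurable fun z => ∑' i, costForm ħ z (U (A (Ψ z) (basis d i))) := by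
    refine Measurable.tsum fun i => ?_
    have h1 : Measurable fun z => U (A (Ψ z) (basis d i)) :=
      U.continuous.measurable.comp ((hA.measurable_apply (basis d i)).comp hΨ)
    exact (measurable_costForm (d := d) hħ).comp (f := fun z => (z, U (A (Ψ z) (basis d i))))
      (Measurable.prodMk measurable_id h1)
  have h2 : amplitudeCost ħ (ν.map Φ) (fun z => U ∘L A (Ψ z)) =
      ∫⁻ z, ∑' i, costForm ħ z (U (A (Ψ z) (basis d i))) ∂ν.map Φ := rfl
  rw [h2, lintegral_map hm hΦ]
  simp_rw [h]

end IsAmplitude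

theorem exists_amplitude_of_isCoupling {ħ : ℝ} {p : Phase d → ℝ} (hp : IsProbDensity p) {R : Op d}
    {Q : Phase d → Op d} (hQ : IsCoupling p R Q) :
    ∃ A, IsAmplitude (densityMeasure p) R A ∧
      amplitudeCost ħ (densityMeasure p) A ≤ ∫⁻ z, costTrace ħ z (Q z) := by
  obtain ⟨hQm, hpos, htr, hint⟩ := hQ
  obtain ⟨p', hp'm, hp'⟩ := hp.1.1.aemeasurable
  set Q' := hQm.mk Q with hQ'
  have hQQ : Q =ᵐ[volume] Q' := hQm.ae_eq_mk
  set A : Phase d → Op d := fun z => (√(p' z))⁻¹ • absSqrt (Q' z) with hA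
  have hν : densityMeasure p = volume.withDensity fun z => ENNReal.ofReal (p' z) :=
    withDensity_congr_ae (by filter_upwards [hp'] with z hz; rw [hz])
  have hAm : StronglyMeasurable A :=
    (hp'm.sqrt.inv.stronglyMeasurable).smul
      (continuous_absSqrt.comp_stronglyMeasurable hQm.stronglyMeasurable_mk)
  have hkey : ∀ᵐ z, 0 < p' z → A z ∘L (A z).adjoint = (p' z)⁻¹ • Q z ∧
      ∀ u, A z u = (√(p' z))⁻¹ • opSqrt (Q z) u := by
    filter_upwards [hpos, hQQ] with z h1 h2 h3
    have h4 : A z = (√(p' z))⁻¹ • opSqrt (Q z) := by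
      rw [hA]
      simp only
      rw [← h2, absSqrt_eq_opSqrt h1]
    refine ⟨?_, fun u => by rw [h4]; rfl⟩
    rw [h4, real_smul_comp_adjoint, opSqrt_comp_adjoint h1, inv_pow, Real.sq_sqrt h3.le]
  have hposν : ∀ {P : Phase d → Prop}, (∀ᵐ z, 0 < p' z → P z) → ∀ᵐ z ∂densityMeasure p, P z := by
    intro P hP
    rw [hν, ae_withDensity_iff hp'm.ennreal_ofReal]
    filter_upwards [hP] with z hz h
    exact hz (ENNReal.ofReal_pos.1 (pos_iff_ne_zero.2 h))
  refine ⟨A, ⟨hAm, hposν ?_, ?_⟩, ?_⟩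
  · filter_upwards [hkey, htr, hp'] with z h1 h2 h3 h4
    rw [(h1 h4).1, posTrace_real_smul _ (inv_nonneg.2 h4.le), h2, h3,
      ← ENNReal.ofReal_mul (inv_nonneg.2 h4.le), inv_mul_cancel₀ h4.ne', ENNReal.ofReal_one]
  · rw [hν, integral_withDensity_eq_integral_toReal_smul hp'm.ennreal_ofReal
      (ae_of_all _ fun _ => ENNReal.ofReal_lt_top), ← hint]
    refine integral_congr_ae ?_
    filter_upwards [hkey, htr, hp', hp.2.1, hpos] with z h1 h2 h3 h4 h5
    rw [h3] at h4 h2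
    rw [ENNReal.toReal_ofReal h4]
    rcases h4.eq_or_lt with h6 | h6
    · have h7 := enorm_le_posTrace h5
      rw [h2, ← h6, ENNReal.ofReal_zero, nonpos_iff_eq_zero, ← ofReal_norm,
        ENNReal.ofReal_eq_zero, norm_le_zero_iff] at h7
      rw [← h6, h7, zero_smul]
    · rw [(h1 h6).1, smul_smul, mul_inv_cancel₀ h6.ne', one_smul]
  · rw [amplitudeCost, hν]
    refine (lintegral_withDensity_le_lintegral_mul _ hp'm.ennreal_ofReal _).trans
      (lintegral_mono_ae ?_)
    filter_upwards [hkey] with z h1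
    rw [Pi.mul_apply]
    rcases le_or_gt (p' z) 0 with h2 | h2
    · rw [ENNReal.ofReal_of_nonpos h2, zero_mul]
      exact zero_le
    · simp_rw [(h1 h2).2, costForm_real_smul, ENNReal.tsum_mul_left]
      rw [← mul_assoc, ← ENNReal.ofReal_mul h2.le, inv_pow, Real.sq_sqrt h2.le,
        mul_inv_cancel₀ h2.ne', ENNReal.ofReal_one, one_mul, costTrace]

theorem Ehbar_sq_le_amplitudeCost {ħ : ℝ} (hħ : 0 < ħ) {p : Phase d → ℝ} (hp : IsProbDensity p)
    {R : Op d} {A : Phase d → Op d} (hA : IsAmplitude (densityMeasure p) R A) :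
    Ehbar ħ p R ^ 2 ≤ amplitudeCost ħ (densityMeasure p) A := by
  have hpm : AEMeasurable (fun z => ENNReal.ofReal (p z)) := hp.1.1.aemeasurable.ennreal_ofReal
  have htr : ∀ᵐ z, posTrace (p z • (A z ∘L (A z).adjoint)) = ENNReal.ofReal (p z) := by
    have h1 := hA.trace
    rw [densityMeasure, ae_withDensity_iff' hpm] at h1
    filter_upwards [h1, hp.2.1] with z h2 h3
    rw [posTrace_real_smul _ h3]
    rcases h3.eq_or_lt with h4 | h4
    · rw [← h4, ENNReal.ofReal_zero, zero_mul]
    · rw [h2 (ENNReal.ofReal_pos.2 h4).ne', mul_one]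
  have hQ : IsCoupling p R fun z => p z • (A z ∘L (A z).adjoint) := by
    refine ⟨hp.1.1.smul (continuous_comp_adjoint.comp_stronglyMeasurable
      hA.stronglyMeasurable).aestronglyMeasurable, ?_, htr, ?_⟩
    · filter_upwards [hp.2.1] with z hz
      exact isPositive_real_smul (isPositive_comp_adjoint _) hz
    · rw [← hA.integral, densityMeasure, integral_withDensity_eq_integral_toReal_smul₀ hpm
        (ae_of_all _ fun _ => ENNReal.ofReal_lt_top)]
      refine integral_congr_ae ?_
      filter_upwards [hp.2.1] with z hz
      rw [ENNReal.toReal_ofReal hz]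
  rw [Ehbar_sq]
  refine (iInf₂_le _ hQ).trans (le_of_eq ?_)
  rw [amplitudeCost, densityMeasure, lintegral_withDensity_eq_lintegral_mul₀ hpm]
  · refine lintegral_congr_ae ?_
    filter_upwards [hp.2.1, htr] with z hz h1
    rw [costTrace_comp_adjoint hħ z (isPositive_real_smul (isPositive_comp_adjoint _) hz)
      (A := √(p z) • A z) (by rw [real_smul_comp_adjoint, Real.sq_sqrt hz])
      (by rw [h1]; exact ENNReal.ofReal_ne_top), Pi.mul_apply, ← ENNReal.tsum_mul_left]
    refine tsum_congr fun i => ?_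
    rw [smul_apply, costForm_real_smul, Real.sq_sqrt hz]
  · refine (Measurable.tsum fun i => (measurable_costForm hħ).comp
      (measurable_id.prodMk ?_)).aemeasurable
    have := hp.isProbabilityMeasure
    exact hA.measurable_apply _

/-! ### An integral Grönwall inequality -/

theorem lintegral_Ioc_ofReal {h H : ℝ → ℝ} {t : ℝ} (ht : 0 ≤ t) (hh : Continuous h)
    (h0 : ∀ s ∈ Ioc 0 t, 0 ≤ h s) (hH : ∀ s, HasDerivAt H (h s) s) :
    ∫⁻ s in Ioc 0 t, ENNReal.ofReal (h s) = ENNReal.ofReal (H t - H 0) := by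
  rw [← intervalIntegral.integral_eq_sub_of_hasDerivAt (fun s _ => hH s) (hh.intervalIntegrable 0 t),
    intervalIntegral.integral_of_le ht, ofReal_integral_eq_lintegral_ofReal]
  · exact (hh.integrableOn_Icc (a := 0) (b := t)).mono_set Ioc_subset_Icc_self
  · exact (ae_restrict_iff' measurableSet_Ioc).2 (ae_of_all _ h0)

theorem gronwall_lintegral {g : ℝ → ℝ≥0∞} {T K B : ℝ} (hK : 0 ≤ K) (hB : 0 ≤ B) {c : ℝ≥0∞}
    (hgB : ∀ t ∈ Icc 0 T, g t ≤ ENNReal.ofReal B)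
    (h : ∀ t ∈ Icc 0 T, g t ≤ c + ENNReal.ofReal K * ∫⁻ s in Ioc 0 t, g s) {t : ℝ}
    (ht : t ∈ Icc 0 T) : g t ≤ ENNReal.ofReal (Real.exp (K * t)) * c := by
  rcases eq_or_ne c ⊤ with rfl | hc
  · rw [ENNReal.mul_top (ENNReal.ofReal_pos.2 (Real.exp_pos _)).ne']
    exact le_top
  obtain ⟨r, hr, rfl⟩ : ∃ r : ℝ, 0 ≤ r ∧ c = ENNReal.ofReal r :=
    ⟨c.toReal, ENNReal.toReal_nonneg, (ENNReal.ofReal_toReal hc).symm⟩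
  have key : ∀ n : ℕ, ∀ t ∈ Icc 0 T, g t ≤
      ENNReal.ofReal (r * Real.exp (K * t) + B * ((K * t) ^ n / n.factorial)) := by
    intro n
    induction n with
    | zero =>
      intro t ht
      refine (hgB t ht).trans (ENNReal.ofReal_le_ofReal ?_)
      have : 0 ≤ r * Real.exp (K * t) := by positivity
      simpa using this
    | succ n ih =>
      intro t ht
      have hd : ∀ s, HasDerivAt
          (fun s => r * Real.exp (K * s) + B * ((K * s) ^ (n + 1) / (n + 1).factorial))
          (K * (r * Real.exp (K * s) + B * ((K * s) ^ n / n.factorial))) s := fun s => by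
        have h1 : HasDerivAt (fun s => K * s) K s := by
          simpa using (hasDerivAt_id s).const_mul K
        have h2 := (h1.exp.const_mul r).add (((h1.pow (n + 1)).div_const
          ((n + 1).factorial : ℝ)).const_mul B)
        refine h2.congr_deriv ?_
        have h3 : ((n.factorial : ℕ) : ℝ) ≠ 0 := by positivity
        rw [Nat.factorial_succ]
        push_cast
        field_simp
      have hle : ENNReal.ofReal K * ∫⁻ s in Ioc 0 t, g s ≤ ∫⁻ s in Ioc 0 t,
          ENNReal.ofReal (K * (r * Real.exp (K * s) + B * ((K * s) ^ n / n.factorial))) := by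
        simp_rw [ENNReal.ofReal_mul hK]
        rw [lintegral_const_mul _ (by fun_prop)]
        refine mul_le_mul_right (setLIntegral_mono' measurableSet_Ioc fun s hs => ?_) _
        exact ih s ⟨hs.1.le, hs.2.trans ht.2⟩
      rw [lintegral_Ioc_ofReal ht.1 (by fun_prop) (fun s hs => by
        have := hs.1
        positivity) hd] at hle
      refine (h t ht).trans ((add_le_add_right hle _).trans ?_)
      simp only [mul_zero, Real.exp_zero, mul_one, ne_eq, Nat.add_eq_zero_iff, one_ne_zero,
        and_false, not_false_eq_true, zero_pow, zero_div, add_zero]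
      have h4 : r ≤ r * Real.exp (K * t) :=
        le_mul_of_one_le_right hr (Real.one_le_exp (mul_nonneg hK ht.1))
      have h5 : 0 ≤ B * ((K * t) ^ (n + 1) / (n + 1).factorial) := by
        have := ht.1
        positivity
      rw [← ENNReal.ofReal_add hr (by linarith), add_sub_cancel]
  rw [mul_comm, ← ENNReal.ofReal_mul hr]
  have hlim : Tendsto (fun n : ℕ => ENNReal.ofReal
      (r * Real.exp (K * t) + B * ((K * t) ^ n / n.factorial))) atTop
      (𝓝 (ENNReal.ofReal (r * Real.exp (K * t)))) := by
    have h1 := ((FloorSemiring.tendsto_pow_div_factorial_atTop (K * t)).const_mul B).const_add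
      (r * Real.exp (K * t))
    rw [mul_zero, add_zero] at h1
    exact (ENNReal.continuous_ofReal.tendsto _).comp h1
  exact ge_of_tendsto' hlim fun n => key n t ht

/-! ### Comparison of the mean field forces -/

theorem DensityCurve.lintegral_mul (D : DensityCurve d) (t : ℝ) {h : Pos d → ℝ} (hh : Continuous h)
    (h0 : ∀ y, 0 ≤ h y) {C : ℝ} (hC : ∀ y, h y ≤ C) :
    ∫⁻ y, ENNReal.ofReal (h y) * ENNReal.ofReal (D.ρ t y) =
      ENNReal.ofReal (∫ y, h y * D.ρ t y) := by
  rw [ofReal_integral_eq_lintegral_ofReal (integrable_bdd_mul (D.integrable t)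
    hh.aestronglyMeasurable fun y => by rw [abs_of_nonneg (h0 y)]; exact hC y)]
  · exact lintegral_congr fun y => (ENNReal.ofReal_mul (h0 y)).symm
  · filter_upwards [D.nonneg t] with y hy
    exact mul_nonneg (h0 y) hy

theorem SmoothPotential.integral_inner_gradient (S : SmoothPotential d) (D : DensityCurve d) (t : ℝ)
    (e x : Pos d) :
    ∫ y, (⟪e, gradient S.V (x - y)⟫_ℝ + S.A) * D.ρ t y =
      ⟪e, meanGradient S.V (D.ρ t) x⟫_ℝ + S.A := by
  have h1 := S.integrable_gradient (D.integrable t) x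
  have h2 : Integrable fun y => ⟪e, gradient S.V (x - y)⟫_ℝ * D.ρ t y := by
    refine (h1.const_inner (𝕜 := ℝ) e).congr (ae_of_all _ fun y => ?_)
    simp only [inner_smul_right, mul_comm]
  simp_rw [add_mul]
  rw [integral_add h2 ((D.integrable t).const_mul _), integral_const_mul, D.integral_eq, mul_one,
    meanGradient, ← integral_inner h1]
  congr 1
  refine integral_congr_ae (ae_of_all _ fun y => ?_)
  simp only [inner_smul_right, mul_comm]

theorem SmoothPotential.abs_inner_gradient_le (S : SmoothPotential d) {e : Pos d} (he : ‖e‖ ≤ 1)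
    (x : Pos d) : |⟪e, gradient S.V x⟫_ℝ| ≤ S.A :=
  (abs_real_inner_le_norm _ _).trans
    ((mul_le_of_le_one_left (norm_nonneg _) he).trans (S.norm_gradient_le x))

/-- The mean over `ν` of the position forms of a field of amplitudes. -/
def positionCost (ν : Measure (Phase d)) (x : Phase d → Pos d) (A : Phase d → Op d) : ℝ≥0∞ :=
  ∫⁻ z, ∑' i, posForm (x z) (A z (basis d i)) ∂ν

section Force

variable {ν : Measure (Phase d)} [IsProbabilityMeasure ν] {R : Op d} {A : Phase d → Op d}
  {x : Phase d → Pos d}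

theorem IsAmplitude.measurable_tsum_posForm (hA : IsAmplitude ν R A) (hx : Measurable x) :
    Measurable fun z => ∑' i, posForm (x z) (A z (basis d i)) := by
  refine Measurable.tsum fun i => ?_
  exact (measurable_posForm (d := d)).comp (f := fun z => (x z, A z (basis d i)))
    (hx.prodMk (hA.measurable_apply _))

theorem IsAmplitude.lintegral_force_le (hA : IsAmplitude ν R A) (hx : Measurable x)
    {h : Pos d → ℝ} {k : Pos d → ℝ} (hm : Measurable h) (hk : Measurable k) (h0 : ∀ y, 0 ≤ h y)
    (k0 : ∀ y, 0 ≤ k y) {C : ℝ} (hC : ∀ y, h y ≤ C) {a b : ℝ} (ha : 0 ≤ a) (hb : 0 ≤ b)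
    (hhk : ∀ z y, h y ≤ k (x z) + a + b * ‖x z - y‖ ^ 2) :
    ∫⁻ y, ENNReal.ofReal (h y) * ENNReal.ofReal (positionDensity R y) ≤
      ∫⁻ z, ENNReal.ofReal (k (x z)) ∂ν + ENNReal.ofReal a +
        ENNReal.ofReal b * positionCost ν x A := by
  rw [← hA.lintegral_mul_enorm_sq hm h0 hC]
  have h1 : ∀ z (u : StateSpace d), ∫⁻ y, ENNReal.ofReal (h y) * ‖u y‖ₑ ^ 2 ≤
      (ENNReal.ofReal (k (x z)) + ENNReal.ofReal a) * ‖u‖ₑ ^ 2 +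
        ENNReal.ofReal b * posForm (x z) u := by
    intro z u
    have hu : Measurable u := (Lp.stronglyMeasurable u).measurable
    rw [enorm_sq_eq_lintegral u, posForm, ← lintegral_const_mul _ (by fun_prop),
      ← lintegral_const_mul _ (by fun_prop), ← lintegral_add_left (by fun_prop)]
    refine lintegral_mono fun y => ?_
    rw [← mul_assoc, ← add_mul]
    refine mul_le_mul_left ?_ _
    rw [← ofReal_norm, ← ENNReal.ofReal_pow (norm_nonneg _), ← ENNReal.ofReal_mul hb,
      ← ENNReal.ofReal_add (k0 _) ha, ← ENNReal.ofReal_add (add_nonneg (k0 _) ha) (by positivity)]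
    exact ENNReal.ofReal_le_ofReal (hhk z y)
  have h2 : ∀ᵐ z ∂ν, ∑' i, ∫⁻ y, ENNReal.ofReal (h y) * ‖A z (basis d i) y‖ₑ ^ 2 ≤
      (ENNReal.ofReal (k (x z)) + ENNReal.ofReal a) +
        ENNReal.ofReal b * ∑' i, posForm (x z) (A z (basis d i)) := by
    filter_upwards [hA.tsum_enorm_sq] with z hz
    refine (ENNReal.tsum_le_tsum fun i => h1 z (A z (basis d i))).trans ?_
    rw [ENNReal.tsum_add, ENNReal.tsum_mul_left, ENNReal.tsum_mul_left, hz, mul_one]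
  refine (lintegral_mono_ae h2).trans (le_of_eq ?_)
  rw [lintegral_add_left (by fun_prop), lintegral_add_right _ measurable_const,
    lintegral_const_mul _ (hA.measurable_tsum_posForm hx), positionCost]
  simp

variable {S : SmoothPotential d} {D D' : DensityCurve d} {t : ℝ}

theorem IsAmplitude.norm_meanGradient_sub_le (hA : IsAmplitude ν R A) (hx : Measurable x)
    (hD : ∀ h : Pos d → ℝ, Continuous h → (∀ y, 0 ≤ h y) → (∃ C, ∀ y, h y ≤ C) →
      ∫⁻ z, ENNReal.ofReal (h (x z)) ∂ν = ∫⁻ y, ENNReal.ofReal (h y) * ENNReal.ofReal (D.ρ t y))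
    (hD' : D'.ρ t = positionDensity R) (hX : positionCost ν x A ≠ ⊤) (p q : Pos d) :
    ‖meanGradient S.V (D'.ρ t) q - meanGradient S.V (D.ρ t) p‖ ≤
      S.L * (‖p - q‖ + √(positionCost ν x A).toReal) := by
  set v := meanGradient S.V (D'.ρ t) q - meanGradient S.V (D.ρ t) p with hv
  set X := (positionCost ν x A).toReal with hXdef
  have hX0 : 0 ≤ X := ENNReal.toReal_nonneg
  have hL := S.L.coe_nonneg
  have hgc := S.continuous_gradient
  have main : ∀ lam > 0, ‖v‖ ≤ S.L * (‖p - q‖ + lam / 2) + S.L / (2 * lam) * X := by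
    intro lam hlam
    set e : Pos d := ‖v‖⁻¹ • v with he
    have he1 : ‖e‖ ≤ 1 := by
      rw [he, norm_smul, norm_inv, norm_norm]
      exact inv_mul_le_one
    have hev : ⟪e, v⟫_ℝ = ‖v‖ := by
      rw [he, real_inner_smul_left, real_inner_self_eq_norm_sq]
      rcases eq_or_ne ‖v‖ 0 with h | h
      · simp [h]
      · field_simp
    have hb : ∀ w, |⟪e, gradient S.V w⟫_ℝ| ≤ S.A := S.abs_inner_gradient_le he1
    have hbound : ∀ w, 0 ≤ ⟪e, gradient S.V w⟫_ℝ + S.A ∧ ⟪e, gradient S.V w⟫_ℝ + S.A ≤ 2 * S.A :=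
      fun w => ⟨by linarith [(abs_le.1 (hb w)).1], by linarith [(abs_le.1 (hb w)).2]⟩
    have ha : 0 ≤ S.L * (‖p - q‖ + lam / 2) := by positivity
    have hb' : 0 ≤ S.L / (2 * lam) := by positivity
    have h1 := hA.lintegral_force_le hx (h := fun y => ⟪e, gradient S.V (q - y)⟫_ℝ + S.A)
      (k := fun y => ⟪e, gradient S.V (p - y)⟫_ℝ + S.A) (by fun_prop) (by fun_prop)
      (fun y => (hbound _).1) (fun y => (hbound _).1) (fun y => (hbound _).2) ha hb'
      (fun z y => by
        have h2 := S.lipschitz.norm_sub_le (q - y) (p - x z)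
        have h3 : ⟪e, gradient S.V (q - y)⟫_ℝ - ⟪e, gradient S.V (p - x z)⟫_ℝ ≤
            S.L * (‖p - q‖ + ‖x z - y‖) := by
          rw [← inner_sub_right]
          refine (real_inner_le_norm _ _).trans
            ((mul_le_of_le_one_left (norm_nonneg _) he1).trans (h2.trans ?_))
          refine mul_le_mul_of_nonneg_left ?_ hL
          have h4 : q - y - (p - x z) = (q - p) + (x z - y) := by abel
          rw [h4, norm_sub_rev p q]
          exact norm_add_le _ _
        have h5 : ‖x z - y‖ ≤ lam / 2 + ‖x z - y‖ ^ 2 / (2 * lam) := by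
          rw [div_add_div _ _ two_ne_zero (by positivity), le_div_iff₀ (by positivity)]
          nlinarith [sq_nonneg (‖x z - y‖ - lam)]
        have h6 := mul_le_mul_of_nonneg_left h5 hL
        have h7 : S.L / (2 * lam) * ‖x z - y‖ ^ 2 = S.L * (‖x z - y‖ ^ 2 / (2 * lam)) := by ring
        rw [h7]
        linarith)
    rw [hD (fun y => ⟪e, gradient S.V (p - y)⟫_ℝ + S.A) (by fun_prop) (fun y => (hbound _).1)
      ⟨_, fun y => (hbound _).2⟩, D.lintegral_mul t (by fun_prop) (fun y => (hbound _).1)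
      (fun y => (hbound _).2), ← hD', D'.lintegral_mul t (by fun_prop) (fun y => (hbound _).1)
      (fun y => (hbound _).2), S.integral_inner_gradient, S.integral_inner_gradient,
      ← ENNReal.ofReal_toReal hX, ← hXdef, ← ENNReal.ofReal_mul hb'] at h1
    have hn : ∀ ρ : ℝ, |ρ| ≤ S.A → 0 ≤ ρ + S.A := fun ρ h => by linarith [(abs_le.1 h).1]
    have h8 : 0 ≤ ⟪e, meanGradient S.V (D.ρ t) p⟫_ℝ + S.A := hn _
      ((abs_real_inner_le_norm _ _).trans ((mul_le_of_le_one_left (norm_nonneg _) he1).trans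
        (S.norm_meanGradient_le D t p)))
    rw [← ENNReal.ofReal_add h8 ha, ← ENNReal.ofReal_add (add_nonneg h8 ha) (by positivity),
      ENNReal.ofReal_le_ofReal_iff (by positivity)] at h1
    rw [← hev, hv, inner_sub_right]
    linarith
  refine le_of_forall_pos_le_add fun ε hε => ?_
  obtain ⟨η, hη, hηε⟩ : ∃ η > 0, S.L * η ≤ ε := by
    refine ⟨ε / (S.L + 1), by positivity, ?_⟩
    rw [← mul_div_assoc, div_le_iff₀ (by positivity)]
    nlinarith
  have h1 := main (√X + η) (by positivity)
  have h2 : S.L / (2 * (√X + η)) * X ≤ S.L * (√X / 2) := by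
    rw [div_mul_eq_mul_div, mul_div_assoc]
    refine mul_le_mul_of_nonneg_left ?_ hL
    rw [div_le_iff₀ (by positivity)]
    nlinarith [Real.sq_sqrt hX0, Real.sqrt_nonneg X]
  nlinarith

theorem IsAmplitude.lintegral_force_sq_le (hA : IsAmplitude ν R A) (hx : Measurable x)
    (hD : ∀ h : Pos d → ℝ, Continuous h → (∀ y, 0 ≤ h y) → (∃ C, ∀ y, h y ≤ C) →
      ∫⁻ z, ENNReal.ofReal (h (x z)) ∂ν = ∫⁻ y, ENNReal.ofReal (h y) * ENNReal.ofReal (D.ρ t y))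
    (hD' : D'.ρ t = positionDensity R) (hX : positionCost ν x A ≠ ⊤) (p : Pos d)
    (u : StateSpace d) :
    ∫⁻ y, ‖-meanGradient S.V (D.ρ t) p + meanGradient S.V (D'.ρ t) y‖ₑ ^ 2 * ‖u y‖ₑ ^ 2 ≤
      ENNReal.ofReal (2 * S.L ^ 2) * (posForm p u + positionCost ν x A * ‖u‖ₑ ^ 2) := by
  have hu : Measurable u := (Lp.stronglyMeasurable u).measurable
  rw [posForm, enorm_sq_eq_lintegral u, ← lintegral_const_mul _ (by fun_prop),
    ← lintegral_add_left (by fun_prop), ← lintegral_const_mul _ (by fun_prop)]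
  refine lintegral_mono fun y => ?_
  rw [← add_mul, ← mul_assoc]
  refine mul_le_mul_left ?_ _
  have hX0 : 0 ≤ (positionCost ν x A).toReal := ENNReal.toReal_nonneg
  rw [neg_add_eq_sub, ← ENNReal.ofReal_toReal hX, ← ofReal_norm, ← ofReal_norm,
    ← ENNReal.ofReal_pow (norm_nonneg _), ← ENNReal.ofReal_pow (norm_nonneg _),
    ← ENNReal.ofReal_add (by positivity) hX0, ← ENNReal.ofReal_mul (by positivity)]
  refine ENNReal.ofReal_le_ofReal ?_
  have h1 := hA.norm_meanGradient_sub_le (S := S) hx hD hD' hX p y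
  have h2 := pow_le_pow_left₀ (norm_nonneg _) h1 2
  refine h2.trans ?_
  rw [mul_pow, mul_comm (2 : ℝ), mul_assoc]
  refine mul_le_mul_of_nonneg_left ?_ (by positivity)
  nlinarith [sq_nonneg (‖p - y‖ - √(positionCost ν x A).toReal), Real.sq_sqrt hX0]

end Force

/-! ### Propagation of the transport cost -/

theorem half_momForm_le (ħ : ℝ) (z : Phase d) (φ : StateSpace d) :
    ENNReal.ofReal (1 / 2) * momForm ħ z.2 φ ≤ costForm ħ z φ := by
  rw [costForm_eq]
  exact mul_le_mul_right le_add_self _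

section Propagation

variable (S : SmoothPotential d) (D D' : DensityCurve d) {ħ T : ℝ}

theorem hasDerivAt_phaseField_fst (z : Phase d) (t : ℝ) :
    HasDerivAt (fun t => ((S.phaseField D).flow 0 t z).1) ((S.phaseField D).flow 0 t z).2 t :=
  (ContinuousLinearMap.fst ℝ (Pos d) (Pos d)).hasFDerivAt.comp_hasDerivAt t
    ((S.phaseField D).hasDerivAt_flow 0 t z)

theorem hasDerivAt_phaseField_snd (z : Phase d) (t : ℝ) :
    HasDerivAt (fun t => ((S.phaseField D).flow 0 t z).2)
      (-meanGradient S.V (D.ρ t) ((S.phaseField D).flow 0 t z).1) t :=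
  (ContinuousLinearMap.snd ℝ (Pos d) (Pos d)).hasFDerivAt.comp_hasDerivAt t
    ((S.phaseField D).hasDerivAt_flow 0 t z)

theorem continuous_force (z : Phase d) :
    Continuous fun t => -meanGradient S.V (D.ρ t) ((S.phaseField D).flow 0 t z).1 := by
  have h := (S.phaseField D).continuous_uncurry.comp
    (f := fun t : ℝ => (t, (S.phaseField D).flow 0 t z))
    (continuous_id.prodMk ((S.phaseField D).continuous_flow_right 0 z))
  exact continuous_snd.comp h

theorem measurable_costForm_flow (hħ : 0 < ħ) {Y : Type*} [MeasurableSpace Y] {t : Y → ℝ}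
    {z : Y → Phase d} {u : Y → StateSpace d} (ht : Measurable t) (hz : Measurable z)
    (hu : Measurable u) :
    Measurable fun y => costForm ħ ((S.phaseField D).flow 0 (t y) (z y))
      ((S.timePotential D').prop ħ T (t y) (u y)) := by
  have h1 : Measurable fun y => (S.phaseField D).flow 0 (t y) (z y) :=
    ((S.phaseField D).continuous_flow_prod 0).measurable.comp (f := fun y => (t y, z y))
      (ht.prodMk hz)
  have h2 : Measurable fun y => (S.timePotential D').prop ħ T (t y) (u y) :=
    ((S.timePotential D').continuous_prop ħ T).measurable.comp (f := fun y => (t y, u y))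
      (ht.prodMk hu)
  exact (measurable_costForm (d := d) hħ).comp (f := fun y => ((S.phaseField D).flow 0 (t y) (z y),
    (S.timePotential D').prop ħ T (t y) (u y))) (h1.prodMk h2)

theorem measurable_momForm_flow (hħ : 0 < ħ) {Y : Type*} [MeasurableSpace Y] {t : Y → ℝ}
    {z : Y → Phase d} {u : Y → StateSpace d} (ht : Measurable t) (hz : Measurable z)
    (hu : Measurable u) :
    Measurable fun y => momForm ħ ((S.phaseField D).flow 0 (t y) (z y)).2
      ((S.timePotential D').prop ħ T (t y) (u y)) := by
  have h1 : Measurable fun y => (S.phaseField D).flow 0 (t y) (z y) :=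
    ((S.phaseField D).continuous_flow_prod 0).measurable.comp (f := fun y => (t y, z y))
      (ht.prodMk hz)
  have h2 : Measurable fun y => (S.timePotential D').prop ħ T (t y) (u y) :=
    ((S.timePotential D').continuous_prop ħ T).measurable.comp (f := fun y => (t y, u y))
      (ht.prodMk hu)
  exact (measurable_momForm (d := d) hħ).comp (f := fun y => (((S.phaseField D).flow 0 (t y) (z y)).2,
    (S.timePotential D').prop ħ T (t y) (u y))) (h1.snd.prodMk h2)

theorem measurable_posForm_flow {Y : Type*} [MeasurableSpace Y] {t : Y → ℝ}
    {z : Y → Phase d} {u : Y → StateSpace d} (ht : Measurable t) (hz : Measurable z)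
    (hu : Measurable u) :
    Measurable fun y => posForm ((S.phaseField D).flow 0 (t y) (z y)).1
      ((S.timePotential D').prop ħ T (t y) (u y)) := by
  have h1 : Measurable fun y => (S.phaseField D).flow 0 (t y) (z y) :=
    ((S.phaseField D).continuous_flow_prod 0).measurable.comp (f := fun y => (t y, z y))
      (ht.prodMk hz)
  have h2 : Measurable fun y => (S.timePotential D').prop ħ T (t y) (u y) :=
    ((S.timePotential D').continuous_prop ħ T).measurable.comp (f := fun y => (t y, u y))
      (ht.prodMk hu)
  exact (measurable_posForm (d := d)).comp (f := fun y => (((S.phaseField D).flow 0 (t y) (z y)).1,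
    (S.timePotential D').prop ħ T (t y) (u y))) (h1.fst.prodMk h2)

theorem enorm_prop (t : ℝ) (u : StateSpace d) :
    ‖(S.timePotential D').prop ħ T t u‖ₑ = ‖u‖ₑ := by
  rw [← ofReal_norm, (S.timePotential D').norm_prop, ofReal_norm]

/-- A crude bound for the cost along the flows, exponential in time. -/
theorem costForm_flow_le_exp (hħ : 0 < ħ) (hT : 0 ≤ T) (z : Phase d) (u : StateSpace d) {t : ℝ}
    (ht : t ∈ Icc 0 T) :
    costForm ħ ((S.phaseField D).flow 0 t z) ((S.timePotential D').prop ħ T t u) ≤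
      ENNReal.ofReal (Real.exp (2 * t)) *
        (costForm ħ z u + ENNReal.ofReal (2 * S.A ^ 2 * T) * ‖u‖ₑ ^ 2) := by
  set P := S.timePotential D' with hP
  set Φ := (S.phaseField D).flow 0 with hΦ
  have hΦ0 : Φ 0 z = z := (S.phaseField D).flow_self 0 z
  rcases eq_or_ne (costForm ħ z u) ⊤ with h | h
  · rw [h, top_add, ENNReal.mul_top (ENNReal.ofReal_pos.2 (Real.exp_pos _)).ne']
    exact le_top
  have hx := hasDerivAt_phaseField_fst S D z
  have hξ := hasDerivAt_phaseField_snd S D z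
  have hF := continuous_force S D z
  obtain ⟨B, hB⟩ := P.exists_costForm_prop_le (T := T) hħ.ne' hT hx hξ hF (u := u)
    (by rw [(S.phaseField D).flow_self]; exact h)
  have hmc : Measurable fun s => costForm ħ (Φ s z) (P.prop ħ T s u) :=
    measurable_costForm_flow S D D' hħ measurable_id measurable_const measurable_const
  refine gronwall_lintegral (g := fun t => costForm ħ (Φ t z) (P.prop ħ T t u)) (B := max B 0)
    (T := T) zero_le_two (le_max_right _ _)
    (fun t ht => (hB t ht).trans (ENNReal.ofReal_le_ofReal (le_max_left _ _))) ?_ ht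
  intro t ht
  refine (P.costForm_prop_le hħ.ne' hT hx hξ hF u ht).trans ?_
  rw [(S.phaseField D).flow_self, add_assoc]
  refine add_le_add_right ?_ _
  have hA := S.A_nonneg
  have hforce : ∀ s, ENNReal.ofReal (1 / 2) *
      ∫⁻ y, ‖-meanGradient S.V (D.ρ s) (Φ s z).1 + P.G s y‖ₑ ^ 2 * ‖P.prop ħ T s u y‖ₑ ^ 2 ≤
        ENNReal.ofReal (2 * S.A ^ 2) * ‖u‖ₑ ^ 2 := by
    intro s
    rw [← enorm_prop S D' s u, enorm_sq_eq_lintegral,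
      ← lintegral_const_mul' _ _ ENNReal.ofReal_ne_top,
      ← lintegral_const_mul' _ _ ENNReal.ofReal_ne_top]
    refine lintegral_mono fun y => ?_
    rw [← mul_assoc]
    refine mul_le_mul_left ?_ _
    rw [← ofReal_norm, ← ENNReal.ofReal_pow (norm_nonneg _), ← ENNReal.ofReal_mul (by norm_num)]
    refine ENNReal.ofReal_le_ofReal ?_
    have h1 : ‖-meanGradient S.V (D.ρ s) (Φ s z).1 + P.G s y‖ ≤ S.A + S.A := by
      refine (norm_add_le _ _).trans (add_le_add ?_ (P.norm_G_le s y))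
      rw [norm_neg]
      exact S.norm_meanGradient_le D s _
    have h2 := pow_le_pow_left₀ (norm_nonneg _) h1 2
    linarith
  have hstep : ∀ s, costForm ħ (Φ s z) (P.prop ħ T s u) +
      ENNReal.ofReal (1 / 2) * momForm ħ (Φ s z).2 (P.prop ħ T s u) +
      ENNReal.ofReal (1 / 2) *
        ∫⁻ y, ‖-meanGradient S.V (D.ρ s) (Φ s z).1 + P.G s y‖ₑ ^ 2 * ‖P.prop ħ T s u y‖ₑ ^ 2 ≤
      ENNReal.ofReal 2 * costForm ħ (Φ s z) (P.prop ħ T s u) +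
        ENNReal.ofReal (2 * S.A ^ 2) * ‖u‖ₑ ^ 2 := fun s => by
    refine add_le_add ?_ (hforce s)
    rw [ENNReal.ofReal_ofNat, two_mul]
    exact add_le_add_right (half_momForm_le ħ _ _) _
  refine (lintegral_mono hstep).trans ?_
  rw [lintegral_add_left (hmc.const_mul _), lintegral_const_mul _ hmc, lintegral_const, add_comm]
  refine add_le_add_left ?_ _
  rw [Measure.restrict_apply MeasurableSet.univ, univ_inter, Real.volume_Ioc, sub_zero, mul_right_comm,
    ← ENNReal.ofReal_mul (by positivity)]
  refine mul_le_mul_left (ENNReal.ofReal_le_ofReal ?_) _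
  exact mul_le_mul_of_nonneg_left ht.2 (by positivity)

variable {ν : Measure (Phase d)} [IsProbabilityMeasure ν] {R₀ : Op d} {A : Phase d → Op d}

/-- The cost between the two flows, summed over the amplitudes at `z`. -/
def fiberCost (ħ T : ℝ) (A : Phase d → Op d) (t : ℝ) (z : Phase d) : ℝ≥0∞ :=
  ∑' i, costForm ħ ((S.phaseField D).flow 0 t z)
    ((S.timePotential D').prop ħ T t (A z (basis d i)))

/-- The momentum part of the cost, summed over the amplitudes at `z`. -/
def fiberMom (ħ T : ℝ) (A : Phase d → Op d) (t : ℝ) (z : Phase d) : ℝ≥0∞ :=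
  ∑' i, momForm ħ ((S.phaseField D).flow 0 t z).2
    ((S.timePotential D').prop ħ T t (A z (basis d i)))

/-- The position part of the cost, summed over the amplitudes at `z`. -/
def fiberPos (ħ T : ℝ) (A : Phase d → Op d) (t : ℝ) (z : Phase d) : ℝ≥0∞ :=
  ∑' i, posForm ((S.phaseField D).flow 0 t z).1
    ((S.timePotential D').prop ħ T t (A z (basis d i)))

theorem measurable_fiberCost (hA : IsAmplitude ν R₀ A) (hħ : 0 < ħ) :
    Measurable fun q : ℝ × Phase d => fiberCost S D D' ħ T A q.1 q.2 :=
  Measurable.tsum fun i => measurable_costForm_flow S D D' hħ measurable_fst measurable_snd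
    ((hA.measurable_apply (basis d i)).comp measurable_snd)

theorem measurable_fiberMom (hA : IsAmplitude ν R₀ A) (hħ : 0 < ħ) :
    Measurable fun q : ℝ × Phase d => fiberMom S D D' ħ T A q.1 q.2 :=
  Measurable.tsum fun i => measurable_momForm_flow S D D' hħ measurable_fst measurable_snd
    ((hA.measurable_apply (basis d i)).comp measurable_snd)

theorem measurable_fiberPos (hA : IsAmplitude ν R₀ A) :
    Measurable fun q : ℝ × Phase d => fiberPos S D D' ħ T A q.1 q.2 :=
  Measurable.tsum fun i => measurable_posForm_flow S D D' measurable_fst measurable_snd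
    ((hA.measurable_apply (basis d i)).comp measurable_snd)

theorem fiberCost_eq (t : ℝ) (z : Phase d) :
    fiberCost S D D' ħ T A t z =
      ENNReal.ofReal (1 / 2) * (fiberPos S D D' ħ T A t z + fiberMom S D D' ħ T A t z) := by
  rw [fiberPos, fiberMom, ← ENNReal.tsum_add, ← ENNReal.tsum_mul_left]
  rfl

/-- The transport cost between the two flows at time `t`. -/
def flowCost (ħ T : ℝ) (ν : Measure (Phase d)) (A : Phase d → Op d) (t : ℝ) : ℝ≥0∞ :=
  ∫⁻ z, fiberCost S D D' ħ T A t z ∂ν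

theorem IsAmplitude.measurable_tsum_costForm (hA : IsAmplitude ν R₀ A) (hħ : 0 < ħ) :
    Measurable fun z => ∑' i, costForm ħ z (A z (basis d i)) := by
  refine Measurable.tsum fun i => ?_
  exact (measurable_costForm (d := d) hħ).comp (f := fun z => (z, A z (basis d i)))
    (measurable_id.prodMk (hA.measurable_apply _))

theorem exists_flowCost_le (hA : IsAmplitude ν R₀ A) (hħ : 0 < ħ) (hT : 0 ≤ T)
    (h0 : amplitudeCost ħ ν A ≠ ⊤) :
    ∃ B, 0 ≤ B ∧ ∀ t ∈ Icc 0 T, flowCost S D D' ħ T ν A t ≤ ENNReal.ofReal B := by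
  set C := ENNReal.ofReal (Real.exp (2 * T)) *
    (amplitudeCost ħ ν A + ENNReal.ofReal (2 * S.A ^ 2 * T)) with hC
  have hCt : C ≠ ⊤ := ENNReal.mul_ne_top ENNReal.ofReal_ne_top
    (ENNReal.add_ne_top.2 ⟨h0, ENNReal.ofReal_ne_top⟩)
  refine ⟨C.toReal, ENNReal.toReal_nonneg, fun t ht => ?_⟩
  rw [ENNReal.ofReal_toReal hCt]
  have hm := hA.measurable_tsum_costForm hħ
  have h1 : ∀ᵐ z ∂ν, ∑' i, costForm ħ ((S.phaseField D).flow 0 t z)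
      ((S.timePotential D').prop ħ T t (A z (basis d i))) ≤
        ENNReal.ofReal (Real.exp (2 * T)) * (∑' i, costForm ħ z (A z (basis d i)) +
          ENNReal.ofReal (2 * S.A ^ 2 * T)) := by
    filter_upwards [hA.tsum_enorm_sq] with z hz
    refine (ENNReal.tsum_le_tsum fun i => costForm_flow_le_exp S D D' hħ hT z _ ht).trans ?_
    rw [ENNReal.tsum_mul_left, ENNReal.tsum_add, ENNReal.tsum_mul_left, hz, mul_one]
    refine mul_le_mul_left (ENNReal.ofReal_le_ofReal (Real.exp_le_exp.2 ?_)) _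
    linarith [ht.2]
  refine (lintegral_mono_ae h1).trans (le_of_eq ?_)
  rw [lintegral_const_mul _ (by fun_prop), lintegral_add_left hm, lintegral_const, measure_univ,
    mul_one, hC, amplitudeCost]

theorem isAmplitude_prop_comp (hA : IsAmplitude ν R₀ A) (t : ℝ) :
    IsAmplitude ν ((S.timePotential D').prop ħ T t ∘L R₀ ∘L
      ((S.timePotential D').prop ħ T t).adjoint)
      fun z => (S.timePotential D').prop ħ T t ∘L A z := by
  have h := hA.transport (Φ := id) (Ψ := id) measurable_id measurable_id (fun _ => rfl)
    (U := (S.timePotential D').prop ħ T t) (fun u => (S.timePotential D').norm_prop ħ T t u)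
  rwa [Measure.map_id] at h

/-- Mean over `ν` of the position part of the cost. -/
def flowPos (ħ T : ℝ) (ν : Measure (Phase d)) (A : Phase d → Op d) (t : ℝ) : ℝ≥0∞ :=
  ∫⁻ z, fiberPos S D D' ħ T A t z ∂ν

/-- Mean over `ν` of the momentum part of the cost. -/
def flowMom (ħ T : ℝ) (ν : Measure (Phase d)) (A : Phase d → Op d) (t : ℝ) : ℝ≥0∞ :=
  ∫⁻ z, fiberMom S D D' ħ T A t z ∂ν

theorem flowPos_eq_positionCost (t : ℝ) :
    flowPos S D D' ħ T ν A t = positionCost ν (fun z => ((S.phaseField D).flow 0 t z).1)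
      fun z => (S.timePotential D').prop ħ T t ∘L A z := rfl

theorem flowCost_eq (hA : IsAmplitude ν R₀ A) (t : ℝ) :
    flowCost S D D' ħ T ν A t =
      ENNReal.ofReal (1 / 2) * (flowPos S D D' ħ T ν A t + flowMom S D D' ħ T ν A t) := by
  have hm : Measurable fun z => fiberPos S D D' ħ T A t z :=
    (measurable_fiberPos S D D' hA).comp (f := fun z => (t, z)) measurable_prodMk_left
  rw [flowPos, flowMom, ← lintegral_add_left hm, ← lintegral_const_mul' _ _ ENNReal.ofReal_ne_top,
    flowCost]
  exact lintegral_congr fun z => fiberCost_eq S D D' t z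

theorem costForm_flow_le (hA : IsAmplitude ν R₀ A) (hħ : 0 < ħ) (hT : 0 ≤ T)
    (hν : ∀ t ∈ Icc 0 T, ∀ h : Pos d → ℝ, Continuous h → (∀ y, 0 ≤ h y) → (∃ C, ∀ y, h y ≤ C) →
      ∫⁻ z, ENNReal.ofReal (h ((S.phaseField D).flow 0 t z).1) ∂ν =
        ∫⁻ y, ENNReal.ofReal (h y) * ENNReal.ofReal (D.ρ t y))
    (hR : ∀ t ∈ Icc 0 T, D'.ρ t = positionDensity ((S.timePotential D').prop ħ T t ∘L R₀ ∘L
      ((S.timePotential D').prop ħ T t).adjoint))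
    (hX : ∀ t ∈ Icc 0 T, flowPos S D D' ħ T ν A t ≠ ⊤) {t : ℝ} (ht : t ∈ Icc 0 T) (z : Phase d)
    (u : StateSpace d) :
    costForm ħ ((S.phaseField D).flow 0 t z) ((S.timePotential D').prop ħ T t u) ≤
      costForm ħ z u + ∫⁻ s in Ioc 0 t,
        (costForm ħ ((S.phaseField D).flow 0 s z) ((S.timePotential D').prop ħ T s u) +
        ENNReal.ofReal (1 / 2) *
          momForm ħ ((S.phaseField D).flow 0 s z).2 ((S.timePotential D').prop ħ T s u) +
        ENNReal.ofReal (S.L ^ 2) *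
          (posForm ((S.phaseField D).flow 0 s z).1 ((S.timePotential D').prop ħ T s u) +
            flowPos S D D' ħ T ν A s * ‖u‖ₑ ^ 2)) := by
  refine ((S.timePotential D').costForm_prop_le hħ.ne' hT (hasDerivAt_phaseField_fst S D z)
    (hasDerivAt_phaseField_snd S D z) (continuous_force S D z) u ht).trans ?_
  rw [(S.phaseField D).flow_self]
  refine add_le_add_right (setLIntegral_mono' measurableSet_Ioc fun s hs => ?_) _
  have hsT : s ∈ Icc 0 T := ⟨hs.1.le, hs.2.trans ht.2⟩
  refine add_le_add_right ?_ _
  have hflow : Measurable fun z => ((S.phaseField D).flow 0 s z).1 :=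
    ((S.phaseField D).continuous_flow 0 s).measurable.fst
  have h1 := (isAmplitude_prop_comp S D' (ħ := ħ) (T := T) hA s).lintegral_force_sq_le (S := S)
    (D := D) (D' := D') (t := s) hflow (hν s hsT) (hR s hsT) (hX s hsT)
    ((S.phaseField D).flow 0 s z).1 ((S.timePotential D').prop ħ T s u)
  rw [enorm_prop S D', ← flowPos_eq_positionCost] at h1
  refine (mul_le_mul_right h1 _).trans (le_of_eq ?_)
  rw [← mul_assoc, ← ENNReal.ofReal_mul (by norm_num)]
  congr 2
  ring

theorem measurable_flowPos (hA : IsAmplitude ν R₀ A) : Measurable (flowPos S D D' ħ T ν A) :=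
  (measurable_fiberPos S D D' hA).lintegral_prod_right'

theorem fiberCost_le_add (hA : IsAmplitude ν R₀ A) (hħ : 0 < ħ) (hT : 0 ≤ T)
    (hν : ∀ t ∈ Icc 0 T, ∀ h : Pos d → ℝ, Continuous h → (∀ y, 0 ≤ h y) → (∃ C, ∀ y, h y ≤ C) →
      ∫⁻ z, ENNReal.ofReal (h ((S.phaseField D).flow 0 t z).1) ∂ν =
        ∫⁻ y, ENNReal.ofReal (h y) * ENNReal.ofReal (D.ρ t y))
    (hR : ∀ t ∈ Icc 0 T, D'.ρ t = positionDensity ((S.timePotential D').prop ħ T t ∘L R₀ ∘L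
      ((S.timePotential D').prop ħ T t).adjoint))
    (hX : ∀ t ∈ Icc 0 T, flowPos S D D' ħ T ν A t ≠ ⊤) {t : ℝ} (ht : t ∈ Icc 0 T) {z : Phase d}
    (hz : ∑' i, ‖A z (basis d i)‖ₑ ^ 2 = 1) :
    fiberCost S D D' ħ T A t z ≤ ∑' i, costForm ħ z (A z (basis d i)) + ∫⁻ s in Ioc 0 t,
      (fiberCost S D D' ħ T A s z + ENNReal.ofReal (1 / 2) * fiberMom S D D' ħ T A s z +
        ENNReal.ofReal (S.L ^ 2) * (fiberPos S D D' ħ T A s z + flowPos S D D' ħ T ν A s)) := by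
  refine (ENNReal.tsum_le_tsum fun i =>
    costForm_flow_le S D D' hA hħ hT hν hR hX ht z (A z (basis d i))).trans (le_of_eq ?_)
  rw [ENNReal.tsum_add, ← lintegral_tsum]
  · congr 1
    refine lintegral_congr fun s => ?_
    rw [ENNReal.tsum_add, ENNReal.tsum_add, ENNReal.tsum_mul_left, ENNReal.tsum_mul_left,
      ENNReal.tsum_add, ENNReal.tsum_mul_left, hz, mul_one, fiberCost, fiberMom, fiberPos]
  · intro i
    have h1 := measurable_costForm_flow S D D' (T := T) hħ measurable_id
      (measurable_const (a := z)) (measurable_const (a := A z (basis d i)))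
    have h2 := measurable_momForm_flow S D D' (T := T) hħ measurable_id
      (measurable_const (a := z)) (measurable_const (a := A z (basis d i)))
    have h3 := measurable_posForm_flow S D D' (ħ := ħ) (T := T) measurable_id
      (measurable_const (a := z)) (measurable_const (a := A z (basis d i)))
    exact ((h1.add (h2.const_mul _)).add
      ((h3.add ((measurable_flowPos S D D' hA).mul_const _)).const_mul _)).aemeasurable

theorem flowCost_le_add (hA : IsAmplitude ν R₀ A) (hħ : 0 < ħ) (hT : 0 ≤ T)
    (hν : ∀ t ∈ Icc 0 T, ∀ h : Pos d → ℝ, Continuous h → (∀ y, 0 ≤ h y) → (∃ C, ∀ y, h y ≤ C) →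
      ∫⁻ z, ENNReal.ofReal (h ((S.phaseField D).flow 0 t z).1) ∂ν =
        ∫⁻ y, ENNReal.ofReal (h y) * ENNReal.ofReal (D.ρ t y))
    (hR : ∀ t ∈ Icc 0 T, D'.ρ t = positionDensity ((S.timePotential D').prop ħ T t ∘L R₀ ∘L
      ((S.timePotential D').prop ħ T t).adjoint))
    (hX : ∀ t ∈ Icc 0 T, flowPos S D D' ħ T ν A t ≠ ⊤) {t : ℝ} (ht : t ∈ Icc 0 T) :
    flowCost S D D' ħ T ν A t ≤ amplitudeCost ħ ν A + ∫⁻ s in Ioc 0 t,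
      (flowCost S D D' ħ T ν A s + ENNReal.ofReal (1 / 2) * flowMom S D D' ħ T ν A s +
        ENNReal.ofReal (S.L ^ 2) * (flowPos S D D' ħ T ν A s + flowPos S D D' ħ T ν A s)) := by
  have hsum : ∀ᵐ z ∂ν, _ := hA.tsum_enorm_sq.mono fun z hz =>
    fiberCost_le_add S D D' hA hħ hT hν hR hX ht hz
  have hmX := measurable_flowPos S D D' (ħ := ħ) (T := T) hA
  have hmc := measurable_fiberCost S D D' (T := T) hA hħ
  have hmm := measurable_fiberMom S D D' (T := T) hA hħ
  have hmp := measurable_fiberPos S D D' (ħ := ħ) (T := T) hA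
  rw [flowCost]
  refine (lintegral_mono_ae hsum).trans (le_of_eq ?_)
  rw [lintegral_add_left (hA.measurable_tsum_costForm hħ), amplitudeCost]
  congr 1
  have hmint : Measurable fun q : ℝ × Phase d => fiberCost S D D' ħ T A q.1 q.2 +
      ENNReal.ofReal (1 / 2) * fiberMom S D D' ħ T A q.1 q.2 +
      ENNReal.ofReal (S.L ^ 2) * (fiberPos S D D' ħ T A q.1 q.2 + flowPos S D D' ħ T ν A q.1) :=
    (hmc.add (hmm.const_mul _)).add ((hmp.add (hmX.comp (f := fun q : ℝ × Phase d => q.1) measurable_fst)).const_mul _)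
  refine (lintegral_lintegral_swap (f := fun z s => fiberCost S D D' ħ T A s z +
    ENNReal.ofReal (1 / 2) * fiberMom S D D' ħ T A s z +
    ENNReal.ofReal (S.L ^ 2) * (fiberPos S D D' ħ T A s z + flowPos S D D' ħ T ν A s))
    (hmint.comp (f := fun q : Phase d × ℝ => (q.2, q.1)) measurable_swap).aemeasurable).trans ?_
  refine lintegral_congr fun s => ?_
  have hc : Measurable fun z => fiberCost S D D' ħ T A s z := hmc.comp (f := fun z => (s, z)) measurable_prodMk_left
  have hmo : Measurable fun z => fiberMom S D D' ħ T A s z := hmm.comp (f := fun z => (s, z)) measurable_prodMk_left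
  have hpo : Measurable fun z => fiberPos S D D' ħ T A s z := hmp.comp (f := fun z => (s, z)) measurable_prodMk_left
  have hcm : Measurable fun z => fiberCost S D D' ħ T A s z +
    ENNReal.ofReal (1 / 2) * fiberMom S D D' ħ T A s z := hc.add (hmo.const_mul _)
  rw [lintegral_add_left hcm, lintegral_add_left hc, lintegral_const_mul _ hmo, lintegral_const_mul _ (hpo.add_const _), lintegral_add_left hpo,
    lintegral_const, measure_univ, mul_one, flowCost, flowMom, flowPos]

/-- Exponential growth bound of the transport cost along the two flows. -/
theorem flowCost_le_exp (hA : IsAmplitude ν R₀ A) (hħ : 0 < ħ) (hT : 0 ≤ T)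
    (hν : ∀ t ∈ Icc 0 T, ∀ h : Pos d → ℝ, Continuous h → (∀ y, 0 ≤ h y) → (∃ C, ∀ y, h y ≤ C) →
      ∫⁻ z, ENNReal.ofReal (h ((S.phaseField D).flow 0 t z).1) ∂ν =
        ∫⁻ y, ENNReal.ofReal (h y) * ENNReal.ofReal (D.ρ t y))
    (hR : ∀ t ∈ Icc 0 T, D'.ρ t = positionDensity ((S.timePotential D').prop ħ T t ∘L R₀ ∘L
      ((S.timePotential D').prop ħ T t).adjoint)) {t : ℝ} (ht : t ∈ Icc 0 T) :
    flowCost S D D' ħ T ν A t ≤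
      ENNReal.ofReal (Real.exp ((1 + max 1 (4 * (S.L : ℝ) ^ 2)) * t)) * amplitudeCost ħ ν A := by
  rcases eq_or_ne (amplitudeCost ħ ν A) ⊤ with h0 | h0
  · rw [h0, ENNReal.mul_top (ENNReal.ofReal_pos.2 (Real.exp_pos _)).ne']
    exact le_top
  obtain ⟨B, hB0, hB⟩ := exists_flowCost_le S D D' hA hħ hT h0
  have hhalf : ENNReal.ofReal (1 / 2) ≠ 0 := (ENNReal.ofReal_pos.2 (by norm_num)).ne'
  have hX : ∀ t ∈ Icc 0 T, flowPos S D D' ħ T ν A t ≠ ⊤ := by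
    intro t ht h
    have h1 := hB t ht
    rw [flowCost_eq S D D' hA, h, top_add, ENNReal.mul_top hhalf, top_le_iff] at h1
    exact ENNReal.ofReal_ne_top h1
  have hκ : (0 : ℝ) ≤ max 1 (4 * (S.L : ℝ) ^ 2) := zero_le_one.trans (le_max_left _ _)
  have hcost : Measurable (flowCost S D D' ħ T ν A) :=
    (measurable_fiberCost S D D' hA hħ).lintegral_prod_right'
  refine gronwall_lintegral (by linarith) hB0 hB (fun t ht => ?_) ht
  refine (flowCost_le_add S D D' hA hħ hT hν hR hX ht).trans (add_le_add_right ?_ _)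
  rw [← lintegral_const_mul _ hcost]
  refine lintegral_mono fun s => ?_
  rw [ENNReal.ofReal_add zero_le_one hκ, add_mul, ENNReal.ofReal_one, one_mul, add_assoc]
  refine add_le_add_right ?_ _
  rw [flowCost_eq S D D' hA s]
  generalize flowPos S D D' ħ T ν A s = X
  generalize flowMom S D D' ħ T ν A s = M
  have e1 : ENNReal.ofReal (S.L ^ 2) * (X + X) = ENNReal.ofReal (2 * S.L ^ 2) * X := by
    rw [ENNReal.ofReal_mul zero_le_two, ENNReal.ofReal_ofNat, ← two_mul, mul_left_comm, mul_assoc]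
  rw [e1, ← mul_assoc, ← ENNReal.ofReal_mul hκ, mul_add, add_comm]
  refine add_le_add ?_ ?_
  · refine mul_le_mul_left (ENNReal.ofReal_le_ofReal ?_) _
    linarith [le_max_right 1 (4 * (S.L : ℝ) ^ 2)]
  · refine mul_le_mul_left (ENNReal.ofReal_le_ofReal ?_) _
    linarith [le_max_left 1 (4 * (S.L : ℝ) ^ 2)]

end Propagation

/-! ### The Vlasov and Hartree equations -/

theorem IsVlasovSolution.lintegral_flow {S : SmoothPotential d} {f₀ : Phase d → ℝ}
    {f : ℝ → Phase d → ℝ} (hf : IsVlasovSolution S.V f₀ f) {T : ℝ} (hT : 0 ≤ T) {t : ℝ}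
    (ht : t ∈ Icc 0 T) {h : Pos d → ℝ} (hh : Continuous h) (h0 : ∀ y, 0 ≤ h y)
    (hC : ∃ C, ∀ y, h y ≤ C) :
    ∫⁻ z, ENNReal.ofReal (h ((S.phaseField (hf.densityCurve hT)).flow 0 t z).1)
        ∂densityMeasure f₀ =
      ∫⁻ y, ENNReal.ofReal (h y) * ENNReal.ofReal ((hf.densityCurve hT).ρ t y) := by
  obtain ⟨C, hC⟩ := hC
  have habs : ∀ y, |h y| ≤ C := fun y => by rw [abs_of_nonneg (h0 y)]; exact hC y
  have hp := hf.1 _ (clamp_mem hT t).1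
  have := hp.isProbabilityMeasure
  rw [(hf.densityCurve hT).lintegral_mul t hh h0 hC]
  have h1 : ∫ y, h y * (hf.densityCurve hT).ρ t y = ∫ z, h z.1 ∂densityMeasure (f (clamp T t)) :=
    hp.integral_mul_spatialDensity hh habs
  rw [h1, ofReal_integral_eq_lintegral_ofReal
    (integrable_of_abs_le (g := fun z : Phase d => h z.1) (by fun_prop) fun z => habs z.1)
    (ae_of_all _ fun z => h0 z.1), clamp_of_mem ht, hf.densityMeasure_eq_map hT ht,
    lintegral_map (by fun_prop) ((S.phaseField (hf.densityCurve hT)).continuous_flow 0 t).measurable]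

theorem Ehbar_sq_le {S : SmoothPotential d} {ħ : ℝ} (hħ : 0 < ħ) {f₀ : Phase d → ℝ}
    (hf₀ : IsProbDensity f₀) {f : ℝ → Phase d → ℝ} (hf : IsVlasovSolution S.V f₀ f) {R₀ : Op d}
    {R : ℝ → Op d} (hR : IsHartreeSolution ħ S.V R₀ R) {t : ℝ} (ht : 0 ≤ t) :
    Ehbar ħ (f t) (R t) ^ 2 ≤
      ENNReal.ofReal (Real.exp ((1 + max 1 (4 * (S.L : ℝ) ^ 2)) * t)) * Ehbar ħ f₀ R₀ ^ 2 := by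
  have htt : t ∈ Icc 0 t := ⟨ht, le_rfl⟩
  set D := hf.densityCurve ht with hD
  set D' := hR.densityCurve ht with hD'
  set X := S.phaseField D with hX
  set P := S.timePotential D' with hP
  have hprob := hf₀.isProbabilityMeasure
  have hΦ : Measurable (X.flow 0 t) := (X.continuous_flow 0 t).measurable
  have hΨ : Measurable (X.flow t 0) := (X.continuous_flow t 0).measurable
  have hΨΦ : ∀ z, X.flow t 0 (X.flow 0 t z) = z := fun z => by rw [X.flow_flow, X.flow_self]
  have hρ : ∀ s ∈ Icc 0 t, D'.ρ s = positionDensity (P.prop ħ t s ∘L R₀ ∘L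
      (P.prop ħ t s).adjoint) := fun s hs => by
    rw [← hR.eq_conj hħ.ne' ht hs]
    have : D'.ρ s = positionDensity (R (clamp t s)) := rfl
    rw [this, clamp_of_mem hs]
  rw [Ehbar_sq ħ f₀ R₀]
  have hexp0 : ENNReal.ofReal (Real.exp ((1 + max 1 (4 * (S.L : ℝ) ^ 2)) * t)) ≠ 0 :=
    (ENNReal.ofReal_pos.2 (Real.exp_pos _)).ne'
  rw [ENNReal.mul_iInf_of_ne hexp0 ENNReal.ofReal_ne_top]
  refine le_iInf fun Q => ?_
  rw [ENNReal.mul_iInf_of_ne hexp0 ENNReal.ofReal_ne_top]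
  refine le_iInf fun hQ => ?_
  obtain ⟨A, hA, hAQ⟩ := exists_amplitude_of_isCoupling (ħ := ħ) hf₀ hQ
  refine le_trans ?_ (mul_le_mul_right hAQ _)
  refine le_trans ?_ (flowCost_le_exp S D D' hA hħ ht
    (fun s hs h hh h0 hC => hf.lintegral_flow ht hs hh h0 hC) hρ htt)
  have h1 := hA.transport hΦ hΨ hΨΦ (U := P.prop ħ t t) (fun u => P.norm_prop ħ t t u)
  rw [← hf.densityMeasure_eq_map ht htt, ← hR.eq_conj hħ.ne' ht htt] at h1
  have h2 := hA.amplitudeCost_transport hħ hΦ hΨ hΨΦ (P.prop ħ t t)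
  rw [← hf.densityMeasure_eq_map ht htt] at h2
  exact (Ehbar_sq_le_amplitudeCost hħ (hf.1 t ht) h1).trans h2.le

end HartreeVlasov

end

theorem theorem2p5 (d : ℕ) (ħ : ℝ) (hħ : 0 < ħ)
    -- `V` is even, bounded, of class `C^{1,1}`, and `L` is a Lipschitz constant of `∇V`
    (V : HartreeVlasov.Pos d → ℝ) (hVeven : ∀ x, V (-x) = V x) (hVbdd : ∃ C : ℝ, ∀ x, |V x| ≤ C)
    (hVC1 : ContDiff ℝ 1 V) (L : ℝ≥0) (hL : LipschitzWith L (gradient V))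
    -- the Vlasov solution
    (f₀ : HartreeVlasov.Phase d → ℝ) (hf₀ : HartreeVlasov.IsProbDensity f₀)
    (hmom : Integrable fun z : HartreeVlasov.Phase d => (‖z.1‖ ^ 2 + ‖z.2‖ ^ 2) * f₀ z)
    (f : ℝ → HartreeVlasov.Phase d → ℝ) (hf : HartreeVlasov.IsVlasovSolution V f₀ f)
    -- the Hartree solution
    (R₀ : HartreeVlasov.Op d) (hR₀ : HartreeVlasov.IsDensityOperator R₀)
    (R : ℝ → HartreeVlasov.Op d) (hR : HartreeVlasov.IsHartreeSolution ħ V R₀ R) :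
    (∀ t : ℝ, 0 ≤ t →
      HartreeVlasov.Ehbar ħ (f t) (R t) ^ 2 ≤
        ENNReal.ofReal (Real.exp ((1 + max 1 (4 * (L : ℝ) ^ 2)) * t)) *
          HartreeVlasov.Ehbar ħ f₀ R₀ ^ 2) ∧
    (∀ t : ℝ, 0 ≤ t →
      HartreeVlasov.distMK2 (HartreeVlasov.densityMeasure (f t))
          (HartreeVlasov.densityMeasure (HartreeVlasov.husimi ħ (R t))) ^ 2 ≤
        ENNReal.ofReal (Real.exp ((1 + max 1 (4 * (L : ℝ) ^ 2)) * t)) *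
            HartreeVlasov.Ehbar ħ f₀ R₀ ^ 2 +
          ENNReal.ofReal (d * ħ / 2)) ∧
    (∀ μ₀ : Measure (HartreeVlasov.Phase d), IsProbabilityMeasure μ₀ →
      R₀ = HartreeVlasov.toeplitz ħ (ENNReal.ofReal ((2 * Real.pi * ħ) ^ d) • μ₀) →
      ∀ t : ℝ, 0 ≤ t →
        HartreeVlasov.distMK2 (HartreeVlasov.densityMeasure (f t))
            (HartreeVlasov.densityMeasure (HartreeVlasov.husimi ħ (R t))) ^ 2 ≤
          ENNReal.ofReal (Real.exp ((1 + max 1 (4 * (L : ℝ) ^ 2)) * t)) *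
              (HartreeVlasov.distMK2 (HartreeVlasov.densityMeasure f₀) μ₀ ^ 2 +
                ENNReal.ofReal (d * ħ / 2)) +
            ENNReal.ofReal (d * ħ / 2)) := by
  obtain ⟨C, hC⟩ := hVbdd
  have hE : ∀ t : ℝ, 0 ≤ t → HartreeVlasov.Ehbar ħ (f t) (R t) ^ 2 ≤
      ENNReal.ofReal (Real.exp ((1 + max 1 (4 * (L : ℝ) ^ 2)) * t)) *
        HartreeVlasov.Ehbar ħ f₀ R₀ ^ 2 := fun t ht =>
    HartreeVlasov.Ehbar_sq_le (S := HartreeVlasov.SmoothPotential.ofBounded hVC1 hL hC) hħ hf₀ hf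
      hR ht
  have hdist : ∀ t : ℝ, 0 ≤ t → HartreeVlasov.distMK2 (HartreeVlasov.densityMeasure (f t))
      (HartreeVlasov.densityMeasure (HartreeVlasov.husimi ħ (R t))) ^ 2 ≤
        ENNReal.ofReal (Real.exp ((1 + max 1 (4 * (L : ℝ) ^ 2)) * t)) *
            HartreeVlasov.Ehbar ħ f₀ R₀ ^ 2 + ENNReal.ofReal (d * ħ / 2) := fun t ht =>
    (HartreeVlasov.distMK2_sq_le_Ehbar hħ (hf.1 t ht) (R t)).trans (by gcongr; exact hE t ht)
  refine ⟨hE, hdist, fun μ₀ hμ₀ hR₀' t ht => (hdist t ht).trans ?_⟩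
  gcongr
  rw [hR₀']
  exact HartreeVlasov.Ehbar_toeplitz_sq_le hħ hf₀ μ₀
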